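/- **Setting.** Let $d,N\ge 1$, $H\ge 0$ be integers, $a_1,\dots,a_N\in\mathbb R$ with $a_N=1$, and let $b_\alpha\in\mathbb R$, $\alpha\in\mathbb N^d$, $|\alpha|\le M$, with $M\ge1$ and $b_\alpha\ne0$ for some $|\alpha|=M$. Let $p_1,\dots,p_N>0$ with $\sum_n p_n=1$, let $q_j\ge 0$ with $\sum_{j\ge0}q_j=1$, and $\ell_j=(\ell_{j,0},\dots,\ell_{j,H})\in\mathbb N^{1+H}$ for $j\ge 0$. Let $f_n:\mathbb R^d\to\mathbb R$ ($1\le n\le N$) be bounded and Lipschitz. For $j\ge0$, $1\le h\le H$ let $c_{j,0}:\mathbb R_+\times\mathbb R^d\to\mathbb R$ be bounded continuous and $c_{j,h}:\mathbb R_+\times\mathbb R^d\to\mathbb R^d$ continuous with $|c_{j,h}|\le1$. Consider the Cauchy problem $$\sum_{n=1}^N a_n\partial_t^n u-\sum_{|\alpha|\le M} b_\alpha D^\alpha u-\mathcal N[u]=0,\quad \mathcal N[u]:=\sum_{j\ge0}q_jc_{j,0}\,u^{\ell_{j,0}}\prod_{h=1}^H(c_{j,h}\cdot Du)^{\ell_{j,h}},\qquad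 \partial_t^{n-1}u(0,\cdot)=p_nf_n,\ 1\le n\le N. \tag{1}$$ A *bounded solution* of (1) on $[0,T]$ is a bounded continuous $v:[0,T]\times\mathbb R^d\to\mathbb R$ such that, for $t\in(0,T]$, $v(t,\cdot)$ is $C^1$ and the series $\mathcal N[v](t,\cdot)$ converges absolutely at every point, with a sum that is bounded on $(0,T]\times\mathbb R^d$, and such that (1) holds in the sense of tempered distributions in $x$: for every Schwartz function $\psi$, $U(t)=\int v(t,x)\psi(x)\,dx$ is $C^{N-1}$ on $[0,T]$, $U^{(n-1)}(0)=p_n\int f_n\psi$ for $1\le n\le N$, and for $t\in[0,T]$ $$\sum_{n=1}^Na_n\big(U^{(n-1)}(t)-U^{(n-1)}(0)\big)=\int_0^t\!\int\Big(v(s,x)\sum_\alpha(-1)^{|\alpha|}b_\alpha D^\alpha\psi(x)+\mathcal N[v](s,x)\psi(x)\Big)dx\,ds .$$ **Green functions.** Put $b(\xi)=\sum_\alpha i^{|\alpha|}b_\alpha\xi^\alpha$, let $B(\xi)$ be the $N\times N$ companion matrix with ones above the diagonal, last row $(b(\xi),-a_1,\dots,-a_{N-1})$ and zeros elsewhere,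 let $\hat g(t,\xi)=(2\pi)^{-d/2}e^{tB(\xi)^{\rm T}}{\rm e}_1\in\mathbb C^N$, and let $g_n(t,\cdot)$ be the inverse Fourier transform (unitary normalization, kernel $(2\pi)^{-d/2}e^{i\xi\cdot x}$) of $\hat g_n(t,\cdot)$ in $\mathcal S'$. **Assumptions.** Let $0<T<\infty$. (A1) $\hat g_n(t,\cdot)\in\mathcal S'$ for $t\in[0,T]$, $1\le n\le N$. (A2) For $t\in[0,T]$, $1\le n\le N$, $g_n(t,\cdot)$ is a finite signed measure $g_n(t,dz)=\gamma_n(t,z)\mu_n(t,dz)$, with $\mu_n(t,\cdot)$ a probability measure and $\gamma_n(t,\cdot)\in\mathbb L^1\cap\mathbb L^\infty(\mu_n(t,\cdot))$ ($\mu_n$, $\gamma_n$ measurable also in $t$); $(t,x)\mapsto\int\phi(x-z)g_n(t,dz)$ is continuous on $[0,T]\times\mathbb R^d$ for all bounded continuous $\phi$; and $t\mapsto\int|\gamma_N(t,z)|\mu_N(t,dz)$ is integrable on $[0,T]$. (A3) For $t\in(0,T]$, $1\le n\le N$, $1\le m\le d$, the distributional derivative $\partial_{x_m}g_n(t,\cdot)$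 is a finite signed measure $\gamma^1_{n,m}(t,z)\mu^1_n(t,dz)$, with $\mu^1_n(t,\cdot)$ a probability measure ($\mu^1_n$, $\gamma^1_n=(\gamma^1_{n,1},\dots,\gamma^1_{n,d})$ measurable also in $t$). Write $|g_n|$ for the total variation of $g_n$ and $|\partial_xg_n|=\sum_m|\partial_{x_m}g_n|$. **Constants.** Let $p>1$, let $\rho$ be a probability density on $(0,\infty)$ that is positive there, and $\bar\rho(t)=\int_t^\infty\rho(s)ds$. With $\|\nabla f_n\|_\infty$ the Lipschitz constant of $f_n$ put $$\hat r_p=\sup_{0<t\le T,\,n}\frac{\big\{\|f_n\|_\infty^p\int|\gamma_n(t,z)|^{p-1}|g_n|(t,dz)\big\}\vee\big\{\|\nabla f_n\|_\infty^p\int|z|^p|\gamma_n^1(t,z)|^{p-1}|\partial_xg_n|(t,dz)\big\}}{\bar\rho(t)^{p-1}},$$ $$\hat\alpha_p=\sup_{0<t\le T}\frac{\int|\gamma_N(t,z)|^{p-1}|g_N|(t,dz)\ \vee\ \int|\gamma_N^1(t,z)|^{p-1}|\partial_xg_N|(t,dz)}{\rho(t)^{p-1}},$$ and let $R_p$ be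 the radius of convergence of $H_p(s)=\sum_{j\ge0}q_j\|c_{j,0}\|_\infty^p\,s^{\ell_{j,0}+\dots+\ell_{j,H}}$. Assume $$\hat r_p<R_p,\qquad \hat\alpha_p<\infty,\qquad \int_{\hat r_p}^{\hat s_p}\frac{ds}{H_p(s)}=\hat\alpha_pT\ \text{ for some }\hat s_p\in(\hat r_p,R_p). \tag{2}$$ **Branching functional.** On a probability space, let the particles be indexed by the finite words $k$, the root being the empty word and the possible children of $k$ being $(k,(h,i))$, $0\le h\le H$, $i\ge 1$ (the $i$-th particle of the $h$-th block of descendants). The type of $(k,(h,i))$ is $\theta=h$ and that of the root is $0$. Let $(\tau_k,I^0_k,\mathbf j_k)_k$ be iid with independent components, where $\tau_k$ has density $\rho$, $\mathbb P[I^0_k=n]=p_n$, $\mathbb P[\mathbf j_k=j]=q_j$. For $t\in[0,T]$ let $k_-$ be the parent of $k$, $T_k=t\wedge(T_{k_-}+\tau_k)$, with $T_{k_-}:=0$ for the root, and $\Delta T_k=T_k-T_{k_-}$. The root lives prior to $t$; a particle $k$ living prior to $t$ with $T_k<t$ branches at $T_k$ into $\ell_{\mathbf j_k,h}$ children $(k,(h,i))$,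 $1\le i\le\ell_{\mathbf j_k,h}$, for each $h$. Let $\overline{\mathcal K}_t$ be the set of all particles living prior to $t$, and $\mathcal K_t\subset\overline{\mathcal K}_t$ the set of those with $T_k=t$. Put $I_k=I^0_k$ if $k\in\mathcal K_t$ and $I_k=N$ if $k\in\overline{\mathcal K}_t\setminus\mathcal K_t$. Given all $(\tau_k,I_k^0,\mathbf j_k)_k$, the displacements $\hat Z_k$, $k\in\overline{\mathcal K}_t$, are independent with laws $\mu_{I_k}(\Delta T_k,\cdot)$ if $\theta_k=0$ and $\mu^1_{I_k}(\Delta T_k,\cdot)$ if $\theta_k\ne0$. For $x\in\mathbb R^d$ let $\hat X_k=\hat X_{k_-}-\hat Z_k$, with $\hat X_{k_-}:=x$ for the root, and let $$\mathcal W_k=\mathbf 1_{\{\theta_k=0\}}\gamma_{I_k}(\Delta T_k,\hat Z_k)+\mathbf 1_{\{\theta_k\ne0\}}\,c_{\mathbf j_{k_-},\theta_k}(t-T_{k_-},\hat X_{k_-})\cdot\gamma^1_{I_k}(\Delta T_k,\hat Z_k),$$ $$\hat\xi_{t,x}=\prod_{k\in\mathcal K_t}\frac{\mathcal W_k}{\bar\rho(\Delta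 T_k)}\Big[f_{I_k}(\hat X_k)-\mathbf 1_{\{\theta_k\ne0\}}f_{I_k}(\hat X_{k_-})\Big]\prod_{k\in\overline{\mathcal K}_t\setminus\mathcal K_t}\frac{\mathcal W_k}{\rho(\Delta T_k)}\,c_{\mathbf j_k,0}(t-T_k,\hat X_k),$$ with $\hat\xi_{t,x}:=0$ if $\overline{\mathcal K}_t$ is infinite. **Theorem 4.1.** Under (A1), (A2), (A3) and (2), $\hat\xi_{t,x}\in\mathbb L^p$ for all $t\in[0,T]$, $x\in\mathbb R^d$, and $u(t,x):=\mathbb E[\hat\xi_{t,x}]$ is a bounded solution of (1) on $[0,T]$ and is the only one: every bounded solution of (1) on $[0,T]$ equals $u$ on $[0,T]\times\mathbb R^d$. -/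

import Mathlib

open MeasureTheory ProbabilityTheory Set
open scoped ENNReal NNReal SchwartzMap FourierTransform LineDeriv Gradient

noncomputable section

namespace BranchingCauchy

/-- The space `ℝ^d` with its Euclidean norm. -/
abbrev Space (d : ℕ) := EuclideanSpace ℝ (Fin d)

/-! ### The Cauchy problem -/

/-- The data of the semilinear Cauchy problem of order `N` in time

`∑_{1≤n≤N} a_n ∂_t^n u - ∑_α b_α D^α u - ∑_j q_j c_{j,0} u^{ℓ_{j,0}} ∏_{1≤h≤H} (c_{j,h}·Du)^{ℓ_{j,h}} = 0`,
`∂_t^{n-1} u(0,·) = p_n f_n` for `n = 1,…,N`,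

together with the standing assumptions on them. Families indexed by `n = 1,…,N` are indexed by
`Fin N`, the element `n : Fin N` standing for the number `n + 1`. -/
structure Problem (d N H : ℕ) where
  /-- time coefficients; only `a 1, …, a N` are used -/
  a : ℕ → ℝ
  a_top : a N = 1
  /-- the polynomial `∑_α b_α X^α`, whose total degree is the order `M ≥ 1` in space -/
  b : MvPolynomial (Fin d) ℝ
  one_le_order : 1 ≤ b.totalDegree
  /-- the probability weights `p_n` in the initial conditions -/
  wt : Fin N → ℝ
  wt_pos : ∀ n, 0 < wt n
  wt_sum : ∑ n, wt n = 1
  /-- the initial data -/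
  f : Fin N → Space d → ℝ
  f_cont : ∀ n, Continuous (f n)
  f_bdd : ∀ n, ∃ C : ℝ, ∀ x, |f n x| ≤ C
  /-- the probability weights of the nonlinearity -/
  q : ℕ → ℝ
  q_nonneg : ∀ j, 0 ≤ q j
  q_sum : HasSum q 1
  /-- the exponents `ℓ_j = (ℓ_{j,0}, …, ℓ_{j,H})` -/
  l : ℕ → Fin (H + 1) → ℕ
  /-- the coefficients `c_{j,0}`, used at times `t ≥ 0` -/
  c₀ : ℕ → ℝ → Space d → ℝ
  c₀_cont : ∀ j, ContinuousOn (fun z : ℝ × Space d => c₀ j z.1 z.2) (Ici 0 ×ˢ univ)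
  c₀_bdd : ∀ j, ∃ C : ℝ, ∀ t, 0 ≤ t → ∀ x, |c₀ j t x| ≤ C
  /-- the directions `c_{j,h}`, `1 ≤ h ≤ H`, used at times `t ≥ 0` -/
  c : ℕ → Fin H → ℝ → Space d → Space d
  c_cont : ∀ j h, ContinuousOn (fun z : ℝ × Space d => c j h z.1 z.2) (Ici 0 ×ˢ univ)
  c_unit : ∀ j h t, 0 ≤ t → ∀ x, ‖c j h t x‖ ≤ 1

variable {d N H : ℕ}

/-- The summand `q_j c_{j,0} v^{ℓ_{j,0}} ∏_h (c_{j,h}·Dv)^{ℓ_{j,h}}` at `(t,x)`. -/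
def Problem.nonlinTerm (S : Problem d N H) (v : ℝ → Space d → ℝ) (t : ℝ) (x : Space d)
    (j : ℕ) : ℝ :=
  S.q j * S.c₀ j t x * v t x ^ S.l j 0 *
    ∏ h : Fin H, (inner ℝ (S.c j h t x) (gradient (v t) x)) ^ S.l j h.succ

/-- The nonlinearity `∑_j q_j c_{j,0} v^{ℓ_{j,0}} ∏_h (c_{j,h}·Dv)^{ℓ_{j,h}}` at `(t,x)`. -/
def Problem.nonlin (S : Problem d N H) (v : ℝ → Space d → ℝ) (t : ℝ) (x : Space d) : ℝ :=
  ∑' j, S.nonlinTerm v t x j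

/-- The derivative `D^α ψ` of a Schwartz function. -/
def multiDeriv (α : Fin d →₀ ℕ) (ψ : 𝓢(Space d, ℂ)) : 𝓢(Space d, ℂ) :=
  (List.finRange d).foldr
    (fun m φ => (fun χ : 𝓢(Space d, ℂ) => ∂_{EuclideanSpace.single m (1 : ℝ)} χ)^[α m] φ) ψ

/-- The formal transpose `∑_α (-1)^{|α|} b_α D^α` of the spatial operator, on Schwartz functions. -/
def Problem.transposeOp (S : Problem d N H) (ψ : 𝓢(Space d, ℂ)) : 𝓢(Space d, ℂ) :=
  ∑ α ∈ S.b.support, (((-1) ^ α.degree * S.b.coeff α : ℝ) : ℂ) • multiDeriv α ψ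

/-- The pairing `⟨w, ψ⟩ = ∫ w ψ` of a function with a Schwartz function. -/
def pairing (w : Space d → ℝ) (ψ : 𝓢(Space d, ℂ)) : ℂ := ∫ x, (w x : ℂ) * ψ x

/-- Bounded continuous solutions on `[0,T] × ℝ^d` of the semilinear Cauchy problem.

`v` is bounded and continuous, it is `C¹` in space at positive times, and its nonlinearity
is given by an absolutely convergent series with a bounded sum. The equation and the initial
conditions hold in the space `𝓢'` of tempered distributions on `ℝ^d`: tested against any Schwartz
function `ψ`, the function `U(t) = ⟨v(t,·), ψ⟩` is of class `C^{N-1}` on `[0,T]`, it satisfies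
`U^{(n-1)}(0) = p_n ⟨f_n, ψ⟩` for `n = 1,…,N`, and it satisfies the equation
`∑_n a_n U^{(n)} = ⟨∑_α b_α D^α v(t,·), ψ⟩ + ⟨nonlinearity(t,·), ψ⟩`, integrated once in time. -/
structure IsBoundedSolution (S : Problem d N H) (T : ℝ) (v : ℝ → Space d → ℝ) : Prop where
  cont : ContinuousOn (fun z : ℝ × Space d => v z.1 z.2) (Icc 0 T ×ˢ univ)
  bdd : ∃ C : ℝ, ∀ t ∈ Icc 0 T, ∀ x, |v t x| ≤ C
  smooth_space : ∀ t ∈ Ioc 0 T, ContDiff ℝ 1 (v t)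
  summable_nonlin : ∀ t ∈ Ioc 0 T, ∀ x, Summable (S.nonlinTerm v t x)
  nonlin_bdd : ∃ C : ℝ, ∀ t ∈ Ioc 0 T, ∀ x, |S.nonlin v t x| ≤ C
  smooth_time : ∀ ψ, ContDiffOn ℝ (N - 1 : ℕ) (fun t => pairing (v t) ψ) (Icc 0 T)
  initial : ∀ ψ, ∀ n : Fin N,
    iteratedDerivWithin n (fun t => pairing (v t) ψ) (Icc 0 T) 0 = S.wt n * pairing (S.f n) ψ
  equation : ∀ ψ, ∀ t ∈ Icc 0 T,
    ∑ n ∈ Finset.Icc 1 N, (S.a n : ℂ) *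
        (iteratedDerivWithin (n - 1) (fun t => pairing (v t) ψ) (Icc 0 T) t -
          iteratedDerivWithin (n - 1) (fun t => pairing (v t) ψ) (Icc 0 T) 0) =
      ∫ s in (0 : ℝ)..t, (pairing (v s) (S.transposeOp ψ) + pairing (S.nonlin v s) ψ)

/-! ### The Green functions -/

/-- The symbol `b(ξ) = ∑_α i^{|α|} b_α ξ^α`. -/
def Problem.symbol (S : Problem d N H) (ξ : Space d) : ℂ :=
  MvPolynomial.aeval (fun m : Fin d => Complex.I * (ξ m : ℂ)) S.b

/-- The companion matrix `B(ξ)`: ones above the diagonal, and last row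
`(b(ξ), -a_1, …, -a_{N-1})`. -/
def Problem.companion (S : Problem d N H) (ξ : Space d) : Matrix (Fin N) (Fin N) ℂ :=
  Matrix.of fun i j =>
    if (i : ℕ) + 1 = N then (if (j : ℕ) = 0 then S.symbol ξ else -(S.a j : ℂ))
    else if (j : ℕ) = i + 1 then 1 else 0

/-- `ĝ_n(t,ξ)`, the `n`-th component of `(2π)^{-d/2} e^{t B(ξ)ᵀ} e_1`. -/
def Problem.greenHat (S : Problem d N H) (n : Fin N) (t : ℝ) (ξ : Space d) : ℂ :=
  (((2 * Real.pi) ^ (-(d : ℝ) / 2) : ℝ) : ℂ) *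
    (NormedSpace.exp ((t : ℂ) • (S.companion ξ).transpose)).mulVec
      (fun i => if (i : ℕ) = 0 then 1 else 0) n

/-- Multiplication by `(2π)⁻¹` on `ℝ^d`. -/
def scaleEquiv (d : ℕ) : Space d ≃L[ℝ] Space d :=
  ContinuousLinearEquiv.smulLeft (Units.mk0 ((2 * Real.pi)⁻¹ : ℝ) (by positivity))

/-- The inverse Fourier transform `φ ↦ (2π)^{-d/2} ∫ e^{iξ·x} φ(ξ) dξ` on Schwartz functions. -/
def invFourier (d : ℕ) : 𝓢(Space d, ℂ) →L[ℂ] 𝓢(Space d, ℂ) :=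
  (((2 * Real.pi) ^ (-(d : ℝ) / 2) : ℝ) : ℂ) •
    ((SchwartzMap.compCLMOfContinuousLinearEquiv ℂ (scaleEquiv d)).comp
      (FourierTransform.fourierInvCLM ℂ 𝓢(Space d, ℂ)))

theorem invFourier_apply (φ : 𝓢(Space d, ℂ)) (x : Space d) :
    invFourier d φ x = (((2 * Real.pi) ^ (-(d : ℝ) / 2) : ℝ) : ℂ) *
      ∫ ξ, Complex.exp (Complex.I * (inner ℝ ξ x : ℝ)) * φ ξ := by
  have h : 𝓕⁻ φ (scaleEquiv d x) = ∫ ξ, Complex.exp (Complex.I * (inner ℝ ξ x : ℝ)) * φ ξ := by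
    rw [SchwartzMap.fourierInv_coe, Real.fourierInv_eq']
    refine integral_congr_ae (Filter.Eventually.of_forall fun ξ => ?_)
    have hx : scaleEquiv d x = (2 * Real.pi)⁻¹ • x := rfl
    have hpi : (Real.pi : ℂ) ≠ 0 := Complex.ofReal_ne_zero.mpr Real.pi_ne_zero
    simp only [hx, inner_smul_right, smul_eq_mul]
    congr 2
    push_cast
    field_simp
  rw [← h]
  rfl

/-- The function `h` defines the tempered distribution `Λ`: both agree on test functions with
compact support, which are dense among the Schwartz functions. -/
def RepresentedByFun (Λ : 𝓢'(Space d, ℂ)) (h : Space d → ℂ) : Prop :=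
  ∀ φ : 𝓢(Space d, ℂ), HasCompactSupport φ → Λ φ = ∫ ξ, h ξ * φ ξ

/-- The function `h` belongs to `𝓢'`. -/
def IsTemperedFun (h : Space d → ℂ) : Prop := ∃ Λ : 𝓢'(Space d, ℂ), RepresentedByFun Λ h

open Classical in
/-- The Green function `g_n(t,·)`, i.e. the inverse Fourier transform of `ĝ_n(t,·)` in `𝓢'`:
`⟨g_n(t,·), φ⟩ = ⟨ĝ_n(t,·), 𝔉⁻¹ φ⟩`. -/
def Problem.green (S : Problem d N H) (n : Fin N) (t : ℝ) : 𝓢'(Space d, ℂ) :=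
  if h : IsTemperedFun (S.greenHat n t) then
    PointwiseConvergenceCLM.precomp ℂ (invFourier d) h.choose
  else 0

/-- The integral of a function against a finite signed measure. -/
def sintegral {F : Type*} [NormedAddCommGroup F] [NormedSpace ℝ F]
    (G : SignedMeasure (Space d)) (φ : Space d → F) : F :=
  (∫ z, φ z ∂G.toJordanDecomposition.posPart) - ∫ z, φ z ∂G.toJordanDecomposition.negPart

/-- The convolution `(G * φ)(x) = ∫ φ(x - z) G(dz)`. -/
def sconv (G : SignedMeasure (Space d)) (φ : Space d → ℝ) (x : Space d) : ℝ :=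
  sintegral G fun z => φ (x - z)

/-- The tempered distribution `Λ` is represented by the signed measure `G`. -/
def RepresentedByMeasure (Λ : 𝓢'(Space d, ℂ)) (G : SignedMeasure (Space d)) : Prop :=
  ∀ φ : 𝓢(Space d, ℂ), Λ φ = sintegral G φ

/-- Signed measures `G_n(t,·)` and `∂_m G_n(t,·)` (candidates for the Green functions and their
partial derivatives), dominating probability measures `μ_n(t,·)` and `μ¹_n(t,·)`, and densities
`γ_n(t,·)` and `γ¹_n(t,·)`, the measures and densities being jointly measurable. -/
structure GreenData (d N : ℕ) where
  G : Fin N → ℝ → SignedMeasure (Space d)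
  μ : Fin N → Kernel ℝ (Space d)
  μ_markov : ∀ n, IsMarkovKernel (μ n)
  γ : Fin N → ℝ → Space d → ℝ
  γ_meas : ∀ n, Measurable fun z : ℝ × Space d => γ n z.1 z.2
  DG : Fin N → Fin d → ℝ → SignedMeasure (Space d)
  μ₁ : Fin N → Kernel ℝ (Space d)
  μ₁_markov : ∀ n, IsMarkovKernel (μ₁ n)
  γ₁ : Fin N → ℝ → Space d → Space d
  γ₁_meas : ∀ n, Measurable fun z : ℝ × Space d => γ₁ n z.1 z.2

/-- The last index `N`. -/
def lastIdx (N : ℕ) [NeZero N] : Fin N := ⟨N - 1, Nat.sub_lt (NeZero.pos N) Nat.one_pos⟩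

/-- The functions `ĝ_n(t,·)` belong to `𝓢'`. -/
def GreenHatTempered (S : Problem d N H) (T : ℝ) : Prop :=
  ∀ n, ∀ t ∈ Icc 0 T, IsTemperedFun (S.greenHat n t)

/-- The Green functions are signed measures with densities `γ_n` with respect to the probability
measures `μ_n`. -/
structure GreenMeasures [NeZero N] (S : Problem d N H) (R : GreenData d N) (T : ℝ) : Prop where
  represents : ∀ n, ∀ t ∈ Icc 0 T, RepresentedByMeasure (S.green n t) (R.G n t)
  conv_cont : ∀ n, ∀ φ : Space d → ℝ, Continuous φ → (∃ C : ℝ, ∀ x, |φ x| ≤ C) →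
    ContinuousOn (fun z : ℝ × Space d => sconv (R.G n z.1) φ z.2) (Icc 0 T ×ˢ univ)
  integrable : ∀ n, ∀ t ∈ Icc 0 T, Integrable (R.γ n t) (R.μ n t)
  density : ∀ n, ∀ t ∈ Icc 0 T, R.G n t = (R.μ n t).withDensityᵥ (R.γ n t)
  density_bdd : ∀ n, ∀ t ∈ Icc 0 T, ∃ C : ℝ, ∀ᵐ z ∂(R.μ n t), |R.γ n t z| ≤ C
  mass_integrable : IntegrableOn (fun t => ∫ z, |R.γ (lastIdx N) t z| ∂(R.μ (lastIdx N) t)) (Icc 0 T)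

/-- At positive times, the distributional partial derivatives of the Green functions are signed
measures with densities `γ¹_{n,m}` with respect to the probability measures `μ¹_n`. -/
structure GreenGradientMeasures (S : Problem d N H) (R : GreenData d N) (T : ℝ) : Prop where
  represents : ∀ n m, ∀ t ∈ Ioc 0 T,
    RepresentedByMeasure (∂_{EuclideanSpace.single m (1 : ℝ)} (S.green n t)) (R.DG n m t)
  integrable : ∀ n m, ∀ t ∈ Ioc 0 T, Integrable (fun z => R.γ₁ n t z m) (R.μ₁ n t)
  density : ∀ n m, ∀ t ∈ Ioc 0 T, R.DG n m t = (R.μ₁ n t).withDensityᵥ (fun z => R.γ₁ n t z m)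

/-- The measure `|∂_x g_n|(t,·) = ∑_m |∂_{x_m} g_n|(t,·)`. -/
def GreenData.gradVariation (R : GreenData d N) (n : Fin N) (t : ℝ) : Measure (Space d) :=
  ∑ m, (R.DG n m t).totalVariation

/-! ### The constants -/

/-- `ρ` is a probability density on `(0,∞)`, positive there. -/
structure IsPositiveDensity (ρ : ℝ → ℝ) : Prop where
  meas : Measurable ρ
  pos : ∀ t, 0 < t → 0 < ρ t
  mass : ∫⁻ t in Ioi 0, ENNReal.ofReal (ρ t) = 1

/-- The tail `ρ̄(t) = ∫_t^∞ ρ(s) ds`. -/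
def tail (ρ : ℝ → ℝ) (t : ℝ) : ℝ := ∫ s in Ioi t, ρ s

/-- The sup norm on `ℝ^d`. -/
def supNorm (f : Space d → ℝ) : ℝ≥0∞ := ⨆ x, ‖f x‖ₑ

/-- The sup norm `‖∇f‖_∞` of the gradient of a Lipschitz function: its least Lipschitz constant
with respect to the Euclidean norm (and `∞` for functions that are not Lipschitz). -/
def gradNorm (f : Space d → ℝ) : ℝ≥0∞ := ⨆ x, ⨆ y, edist (f x) (f y) / edist x y

/-- `r̂_p`, with the supremum over `0 < t ≤ T`. -/
def rHat (S : Problem d N H) (R : GreenData d N) (ρ : ℝ → ℝ) (T p : ℝ) : ℝ≥0∞ :=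
  ⨆ t ∈ Ioc 0 T, ⨆ n : Fin N,
    max (supNorm (S.f n) ^ p * ∫⁻ z, ‖R.γ n t z‖ₑ ^ (p - 1) ∂(R.G n t).totalVariation)
      (gradNorm (S.f n) ^ p *
        ∫⁻ z, ‖z‖ₑ ^ p * ‖R.γ₁ n t z‖ₑ ^ (p - 1) ∂(R.gradVariation n t)) /
      ENNReal.ofReal (tail ρ t) ^ (p - 1)

/-- `α̂_p`, with the supremum over `0 < t ≤ T`. -/
def alphaHat [NeZero N] (R : GreenData d N) (ρ : ℝ → ℝ) (T p : ℝ) : ℝ≥0∞ :=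
  ⨆ t ∈ Ioc 0 T,
    max (∫⁻ z, ‖R.γ (lastIdx N) t z‖ₑ ^ (p - 1) ∂(R.G (lastIdx N) t).totalVariation)
      (∫⁻ z, ‖R.γ₁ (lastIdx N) t z‖ₑ ^ (p - 1) ∂(R.gradVariation (lastIdx N) t)) /
      ENNReal.ofReal (ρ t) ^ (p - 1)

/-- The power series `H_p(s) = ∑_j q_j ‖c_{j,0}‖_∞^p s^{ℓ_{j,0} + ⋯ + ℓ_{j,H}}`, for `s ≥ 0`. -/
def Problem.powerSeries (S : Problem d N H) (p : ℝ) (s : ℝ≥0∞) : ℝ≥0∞ :=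
  ∑' j, ENNReal.ofReal (S.q j) * (⨆ t ∈ Ici (0 : ℝ), supNorm (S.c₀ j t)) ^ p * s ^ (∑ h, S.l j h)

/-- The radius of convergence `R_p ∈ [0,∞]` of `H_p`, a power series with nonnegative
coefficients. -/
def Problem.radius (S : Problem d N H) (p : ℝ) : ℝ≥0∞ :=
  ⨆ s : ℝ≥0, ⨆ _ : S.powerSeries p s < ∞, (s : ℝ≥0∞)

/-! ### The branching mechanism -/

/-- Particles. The root is `[]`, and `(h, i) :: k` is the `i`-th particle (`i = 0, 1, …`) in the
`h`-th block of descendants of `k`. -/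
abbrev Particle (H : ℕ) := List (Fin (H + 1) × ℕ)

/-- The marks `(τ_k, I⁰_k, j)` of a particle; its numbers of descendants are `J_k = ℓ_j`. -/
abbrev Mark (N : ℕ) := ℝ × Fin N × ℕ

/-- The type `θ_k`. -/
def theta : Particle H → Fin (H + 1)
  | [] => 0
  | (h, _) :: _ => h

section Mechanism

variable (S : Problem d N H) (R : GreenData d N) (ρ : ℝ → ℝ) (t : ℝ)
  (D : Particle H → Mark N)

/-- The branching times `T^t_k`. -/
def brTime : Particle H → ℝ
  | [] => min t (D []).1
  | e :: k => min t (brTime k + (D (e :: k)).1)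

/-- The birth times `T^t_{k-}`. -/
def birthTime : Particle H → ℝ
  | [] => 0
  | _ :: k => brTime t D k

/-- The life times `ΔT^t_k`. -/
def lifeTime (k : Particle H) : ℝ := brTime t D k - birthTime t D k

/-- `k` has been living prior to `t`, i.e. `k ∈ K̄_t`. -/
def Born : Particle H → Prop
  | [] => True
  | (h, i) :: k => Born k ∧ brTime t D k < t ∧ i < S.l (D k).2.2 h

open Classical in
/-- The index `I^t_k`: it is `I⁰_k` for the particles alive at time `t`, and `N` for those which
branch before `t`. -/
def idx [NeZero N] (k : Particle H) : Fin N :=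
  if brTime t D k < t then lastIdx N else (D k).2.1

/-- The conditional law of the displacement `Ẑ_k` given the marks. -/
def stepLaw [NeZero N] (k : Particle H) : Measure (Space d) :=
  if theta k = 0 then R.μ (idx t D k) (lifeTime t D k) else R.μ₁ (idx t D k) (lifeTime t D k)

variable (x : Space d) (Z : Particle H → Space d)

/-- The position `X̂^k` of the particle `k` at its branching time. -/
def position : Particle H → Space d
  | [] => x - Z []
  | e :: k => position k - Z (e :: k)

/-- The position of the parent of `k` at the birth time of `k`. -/
def birthPosition : Particle H → Space d
  | [] => x
  | _ :: k => position x Z k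

/-- The weight `W_k`. -/
def weight [NeZero N] : Particle H → ℝ
  | [] => R.γ (idx t D []) (lifeTime t D []) (Z [])
  | (h, i) :: k =>
    Fin.cases (motive := fun _ => ℝ)
      (R.γ (idx t D ((h, i) :: k)) (lifeTime t D ((h, i) :: k)) (Z ((h, i) :: k)))
      (fun h' => inner ℝ (S.c (D k).2.2 h' (t - brTime t D k) (position x Z k))
        (R.γ₁ (idx t D ((h, i) :: k)) (lifeTime t D ((h, i) :: k)) (Z ((h, i) :: k))))
      h

open Classical in
/-- The factor of the particle `k`: the first case is for the particles which branch before `t`,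
the second case for those alive at `t`. -/
def factor [NeZero N] (k : Particle H) : ℝ :=
  if brTime t D k < t then
    weight S R t D x Z k / ρ (lifeTime t D k) *
      S.c₀ (D k).2.2 (t - brTime t D k) (position x Z k)
  else
    weight S R t D x Z k / tail ρ (lifeTime t D k) *
      (S.f (idx t D k) (position x Z k) -
        if theta k = 0 then 0 else S.f (idx t D k) (birthPosition x Z k))

open Classical in
/-- The random variable `ξ̂_{t,x}`: the product of the factors of all particles living prior to
`t`, and `0` if there are infinitely many of them. -/
def xiHat [NeZero N] : ℝ :=
  if h : {k | Born S t D k}.Finite then ∏ k ∈ h.toFinset, factor S R ρ t D x Z k else 0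

end Mechanism

/-- The random variables of the branching process on a probability space `(Ω, P)`: iid marks
`(τ_k, I⁰_k, J_k)` with independent components, `τ_k` of density `ρ`, `P[I⁰_k = n] = p_n`,
`P[J_k = ℓ_j] = q_j`; and, for each horizon `t`, displacements `Z_k` of the particles living prior
to `t`, which are conditionally independent given the marks, with conditional laws `stepLaw`. -/
structure BranchingSystem [NeZero N] (S : Problem d N H) (R : GreenData d N) (ρ : ℝ → ℝ) (T : ℝ)
    {Ω : Type*} [MeasurableSpace Ω] (P : Measure Ω) where
  mark : Particle H → Ω → Mark N
  mark_law : ∀ k, HasLaw (mark k)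
    (((volume.restrict (Ioi 0)).withDensity fun s => ENNReal.ofReal (ρ s)).prod
      ((∑ n : Fin N, ENNReal.ofReal (S.wt n) • Measure.dirac n).prod
        (Measure.sum fun j : ℕ => ENNReal.ofReal (S.q j) • Measure.dirac j))) P
  mark_meas : ∀ k, Measurable (mark k)
  mark_indep : iIndepFun mark P
  Z : ℝ → Particle H → Ω → Space d
  Z_meas : ∀ t k, Measurable (Z t k)
  Z_law : ∀ t ∈ Icc 0 T, ∀ (K : Finset (Particle H)) (A : Particle H → Set (Space d))
    (B : Set (Particle H → Mark N)), (∀ k, MeasurableSet (A k)) → MeasurableSet B →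
    P {ω | ((fun k => mark k ω) ∈ B ∧ ∀ k ∈ K, Born S t (fun k => mark k ω) k) ∧
        ∀ k ∈ K, Z t k ω ∈ A k} =
      ∫⁻ ω in {ω | (fun k => mark k ω) ∈ B ∧ ∀ k ∈ K, Born S t (fun k => mark k ω) k},
        ∏ k ∈ K, stepLaw R t (fun k => mark k ω) k (A k) ∂P

/-- The random variable `ξ̂_{t,x}` on the probability space of a branching system. -/
def BranchingSystem.xi [NeZero N] {S : Problem d N H} {R : GreenData d N} {ρ : ℝ → ℝ} {T : ℝ}
    {Ω : Type*} [MeasurableSpace Ω] {P : Measure Ω} (Y : BranchingSystem S R ρ T P)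
    (t : ℝ) (x : Space d) (ω : Ω) : ℝ :=
  xiHat S R ρ t (fun k => Y.mark k ω) x (fun k => Y.Z t k ω)

end BranchingCauchy

end

/-!
The proof links the branching functional to the Cauchy problem through the Duhamel formula
`u(t) = ∑_n p_n g_n(t) * f_n + ∫_0^t g_N(t - s) * 𝒩[u](s) ds`, whose fixed points are called mild
solutions.

**Bounded solutions are mild solutions.** Tested against a function with compact spectrum, the row
`(g_1, …, g_N)` solves `∂_t g = g B` with the companion matrix `B` of differential operators, and a
spectral cutoff extends this to all Schwartz functions (`GreenMeasures.pair_evolution`). By the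
Cayley–Hamilton identity for `B` (`Problem.sum_companionOp_pow`), the Duhamel formula therefore produces
weak solutions of the linear equation with a given bounded source (`isWeakSolution_mild`). Bounded weak
solutions of the linear equation are unique (`ae_eq_of_isWeakSolution`): on a test function with compact
spectrum the iterates of the spatial operator grow at most geometrically, so that a Gronwall argument
applies, and such test functions separate bounded functions. Taking `𝒩[u]` as the source,
every bounded solution satisfies the Duhamel formula (`IsBoundedSolution.ae_eq_mild`). The measures
`∂_{x_m} g_n` have total mass zero, and give the same formula for the directional derivatives, with
`f_n` replaced by its increments. Both formulas are treated together, as `mild θ`, where `θ` says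
whether the function or a derivative is meant.

**Moments.** Conditioning on the first branching step bounds the `p`-th moment of the functional,
truncated at generation `n + 1`, by `r̂_p + α̂_p ∫_0^t H_p` of the bound for generation `n`
(`lintegral_step_le`, `lintegral_offspring_le`). The solution of `φ' = α̂_p H_p(φ)`, `φ(0) = r̂_p`, stays
below `ŝ_p` up to time `T` by the hypothesis on the integral of `1 / H_p` (`exists_monotone_lintegral_le`,
`Problem.exists_supersolution`), and so it bounds the moments of all truncations
(`lintegral_branchVal_le`).

**Existence and uniqueness.** The expectation of the first branching step is the Duhamel formula
(`integral_stepVal`), so that the expectations of the truncated functionals form its Picard iteration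
started at zero (`meanVal_succ`). By the moment bound the iterates stay below `ŝ_p^{1/p}`, which
is less than `R_p^{1/p}`. On such functions the nonlinearity is Lipschitz, and since `g_N` and its gradient have
integrable mass in time, the iteration contracts in an exponentially weighted norm
(`exists_isMildSource`). Its limit is a bounded solution (`isBoundedSolution_mild`). A bounded solution
need not respect this bound a priori, but it starts close to the limit and cannot leave its
neighbourhood within a time step of fixed length, in which the contraction forces equality
(`IsBoundedSolution.eq_mild`).

**The branching functional.** For the argument above each particle carries an independent seed, that
is its marks and a uniform variable from which its displacement is sampled, and the subtrees of the
children of the root are independent copies of the whole tree (`measurePreserving_subtree`). The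
recursively defined truncated functional is the product over the tree if there are no particles of
generation `n`, and zero otherwise (`branchVal_eq_xiHat`). Hence it converges to the branching functional
pointwise, and it is dominated by it, which is in `L^p` by Fatou's lemma
(`exists_isMildSource_integral_xiHat`). Finally, the law of the branching functional is the same on every
probability space (`BranchingSystem.map_xi_eq`), in particular on that of the seeds.
-/

noncomputable section

namespace BranchingCauchy

variable {d N H : ℕ}

/-! ### Signed measures with a density -/

/-- The Jordan decomposition of a signed measure with density `g`: its parts have the densities
`g⁺` and `g⁻`. -/
theorem toJordanDecomposition_withDensityᵥ {μ : Measure (Space d)} {g : Space d → ℝ}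
    (hg : Integrable g μ) (hgm : Measurable g) :
    (SignedMeasure.toJordanDecomposition (μ.withDensityᵥ g)).posPart = μ.withDensity (fun z => ENNReal.ofReal (g z))
      ∧ (SignedMeasure.toJordanDecomposition (μ.withDensityᵥ g)).negPart =
        μ.withDensity (fun z => ENNReal.ofReal (-g z)) := by
  have h1 : IsFiniteMeasure (μ.withDensity fun z => ENNReal.ofReal (g z)) :=
    isFiniteMeasure_withDensity_ofReal hg.2
  have h2 : IsFiniteMeasure (μ.withDensity fun z => ENNReal.ofReal (-g z)) :=
    isFiniteMeasure_withDensity_ofReal hg.neg.2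
  let j : JordanDecomposition (Space d) :=
    { posPart := μ.withDensity (fun z => ENNReal.ofReal (g z))
      negPart := μ.withDensity (fun z => ENNReal.ofReal (-g z))
      mutuallySingular := withDensity_ofReal_mutuallySingular hgm }
  have : (SignedMeasure.toJordanDecomposition (μ.withDensityᵥ g)) = j := by
    apply SignedMeasure.toJordanDecomposition_eq
    exact withDensityᵥ_eq_withDensity_pos_part_sub_withDensity_neg_part hg
  rw [this]
  exact ⟨rfl, rfl⟩

theorem lintegral_totalVariation_withDensityᵥ {μ : Measure (Space d)} {g : Space d → ℝ}
    (hg : Integrable g μ) (hgm : Measurable g) {h : Space d → ℝ≥0∞} (hh : Measurable h) :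
    ∫⁻ z, h z ∂(SignedMeasure.totalVariation (μ.withDensityᵥ g)) = ∫⁻ z, ‖g z‖ₑ * h z ∂μ := by
  obtain ⟨h1, h2⟩ := toJordanDecomposition_withDensityᵥ hg hgm
  rw [SignedMeasure.totalVariation, h1, h2, lintegral_add_measure,
    lintegral_withDensity_eq_lintegral_mul _ (by fun_prop) hh,
    lintegral_withDensity_eq_lintegral_mul _ (by fun_prop) hh, ← lintegral_add_left (by fun_prop)]
  refine lintegral_congr fun z => ?_
  simp only [Pi.mul_apply]
  rw [← add_mul]
  congr 1
  rcases le_total 0 (g z) with h | h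
  · rw [ENNReal.ofReal_of_nonpos (neg_nonpos.2 h), add_zero, Real.enorm_of_nonneg h]
  · rw [ENNReal.ofReal_of_nonpos h, zero_add, ← enorm_neg, Real.enorm_of_nonneg (neg_nonneg.2 h)]

theorem sintegral_withDensityᵥ {F : Type*} [NormedAddCommGroup F] [NormedSpace ℝ F]
    {μ : Measure (Space d)} {g : Space d → ℝ} (hg : Integrable g μ) (hgm : Measurable g)
    {φ : Space d → F} (hφ : Integrable (fun z => g z • φ z) μ) :
    sintegral (μ.withDensityᵥ g) φ = ∫ z, g z • φ z ∂μ := by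
  obtain ⟨h1, h2⟩ := toJordanDecomposition_withDensityᵥ hg hgm
  have key : ∀ k : Space d → ℝ, Measurable k → ∫ z, φ z ∂(μ.withDensity fun z => ENNReal.ofReal (k z))
      = ∫ z, max (k z) 0 • φ z ∂μ := by
    intro k hk
    have : (fun z => ENNReal.ofReal (k z)) = fun z => ((k z).toNNReal : ℝ≥0∞) := rfl
    rw [this, integral_withDensity_eq_integral_smul (by fun_prop)]
    rfl
  have hsum : Integrable (fun z => max (g z) 0 • φ z) μ ∧ Integrable (fun z => max (-g z) 0 • φ z) μ := by
    have hs : ∀ s : Set (Space d), MeasurableSet s → Integrable (s.indicator fun z => g z • φ z) μ :=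
      fun s hs => hφ.indicator hs
    refine ⟨(hs {z | 0 ≤ g z} (measurableSet_le measurable_const hgm)).congr (.of_forall fun z => ?_),
      (hs {z | g z ≤ 0} (measurableSet_le hgm measurable_const)).neg.congr (.of_forall fun z => ?_)⟩
    · by_cases h : 0 ≤ g z
      · simp [indicator, h]
      · simp [indicator, h, max_eq_right (not_le.1 h).le]
    · by_cases h : g z ≤ 0
      · simp [indicator, h]
      · simp [indicator, h, (not_le.1 h).le]
  rw [sintegral, h1, h2, key _ hgm, key (fun z => -g z) hgm.neg, ← integral_sub hsum.1 hsum.2]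
  refine integral_congr_ae (.of_forall fun z => ?_)
  simp only [← sub_smul]
  congr 1
  rcases le_total 0 (g z) with h | h
  · rw [max_eq_left h, max_eq_right (neg_nonpos.2 h), sub_zero]
  · rw [max_eq_right h, max_eq_left (neg_nonneg.2 h)]; ring

/-- The `L¹` norm of a density is recovered by testing against bounded continuous functions. -/
theorem integral_abs_le_of_forall_continuous {μ : Measure (Space d)} [IsFiniteMeasure μ]
    {g : Space d → ℝ} (hg : Integrable g μ) {K : ℝ}
    (h : ∀ φ : Space d → ℝ, Continuous φ → (∀ x, |φ x| ≤ 1) → ∫ z, g z * φ z ∂μ ≤ K) :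
    ∫ z, |g z| ∂μ ≤ K := by
  -- approximate `g` in `L¹` by a bounded continuous `f`, and test with `f / (|f| + ε)`
  set m : ℝ := μ.real univ
  have hm : 0 ≤ m := measureReal_nonneg
  have key : ∀ ε > 0, ∫ z, |g z| ∂μ ≤ K + (2 + m) * ε := by
    intro ε hε
    obtain ⟨f, hf, hfm⟩ := (memLp_one_iff_integrable.2 hg).exists_boundedContinuous_eLpNorm_sub_le
      (by simp) (ε := ENNReal.ofReal ε) (by simpa using hε)
    have hfi : Integrable f μ := memLp_one_iff_integrable.1 hfm
    have hd : ∫ z, |g z - f z| ∂μ ≤ ε := by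
      rw [eLpNorm_one_eq_lintegral_enorm] at hf
      have := (integral_norm_eq_lintegral_enorm (hg.sub hfi).1)
      simp only [Pi.sub_apply, Real.norm_eq_abs] at this
      rw [this]
      exact ENNReal.toReal_le_of_le_ofReal hε.le hf
    have hpos : ∀ z, 0 < |f z| + ε := fun z => by positivity
    let φ : Space d → ℝ := fun z => f z / (|f z| + ε)
    have hφc : Continuous φ := f.continuous.div (by fun_prop) fun z => (hpos z).ne'
    have hφ1 : ∀ z, |φ z| ≤ 1 := fun z => by
      simp only [φ, abs_div, abs_of_pos (hpos z)]
      rw [div_le_one (hpos z)]; linarith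
    have hgφ : Integrable (fun z => g z * φ z) μ :=
      hg.mul_bdd (c := 1) hφc.aestronglyMeasurable (.of_forall hφ1)
    have hle : ∀ z, |g z| ≤ g z * φ z + 2 * |g z - f z| + ε := fun z => by
      have h1 : |g z| ≤ |g z - f z| + |f z| := by
        have := abs_add_le (g z - f z) (f z); simpa using this
      have h2 : |f z| - ε ≤ f z * φ z := by
        simp only [φ]
        rw [← mul_div_assoc, le_div_iff₀ (hpos z)]
        have : f z * f z = |f z| * |f z| := by rw [abs_mul_abs_self]
        rw [this]; nlinarith [sq_nonneg ε]
      have h3 : f z * φ z ≤ g z * φ z + |g z - f z| := by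
        have : (f z - g z) * φ z ≤ |g z - f z| := by
          calc (f z - g z) * φ z ≤ |(f z - g z) * φ z| := le_abs_self _
            _ = |g z - f z| * |φ z| := by rw [abs_mul, abs_sub_comm]
            _ ≤ |g z - f z| * 1 := by gcongr; exact hφ1 z
            _ = _ := mul_one _
        nlinarith
      linarith
    have hi1 : Integrable (fun z => 2 * |g z - f z|) μ := (hg.sub hfi).abs.const_mul 2
    calc ∫ z, |g z| ∂μ ≤ ∫ z, (g z * φ z + 2 * |g z - f z| + ε) ∂μ :=
          integral_mono hg.abs ((hgφ.add hi1).add (integrable_const _)) hle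
      _ = ∫ z, g z * φ z ∂μ + 2 * ∫ z, |g z - f z| ∂μ + m * ε := by
          rw [integral_add (by exact hgφ.add hi1) (integrable_const _), integral_add hgφ hi1,
            integral_const_mul, integral_const, smul_eq_mul]
      _ ≤ K + 2 * ε + m * ε := by gcongr; exact h φ hφc hφ1
      _ = _ := by ring
  refine le_of_forall_pos_le_add fun ε hε => ?_
  have h2 : 0 < 2 + m := by linarith
  have := key (ε / (2 + m)) (by positivity)
  rwa [mul_div_cancel₀ _ h2.ne'] at this

attribute [instance] GreenData.μ_markov GreenData.μ₁_markov

/-- By the uniform boundedness principle, the total masses of the Green functions are bounded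
on `[0,T]`: tested against bounded continuous functions they are continuous in time. -/
theorem GreenMeasures.exists_mass_bound [NeZero N] {S : Problem d N H} {R : GreenData d N} {T : ℝ}
    (h : GreenMeasures S R T) :
    ∃ K : ℝ, 0 ≤ K ∧ ∀ n, ∀ t ∈ Icc 0 T, ∫ z, |R.γ n t z| ∂(R.μ n t) ≤ K := by
  have main : ∀ n, ∃ K : ℝ, 0 ≤ K ∧ ∀ t ∈ Icc 0 T, ∫ z, |R.γ n t z| ∂(R.μ n t) ≤ K := by
    intro n
    have hγm : ∀ t, Measurable (R.γ n t) := fun t => (R.γ_meas n).comp measurable_prodMk_left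
    have hbd : ∀ t ∈ Icc 0 T, ∀ φ : BoundedContinuousFunction (Space d) ℝ,
        Integrable (fun z => R.γ n t z * φ z) (R.μ n t) := fun t ht φ =>
      (h.integrable n t ht).mul_bdd (c := ‖φ‖) φ.continuous.aestronglyMeasurable
        (.of_forall φ.norm_coe_le_norm)
    let L : Icc 0 T → BoundedContinuousFunction (Space d) ℝ →L[ℝ] ℝ := fun t =>
      LinearMap.mkContinuous
        { toFun := fun φ => ∫ z, R.γ n t z * φ z ∂(R.μ n t)
          map_add' := fun φ χ => by
            simp only [BoundedContinuousFunction.coe_add, Pi.add_apply, mul_add]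
            exact integral_add (hbd t t.2 φ) (hbd t t.2 χ)
          map_smul' := fun c φ => by
            simp only [BoundedContinuousFunction.coe_smul, smul_eq_mul, RingHom.id_apply,
              mul_left_comm _ c]
            exact integral_const_mul _ _ } (∫ z, |R.γ n t z| ∂(R.μ n t)) (fun φ => by
          simp only [LinearMap.coe_mk, AddHom.coe_mk, ← integral_mul_const]
          refine (norm_integral_le_integral_norm _).trans (integral_mono (hbd t t.2 φ).norm
            ((h.integrable n t t.2).abs.mul_const _) fun z => ?_)
          simp only [norm_mul, Real.norm_eq_abs]
          gcongr
          exact φ.norm_coe_le_norm z)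
    have hpt : ∀ φ, ∃ C, ∀ t, ‖L t φ‖ ≤ C := by
      intro φ
      have hc := h.conv_cont n (fun z => φ (-z)) (by fun_prop)
        ⟨‖φ‖, fun x => φ.norm_coe_le_norm _⟩
      have hc' : ContinuousOn (fun t => sconv (R.G n t) (fun z => φ (-z)) 0) (Icc 0 T) :=
        hc.comp (f := fun t : ℝ => (t, (0 : Space d))) (by fun_prop) fun t ht => ⟨ht, mem_univ _⟩
      obtain ⟨C, hC⟩ := isCompact_Icc.exists_bound_of_continuousOn hc'
      refine ⟨C, fun t => ?_⟩
      have := hC t t.2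
      rw [sconv, h.density n t t.2, sintegral_withDensityᵥ (h.integrable n t t.2) (hγm t)] at this
      · simp only [zero_sub, neg_neg] at this
        exact this
      · simpa using hbd t t.2 φ
    obtain ⟨C, hC⟩ := banach_steinhaus hpt
    refine ⟨max C 0, le_max_right _ _, fun t ht => (integral_abs_le_of_forall_continuous
      (h.integrable n t ht) fun φ hφ hφ1 => ?_).trans (le_max_left C 0)⟩
    let φ' := BoundedContinuousFunction.ofNormedAddCommGroup φ hφ 1 hφ1
    calc ∫ z, R.γ n t z * φ z ∂(R.μ n t) = L ⟨t, ht⟩ φ' := rfl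
      _ ≤ ‖L ⟨t, ht⟩ φ'‖ := le_abs_self _
      _ ≤ ‖L ⟨t, ht⟩‖ * ‖φ'‖ := ContinuousLinearMap.le_opNorm _ _
      _ ≤ ‖L ⟨t, ht⟩‖ * 1 := by
          gcongr; exact BoundedContinuousFunction.norm_ofNormedAddCommGroup_le _ zero_le_one _
      _ ≤ C := by rw [mul_one]; exact hC _
  choose K hK0 hK using main
  exact ⟨∑ n, K n, Finset.sum_nonneg fun n _ => hK0 n, fun n t ht => (hK n t ht).trans
    (Finset.single_le_sum (fun n _ => hK0 n) (Finset.mem_univ n))⟩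

/-! ### The spatial operator on the Fourier side -/

theorem invFourier_eq (φ : 𝓢(Space d, ℂ)) (ξ : Space d) :
    invFourier d φ ξ = (((2 * Real.pi) ^ (-(d : ℝ) / 2) : ℝ) : ℂ) *
      𝓕⁻ φ ((2 * Real.pi)⁻¹ • ξ) := rfl

theorem invFourier_injective : Function.Injective (invFourier d) := by
  intro φ ψ h
  have h0 : (((2 * Real.pi) ^ (-(d : ℝ) / 2) : ℝ) : ℂ) ≠ 0 :=
    Complex.ofReal_ne_zero.2 (by positivity)
  have : (𝓕⁻ φ : 𝓢(Space d, ℂ)) = 𝓕⁻ ψ := by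
    ext x
    have := DFunLike.congr_fun h ((2 * Real.pi) • x)
    rw [invFourier_eq, invFourier_eq, inv_smul_smul₀ (by positivity)] at this
    exact mul_left_cancel₀ h0 this
  have := congrArg (fun χ : 𝓢(Space d, ℂ) => (𝓕 χ : 𝓢(Space d, ℂ))) this
  simpa using this

theorem invFourier_lineDeriv (φ : 𝓢(Space d, ℂ)) (m : Fin d) (ξ : Space d) :
    invFourier d (∂_{EuclideanSpace.single m (1 : ℝ)} φ) ξ =
      -(Complex.I * (ξ m : ℂ)) * invFourier d φ ξ := by
  rw [invFourier_eq, invFourier_eq, SchwartzMap.fourierInv_lineDerivOp_eq]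
  have h : (fun x : Space d => inner ℝ x (EuclideanSpace.single m (1 : ℝ))).HasTemperateGrowth := by
    fun_prop
  have hpi : (Real.pi : ℂ) ≠ 0 := Complex.ofReal_ne_zero.2 Real.pi_ne_zero
  rw [smul_apply, SchwartzMap.smulLeftCLM_apply_apply h]
  simp [EuclideanSpace.inner_single_right]
  field_simp

theorem invFourier_multiDeriv (α : Fin d →₀ ℕ) (φ : 𝓢(Space d, ℂ)) (ξ : Space d) :
    invFourier d (multiDeriv α φ) ξ =
      (∏ m, (-(Complex.I * (ξ m : ℂ))) ^ α m) * invFourier d φ ξ := by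
  have hit : ∀ (m : Fin d) (k : ℕ) (χ : 𝓢(Space d, ℂ)), invFourier d
      ((fun χ : 𝓢(Space d, ℂ) => ∂_{EuclideanSpace.single m (1 : ℝ)} χ)^[k] χ) ξ =
      (-(Complex.I * (ξ m : ℂ))) ^ k * invFourier d χ ξ := by
    intro m k χ
    induction k with
    | zero => simp
    | succ k ih =>
      rw [Function.iterate_succ_apply', invFourier_lineDeriv, ih]
      ring
  have hl : ∀ l : List (Fin d), invFourier d (l.foldr (fun m φ => (fun χ : 𝓢(Space d, ℂ) =>
      ∂_{EuclideanSpace.single m (1 : ℝ)} χ)^[α m] φ) φ) ξ =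
      (l.map fun m => (-(Complex.I * (ξ m : ℂ))) ^ α m).prod * invFourier d φ ξ := by
    intro l
    induction l with
    | nil => simp
    | cons m l ih => rw [List.foldr_cons, hit, ih, List.map_cons, List.prod_cons, mul_assoc]
  rw [multiDeriv, hl, ← List.ofFn_eq_map, List.prod_ofFn]

theorem Problem.invFourier_transposeOp (S : Problem d N H) (φ : 𝓢(Space d, ℂ)) (ξ : Space d) :
    invFourier d (S.transposeOp φ) ξ = S.symbol ξ * invFourier d φ ξ := by
  rw [Problem.transposeOp, map_sum, Problem.symbol, MvPolynomial.aeval_def, MvPolynomial.eval₂_eq']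
  rw [sum_apply, Finset.sum_mul]
  refine Finset.sum_congr rfl fun α _ => ?_
  rw [map_smul, smul_apply, invFourier_multiDeriv, smul_eq_mul, ← mul_assoc]
  congr 1
  have : ∀ m, (-(Complex.I * (ξ m : ℂ))) ^ α m = (-1) ^ α m * (Complex.I * (ξ m : ℂ)) ^ α m :=
    fun m => by rw [← mul_pow]; ring
  simp only [this, Finset.prod_mul_distrib, Finset.prod_pow_eq_pow_sum]
  have h2 : ∑ m, α m = α.degree := by
    rw [Finsupp.degree_eq_sum]
  rw [h2]
  have h3 : ((-1 : ℂ)) ^ α.degree * (-1) ^ α.degree = 1 := by rw [← mul_pow]; simp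
  push_cast
  simp only [Complex.coe_algebraMap]
  linear_combination ((S.b.coeff α : ℝ) : ℂ) * (∏ i, (Complex.I * (ξ i : ℂ)) ^ α i) * h3

theorem Problem.continuous_symbol (S : Problem d N H) : Continuous S.symbol := by
  unfold Problem.symbol
  simp only [MvPolynomial.aeval_def, MvPolynomial.eval₂_eq']
  fun_prop

/-- The transposed spatial operator as a linear map. -/
def Problem.transposeLM (S : Problem d N H) : 𝓢(Space d, ℂ) →ₗ[ℂ] 𝓢(Space d, ℂ) where
  toFun := S.transposeOp
  map_add' φ ψ := invFourier_injective <| by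
    ext ξ
    simp only [map_add, add_apply, S.invFourier_transposeOp, mul_add]
  map_smul' c φ := invFourier_injective <| by
    ext ξ
    simp only [map_smul, smul_apply, S.invFourier_transposeOp, smul_eq_mul,
      RingHom.id_apply]
    ring

/-- The companion matrix with the symbol `b(ξ)` replaced by the transposed spatial operator: a
matrix of operators on Schwartz functions. -/
def Problem.companionOp (S : Problem d N H) :
    Matrix (Fin N) (Fin N) (Module.End ℂ 𝓢(Space d, ℂ)) :=
  Matrix.of fun i j =>
    if (i : ℕ) + 1 = N then (if (j : ℕ) = 0 then S.transposeLM else -(S.a j : ℂ) • 1)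
    else if (j : ℕ) = i + 1 then 1 else 0

theorem Problem.invFourier_companionOp (S : Problem d N H) (i j : Fin N) (φ : 𝓢(Space d, ℂ))
    (ξ : Space d) :
    invFourier d (S.companionOp i j φ) ξ = S.companion ξ i j * invFourier d φ ξ := by
  simp only [Problem.companionOp, Problem.companion, Matrix.of_apply]
  split_ifs
  · exact S.invFourier_transposeOp φ ξ
  · simp
  · simp
  · simp

theorem Problem.continuous_companion (S : Problem d N H) : Continuous S.companion := by
  refine continuous_matrix fun i j => ?_
  simp only [Problem.companion, Matrix.of_apply]
  split_ifs
  · exact S.continuous_symbol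
  all_goals fun_prop

/-- The translate `ψ(y + ·)`. -/
def shift (y : Space d) : 𝓢(Space d, ℂ) →L[ℂ] 𝓢(Space d, ℂ) := SchwartzMap.compSubConstCLM ℂ (-y)

theorem shift_apply (y : Space d) (ψ : 𝓢(Space d, ℂ)) (z : Space d) : shift y ψ z = ψ (y + z) := by
  simp [shift, add_comm]

theorem lineDeriv_shift (v y : Space d) (ψ : 𝓢(Space d, ℂ)) :
    ∂_{v} (shift y ψ) = shift y (∂_{v} ψ) := by
  ext z
  rw [shift_apply, SchwartzMap.lineDerivOp_apply_eq_fderiv, SchwartzMap.lineDerivOp_apply_eq_fderiv]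
  have : (shift y ψ : Space d → ℂ) = fun z => ψ (y + z) := funext (shift_apply y ψ)
  rw [this, fderiv_comp_add_left]

theorem multiDeriv_shift (α : Fin d →₀ ℕ) (y : Space d) (ψ : 𝓢(Space d, ℂ)) :
    multiDeriv α (shift y ψ) = shift y (multiDeriv α ψ) := by
  unfold multiDeriv
  induction List.finRange d with
  | nil => rfl
  | cons m l ih =>
    rw [List.foldr_cons, List.foldr_cons, ih]
    have hc : Function.Commute (fun χ : 𝓢(Space d, ℂ) => ∂_{EuclideanSpace.single m (1 : ℝ)} χ)
        (shift y) := fun χ => lineDeriv_shift _ _ _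
    exact (hc.iterate_left _).eq _

theorem Problem.transposeOp_shift (S : Problem d N H) (y : Space d) (ψ : 𝓢(Space d, ℂ)) :
    S.transposeOp (shift y ψ) = shift y (S.transposeOp ψ) := by
  simp only [Problem.transposeOp, map_sum, map_smul, multiDeriv_shift]

theorem Problem.companionOp_shift (S : Problem d N H) (i j : Fin N) (y : Space d)
    (ψ : 𝓢(Space d, ℂ)) :
    S.companionOp i j (shift y ψ) = shift y (S.companionOp i j ψ) := by
  simp only [Problem.companionOp, Matrix.of_apply]
  split_ifs
  · exact S.transposeOp_shift y ψ
  · simp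
  · simp
  · simp

/-! ### Cutting off the spectrum of a test function -/

/-- A smooth cutoff equal to `1` on the unit ball. -/
def cutoffBump (d : ℕ) : ContDiffBump (0 : Space d) := ⟨1, 2, by norm_num, by norm_num⟩

/-- The dilated cutoff `χ(x / (k + 1))` as a Schwartz function. -/
def cutoffFun (d k : ℕ) : 𝓢(Space d, ℂ) :=
  HasCompactSupport.toSchwartzMap
    (f := fun x : Space d => ((cutoffBump d ((k + 1 : ℝ)⁻¹ • x) : ℝ) : ℂ))
    (by
      have : HasCompactSupport fun x : Space d => cutoffBump d ((k + 1 : ℝ)⁻¹ • x) :=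
        (cutoffBump d).hasCompactSupport.comp_smul (by positivity)
      exact this.comp_left (g := fun r : ℝ => (r : ℂ)) (by simp))
    (by
      have : ContDiff ℝ ((⊤ : ℕ∞) : WithTop ℕ∞) fun x : Space d => cutoffBump d ((k + 1 : ℝ)⁻¹ • x) :=
        (cutoffBump d).contDiff.comp (contDiff_const_smul _)
      exact Complex.ofRealCLM.contDiff.comp this)

theorem cutoffFun_apply (k : ℕ) (x : Space d) :
    cutoffFun d k x = ((cutoffBump d ((k + 1 : ℝ)⁻¹ • x) : ℝ) : ℂ) := rfl

theorem hasCompactSupport_cutoffFun (k : ℕ) : HasCompactSupport (cutoffFun d k) := by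
  have : HasCompactSupport fun x : Space d => cutoffBump d ((k + 1 : ℝ)⁻¹ • x) :=
    (cutoffBump d).hasCompactSupport.comp_smul (by positivity)
  exact this.comp_left (g := fun r : ℝ => (r : ℂ)) (by simp)

theorem norm_cutoffFun_sub_one_le (k : ℕ) (x : Space d) : ‖cutoffFun d k x - 1‖ ≤ 1 := by
  rw [cutoffFun_apply, ← Complex.ofReal_one, ← Complex.ofReal_sub, Complex.norm_real,
    Real.norm_eq_abs, abs_le]
  have h1 := (cutoffBump d).nonneg (x := (k + 1 : ℝ)⁻¹ • x)
  have h2 := (cutoffBump d).le_one (x := (k + 1 : ℝ)⁻¹ • x)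
  constructor <;> linarith

open Filter Topology in
theorem tendsto_cutoffFun (x : Space d) : Tendsto (fun k => cutoffFun d k x) atTop (𝓝 1) := by
  have h : Tendsto (fun k : ℕ => ((k : ℝ) + 1)⁻¹ • x) atTop (𝓝 0) := by
    have h1 : Tendsto (fun k : ℕ => ((k : ℝ) + 1)⁻¹) atTop (𝓝 0) := by
      simpa using tendsto_one_div_add_atTop_nhds_zero_nat (𝕜 := ℝ)
    simpa using h1.smul_const x
  have h2 : ContinuousAt (fun y => ((cutoffBump d y : ℝ) : ℂ)) 0 :=
    (Complex.continuous_ofReal.comp (cutoffBump d).continuous).continuousAt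
  have h3 := h2.tendsto.comp h
  have h4 : (cutoffBump d (0 : Space d)) = 1 :=
    (cutoffBump d).one_of_mem_closedBall (by simp [(cutoffBump d).rIn_pos.le])
  rw [h4] at h3
  simpa [Function.comp_def, cutoffFun_apply] using h3

/-- The Schwartz function whose Fourier transform is that of `φ` times a cutoff. -/
def cutSpectrum (k : ℕ) (φ : 𝓢(Space d, ℂ)) : 𝓢(Space d, ℂ) :=
  𝓕 (SchwartzMap.smulLeftCLM ℂ (cutoffFun d k) (𝓕⁻ φ))

theorem fourierInv_cutSpectrum (k : ℕ) (φ : 𝓢(Space d, ℂ)) (x : Space d) :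
    𝓕⁻ (cutSpectrum k φ) x = cutoffFun d k x * 𝓕⁻ φ x := by
  have h : (cutoffFun d k : Space d → ℂ).HasTemperateGrowth := (cutoffFun d k).hasTemperateGrowth
  rw [cutSpectrum, FourierTransform.fourierInv_fourier_eq, SchwartzMap.smulLeftCLM_apply_apply h,
    smul_eq_mul]

theorem hasCompactSupport_invFourier_cutSpectrum (k : ℕ) (φ : 𝓢(Space d, ℂ)) :
    HasCompactSupport (invFourier d (cutSpectrum k φ)) := by
  have h : (invFourier d (cutSpectrum k φ) : Space d → ℂ) = fun ξ =>
      cutoffFun d k ((2 * Real.pi)⁻¹ • ξ) * invFourier d φ ξ := by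
    funext ξ
    rw [invFourier_eq, invFourier_eq, fourierInv_cutSpectrum]
    ring
  rw [h]
  exact ((hasCompactSupport_cutoffFun k).comp_smul (by positivity)).mul_right

theorem Problem.companionOp_cutSpectrum (S : Problem d N H) (i j : Fin N) (k : ℕ)
    (φ : 𝓢(Space d, ℂ)) :
    S.companionOp i j (cutSpectrum k φ) = cutSpectrum k (S.companionOp i j φ) := by
  refine invFourier_injective ?_
  ext ξ
  rw [S.invFourier_companionOp, invFourier_eq, invFourier_eq, fourierInv_cutSpectrum,
    fourierInv_cutSpectrum]
  have := S.invFourier_companionOp i j φ ξ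
  rw [invFourier_eq, invFourier_eq] at this
  linear_combination (-cutoffFun d k ((2 * Real.pi)⁻¹ • ξ)) * this

open Filter Topology in
/-- Cutting off the spectrum at larger and larger frequencies approximates a test function
uniformly. -/
theorem exists_tendsto_cutSpectrum (φ : 𝓢(Space d, ℂ)) :
    ∃ ε : ℕ → ℝ, Tendsto ε atTop (𝓝 0) ∧ ∀ k x, ‖cutSpectrum k φ x - φ x‖ ≤ ε k := by
  refine ⟨fun k => ∫ ξ, ‖(cutoffFun d k ξ - 1) * 𝓕⁻ φ ξ‖, ?_, fun k x => ?_⟩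
  · have h0 : (0 : ℝ) = ∫ ξ : Space d, (0 : ℝ) := by simp
    rw [h0]
    refine tendsto_integral_of_dominated_convergence (fun ξ => ‖𝓕⁻ φ ξ‖) (fun k => ?_)
      ((𝓕⁻ φ).integrable.norm) (fun k => .of_forall fun ξ => ?_) (.of_forall fun ξ => ?_)
    · have := (cutoffFun d k).continuous
      have := (𝓕⁻ φ).continuous
      exact Continuous.aestronglyMeasurable (by fun_prop)
    · rw [norm_norm, norm_mul]
      exact mul_le_of_le_one_left (norm_nonneg _) (norm_cutoffFun_sub_one_le k ξ)
    · have := (((tendsto_cutoffFun ξ).sub_const 1).mul_const (𝓕⁻ φ ξ)).norm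
      simpa using this
  · have h1 : cutSpectrum k φ x - φ x = 𝓕 (𝓕⁻ (cutSpectrum k φ - φ)) x := by simp
    rw [h1, SchwartzMap.fourier_coe]
    refine (VectorFourier.norm_fourierIntegral_le_integral_norm _ _ _ _ _).trans_eq ?_
    refine integral_congr_ae (.of_forall fun ξ => ?_)
    have h2 : 𝓕⁻ (cutSpectrum k φ - φ) ξ = 𝓕⁻ (cutSpectrum k φ) ξ - 𝓕⁻ φ ξ := by
      exact DFunLike.congr_fun ((FourierTransform.fourierInvCLM ℂ 𝓢(Space d, ℂ)).map_sub _ _) ξ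
    simp only [h2, fourierInv_cutSpectrum, sub_mul, one_mul]

/-! ### The evolution equation of the Green functions -/

section GreenHat

open scoped Matrix.Norms.Operator

theorem Problem.hasDerivAt_greenHat (S : Problem d N H) (m : Fin N) (t : ℝ) (ξ : Space d) :
    HasDerivAt (fun t => S.greenHat m t ξ)
      (∑ i, S.greenHat i t ξ * S.companion ξ i m) t := by
  set A := (S.companion ξ).transpose with hA
  have h1 : HasDerivAt (fun t : ℝ => NormedSpace.exp ((t : ℂ) • A))
      (A * NormedSpace.exp ((t : ℂ) • A)) t := by
    convert! hasDerivAt_exp_smul_const' A t using 1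
  set e : Fin N → ℂ := fun i => if (i : ℕ) = 0 then 1 else 0 with he
  let L : Matrix (Fin N) (Fin N) ℂ →ₗ[ℝ] ℂ :=
    { toFun := fun M => (((2 * Real.pi) ^ (-(d : ℝ) / 2) : ℝ) : ℂ) * M.mulVec e m
      map_add' := fun M M' => by rw [Matrix.add_mulVec, Pi.add_apply, mul_add]
      map_smul' := fun c M => by
        rw [Matrix.smul_mulVec, Pi.smul_apply, mul_smul_comm, RingHom.id_apply] }
  have h2 := (LinearMap.toContinuousLinearMap L).hasFDerivAt.comp_hasDerivAt t h1
  refine h2.congr_deriv ?_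
  change (((2 * Real.pi) ^ (-(d : ℝ) / 2) : ℝ) : ℂ) *
    (A * NormedSpace.exp ((t : ℂ) • A)).mulVec e m = _
  rw [← Matrix.mulVec_mulVec, Matrix.mulVec, dotProduct, Finset.mul_sum]
  refine Finset.sum_congr rfl fun i _ => ?_
  rw [Problem.greenHat, ← hA, ← he, hA, Matrix.transpose_apply]
  ring

theorem Problem.continuous_greenHat (S : Problem d N H) (m : Fin N) :
    Continuous fun z : ℝ × Space d => S.greenHat m z.1 z.2 := by
  have h1 : Continuous fun z : ℝ × Space d =>
      NormedSpace.exp ((z.1 : ℂ) • (S.companion z.2).transpose) := by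
    refine NormedSpace.exp_continuous.comp ?_
    exact (Complex.continuous_ofReal.comp continuous_fst).smul
      (S.continuous_companion.comp continuous_snd).matrix_transpose
  unfold Problem.greenHat
  refine continuous_const.mul ?_
  exact (continuous_apply m).comp (h1.matrix_mulVec continuous_const)

theorem eq_add_integral_of_hasDerivAt {f f' : ℝ → ℂ} (h : ∀ s, HasDerivAt f (f' s) s)
    (hf' : Continuous f') (t : ℝ) : f t = f 0 + ∫ s in (0 : ℝ)..t, f' s := by
  rw [intervalIntegral.integral_eq_sub_of_hasDerivAt (fun s _ => h s) (hf'.intervalIntegrable 0 t)]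
  ring

theorem Problem.greenHat_eq_add_integral (S : Problem d N H) (m : Fin N) (t : ℝ) (ξ : Space d) :
    S.greenHat m t ξ = S.greenHat m 0 ξ +
      ∫ s in (0 : ℝ)..t, ∑ i, S.greenHat i s ξ * S.companion ξ i m := by
  have hc : ∀ i, Continuous fun s : ℝ => S.greenHat i s ξ := by
    intro i
    have h := (S.continuous_greenHat i).comp (by fun_prop : Continuous fun s : ℝ => (s, ξ))
    exact h
  have hc' : Continuous fun s => ∑ i, S.greenHat i s ξ * S.companion ξ i m :=
    continuous_finsetSum _ fun i _ => (hc i).mul continuous_const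
  have hd : ∀ s, HasDerivAt (fun s => S.greenHat m s ξ)
      ((fun s => ∑ i, S.greenHat i s ξ * S.companion ξ i m) s) s := by
    intro s
    exact S.hasDerivAt_greenHat m s ξ
  have := eq_add_integral_of_hasDerivAt hd hc' t
  exact this

theorem Problem.greenHat_zero (S : Problem d N H) (m : Fin N) (ξ : Space d) :
    S.greenHat m 0 ξ =
      if (m : ℕ) = 0 then (((2 * Real.pi) ^ (-(d : ℝ) / 2) : ℝ) : ℂ) else 0 := by
  simp [Problem.greenHat]

end GreenHat

/-- The pairing of the Green measure `g_n(t,·)` with a function. -/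
def GreenData.pair (R : GreenData d N) (n : Fin N) (t : ℝ) (φ : Space d → ℂ) : ℂ :=
  ∫ z, (R.γ n t z : ℂ) * φ z ∂(R.μ n t)

theorem GreenData.measurable_γ (R : GreenData d N) (n : Fin N) (t : ℝ) : Measurable (R.γ n t) :=
  (R.γ_meas n).comp measurable_prodMk_left

theorem GreenMeasures.integrable_γ_mul [NeZero N] {S : Problem d N H} {R : GreenData d N} {T : ℝ}
    (h : GreenMeasures S R T) (n : Fin N) {t : ℝ} (ht : t ∈ Icc 0 T) {φ : Space d → ℂ}
    (hφm : AEStronglyMeasurable φ (R.μ n t)) {C : ℝ} (hφ : ∀ z, ‖φ z‖ ≤ C) :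
    Integrable (fun z => (R.γ n t z : ℂ) * φ z) (R.μ n t) :=
  (h.integrable n t ht).ofReal.mul_bdd (c := C) hφm (.of_forall hφ)

theorem GreenMeasures.pair_eq [NeZero N] {S : Problem d N H} {R : GreenData d N} {T : ℝ}
    (h : GreenMeasures S R T) (n : Fin N) {t : ℝ} (ht : t ∈ Icc 0 T) (φ : 𝓢(Space d, ℂ)) :
    S.green n t φ = R.pair n t φ := by
  rw [h.represents n t ht φ, h.density n t ht,
    sintegral_withDensityᵥ (h.integrable n t ht) (R.measurable_γ n t)]
  · rfl
  · exact h.integrable_γ_mul n ht φ.continuous.aestronglyMeasurable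
      (fun z => φ.norm_le_seminorm ℝ z)

theorem GreenMeasures.norm_pair_le [NeZero N] {S : Problem d N H} {R : GreenData d N} {T K : ℝ}
    (h : GreenMeasures S R T) (hK : ∀ n, ∀ t ∈ Icc 0 T, ∫ z, |R.γ n t z| ∂(R.μ n t) ≤ K)
    (n : Fin N) {t : ℝ} (ht : t ∈ Icc 0 T) {φ : Space d → ℂ} {C : ℝ} (hφ : ∀ z, ‖φ z‖ ≤ C) :
    ‖R.pair n t φ‖ ≤ K * C := by
  have hC : 0 ≤ C := (norm_nonneg _).trans (hφ 0)
  have hi := (h.integrable n t ht).abs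
  calc ‖R.pair n t φ‖ ≤ ∫ z, |R.γ n t z| * C ∂(R.μ n t) := by
        refine norm_integral_le_of_norm_le (hi.mul_const C) (.of_forall fun z => ?_)
        rw [norm_mul, Complex.norm_real, Real.norm_eq_abs]
        gcongr
        exact hφ z
    _ = (∫ z, |R.γ n t z| ∂(R.μ n t)) * C := integral_mul_const _ _
    _ ≤ K * C := by gcongr; exact hK n t ht

theorem GreenData.measurable_pair {X : Type*} [MeasurableSpace X] (R : GreenData d N) (n : Fin N)
    {φ : X → Space d → ℂ} (hφ : Measurable fun z : X × Space d => φ z.1 z.2)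
    {s : X → ℝ} (hs : Measurable s) : Measurable fun x => R.pair n (s x) (φ x) := by
  let κ : Kernel X (Space d) := (R.μ n).comap s hs
  have : StronglyMeasurable fun x => ∫ z, (R.γ n (s x) z : ℂ) * φ x z ∂(κ x) := by
    refine StronglyMeasurable.integral_kernel_prod_right'
      (f := fun q : X × Space d => (R.γ n (s q.1) q.2 : ℂ) * φ q.1 q.2) ?_
    refine Measurable.stronglyMeasurable (Measurable.mul ?_ hφ)
    exact Complex.measurable_ofReal.comp
      ((R.γ_meas n).comp ((hs.comp measurable_fst).prodMk measurable_snd))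
  simpa [κ, GreenData.pair, Kernel.comap_apply] using this.measurable

/-- For a test function with compactly supported Fourier transform, the pairing with the Green
function is an honest integral on the Fourier side. -/
theorem Problem.green_apply_of_hasCompactSupport (S : Problem d N H) {T : ℝ}
    (hS : GreenHatTempered S T) (n : Fin N) {t : ℝ} (ht : t ∈ Icc 0 T) {φ : 𝓢(Space d, ℂ)}
    (hφ : HasCompactSupport (invFourier d φ)) :
    S.green n t φ = ∫ ξ, S.greenHat n t ξ * invFourier d φ ξ := by
  have h := hS n t ht
  rw [Problem.green, dif_pos h]
  exact h.choose_spec (invFourier d φ) hφ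

theorem integral_invFourier (φ : 𝓢(Space d, ℂ)) :
    ∫ ξ, (((2 * Real.pi) ^ (-(d : ℝ) / 2) : ℝ) : ℂ) * invFourier d φ ξ = φ 0 := by
  simp only [invFourier_eq, ← mul_assoc]
  rw [integral_const_mul, Measure.integral_comp_inv_smul, finrank_euclideanSpace_fin]
  have h1 : ∫ x, 𝓕⁻ φ x = φ 0 := by
    have h2 : φ 0 = 𝓕 (𝓕⁻ φ) 0 := by simp
    rw [h2, SchwartzMap.fourier_coe, Real.fourier_eq]
    simp
  rw [h1, abs_of_pos (by positivity), Complex.real_smul, ← mul_assoc, ← Complex.ofReal_mul,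
    ← Complex.ofReal_mul, ← Real.rpow_add (by positivity), ← Real.rpow_natCast,
    ← Real.rpow_add (by positivity)]
  simp

theorem Problem.integrable_greenHat_mul (S : Problem d N H) (i m : Fin N) {t : ℝ}
    {χ : 𝓢(Space d, ℂ)} (hχ : HasCompactSupport χ) :
    Integrable (fun q : ℝ × Space d => S.greenHat i q.1 q.2 * (S.companion q.2 i m * χ q.2))
      ((volume.restrict (Ioc 0 t)).prod volume) := by
  have hc : Continuous fun q : ℝ × Space d =>
      S.greenHat i q.1 q.2 * (S.companion q.2 i m * χ q.2) := by
    have h1 := S.continuous_greenHat i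
    have h2 : Continuous fun ξ => S.companion ξ i m :=
      (continuous_apply_apply i m).comp S.continuous_companion
    have h3 := χ.continuous
    fun_prop
  have hcomp : IsCompact (Icc 0 t ×ˢ tsupport χ) := isCompact_Icc.prod hχ
  have h1 : IntegrableOn (fun q : ℝ × Space d =>
      S.greenHat i q.1 q.2 * (S.companion q.2 i m * χ q.2)) (Ioc 0 t ×ˢ tsupport χ) volume :=
    (hc.continuousOn.integrableOn_compact hcomp).mono_set (prod_mono Ioc_subset_Icc_self le_rfl)
  have h2 : IntegrableOn (fun q : ℝ × Space d =>
      S.greenHat i q.1 q.2 * (S.companion q.2 i m * χ q.2)) (Ioc 0 t ×ˢ univ) volume := by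
    refine h1.of_forall_sdiff_eq_zero (measurableSet_Ioc.prod MeasurableSet.univ) ?_
    rintro ⟨s, ξ⟩ ⟨⟨hs, -⟩, h⟩
    have : ξ ∉ tsupport χ := fun hξ => h ⟨hs, hξ⟩
    simp [image_eq_zero_of_notMem_tsupport this]
  rw [IntegrableOn, Measure.volume_eq_prod, ← Measure.prod_restrict, Measure.restrict_univ] at h2
  exact h2

/-- On test functions with compact spectrum the pairing is an integral of `e^{tB(ξ)}` over a compact set,
so that it may be differentiated under the integral sign although `b` is unbounded. -/
theorem GreenMeasures.pair_evolution_of_hasCompactSupport [NeZero N] {S : Problem d N H}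
    {R : GreenData d N} {T : ℝ} (h : GreenMeasures S R T) (hS : GreenHatTempered S T) (m : Fin N)
    {t : ℝ} (ht : t ∈ Icc 0 T) {φ : 𝓢(Space d, ℂ)} (hφ : HasCompactSupport (invFourier d φ)) :
    R.pair m t φ = (if (m : ℕ) = 0 then φ 0 else 0) +
      ∫ s in (0 : ℝ)..t, ∑ i, R.pair i s (S.companionOp i m φ) := by
  set χ := invFourier d φ with hχ
  have hsub : ∀ s ∈ Ioc 0 t, s ∈ Icc 0 T := fun s hs => ⟨hs.1.le, hs.2.trans ht.2⟩
  have hpair : ∀ i, ∀ s ∈ Ioc 0 t, R.pair i s (S.companionOp i m φ) =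
      ∫ ξ, S.greenHat i s ξ * (S.companion ξ i m * χ ξ) := by
    intro i s hs
    rw [← h.pair_eq i (hsub s hs), S.green_apply_of_hasCompactSupport hS i (hsub s hs)]
    · simp only [S.invFourier_companionOp, hχ]
    · have : (invFourier d (S.companionOp i m φ) : Space d → ℂ) = fun ξ => S.companion ξ i m * χ ξ :=
        funext fun ξ => S.invFourier_companionOp i m φ ξ
      rw [this]
      exact hφ.mul_left
  have hder : ∀ ξ, S.greenHat m t ξ * χ ξ = S.greenHat m 0 ξ * χ ξ +
      ∫ s in (0 : ℝ)..t, ∑ i, S.greenHat i s ξ * (S.companion ξ i m * χ ξ) := by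
    intro ξ
    have h1 := S.greenHat_eq_add_integral m t ξ
    rw [h1, add_mul, ← intervalIntegral.integral_mul_const]
    simp only [Finset.sum_mul, mul_assoc]
  have hint := fun i => S.integrable_greenHat_mul i m (t := t) hφ
  have hsum : Integrable (fun q : ℝ × Space d =>
      ∑ i, S.greenHat i q.1 q.2 * (S.companion q.2 i m * χ q.2))
      ((volume.restrict (Ioc 0 t)).prod volume) := integrable_finsetSum _ fun i _ => hint i
  have hzero : Integrable fun ξ => S.greenHat m 0 ξ * χ ξ := by
    have : Continuous fun ξ => S.greenHat m 0 ξ * χ ξ :=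
      ((S.continuous_greenHat m).comp (by fun_prop : Continuous fun ξ : Space d => ((0 : ℝ), ξ))).mul χ.continuous
    exact this.integrable_of_hasCompactSupport hφ.mul_left
  rw [← h.pair_eq m ht, S.green_apply_of_hasCompactSupport hS m ht hφ, ← hχ]
  simp only [hder]
  rw [integral_add hzero]
  · congr 1
    · simp only [S.greenHat_zero, ite_mul, zero_mul]
      split_ifs
      · exact integral_invFourier φ
      · simp
    · simp only [intervalIntegral.integral_of_le ht.1]
      rw [← integral_integral_swap (f := fun s ξ =>
        ∑ i, S.greenHat i s ξ * (S.companion ξ i m * χ ξ)) hsum]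
      refine setIntegral_congr_ae measurableSet_Ioc ?_
      filter_upwards [ae_all_iff.2 fun i => (ae_restrict_iff' measurableSet_Ioc).1
        (hint i).prod_right_ae] with s hs hst
      rw [integral_finsetSum _ fun i _ => hs i hst]
      exact Finset.sum_congr rfl fun i _ => (hpair i s hst).symm
  · have := hsum.integral_prod_right
    simpa only [intervalIntegral.integral_of_le ht.1] using this

/-- **Evolution of the Green functions.** Tested against Schwartz functions, the row
`(g_1(t), …, g_N(t))` solves `∂_t g = g B` with `g(0) = (δ_0, 0, …, 0)`, where `B` is the companion
matrix of operators. -/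
theorem GreenMeasures.pair_evolution [NeZero N] {S : Problem d N H}
    {R : GreenData d N} {T : ℝ} (h : GreenMeasures S R T) (hS : GreenHatTempered S T) (m : Fin N)
    {t : ℝ} (ht : t ∈ Icc 0 T) (φ : 𝓢(Space d, ℂ)) :
    R.pair m t φ = (if (m : ℕ) = 0 then φ 0 else 0) +
      ∫ s in (0 : ℝ)..t, ∑ i, R.pair i s (S.companionOp i m φ) := by
  obtain ⟨K, hK0, hK⟩ := h.exists_mass_bound
  have hconv : ∀ i, ∀ s ∈ Icc 0 T, ∀ ψ : 𝓢(Space d, ℂ), Filter.Tendsto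
      (fun k => R.pair i s (cutSpectrum k ψ)) Filter.atTop (nhds (R.pair i s ψ)) := by
    intro i s hs ψ
    obtain ⟨ε, hε, hle⟩ := exists_tendsto_cutSpectrum ψ
    rw [tendsto_iff_norm_sub_tendsto_zero]
    refine squeeze_zero (fun _ => norm_nonneg _) (fun k => ?_)
      (by simpa using hε.const_mul K)
    have hi : ∀ χ : 𝓢(Space d, ℂ), Integrable (fun z => (R.γ i s z : ℂ) * χ z) (R.μ i s) :=
      fun χ => h.integrable_γ_mul i hs χ.continuous.aestronglyMeasurable
        (fun z => χ.norm_le_seminorm ℝ z)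
    have : R.pair i s (cutSpectrum k ψ) - R.pair i s ψ =
        R.pair i s fun z => cutSpectrum k ψ z - ψ z := by
      rw [GreenData.pair, GreenData.pair, ← integral_sub]
      · simp only [GreenData.pair, mul_sub]
      · exact hi _
      · exact hi _
    rw [this]
    exact h.norm_pair_le hK i hs (hle k)
  have h1 := hconv m t ht φ
  have h0 : Filter.Tendsto (fun k => cutSpectrum k φ 0) Filter.atTop (nhds (φ 0)) := by
    obtain ⟨ε, hε, hle⟩ := exists_tendsto_cutSpectrum φ
    rw [tendsto_iff_norm_sub_tendsto_zero]
    exact squeeze_zero (fun _ => norm_nonneg _) (fun k => hle k 0) hε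
  have h2 : Filter.Tendsto (fun k => ∫ s in (0 : ℝ)..t,
      ∑ i, R.pair i s (S.companionOp i m (cutSpectrum k φ))) Filter.atTop
      (nhds (∫ s in (0 : ℝ)..t, ∑ i, R.pair i s (S.companionOp i m φ))) := by
    have hB : ∀ i, ∃ C, ∀ k z, ‖S.companionOp i m (cutSpectrum k φ) z‖ ≤ C := by
      intro i
      obtain ⟨ε, hε, hle⟩ := exists_tendsto_cutSpectrum (S.companionOp i m φ)
      obtain ⟨C, hC⟩ := hε.bddAbove_range
      refine ⟨C + SchwartzMap.seminorm ℝ 0 0 (S.companionOp i m φ), fun k z => ?_⟩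
      rw [S.companionOp_cutSpectrum]
      have := norm_le_norm_sub_add (cutSpectrum k (S.companionOp i m φ) z) (S.companionOp i m φ z)
      exact this.trans (add_le_add ((hle k z).trans (hC ⟨k, rfl⟩))
        (SchwartzMap.norm_le_seminorm ℝ _ z))
    choose C hC using hB
    refine intervalIntegral.tendsto_integral_filter_of_dominated_convergence
      (fun _ => ∑ i, K * C i) (.of_forall fun k => ?_) (.of_forall fun k => .of_forall fun s hs => ?_)
      (by simp) (.of_forall fun s hs => ?_)
    · refine Measurable.aestronglyMeasurable (Finset.measurable_sum _ fun i _ => ?_)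
      exact R.measurable_pair i (((SchwartzMap.continuous _).measurable).comp measurable_snd)
        measurable_id
    · rw [uIoc_of_le ht.1] at hs
      refine (norm_sum_le _ _).trans (Finset.sum_le_sum fun i _ => ?_)
      exact h.norm_pair_le hK i ⟨hs.1.le, hs.2.trans ht.2⟩ (hC i k)
    · rw [uIoc_of_le ht.1] at hs
      refine tendsto_finsetSum _ fun i _ => ?_
      simp only [S.companionOp_cutSpectrum]
      exact hconv i s ⟨hs.1.le, hs.2.trans ht.2⟩ _
  have h3 : Filter.Tendsto (fun k => (if (m : ℕ) = 0 then cutSpectrum k φ 0 else 0) +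
      ∫ s in (0 : ℝ)..t, ∑ i, R.pair i s (S.companionOp i m (cutSpectrum k φ))) Filter.atTop
      (nhds ((if (m : ℕ) = 0 then φ 0 else 0) +
        ∫ s in (0 : ℝ)..t, ∑ i, R.pair i s (S.companionOp i m φ))) := by
    refine Filter.Tendsto.add ?_ h2
    split_ifs
    · exact h0
    · exact tendsto_const_nhds
  refine tendsto_nhds_unique h1 (h3.congr fun k => ?_)
  exact (h.pair_evolution_of_hasCompactSupport hS m ht
    (hasCompactSupport_invFourier_cutSpectrum k φ)).symm

/-! ### Weak solutions of the linear equation -/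

section TimeDerivatives

variable {T : ℝ} {n : ℕ} {y : ℕ → ℝ → ℂ}

theorem hasDerivWithinAt_of_eq_add_integral {f g : ℝ → ℂ} (hT : 0 ≤ T)
    (hg : ContinuousOn g (Icc 0 T))
    (h : ∀ t ∈ Icc 0 T, f t = f 0 + ∫ s in (0 : ℝ)..t, g s) {t : ℝ} (ht : t ∈ Icc 0 T) :
    HasDerivWithinAt f (g t) (Icc 0 T) t := by
  set e : ℝ → ℂ := IccExtend hT ((Icc 0 T).domRestrict g) with he
  have hec : Continuous e := (continuousOn_iff_continuous_domRestrict.1 hg).Icc_extend'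
  have heq : ∀ s ∈ Icc 0 T, e s = g s := fun s hs => by
    rw [he, IccExtend_of_mem _ _ hs]; rfl
  have h1 : HasDerivAt (fun t => f 0 + ∫ s in (0 : ℝ)..t, e s) (e t) t :=
    (hec.integral_hasStrictDerivAt 0 t).hasDerivAt.const_add _
  rw [heq t ht] at h1
  refine h1.hasDerivWithinAt.congr_of_mem (fun r hr => ?_) ht
  rw [h r hr]
  congr 1
  refine intervalIntegral.integral_congr fun s hs => ?_
  rw [uIcc_of_le hr.1] at hs
  exact (heq s ⟨hs.1, hs.2.trans hr.2⟩).symm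

/-- Successive primitives are successive derivatives. -/
theorem contDiffOn_of_eq_add_integral (hT : 0 < T)
    (hc : ∀ k ≤ n, ContinuousOn (y k) (Icc 0 T))
    (h : ∀ k < n, ∀ t ∈ Icc 0 T, y k t = y k 0 + ∫ s in (0 : ℝ)..t, y (k + 1) s) :
    ContDiffOn ℝ n (y 0) (Icc 0 T) ∧
      ∀ k ≤ n, ∀ t ∈ Icc 0 T, iteratedDerivWithin k (y 0) (Icc 0 T) t = y k t := by
  have key : ∀ k ≤ n, ∀ t ∈ Icc 0 T, iteratedDerivWithin k (y 0) (Icc 0 T) t = y k t := by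
    intro k
    induction k with
    | zero => intro _ t _; simp
    | succ k ih =>
      intro hk t ht
      rw [iteratedDerivWithin_succ, derivWithin_congr (fun s hs => ih (by omega) s hs)
        (ih (by omega) t ht)]
      exact (hasDerivWithinAt_of_eq_add_integral hT.le (hc _ hk) (h k (by omega)) ht).derivWithin
        (uniqueDiffOn_Icc hT t ht)
  refine ⟨contDiffOn_of_continuousOn_differentiableOn_deriv (fun k hk => ?_) (fun k hk => ?_), key⟩
  · have hk' : k ≤ n := by exact_mod_cast hk
    exact (hc k hk').congr fun t ht => key k hk' t ht
  · have hk' : k < n := by exact_mod_cast hk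
    refine DifferentiableOn.congr (f := y k) (fun t ht => ?_) fun t ht => key k hk'.le t ht
    exact (hasDerivWithinAt_of_eq_add_integral hT.le (hc _ hk') (h k hk')
      ht).differentiableWithinAt

theorem iteratedDerivWithin_eq_add_integral {f : ℝ → ℂ} (hT : 0 < T)
    (hf : ContDiffOn ℝ n f (Icc 0 T)) {k : ℕ} (hk : k < n) {t : ℝ} (ht : t ∈ Icc 0 T) :
    iteratedDerivWithin k f (Icc 0 T) t = iteratedDerivWithin k f (Icc 0 T) 0 +
      ∫ s in (0 : ℝ)..t, iteratedDerivWithin (k + 1) f (Icc 0 T) s := by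
  have hu := uniqueDiffOn_Icc hT
  have hd := hf.differentiableOn_iteratedDerivWithin (m := k) (by exact_mod_cast hk) hu
  have hc := hf.continuousOn_iteratedDerivWithin (m := k + 1) (by exact_mod_cast hk) hu
  have hsub : Icc 0 t ⊆ Icc 0 T := Icc_subset_Icc_right ht.2
  rw [intervalIntegral.integral_eq_sub_of_hasDeriv_right_of_le ht.1
    (f := iteratedDerivWithin k f (Icc 0 T))
    (hd.continuousOn.mono hsub) (fun s hs => ?_)
    ((hc.mono (by rwa [uIcc_of_le ht.1])).intervalIntegrable)]
  · ring
  · have hs' : s ∈ Icc 0 T := hsub (Ioo_subset_Icc_self hs)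
    have h1 := (hd s hs').hasDerivWithinAt
    rw [← iteratedDerivWithin_succ] at h1
    exact (h1.hasDerivAt (Icc_mem_nhds hs.1 (hs.2.trans_le ht.2))).hasDerivWithinAt

end TimeDerivatives

/-- The family of functionals `U t`, `t ∈ [0,T]`, solves
`∑_n a_n ∂_t^n U = ∑_α b_α D^α U + σ`, `∂_t^{n-1} U(0) = init n`,
in the sense of distributions in space and integrated once in time. -/
structure IsWeakSolution (S : Problem d N H) (T : ℝ) (U : ℝ → 𝓢(Space d, ℂ) → ℂ)
    (init : Fin N → 𝓢(Space d, ℂ) → ℂ) (σ : ℝ → 𝓢(Space d, ℂ) → ℂ) : Prop where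
  integrable_source : ∀ ψ, IntervalIntegrable (fun s => σ s ψ) volume 0 T
  smooth_time : ∀ ψ, ContDiffOn ℝ (N - 1 : ℕ) (fun t => U t ψ) (Icc 0 T)
  initial : ∀ ψ, ∀ n : Fin N, iteratedDerivWithin n (fun t => U t ψ) (Icc 0 T) 0 = init n ψ
  equation : ∀ ψ, ∀ t ∈ Icc 0 T,
    ∑ n ∈ Finset.Icc 1 N, (S.a n : ℂ) *
        (iteratedDerivWithin (n - 1) (fun t => U t ψ) (Icc 0 T) t -
          iteratedDerivWithin (n - 1) (fun t => U t ψ) (Icc 0 T) 0) =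
      ∫ s in (0 : ℝ)..t, (U s (S.transposeOp ψ) + σ s ψ)

namespace IsWeakSolution

variable {S : Problem d N H} {T : ℝ} {U U' : ℝ → 𝓢(Space d, ℂ) → ℂ}
  {init init' : Fin N → 𝓢(Space d, ℂ) → ℂ} {σ σ' : ℝ → 𝓢(Space d, ℂ) → ℂ}

theorem intervalIntegrable (h : IsWeakSolution S T U init σ) (ψ : 𝓢(Space d, ℂ)) {t : ℝ}
    (ht : t ∈ Icc 0 T) : IntervalIntegrable (fun s => U s ψ) volume 0 t :=
  ((h.smooth_time ψ).continuousOn.mono (by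
    rw [uIcc_of_le ht.1]; exact Icc_subset_Icc_right ht.2)).intervalIntegrable

theorem intervalIntegrable_source (h : IsWeakSolution S T U init σ) (ψ : 𝓢(Space d, ℂ)) {t : ℝ}
    (ht : t ∈ Icc 0 T) : IntervalIntegrable (fun s => σ s ψ) volume 0 t :=
  (h.integrable_source ψ).mono_set (by
    rw [uIcc_of_le ht.1, uIcc_of_le (ht.1.trans ht.2)]; exact Icc_subset_Icc_right ht.2)

theorem congr (hT : 0 ≤ T) (h : IsWeakSolution S T U init σ)
    (hU : ∀ t ∈ Icc 0 T, ∀ ψ, U' t ψ = U t ψ)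
    (hi : ∀ n ψ, init' n ψ = init n ψ) (hσ : ∀ t ∈ Ioc 0 T, ∀ ψ, σ' t ψ = σ t ψ) :
    IsWeakSolution S T U' init' σ' := by
  have hit : ∀ (k : ℕ) ψ, ∀ t ∈ Icc 0 T, iteratedDerivWithin k (fun t => U' t ψ) (Icc 0 T) t =
      iteratedDerivWithin k (fun t => U t ψ) (Icc 0 T) t := fun k ψ t ht =>
    iteratedDerivWithin_congr (fun s hs => hU s hs ψ) ht
  have h0 : (0 : ℝ) ∈ Icc 0 T := ⟨le_rfl, hT⟩
  refine ⟨fun ψ => ?_, fun ψ => ?_, fun ψ n => ?_, fun ψ t ht => ?_⟩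
  · refine (h.integrable_source ψ).congr fun s hs => ?_
    rw [uIoc_of_le hT] at hs
    exact (hσ s hs ψ).symm
  · exact (h.smooth_time ψ).congr fun t ht => hU t ht ψ
  · rw [hit _ _ _ h0, h.initial, hi]
  · simp only [hit _ _ _ h0, hit _ _ _ ht]
    rw [h.equation ψ t ht]
    refine intervalIntegral.integral_congr_ae (.of_forall fun s hs => ?_)
    rw [uIoc_of_le ht.1] at hs
    rw [hU s ⟨hs.1.le, hs.2.trans ht.2⟩, hσ s ⟨hs.1, hs.2.trans ht.2⟩]

theorem add (hT : 0 < T) (h : IsWeakSolution S T U init σ) (h' : IsWeakSolution S T U' init' σ') :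
    IsWeakSolution S T (fun t ψ => U t ψ + U' t ψ) (fun n ψ => init n ψ + init' n ψ)
      (fun s ψ => σ s ψ + σ' s ψ) := by
  have hu := uniqueDiffOn_Icc hT
  have h0 : (0 : ℝ) ∈ Icc 0 T := ⟨le_rfl, hT.le⟩
  have hit : ∀ k ≤ N - 1, ∀ ψ, ∀ t ∈ Icc 0 T,
      iteratedDerivWithin k (fun t => U t ψ + U' t ψ) (Icc 0 T) t =
      iteratedDerivWithin k (fun t => U t ψ) (Icc 0 T) t +
      iteratedDerivWithin k (fun t => U' t ψ) (Icc 0 T) t := fun k hk ψ t ht => by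
    refine iteratedDerivWithin_fun_add ht hu ?_ ?_
    · exact ((h.smooth_time ψ).of_le (by exact_mod_cast hk)).contDiffWithinAt ht
    · exact ((h'.smooth_time ψ).of_le (by exact_mod_cast hk)).contDiffWithinAt ht
  refine ⟨fun ψ => (h.integrable_source ψ).add (h'.integrable_source ψ),
    fun ψ => (h.smooth_time ψ).add (h'.smooth_time ψ), fun ψ n => ?_, fun ψ t ht => ?_⟩
  · rw [hit n (by omega) ψ 0 h0, h.initial, h'.initial]
  · have e1 := h.equation ψ t ht
    have e2 := h'.equation ψ t ht
    have : ∫ s in (0 : ℝ)..t, (U s (S.transposeOp ψ) + U' s (S.transposeOp ψ) +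
        (σ s ψ + σ' s ψ)) = (∫ s in (0 : ℝ)..t, (U s (S.transposeOp ψ) + σ s ψ)) +
          ∫ s in (0 : ℝ)..t, (U' s (S.transposeOp ψ) + σ' s ψ) := by
      rw [← intervalIntegral.integral_add
        ((h.intervalIntegrable _ ht).add (h.intervalIntegrable_source _ ht))
        ((h'.intervalIntegrable _ ht).add (h'.intervalIntegrable_source _ ht))]
      refine intervalIntegral.integral_congr fun s _ => ?_
      ring
    rw [this, ← e1, ← e2, ← Finset.sum_add_distrib]
    refine Finset.sum_congr rfl fun n hn => ?_
    have hn' : n - 1 ≤ N - 1 := by have := (Finset.mem_Icc.1 hn).2; omega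
    rw [hit _ hn' ψ t ht, hit _ hn' ψ 0 h0]
    ring

theorem const_mul (hT : 0 < T) (c : ℂ) (h : IsWeakSolution S T U init σ) :
    IsWeakSolution S T (fun t ψ => c * U t ψ) (fun n ψ => c * init n ψ)
      (fun s ψ => c * σ s ψ) := by
  have hu := uniqueDiffOn_Icc hT
  have h0 : (0 : ℝ) ∈ Icc 0 T := ⟨le_rfl, hT.le⟩
  have hit : ∀ k ≤ N - 1, ∀ ψ, ∀ t ∈ Icc 0 T,
      iteratedDerivWithin k (fun t => c * U t ψ) (Icc 0 T) t =
      c * iteratedDerivWithin k (fun t => U t ψ) (Icc 0 T) t := fun k hk ψ t ht => by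
    refine iteratedDerivWithin_const_mul ht hu c ?_
    exact ((h.smooth_time ψ).of_le (by exact_mod_cast hk)).contDiffWithinAt ht
  refine ⟨fun ψ => (h.integrable_source ψ).const_mul c,
    fun ψ => contDiffOn_const.mul (h.smooth_time ψ), fun ψ n => ?_, fun ψ t ht => ?_⟩
  · rw [hit n (by omega) ψ 0 h0, h.initial]
  · simp only [← mul_add]
    rw [intervalIntegral.integral_const_mul, ← h.equation ψ t ht, Finset.mul_sum]
    refine Finset.sum_congr rfl fun n hn => ?_
    have hn' : n - 1 ≤ N - 1 := by have := (Finset.mem_Icc.1 hn).2; omega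
    rw [hit _ hn' ψ t ht, hit _ hn' ψ 0 h0]
    ring

theorem zero (S : Problem d N H) : IsWeakSolution S T (fun _ _ => 0) (fun _ _ => 0) (fun _ _ => 0) := by
  have hit : ∀ k (t : ℝ), iteratedDerivWithin k (fun _ : ℝ => (0 : ℂ)) (Icc 0 T) t = 0 := by
    intro k t
    simp
  exact ⟨fun ψ => by simp, fun ψ => contDiffOn_const, fun ψ n => hit _ _, fun ψ t ht => by simp [hit]⟩

theorem sum (hT : 0 < T) {ι : Type*} (A : Finset ι) {U : ι → ℝ → 𝓢(Space d, ℂ) → ℂ}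
    {init : ι → Fin N → 𝓢(Space d, ℂ) → ℂ} {σ : ι → ℝ → 𝓢(Space d, ℂ) → ℂ}
    (h : ∀ i ∈ A, IsWeakSolution S T (U i) (init i) (σ i)) :
    IsWeakSolution S T (fun t ψ => ∑ i ∈ A, U i t ψ) (fun n ψ => ∑ i ∈ A, init i n ψ)
      (fun s ψ => ∑ i ∈ A, σ i s ψ) := by
  classical
  induction A using Finset.induction_on with
  | empty => simpa using zero S
  | insert a A ha ih =>
    simp only [Finset.sum_insert ha]
    exact add hT (h a (by simp)) (ih fun i hi => h i (by simp [hi]))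

end IsWeakSolution

section Companion

variable [NeZero N] (S : Problem d N H)

theorem Problem.companionOp_pow_zero {k : ℕ} (hk : k < N) (j : Fin N) :
    (S.companionOp ^ k) 0 j = if (j : ℕ) = k then 1 else 0 := by
  induction k generalizing j with
  | zero =>
    rw [pow_zero, Matrix.one_apply]
    by_cases h : (j : ℕ) = 0
    · rw [if_pos h, if_pos (Fin.ext (by simpa using h.symm))]
    · rw [if_neg h, if_neg (fun h' => h (by rw [← h']; simp))]
  | succ k ih =>
    rw [pow_succ, Matrix.mul_apply, Finset.sum_eq_single ⟨k, by omega⟩]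
    · rw [ih (by omega), if_pos rfl, one_mul]
      simp only [Problem.companionOp, Matrix.of_apply]
      rw [if_neg (show ¬(k + 1 = N) by omega)]
    · intro i _ hi
      rw [ih (by omega), if_neg (fun h => hi (Fin.ext h)), zero_mul]
    · simp

/-- The Cayley–Hamilton identity for the companion matrix. -/
theorem Problem.sum_companionOp_pow :
    ∑ n ∈ Finset.Icc 1 N, (S.a n : ℂ) • S.companionOp ^ n =
      Matrix.diagonal fun _ => S.transposeLM := by
  set M := ∑ n ∈ Finset.Icc 1 N, (S.a n : ℂ) • S.companionOp ^ n with hM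
  have hN : 0 < N := NeZero.pos N
  -- the first row
  have h0 : ∀ j, M 0 j = if (j : ℕ) = 0 then S.transposeLM else 0 := by
    intro j
    have hs : Finset.Icc 1 N = insert N (Finset.Ico 1 N) := by
      ext x; simp; omega
    rw [hM, hs, Finset.sum_insert (by simp), Matrix.add_apply, Matrix.sum_apply]
    have h1 : ∀ n ∈ Finset.Ico 1 N, ((S.a n : ℂ) • S.companionOp ^ n) 0 j =
        if (j : ℕ) = n then (S.a n : ℂ) • 1 else 0 := by
      intro n hn
      rw [Matrix.smul_apply, S.companionOp_pow_zero (Finset.mem_Ico.1 hn).2]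
      split_ifs <;> simp
    rw [Finset.sum_congr rfl h1, S.a_top, Complex.ofReal_one, one_smul]
    obtain ⟨N', hN'⟩ : ∃ N', N = N' + 1 := ⟨N - 1, by omega⟩
    have h2 : (S.companionOp ^ N) 0 j = if (j : ℕ) = 0 then S.transposeLM else -(S.a j : ℂ) • 1 := by
      have : S.companionOp ^ N = S.companionOp ^ N' * S.companionOp := by rw [← pow_succ, ← hN']
      rw [this, Matrix.mul_apply, Finset.sum_eq_single ⟨N', by omega⟩]
      · rw [S.companionOp_pow_zero (by omega), if_pos rfl, one_mul]
        simp only [Problem.companionOp, Matrix.of_apply]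
        rw [if_pos hN'.symm]
      · intro i _ hi
        rw [S.companionOp_pow_zero (by omega), if_neg (fun h => hi (Fin.ext h)), zero_mul]
      · simp
    rw [h2]
    by_cases hj : (j : ℕ) = 0
    · rw [if_pos hj, if_pos hj, Finset.sum_eq_zero, add_zero]
      intro n hn
      rw [if_neg (by have := (Finset.mem_Ico.1 hn).1; omega)]
    · rw [if_neg hj, if_neg hj, Finset.sum_eq_single (j : ℕ)]
      · simp
      · intro n _ hn
        rw [if_neg (fun h => hn h.symm)]
      · intro h
        exact absurd (Finset.mem_Ico.2 ⟨by omega, j.2⟩) h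
  have hcomm : ∀ k, S.companionOp ^ k * M = M * S.companionOp ^ k := by
    intro k
    rw [hM, Finset.sum_mul, Finset.mul_sum]
    refine Finset.sum_congr rfl fun n _ => ?_
    rw [Matrix.mul_smul, Matrix.smul_mul, ← pow_add, ← pow_add, add_comm]
  ext1 i j
  have h3 : (S.companionOp ^ (i : ℕ) * M) 0 j = M i j := by
    rw [Matrix.mul_apply, Finset.sum_eq_single i]
    · rw [S.companionOp_pow_zero i.2, if_pos rfl, one_mul]
    · intro l _ hl
      rw [S.companionOp_pow_zero i.2, if_neg (fun h => hl (Fin.ext h)), zero_mul]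
    · simp
  have h4 : (M * S.companionOp ^ (i : ℕ)) 0 j = if j = i then S.transposeLM else 0 := by
    rw [Matrix.mul_apply, Finset.sum_eq_single 0]
    · rw [h0, if_pos (by simp), S.companionOp_pow_zero i.2]
      by_cases h : j = i
      · rw [if_pos (by rw [h]), if_pos h, mul_one]
      · rw [if_neg (fun h' => h (Fin.ext h')), if_neg h, mul_zero]
    · intro l _ hl
      rw [h0, if_neg (fun h => hl (Fin.ext (by simpa using h))), zero_mul]
    · simp
  rw [← h3, hcomm, h4, Matrix.diagonal_apply]
  by_cases h : j = i
  · rw [if_pos h, if_pos h.symm]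
  · rw [if_neg h, if_neg (fun h' => h h'.symm)]

/-- A row vector `P` of functionals with `P' = P B + σ e_1ᵀ`, `P(0) = w e_1ᵀ`, where `B` is the
companion matrix, consists of weak solutions of the scalar equation, as far as the source does not
enter the derivatives of order less than `N`. -/
theorem isWeakSolution_of_evolution {T : ℝ} (hT : 0 < T)
    {P : Fin N → ℝ → 𝓢(Space d, ℂ) → ℂ} {w : 𝓢(Space d, ℂ) → ℂ} {σ : ℝ → 𝓢(Space d, ℂ) → ℂ}
    (hlin : ∀ i, ∀ s ∈ Icc 0 T, IsLinearMap ℂ (P i s))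
    (hint : ∀ i ψ, IntervalIntegrable (fun s => P i s ψ) volume 0 T)
    (hw : w 0 = 0) (hσ0 : ∀ s, σ s 0 = 0)
    (hσ : ∀ ψ, IntervalIntegrable (fun s => σ s ψ) volume 0 T)
    (hev : ∀ i, ∀ t ∈ Icc 0 T, ∀ ψ, P i t ψ =
      (if (i : ℕ) = 0 then w ψ + ∫ s in (0 : ℝ)..t, σ s ψ else 0) +
        ∫ s in (0 : ℝ)..t, ∑ j, P j s (S.companionOp j i ψ))
    (m : Fin N) (hm : (m : ℕ) + 1 = N ∨ ∀ s ψ, σ s ψ = 0) :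
    IsWeakSolution S T (P m) (fun n ψ => if n = m then w ψ else 0) σ := by
  have hu : ∀ t ∈ Icc 0 T, uIcc 0 t ⊆ uIcc 0 T := fun t ht => by
    rw [uIcc_of_le ht.1, uIcc_of_le hT.le]; exact Icc_subset_Icc_right ht.2
  have h0T : (0 : ℝ) ∈ Icc 0 T := ⟨le_rfl, hT.le⟩
  set y : 𝓢(Space d, ℂ) → ℕ → ℝ → ℂ := fun ψ k t => ∑ i, P i t ((S.companionOp ^ k) i m ψ) with hy
  have hyint : ∀ ψ k, IntervalIntegrable (y ψ k) volume 0 T := fun ψ k => by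
    have := IntervalIntegrable.sum (s := Finset.univ)
      (f := fun i s => P i s ((S.companionOp ^ k) i m ψ)) (fun i _ => hint i _)
    convert! this using 1
    funext s; simp [hy]
  have hyev : ∀ ψ, ∀ k < N, ∀ t ∈ Icc 0 T, y ψ k t =
      (if k = (m : ℕ) then w ψ + ∫ s in (0 : ℝ)..t, σ s ψ else 0) +
        ∫ s in (0 : ℝ)..t, y ψ (k + 1) s := by
    intro ψ k hk t ht
    simp only [hy]
    rw [Finset.sum_congr rfl fun i _ => hev i t ht _, Finset.sum_add_distrib]
    congr 1
    · rw [Finset.sum_eq_single 0]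
      · rw [if_pos (by simp), S.companionOp_pow_zero hk]
        by_cases h : k = (m : ℕ)
        · rw [if_pos h.symm, if_pos h]; rfl
        · rw [if_neg (fun h' => h h'.symm), if_neg h]
          simp [hw, hσ0]
      · intro i _ hi
        rw [if_neg (fun h => hi (Fin.ext (by simpa using h)))]
      · simp
    · rw [← intervalIntegral.integral_finsetSum]
      · refine intervalIntegral.integral_congr fun s hs => ?_
        have hs' : s ∈ Icc 0 T := by
          have := hu t ht hs
          rwa [uIcc_of_le hT.le] at this
        rw [Finset.sum_comm]
        refine Finset.sum_congr rfl fun j _ => ?_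
        rw [pow_succ', Matrix.mul_apply, LinearMap.sum_apply,
          ← IsLinearMap.mk'_apply (hlin j s hs'), map_sum]
        rfl
      · intro i _
        have := IntervalIntegrable.sum (s := Finset.univ)
          (f := fun j s => P j s (S.companionOp j i ((S.companionOp ^ k) i m ψ)))
          (fun j _ => (hint j _).mono_set (hu t ht))
        convert! this using 1
        funext s; simp
  have hsrc : ∀ ψ, ∀ k, k + 1 < N → (∀ t, (if k = (m : ℕ) then w ψ + ∫ s in (0 : ℝ)..t, σ s ψ else 0) =
      if k = (m : ℕ) then w ψ else 0) := by
    intro ψ k hk t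
    rcases hm with hm | hm
    · rw [if_neg (by omega), if_neg (by omega)]
    · simp [hm]
  have hy0 : ∀ ψ, ∀ k < N, y ψ k 0 = if k = (m : ℕ) then w ψ else 0 := by
    intro ψ k hk
    rw [hyev ψ k hk 0 h0T]
    simp
  have hprim : ∀ f : ℝ → ℂ, IntervalIntegrable f volume 0 T →
      ContinuousOn (fun t => ∫ s in (0 : ℝ)..t, f s) (Icc 0 T) := by
    intro f hf
    have := intervalIntegral.continuousOn_primitive_interval' hf (left_mem_uIcc)
    rwa [uIcc_of_le hT.le] at this
  have hyc : ∀ ψ, ∀ k ≤ N - 1, ContinuousOn (y ψ k) (Icc 0 T) := by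
    intro ψ k hk
    have hk' : k < N := by have := NeZero.pos N; omega
    refine ContinuousOn.congr ?_ fun t ht => hyev ψ k hk' t ht
    refine ContinuousOn.add ?_ (hprim _ (hyint ψ (k + 1)))
    split_ifs
    · exact continuousOn_const.add (hprim _ (hσ ψ))
    · exact continuousOn_const
  have hyP : ∀ ψ, ∀ t, y ψ 0 t = P m t ψ + ∑ i ∈ Finset.univ.erase m, P i t 0 := by
    intro ψ t
    simp only [hy, pow_zero]
    rw [← Finset.add_sum_erase _ _ (Finset.mem_univ m)]
    congr 1
    · simp
    · refine Finset.sum_congr rfl fun i hi => ?_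
      rw [Matrix.one_apply_ne (Finset.ne_of_mem_erase hi)]
      rfl
  have hyP' : ∀ ψ, ∀ t ∈ Icc 0 T, P m t ψ = y ψ 0 t := by
    intro ψ t ht
    rw [hyP, Finset.sum_eq_zero fun i _ => (hlin i t ht).map_zero, add_zero]
  have main : ∀ ψ, ContDiffOn ℝ (N - 1 : ℕ) (y ψ 0) (Icc 0 T) ∧
      ∀ k ≤ N - 1, ∀ t ∈ Icc 0 T, iteratedDerivWithin k (y ψ 0) (Icc 0 T) t = y ψ k t := by
    intro ψ
    refine contDiffOn_of_eq_add_integral hT (hyc ψ) fun k hk t ht => ?_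
    rw [hyev ψ k (by omega) t ht, hsrc ψ k (by omega), hy0 ψ k (by omega)]
  have hit : ∀ ψ, ∀ k ≤ N - 1, ∀ t ∈ Icc 0 T,
      iteratedDerivWithin k (fun t => P m t ψ) (Icc 0 T) t = y ψ k t := by
    intro ψ k hk t ht
    rw [← (main ψ).2 k hk t ht]
    exact iteratedDerivWithin_congr (fun s hs => hyP' ψ s hs) ht
  refine ⟨hσ, fun ψ => (main ψ).1.congr fun t ht => hyP' ψ t ht, fun ψ n => ?_, fun ψ t ht => ?_⟩
  · rw [hit ψ n (by omega) 0 h0T, hy0 ψ n n.2]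
    simp [Fin.ext_iff]
  · have hterm : ∀ n ∈ Finset.Icc 1 N, (S.a n : ℂ) *
        (iteratedDerivWithin (n - 1) (fun t => P m t ψ) (Icc 0 T) t -
          iteratedDerivWithin (n - 1) (fun t => P m t ψ) (Icc 0 T) 0) =
        (S.a n : ℂ) * (if n - 1 = (m : ℕ) then ∫ s in (0 : ℝ)..t, σ s ψ else 0) +
          ∫ s in (0 : ℝ)..t, (S.a n : ℂ) * y ψ n s := by
      intro n hn
      have hn' := Finset.mem_Icc.1 hn
      have e : n - 1 + 1 = n := by omega
      rw [hit ψ _ (by omega) t ht, hit ψ _ (by omega) 0 h0T, hy0 ψ _ (by omega),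
        hyev ψ _ (by omega) t ht, e, intervalIntegral.integral_const_mul]
      split_ifs <;> ring
    rw [Finset.sum_congr rfl hterm, Finset.sum_add_distrib, ← intervalIntegral.integral_finsetSum
      (fun n _ => (((hyint ψ n).mono_set (hu t ht)).const_mul _))]
    have hL : ∀ s ∈ Icc 0 T, ∑ n ∈ Finset.Icc 1 N, (S.a n : ℂ) * y ψ n s =
        P m s (S.transposeOp ψ) := by
      intro s hs
      have e1 : ∀ n, (S.a n : ℂ) * y ψ n s =
          ∑ i, P i s (((S.a n : ℂ) • S.companionOp ^ n) i m ψ) := by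
        intro n
        simp only [hy]
        rw [Finset.mul_sum]
        refine Finset.sum_congr rfl fun i _ => ?_
        rw [Matrix.smul_apply, LinearMap.smul_apply, (hlin i s hs).map_smul, smul_eq_mul]
      rw [Finset.sum_congr rfl fun n _ => e1 n, Finset.sum_comm]
      have e2 : ∀ i, ∑ n ∈ Finset.Icc 1 N, P i s (((S.a n : ℂ) • S.companionOp ^ n) i m ψ) =
          P i s ((Matrix.diagonal fun _ => S.transposeLM) i m ψ) := by
        intro i
        rw [← S.sum_companionOp_pow, Matrix.sum_apply, LinearMap.sum_apply,
          ← IsLinearMap.mk'_apply (hlin i s hs), map_sum]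
        rfl
      rw [Finset.sum_congr rfl fun i _ => e2 i, Finset.sum_eq_single m]
      · rw [Matrix.diagonal_apply_eq]; rfl
      · intro i _ hi
        rw [Matrix.diagonal_apply_ne _ hi]
        exact (hlin i s hs).map_zero
      · simp
    have hsσ : ∑ n ∈ Finset.Icc 1 N, (S.a n : ℂ) *
        (if n - 1 = (m : ℕ) then ∫ s in (0 : ℝ)..t, σ s ψ else 0) = ∫ s in (0 : ℝ)..t, σ s ψ := by
      rcases hm with hm | hm
      · rw [Finset.sum_eq_single N]
        · rw [if_pos (by omega), S.a_top]; simp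
        · intro n hn hne
          have := Finset.mem_Icc.1 hn
          rw [if_neg (by omega), mul_zero]
        · intro h
          exact absurd (Finset.mem_Icc.2 ⟨NeZero.pos N, le_rfl⟩) h
      · simp [hm]
    rw [hsσ, intervalIntegral.integral_add ((hint m _).mono_set (hu t ht))
      ((hσ ψ).mono_set (hu t ht)), add_comm]
    congr 1
    refine intervalIntegral.integral_congr fun s hs => hL s ?_
    have := hu t ht hs
    rwa [uIcc_of_le hT.le] at this

end Companion

/-! ### Mild solutions are weak solutions -/

/-- The functional `ψ ↦ ⟨g_n(t,·) * w, ψ⟩ = ∫ w(y) ⟨g_n(t,·), ψ(y + ·)⟩ dy`. -/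
def GreenData.smear (R : GreenData d N) (n : Fin N) (t : ℝ) (w : Space d → ℝ) (ψ : 𝓢(Space d, ℂ)) :
    ℂ := ∫ y, (w y : ℂ) * R.pair n t (shift y ψ)

theorem measurable_shift (ψ : 𝓢(Space d, ℂ)) :
    Measurable fun q : Space d × Space d => shift q.1 ψ q.2 := by
  simp only [shift_apply]
  exact (ψ.continuous.comp (by fun_prop : Continuous fun q : Space d × Space d => q.1 + q.2)).measurable

theorem GreenData.measurable_pair_shift {X : Type*} [MeasurableSpace X] (R : GreenData d N) (n : Fin N)
    (ψ : 𝓢(Space d, ℂ)) {s : X → ℝ} (hs : Measurable s) {y : X → Space d} (hy : Measurable y) :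
    Measurable fun x => R.pair n (s x) (shift (y x) ψ) := by
  have h : Measurable fun z : X × Space d => ψ (y z.1 + z.2) :=
    ψ.continuous.measurable.comp ((hy.comp measurable_fst).add measurable_snd)
  have h2 := R.measurable_pair n (φ := fun x z => ψ (y x + z)) h hs
  convert h2 using 3 with x
  funext z
  exact shift_apply _ _ _

theorem GreenData.measurable_smear {X : Type*} [MeasurableSpace X] (R : GreenData d N) (n : Fin N)
    (ψ : 𝓢(Space d, ℂ)) {s : X → ℝ} (hs : Measurable s) {F : X → Space d → ℝ}
    (hF : Measurable fun q : X × Space d => F q.1 q.2) :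
    Measurable fun x => R.smear n (s x) (F x) ψ := by
  have h1 : Measurable fun q : X × Space d => R.pair n (s q.1) (shift q.2 ψ) :=
    R.measurable_pair_shift n ψ (s := fun q : X × Space d => s q.1) (hs.comp measurable_fst)
      measurable_snd
  have h2 : Measurable fun q : X × Space d => (F q.1 q.2 : ℂ) * R.pair n (s q.1) (shift q.2 ψ) :=
    (Complex.measurable_ofReal.comp hF).mul h1
  exact (h2.stronglyMeasurable.integral_prod_right' (ν := (volume : Measure (Space d)))).measurable

section Smear

variable [NeZero N] {S : Problem d N H} {R : GreenData d N} {T : ℝ}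

theorem GreenMeasures.integrable_γ_mul_shift (h : GreenMeasures S R T) (n : Fin N) {t : ℝ}
    (ht : t ∈ Icc 0 T) (ψ : 𝓢(Space d, ℂ)) :
    Integrable (fun q : Space d × Space d => (R.γ n t q.2 : ℂ) * shift q.1 ψ q.2)
      (volume.prod (R.μ n t)) := by
  have hm : Measurable (fun q : Space d × Space d => (R.γ n t q.2 : ℂ) * shift q.1 ψ q.2) :=
    (Complex.measurable_ofReal.comp ((R.measurable_γ n t).comp measurable_snd)).mul
      (measurable_shift ψ)
  refine (integrable_prod_iff' hm.aestronglyMeasurable).2 ⟨.of_forall fun z => ?_, ?_⟩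
  · simp only [shift_apply]
    exact (ψ.integrable.comp_add_right z).const_mul _
  · have : ∀ z, ∫ y, ‖(R.γ n t z : ℂ) * shift y ψ z‖ = |R.γ n t z| * ∫ y, ‖ψ y‖ := by
      intro z
      simp only [shift_apply, norm_mul, Complex.norm_real, Real.norm_eq_abs]
      rw [integral_const_mul, integral_add_right_eq_self (fun y => ‖ψ y‖)]
    simp only [this]
    exact (h.integrable n t ht).abs.mul_const _

theorem GreenMeasures.integrable_pair_shift (h : GreenMeasures S R T) (n : Fin N) {t : ℝ}
    (ht : t ∈ Icc 0 T) (ψ : 𝓢(Space d, ℂ)) : Integrable fun y => R.pair n t (shift y ψ) :=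
  (h.integrable_γ_mul_shift n ht ψ).integral_prod_left

theorem GreenMeasures.integral_norm_pair_shift_le (h : GreenMeasures S R T) {K : ℝ}
    (hK : ∀ n, ∀ t ∈ Icc 0 T, ∫ z, |R.γ n t z| ∂(R.μ n t) ≤ K) (n : Fin N) {t : ℝ}
    (ht : t ∈ Icc 0 T) (ψ : 𝓢(Space d, ℂ)) :
    ∫ y, ‖R.pair n t (shift y ψ)‖ ≤ K * ∫ y, ‖ψ y‖ := by
  have hi := h.integrable_γ_mul_shift n ht ψ
  calc ∫ y, ‖R.pair n t (shift y ψ)‖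
      ≤ ∫ y, ∫ z, ‖(R.γ n t z : ℂ) * shift y ψ z‖ ∂(R.μ n t) :=
        integral_mono (h.integrable_pair_shift n ht ψ).norm hi.integral_norm_prod_left
          fun y => norm_integral_le_integral_norm _
    _ = ∫ z, ∫ y, ‖(R.γ n t z : ℂ) * shift y ψ z‖ ∂volume ∂(R.μ n t) :=
        integral_integral_swap hi.norm
    _ = (∫ z, |R.γ n t z| ∂(R.μ n t)) * ∫ y, ‖ψ y‖ := by
        rw [← integral_mul_const]
        refine integral_congr_ae (.of_forall fun z => ?_)
        simp only [shift_apply, norm_mul, Complex.norm_real, Real.norm_eq_abs]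
        rw [integral_const_mul, integral_add_right_eq_self (fun y => ‖ψ y‖)]
    _ ≤ K * ∫ y, ‖ψ y‖ := by
        gcongr
        exact hK n t ht

theorem GreenMeasures.integrable_mul_pair_shift (h : GreenMeasures S R T) (n : Fin N) {t : ℝ}
    (ht : t ∈ Icc 0 T) {w : Space d → ℝ} (hw : Measurable w) {C : ℝ} (hC : ∀ x, |w x| ≤ C)
    (ψ : 𝓢(Space d, ℂ)) : Integrable fun y => (w y : ℂ) * R.pair n t (shift y ψ) :=
  (h.integrable_pair_shift n ht ψ).bdd_mul (c := C)
    (Complex.measurable_ofReal.comp hw).aestronglyMeasurable (.of_forall fun y => by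
      rw [Complex.norm_real]; exact hC y)

theorem GreenMeasures.norm_smear_le (h : GreenMeasures S R T) {K : ℝ}
    (hK : ∀ n, ∀ t ∈ Icc 0 T, ∫ z, |R.γ n t z| ∂(R.μ n t) ≤ K) (n : Fin N) {t : ℝ}
    (ht : t ∈ Icc 0 T) {w : Space d → ℝ} {C : ℝ} (hC : ∀ x, |w x| ≤ C)
    (ψ : 𝓢(Space d, ℂ)) : ‖R.smear n t w ψ‖ ≤ C * (K * ∫ y, ‖ψ y‖) := by
  have hC0 : 0 ≤ C := (abs_nonneg _).trans (hC 0)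
  calc ‖R.smear n t w ψ‖ ≤ ∫ y, C * ‖R.pair n t (shift y ψ)‖ := by
        refine norm_integral_le_of_norm_le ((h.integrable_pair_shift n ht ψ).norm.const_mul C)
          (.of_forall fun y => ?_)
        rw [norm_mul, Complex.norm_real, Real.norm_eq_abs]
        gcongr
        exact hC y
    _ ≤ _ := by
        rw [integral_const_mul]
        gcongr
        exact h.integral_norm_pair_shift_le hK n ht ψ

theorem GreenMeasures.isLinearMap_pair (h : GreenMeasures S R T) (n : Fin N) {t : ℝ}
    (ht : t ∈ Icc 0 T) : IsLinearMap ℂ fun ψ : 𝓢(Space d, ℂ) => R.pair n t ψ where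
  map_add φ ψ := by rw [← h.pair_eq n ht, ← h.pair_eq n ht, ← h.pair_eq n ht, map_add]
  map_smul c ψ := by rw [← h.pair_eq n ht, ← h.pair_eq n ht, map_smul]

theorem GreenMeasures.isLinearMap_smear (h : GreenMeasures S R T) (n : Fin N) {t : ℝ}
    (ht : t ∈ Icc 0 T) {w : Space d → ℝ} (hw : Measurable w) {C : ℝ} (hC : ∀ x, |w x| ≤ C) :
    IsLinearMap ℂ (R.smear n t w) where
  map_add φ ψ := by
    unfold GreenData.smear
    rw [← integral_add (h.integrable_mul_pair_shift n ht hw hC φ)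
      (h.integrable_mul_pair_shift n ht hw hC ψ)]
    refine integral_congr_ae (.of_forall fun y => ?_)
    simp only [map_add, (h.isLinearMap_pair n ht).map_add, mul_add]
  map_smul c ψ := by
    unfold GreenData.smear
    rw [smul_eq_mul, ← integral_const_mul]
    refine integral_congr_ae (.of_forall fun y => ?_)
    simp only [map_smul, (h.isLinearMap_pair n ht).map_smul, smul_eq_mul]
    ring

theorem GreenMeasures.smear_evolution (h : GreenMeasures S R T) (hS : GreenHatTempered S T)
    (m : Fin N) {t : ℝ} (ht : t ∈ Icc 0 T) {w : Space d → ℝ} (hw : Measurable w) {C : ℝ}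
    (hC : ∀ x, |w x| ≤ C) (ψ : 𝓢(Space d, ℂ)) :
    R.smear m t w ψ = (if (m : ℕ) = 0 then pairing w ψ else 0) +
      ∫ s in (0 : ℝ)..t, ∑ i, R.smear i s w (S.companionOp i m ψ) := by
  obtain ⟨K, hK0, hK⟩ := h.exists_mass_bound
  have hC0 : 0 ≤ C := (abs_nonneg _).trans (hC 0)
  have hsub : ∀ s ∈ Ioc 0 t, s ∈ Icc 0 T := fun s hs => ⟨hs.1.le, hs.2.trans ht.2⟩
  have hwm : Measurable fun y => (w y : ℂ) := Complex.measurable_ofReal.comp hw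
  have hint : ∀ i φ, Integrable (fun q : ℝ × Space d => (w q.2 : ℂ) * R.pair i q.1 (shift q.2 φ))
      ((volume.restrict (Ioc 0 t)).prod volume) := by
    intro i φ
    have hm : Measurable (fun q : ℝ × Space d => (w q.2 : ℂ) * R.pair i q.1 (shift q.2 φ)) :=
      (hwm.comp measurable_snd).mul (R.measurable_pair_shift i φ measurable_fst measurable_snd)
    refine (integrable_prod_iff hm.aestronglyMeasurable).2 ⟨?_, ?_⟩
    · refine (ae_restrict_iff' measurableSet_Ioc).2 (.of_forall fun s hs => ?_)
      exact h.integrable_mul_pair_shift i (hsub s hs) hw hC φ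
    · refine Measure.integrableOn_of_bounded (M := C * (K * ∫ y, ‖φ y‖)) (by simp)
        (hm.norm.stronglyMeasurable.integral_prod_right').aestronglyMeasurable ?_
      refine (ae_restrict_iff' measurableSet_Ioc).2 (.of_forall fun s hs => ?_)
      rw [Real.norm_of_nonneg (integral_nonneg fun y => norm_nonneg _)]
      calc ∫ y, ‖(w y : ℂ) * R.pair i s (shift y φ)‖
          ≤ ∫ y, C * ‖R.pair i s (shift y φ)‖ := by
            refine integral_mono (h.integrable_mul_pair_shift i (hsub s hs) hw hC φ).norm
              ((h.integrable_pair_shift i (hsub s hs) φ).norm.const_mul C) fun y => ?_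
            simp only [norm_mul, Complex.norm_real, Real.norm_eq_abs]
            gcongr
            exact hC y
        _ ≤ _ := by
            rw [integral_const_mul]
            gcongr
            exact h.integral_norm_pair_shift_le hK i (hsub s hs) φ
  have hsum : Integrable (fun q : ℝ × Space d => ∑ i, (w q.2 : ℂ) *
      R.pair i q.1 (shift q.2 (S.companionOp i m ψ))) ((volume.restrict (Ioc 0 t)).prod volume) :=
    integrable_finsetSum _ fun i _ => hint i _
  have e1 : R.smear m t w ψ = ∫ y, ((w y : ℂ) * (if (m : ℕ) = 0 then ψ y else 0) +
      ∫ s in Ioc 0 t, ∑ i, (w y : ℂ) * R.pair i s (shift y (S.companionOp i m ψ))) := by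
    refine integral_congr_ae (.of_forall fun y => ?_)
    simp only
    rw [h.pair_evolution hS m ht, mul_add, intervalIntegral.integral_of_le ht.1,
      ← integral_const_mul]
    simp only [shift_apply, add_zero, S.companionOp_shift, Finset.mul_sum]
  rw [e1, integral_add, intervalIntegral.integral_of_le ht.1]
  · congr 1
    · split_ifs
      · rfl
      · simp
    · rw [← integral_integral_swap hsum]
      refine setIntegral_congr_fun measurableSet_Ioc fun s hs => ?_
      exact integral_finsetSum _ fun i _ => h.integrable_mul_pair_shift i (hsub s hs) hw hC _
  · split_ifs
    · exact ψ.integrable.bdd_mul (c := C) hwm.aestronglyMeasurable (.of_forall fun y => by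
        rw [Complex.norm_real]; exact hC y)
    · simp
  · exact hsum.integral_prod_right

end Smear

theorem integral_integral_triangle {f : ℝ → ℝ → ℂ} (hf : Measurable fun q : ℝ × ℝ => f q.1 q.2)
    {t C : ℝ} (ht : 0 ≤ t) (hC : ∀ s u, 0 < s → s < u → u ≤ t → ‖f s u‖ ≤ C) :
    ∫ s in (0 : ℝ)..t, ∫ u in s..t, f s u = ∫ u in (0 : ℝ)..t, ∫ s in (0 : ℝ)..u, f s u := by
  have hC0 : 0 < t → 0 ≤ C := fun h => (norm_nonneg _).trans (hC (t / 2) t (by linarith) (by linarith) le_rfl)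
  set A : Set (ℝ × ℝ) := {q | q.1 < q.2} with hA
  have hAm : MeasurableSet A := measurableSet_lt measurable_fst measurable_snd
  set g : ℝ × ℝ → ℂ := A.indicator fun q => f q.1 q.2 with hg
  have hgm : Measurable g := hf.indicator hAm
  have hgi : Integrable g ((volume.restrict (Ioc 0 t)).prod (volume.restrict (Ioc 0 t))) := by
    refine Integrable.of_bound hgm.aestronglyMeasurable C ?_
    rw [Measure.prod_restrict]
    refine (ae_restrict_iff' (measurableSet_Ioc.prod measurableSet_Ioc)).2 (.of_forall fun q hq => ?_)
    rw [hg]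
    by_cases hqA : q ∈ A
    · rw [indicator_of_mem hqA]
      exact hC _ _ hq.1.1 hqA hq.2.2
    · rw [indicator_of_notMem hqA, norm_zero]
      exact hC0 (hq.1.1.trans_le hq.1.2)
  rw [intervalIntegral.integral_of_le ht, intervalIntegral.integral_of_le ht]
  have e1 : ∀ s ∈ Ioc 0 t, ∫ u in s..t, f s u = ∫ u in Ioc 0 t, g (s, u) := by
    intro s hs
    have : (fun u => g (s, u)) = (Ioi s).indicator (f s) := by
      funext u
      simp only [hg, indicator, hA, mem_ofPred_eq, mem_Ioi]
    rw [this, setIntegral_indicator measurableSet_Ioi, intervalIntegral.integral_of_le hs.2,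
      Ioc_inter_Ioi, max_eq_right hs.1.le]
  have e2 : ∀ u ∈ Ioc 0 t, ∫ s in (0 : ℝ)..u, f s u = ∫ s in Ioc 0 t, g (s, u) := by
    intro u hu
    have : (fun s => g (s, u)) = (Iio u).indicator fun s => f s u := by
      funext s
      simp only [hg, indicator, hA, mem_ofPred_eq, mem_Iio]
    rw [this, setIntegral_indicator measurableSet_Iio, intervalIntegral.integral_of_le hu.1.le,
      integral_Ioc_eq_integral_Ioo]
    congr 2
    ext s
    simp only [mem_Ioo, mem_inter_iff, mem_Ioc, mem_Iio]
    exact ⟨fun h => ⟨⟨h.1, h.2.le.trans hu.2⟩, h.2⟩, fun h => ⟨h.1.1, h.2⟩⟩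
  rw [setIntegral_congr_fun measurableSet_Ioc e1, setIntegral_congr_fun measurableSet_Ioc e2]
  exact integral_integral_swap hgi

section Duhamel

variable [NeZero N] {S : Problem d N H} {R : GreenData d N} {T : ℝ}

theorem pairing_zero (w : Space d → ℝ) : pairing w 0 = 0 := by simp [pairing]

theorem measurable_pairing {X : Type*} [MeasurableSpace X] {F : X → Space d → ℝ}
    (hF : Measurable fun q : X × Space d => F q.1 q.2) (ψ : 𝓢(Space d, ℂ)) :
    Measurable fun x => pairing (F x) ψ := by
  have h2 : Measurable fun q : X × Space d => (F q.1 q.2 : ℂ) * ψ q.2 :=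
    (Complex.measurable_ofReal.comp hF).mul (ψ.continuous.measurable.comp measurable_snd)
  exact (h2.stronglyMeasurable.integral_prod_right' (ν := (volume : Measure (Space d)))).measurable

theorem integrable_mul_schwartz {w : Space d → ℝ} (hw : Measurable w) {C : ℝ} (hC : ∀ x, |w x| ≤ C)
    (ψ : 𝓢(Space d, ℂ)) : Integrable fun x => (w x : ℂ) * ψ x :=
  ψ.integrable.bdd_mul (c := C) (Complex.measurable_ofReal.comp hw).aestronglyMeasurable
    (.of_forall fun y => by rw [Complex.norm_real]; exact hC y)

theorem norm_pairing_le {w : Space d → ℝ} {C : ℝ} (hC : ∀ x, |w x| ≤ C)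
    (ψ : 𝓢(Space d, ℂ)) : ‖pairing w ψ‖ ≤ C * ∫ x, ‖ψ x‖ := by
  rw [← integral_const_mul]
  refine norm_integral_le_of_norm_le (ψ.integrable.norm.const_mul C) (.of_forall fun y => ?_)
  rw [norm_mul, Complex.norm_real, Real.norm_eq_abs]
  gcongr
  exact hC y

theorem intervalIntegrable_of_bound {f : ℝ → ℂ} (hf : Measurable f) {a b C : ℝ} (hab : a ≤ b)
    (hC : ∀ s ∈ Ioc a b, ‖f s‖ ≤ C) : IntervalIntegrable f volume a b := by
  rw [intervalIntegrable_iff_integrableOn_Ioc_of_le hab]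
  exact Measure.integrableOn_of_bounded (M := C) (by simp) hf.aestronglyMeasurable
    ((ae_restrict_iff' measurableSet_Ioc).2 (.of_forall hC))

/-- The initial value `w` for the derivative `∂_t^{m-1}`, propagated by `g_m`. -/
theorem GreenMeasures.isWeakSolution_smear (h : GreenMeasures S R T) (hS : GreenHatTempered S T)
    (hT : 0 < T) (m : Fin N) {w : Space d → ℝ} (hw : Measurable w) {C : ℝ}
    (hC : ∀ x, |w x| ≤ C) :
    IsWeakSolution S T (fun t ψ => R.smear m t w ψ) (fun n ψ => if n = m then pairing w ψ else 0)
      (fun _ _ => 0) := by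
  obtain ⟨K, hK0, hK⟩ := h.exists_mass_bound
  refine isWeakSolution_of_evolution S hT (P := fun i t ψ => R.smear i t w ψ)
    (fun i s hs => h.isLinearMap_smear i hs hw hC) (fun i ψ => ?_) (pairing_zero w)
    (fun _ => rfl) (fun _ => by simp) (fun i t ht ψ => ?_) m (.inr fun _ _ => rfl)
  · refine intervalIntegrable_of_bound (R.measurable_smear i ψ measurable_id
      (F := fun _ => w) (hw.comp measurable_snd)) hT.le fun s hs => h.norm_smear_le hK i ⟨hs.1.le, hs.2⟩ hC ψ
  · rw [h.smear_evolution hS i ht hw hC]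
    simp

/-- Duhamel's formula: the source `F`, propagated by `g_N`. -/
theorem GreenMeasures.isWeakSolution_duhamel (h : GreenMeasures S R T) (hS : GreenHatTempered S T)
    (hT : 0 < T) {F : ℝ → Space d → ℝ} (hF : Measurable fun q : ℝ × Space d => F q.1 q.2) {C : ℝ}
    (hC : ∀ s x, |F s x| ≤ C) :
    IsWeakSolution S T (fun t ψ => ∫ s in (0 : ℝ)..t, R.smear (lastIdx N) (t - s) (F s) ψ)
      (fun _ _ => 0) (fun s ψ => pairing (F s) ψ) := by
  obtain ⟨K, hK0, hK⟩ := h.exists_mass_bound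
  have hFs : ∀ s, Measurable (F s) := fun s => hF.comp measurable_prodMk_left
  have hm2 : ∀ i ψ, Measurable fun q : ℝ × ℝ => R.smear i (q.2 - q.1) (F q.1) ψ := fun i ψ =>
    R.measurable_smear i ψ (measurable_snd.sub measurable_fst) (F := fun q : ℝ × ℝ => F q.1)
      (hF.comp ((measurable_fst.comp measurable_fst).prodMk measurable_snd))
  have hm1 : ∀ i ψ (t : ℝ), Measurable fun s : ℝ => R.smear i (t - s) (F s) ψ := fun i ψ t =>
    (hm2 i ψ).comp (measurable_id.prodMk measurable_const)
  have hb : ∀ i ψ (t s : ℝ), t ∈ Icc 0 T → s ∈ Ioc 0 t →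
      ‖R.smear i (t - s) (F s) ψ‖ ≤ C * (K * ∫ y, ‖ψ y‖) := fun i ψ t s ht hs =>
    h.norm_smear_le hK i ⟨by linarith [hs.2], by linarith [hs.1, ht.2]⟩ (hC s) ψ
  have hint : ∀ i ψ (t : ℝ), t ∈ Icc 0 T →
      IntervalIntegrable (fun s => R.smear i (t - s) (F s) ψ) volume 0 t := fun i ψ t ht =>
    intervalIntegrable_of_bound (hm1 i ψ t) ht.1 fun s hs => hb i ψ t s ht hs
  have hDm : ∀ i ψ, Measurable fun t : ℝ => ∫ s in Ioc 0 t, R.smear i (t - s) (F s) ψ := by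
    intro i ψ
    set A : Set (ℝ × ℝ) := {q | q.2 ∈ Ioc 0 q.1}
    have hA : MeasurableSet A :=
      (measurableSet_lt measurable_const measurable_snd).inter
        (measurableSet_le measurable_snd measurable_fst)
    have h1 : Measurable (A.indicator fun q : ℝ × ℝ => R.smear i (q.1 - q.2) (F q.2) ψ) :=
      ((hm2 i ψ).comp measurable_swap).indicator hA
    have h2 := (h1.stronglyMeasurable.integral_prod_right' (ν := (volume : Measure ℝ))).measurable
    convert! h2 using 1
    funext t
    rw [← integral_indicator measurableSet_Ioc]
    rfl
  refine (isWeakSolution_of_evolution S hT (w := fun _ => 0)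
    (P := fun i t ψ => ∫ s in (0 : ℝ)..t, R.smear i (t - s) (F s) ψ)
    (σ := fun s ψ => pairing (F s) ψ) (fun i t ht => ⟨fun φ ψ => ?_, fun c ψ => ?_⟩)
    (fun i ψ => ?_) rfl (fun s => pairing_zero _) (fun ψ => ?_) (fun i t ht ψ => ?_) (lastIdx N)
    (.inl ?_)).congr hT.le (fun _ _ _ => rfl) (fun n ψ => by simp) (fun _ _ _ => rfl)
  · rw [← intervalIntegral.integral_add (hint i φ t ht) (hint i ψ t ht)]
    refine intervalIntegral.integral_congr fun s hs => ?_
    rw [uIcc_of_le ht.1] at hs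
    exact (h.isLinearMap_smear i ⟨by linarith [hs.2], by linarith [hs.1, ht.2]⟩ (hFs s) (hC s)).map_add _ _
  · rw [smul_eq_mul, ← intervalIntegral.integral_const_mul]
    refine intervalIntegral.integral_congr fun s hs => ?_
    rw [uIcc_of_le ht.1] at hs
    exact (h.isLinearMap_smear i ⟨by linarith [hs.2], by linarith [hs.1, ht.2]⟩ (hFs s) (hC s)).map_smul _ _
  · have : IntervalIntegrable (fun t : ℝ => ∫ s in Ioc 0 t, R.smear i (t - s) (F s) ψ) volume 0 T := by
      refine intervalIntegrable_of_bound (C := C * (K * ∫ y, ‖ψ y‖) * T) (hDm i ψ) hT.le fun t ht => ?_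
      have ht' : t ∈ Icc 0 T := ⟨ht.1.le, ht.2⟩
      refine (norm_setIntegral_le_of_norm_le_const (C := C * (K * ∫ y, ‖ψ y‖)) (by simp)
        fun s hs => hb i ψ t s ht' hs).trans ?_
      have hnn : 0 ≤ C * (K * ∫ y, ‖ψ y‖) := by
        have : 0 ≤ C := (abs_nonneg _).trans (hC 0 0)
        have : 0 ≤ ∫ y, ‖ψ y‖ := integral_nonneg fun _ => norm_nonneg _
        positivity
      gcongr
      simp [ht'.1, ht'.2]
    refine this.congr fun t ht => ?_
    rw [uIoc_of_le hT.le] at ht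
    exact (intervalIntegral.integral_of_le ht.1.le).symm
  · exact intervalIntegrable_of_bound (measurable_pairing hF ψ) hT.le fun s _ => norm_pairing_le (hC s) ψ
  · have e1 : ∫ s in (0 : ℝ)..t, R.smear i (t - s) (F s) ψ =
        ∫ s in (0 : ℝ)..t, ((if (i : ℕ) = 0 then pairing (F s) ψ else 0) +
          ∫ u in s..t, ∑ j, R.smear j (u - s) (F s) (S.companionOp j i ψ)) := by
      refine intervalIntegral.integral_congr fun s hs => ?_
      rw [uIcc_of_le ht.1] at hs
      rw [h.smear_evolution hS i ⟨by linarith [hs.2], by linarith [hs.1, ht.2]⟩ (hFs s) (hC s)]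
      congr 1
      rw [intervalIntegral.integral_comp_sub_right
        (fun r => ∑ j, R.smear j r (F s) (S.companionOp j i ψ)), sub_self]
    have hmS : Measurable fun q : ℝ × ℝ =>
        ∑ j, R.smear j (q.2 - q.1) (F q.1) (S.companionOp j i ψ) :=
      Finset.measurable_sum _ fun j _ => hm2 j _
    have hbS : ∀ s u, 0 < s → s < u → u ≤ t →
        ‖∑ j, R.smear j (u - s) (F s) (S.companionOp j i ψ)‖ ≤
          ∑ j, C * (K * ∫ y, ‖S.companionOp j i ψ y‖) := fun s u hs hsu hut =>
      norm_sum_le_of_le _ fun j _ => hb j _ u s ⟨(hs.trans hsu).le, hut.trans ht.2⟩ ⟨hs, hsu.le⟩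
    have hmI : Measurable fun s : ℝ => ∫ u in Ioc s t, ∑ j, R.smear j (u - s) (F s) (S.companionOp j i ψ) := by
      set A : Set (ℝ × ℝ) := {q | q.2 ∈ Ioc q.1 t}
      have hA : MeasurableSet A :=
        (measurableSet_lt measurable_fst measurable_snd).inter
          (measurableSet_le measurable_snd measurable_const)
      have h2 := ((hmS.indicator hA).stronglyMeasurable.integral_prod_right'
        (ν := (volume : Measure ℝ))).measurable
      convert! h2 using 1
      funext t
      rw [← integral_indicator measurableSet_Ioc]
      rfl
    rw [e1, intervalIntegral.integral_add]
    · congr 1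
      · split_ifs
        · simp
        · simp
      · rw [integral_integral_triangle hmS ht.1 hbS]
        refine intervalIntegral.integral_congr fun u hu => ?_
        rw [uIcc_of_le ht.1] at hu
        exact intervalIntegral.integral_finsetSum fun j _ => hint j _ u ⟨hu.1, hu.2.trans ht.2⟩
    · split_ifs
      · exact intervalIntegrable_of_bound (measurable_pairing hF ψ) ht.1
          fun s _ => norm_pairing_le (hC s) ψ
      · simp
    · have : IntervalIntegrable (fun s : ℝ => ∫ u in Ioc s t,
          ∑ j, R.smear j (u - s) (F s) (S.companionOp j i ψ)) volume 0 t := by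
        have hnn : 0 ≤ ∑ j, C * (K * ∫ y, ‖S.companionOp j i ψ y‖) := Finset.sum_nonneg fun j _ => by
          have : 0 ≤ C := (abs_nonneg _).trans (hC 0 0)
          have : 0 ≤ ∫ y, ‖S.companionOp j i ψ y‖ := integral_nonneg fun _ => norm_nonneg _
          positivity
        refine intervalIntegrable_of_bound
          (C := (∑ j, C * (K * ∫ y, ‖S.companionOp j i ψ y‖)) * T) hmI ht.1 fun s hs => ?_
        refine (norm_setIntegral_le_of_norm_le_const (C := ∑ j, C * (K * ∫ y, ‖S.companionOp j i ψ y‖))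
          (by simp) fun u hu => hbS s u hs.1 hu.1 hu.2).trans ?_
        gcongr
        simp only [Real.volume_real_Ioc]
        exact max_le (by linarith [hs.1, ht.2]) hT.le
      refine this.congr fun s hs => ?_
      rw [uIoc_of_le ht.1] at hs
      exact (intervalIntegral.integral_of_le hs.2).symm
  · have := NeZero.pos N
    simp only [lastIdx]
    omega

end Duhamel

/-! ### Mild solutions and their weak gradients -/

/-- The displacement laws of the particles of type `0` (`θ = false`) and of type `h ≥ 1`
(`θ = true`). -/
def GreenData.law (R : GreenData d N) (θ : Bool) (n : Fin N) : Kernel ℝ (Space d) :=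
  match θ with
  | false => R.μ n
  | true => R.μ₁ n

instance GreenData.isMarkovKernel_law (R : GreenData d N) (θ : Bool) (n : Fin N) :
    IsMarkovKernel (R.law θ n) := by
  cases θ
  · exact R.μ_markov n
  · exact R.μ₁_markov n

/-- The weights of the particles: `γ_n` for type `0`, and `v · γ¹_n` for the other types, where `v`
is the direction of differentiation. -/
def GreenData.wgt (R : GreenData d N) (θ : Bool) (v : Space d) (n : Fin N) (s : ℝ) (z : Space d) : ℝ :=
  match θ with
  | false => R.γ n s z
  | true => inner ℝ v (R.γ₁ n s z)

theorem GreenData.measurable_wgt (R : GreenData d N) (θ : Bool) (n : Fin N) {X : Type*}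
    [MeasurableSpace X] {v : X → Space d} (hv : Measurable v) {s : X → ℝ} (hs : Measurable s)
    {z : X → Space d} (hz : Measurable z) :
    Measurable fun x => R.wgt θ (v x) n (s x) (z x) := by
  cases θ
  · exact (R.γ_meas n).comp (hs.prodMk hz)
  · exact hv.inner ((R.γ₁_meas n).comp (hs.prodMk hz))

/-- The convolution of `φ` with `g_n(t,·)`, resp. with its derivative in direction `v`. -/
def GreenData.conv (R : GreenData d N) (θ : Bool) (v : Space d) (n : Fin N) (t : ℝ)
    (φ : Space d → ℝ) (x : Space d) : ℝ :=
  ∫ z, R.wgt θ v n t z * φ (x - z) ∂(R.law θ n t)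

theorem GreenData.measurable_conv (R : GreenData d N) (θ : Bool) (n : Fin N) {X : Type*}
    [MeasurableSpace X] {v : X → Space d} (hv : Measurable v) {s : X → ℝ} (hs : Measurable s)
    {F : X → Space d → ℝ} (hF : Measurable fun q : X × Space d => F q.1 q.2)
    {y : X → Space d} (hy : Measurable y) :
    Measurable fun x => R.conv θ (v x) n (s x) (F x) (y x) := by
  let κ : Kernel X (Space d) := (R.law θ n).comap s hs
  have hm : Measurable fun q : X × Space d =>
      R.wgt θ (v q.1) n (s q.1) q.2 * F q.1 (y q.1 - q.2) :=
    (R.measurable_wgt θ n (hv.comp measurable_fst) (hs.comp measurable_fst) measurable_snd).mul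
      (hF.comp (measurable_fst.prodMk ((hy.comp measurable_fst).sub measurable_snd)))
  exact (hm.stronglyMeasurable.integral_kernel_prod_right' (κ := κ)).measurable

theorem abs_integral_mul_le {μ : Measure (Space d)} {g w : Space d → ℝ} (hg : Integrable g μ)
    {C : ℝ} (hC : ∀ z, |w z| ≤ C) : |∫ z, g z * w z ∂μ| ≤ (∫ z, |g z| ∂μ) * C := by
  rw [← integral_mul_const, ← Real.norm_eq_abs]
  refine norm_integral_le_of_norm_le (hg.abs.mul_const C) (.of_forall fun z => ?_)
  rw [norm_mul, Real.norm_eq_abs, Real.norm_eq_abs]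
  gcongr
  exact hC z

theorem pairing_convolution {μ : Measure (Space d)} [SFinite μ] {g : Space d → ℝ}
    (hg : Integrable g μ) (hgm : Measurable g) {w : Space d → ℝ} (hw : Measurable w) {C : ℝ}
    (hC : ∀ x, |w x| ≤ C) (ψ : 𝓢(Space d, ℂ)) :
    pairing (fun x => ∫ z, g z * w (x - z) ∂μ) ψ =
      ∫ y, (w y : ℂ) * ∫ z, (g z : ℂ) * ψ (y + z) ∂μ := by
  have hC0 : 0 ≤ C := (abs_nonneg _).trans (hC 0)
  have hm : Measurable fun q : Space d × Space d => (g q.2 : ℂ) * ((w q.1 : ℂ) * ψ (q.1 + q.2)) := by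
    have := ψ.continuous.measurable
    fun_prop
  have hm' : Measurable fun q : Space d × Space d => (g q.2 : ℂ) * ((w (q.1 - q.2) : ℂ) * ψ q.1) := by
    have := ψ.continuous.measurable
    fun_prop
  have hi' : Integrable (fun q : Space d × Space d => (g q.2 : ℂ) * ((w (q.1 - q.2) : ℂ) * ψ q.1))
      (volume.prod μ) := by
    have h1 : Integrable (fun q : Space d × Space d => ψ q.1 * (g q.2 : ℂ)) (volume.prod μ) :=
      ψ.integrable.mul_prod hg.ofReal
    refine (h1.norm.const_mul C).mono' hm'.aestronglyMeasurable (.of_forall fun q => ?_)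
    simp only [norm_mul, Complex.norm_real, Real.norm_eq_abs]
    calc |g q.2| * (|w (q.1 - q.2)| * ‖ψ q.1‖) ≤ |g q.2| * (C * ‖ψ q.1‖) := by gcongr; exact hC _
      _ = _ := by ring
  have hi : Integrable (fun q : Space d × Space d => (g q.2 : ℂ) * ((w q.1 : ℂ) * ψ (q.1 + q.2)))
      (volume.prod μ) := by
    refine (integrable_prod_iff' hm.aestronglyMeasurable).2 ⟨.of_forall fun z => ?_, ?_⟩
    · have h1 : Integrable fun y => (w y : ℂ) * ψ (y + z) :=
        ((ψ.integrable (μ := volume)).comp_add_right z).bdd_mul (c := C)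
          (Complex.measurable_ofReal.comp hw).aestronglyMeasurable (.of_forall fun y => by
            rw [Complex.norm_real]; exact hC y)
      exact h1.const_mul (g z : ℂ)
    · refine (hg.abs.mul_const (C * ∫ y, ‖ψ y‖)).mono'
        (hm.norm.stronglyMeasurable.integral_prod_left').aestronglyMeasurable (.of_forall fun z => ?_)
      rw [Real.norm_of_nonneg (integral_nonneg fun y => norm_nonneg _)]
      simp only [norm_mul, Complex.norm_real, Real.norm_eq_abs]
      rw [integral_const_mul]
      refine mul_le_mul_of_nonneg_left ?_ (abs_nonneg _)
      rw [← integral_add_right_eq_self (fun y => ‖ψ y‖) z, ← integral_const_mul]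
      refine integral_mono_of_nonneg (.of_forall fun y => by positivity)
        (((ψ.integrable (μ := volume)).comp_add_right z).norm.const_mul C) (.of_forall fun y => ?_)
      simp only
      gcongr
      exact hC y
  calc pairing (fun x => ∫ z, g z * w (x - z) ∂μ) ψ
      = ∫ x, ∫ z, (g z : ℂ) * ((w (x - z) : ℂ) * ψ x) ∂μ := by
        refine integral_congr_ae (.of_forall fun x => ?_)
        simp only
        rw [← integral_complex_ofReal, ← integral_mul_const]
        refine integral_congr_ae (.of_forall fun z => ?_)
        simp only
        push_cast; ring
    _ = ∫ z, ∫ x, (g z : ℂ) * ((w (x - z) : ℂ) * ψ x) ∂volume ∂μ := integral_integral_swap hi'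
    _ = ∫ z, ∫ y, (g z : ℂ) * ((w y : ℂ) * ψ (y + z)) ∂volume ∂μ := by
        refine integral_congr_ae (.of_forall fun z => ?_)
        simp only
        rw [← integral_add_right_eq_self _ z]
        simp
    _ = ∫ y, ∫ z, (g z : ℂ) * ((w y : ℂ) * ψ (y + z)) ∂μ ∂volume := (integral_integral_swap hi).symm
    _ = _ := by
        refine integral_congr_ae (.of_forall fun y => ?_)
        simp only
        rw [← integral_const_mul]
        refine integral_congr_ae (.of_forall fun z => ?_)
        simp only
        ring

theorem GreenData.pairing_conv_false [NeZero N] {S : Problem d N H} {R : GreenData d N} {T : ℝ}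
    (h : GreenMeasures S R T) (v : Space d) (n : Fin N) {t : ℝ} (ht : t ∈ Icc 0 T) {w : Space d → ℝ}
    (hw : Measurable w) {C : ℝ} (hC : ∀ x, |w x| ≤ C) (ψ : 𝓢(Space d, ℂ)) :
    pairing (R.conv false v n t w) ψ = R.smear n t w ψ := by
  refine (pairing_convolution (h.integrable n t ht) (R.measurable_γ n t) hw hC ψ).trans ?_
  simp only [GreenData.smear, GreenData.pair, shift_apply]

section Gradient

variable [NeZero N] {S : Problem d N H} {R : GreenData d N} {T : ℝ}

theorem lineDeriv_eq_sum (v : Space d) (φ : 𝓢(Space d, ℂ)) (x : Space d) :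
    (∂_{v} φ) x = ∑ m, (v m : ℂ) * (∂_{EuclideanSpace.single m (1 : ℝ)} φ) x := by
  simp only [SchwartzMap.lineDerivOp_apply_eq_fderiv]
  conv_lhs => rw [← (EuclideanSpace.basisFun (Fin d) ℝ).sum_repr v]
  rw [map_sum]
  refine Finset.sum_congr rfl fun m _ => ?_
  rw [map_smul]
  simp

omit [NeZero N] in
theorem GreenGradientMeasures.integrable_γ₁ (h : GreenGradientMeasures S R T) (n : Fin N) {t : ℝ}
    (ht : t ∈ Ioc 0 T) : Integrable (R.γ₁ n t) (R.μ₁ n t) := by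
  have hm : Measurable (R.γ₁ n t) := (R.γ₁_meas n).comp measurable_prodMk_left
  refine Integrable.mono' (g := fun z => ∑ m, |R.γ₁ n t z m|)
    (integrable_finsetSum _ fun m _ => (h.integrable n m t ht).abs) hm.aestronglyMeasurable
    (.of_forall fun z => ?_)
  have h1 := (EuclideanSpace.basisFun (Fin d) ℝ).sum_repr (R.γ₁ n t z)
  calc ‖R.γ₁ n t z‖ = ‖∑ m, R.γ₁ n t z m • EuclideanSpace.basisFun (Fin d) ℝ m‖ := by
        conv_lhs => rw [← h1]
        rfl
    _ ≤ ∑ m, ‖R.γ₁ n t z m • EuclideanSpace.basisFun (Fin d) ℝ m‖ := norm_sum_le _ _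
    _ = _ := by
        refine Finset.sum_congr rfl fun m _ => ?_
        rw [norm_smul, OrthonormalBasis.norm_eq_one, mul_one, Real.norm_eq_abs]

theorem integrable_wgt (h : GreenMeasures S R T) (h₁ : GreenGradientMeasures S R T) (θ : Bool)
    (v : Space d) (n : Fin N) {t : ℝ} (ht : t ∈ Ioc 0 T) :
    Integrable (R.wgt θ v n t) (R.law θ n t) := by
  cases θ
  · exact h.integrable n t ⟨ht.1.le, ht.2⟩
  · exact (h₁.integrable_γ₁ n ht).const_inner v

/-- The measures `∂_{x_m} g_n` are the distributional derivatives of `g_n`. -/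
theorem integral_inner_γ₁_mul (h : GreenMeasures S R T) (h₁ : GreenGradientMeasures S R T)
    (v : Space d) (n : Fin N) {t : ℝ} (ht : t ∈ Ioc 0 T) (φ : 𝓢(Space d, ℂ)) :
    ∫ z, ((inner ℝ v (R.γ₁ n t z) : ℝ) : ℂ) * φ z ∂(R.μ₁ n t) = -R.pair n t (∂_{v} φ : 𝓢(Space d, ℂ)) := by
  have ht' : t ∈ Icc 0 T := ⟨ht.1.le, ht.2⟩
  obtain ⟨C, hC⟩ : ∃ C, ∀ z, ‖φ z‖ ≤ C := ⟨_, fun z => φ.norm_le_seminorm ℝ z⟩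
  have hφi : ∀ m, Integrable (fun z => (R.γ₁ n t z m : ℂ) * φ z) (R.μ₁ n t) := fun m =>
    (h₁.integrable n m t ht).ofReal.mul_bdd (c := C) φ.continuous.aestronglyMeasurable (.of_forall hC)
  have key : ∀ m, ∫ z, (R.γ₁ n t z m : ℂ) * φ z ∂(R.μ₁ n t) =
      -R.pair n t (∂_{EuclideanSpace.single m (1 : ℝ)} φ : 𝓢(Space d, ℂ)) := by
    intro m
    have e1 := h₁.represents n m t ht φ
    have hm : Measurable (fun z => R.γ₁ n t z m) := by
      have : Measurable (R.γ₁ n t) := (R.γ₁_meas n).comp measurable_prodMk_left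
      fun_prop
    rw [TemperedDistribution.lineDerivOp_apply_apply, map_neg, h.pair_eq n ht', h₁.density n m t ht,
      sintegral_withDensityᵥ (h₁.integrable n m t ht) hm] at e1
    · rw [e1]; rfl
    · exact hφi m
  have e2 : ∀ z, ((inner ℝ v (R.γ₁ n t z) : ℝ) : ℂ) * φ z =
      ∑ m, (v m : ℂ) * ((R.γ₁ n t z m : ℂ) * φ z) := by
    intro z
    rw [PiLp.inner_apply]
    simp only [Complex.ofReal_sum, Finset.sum_mul]
    refine Finset.sum_congr rfl fun m _ => ?_
    simp
    ring
  simp only [e2]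
  rw [integral_finsetSum _ fun m _ => (hφi m).const_mul _]
  have e3 : R.pair n t (∂_{v} φ : 𝓢(Space d, ℂ)) =
      ∑ m, (v m : ℂ) * R.pair n t (∂_{EuclideanSpace.single m (1 : ℝ)} φ : 𝓢(Space d, ℂ)) := by
    have : (∂_{v} φ : 𝓢(Space d, ℂ)) = ∑ m, (v m : ℂ) • (∂_{EuclideanSpace.single m (1 : ℝ)} φ : 𝓢(Space d, ℂ)) := by
      ext x
      rw [lineDeriv_eq_sum, sum_apply]
      rfl
    rw [this, ← IsLinearMap.mk'_apply (h.isLinearMap_pair n ht'), map_sum]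
    refine Finset.sum_congr rfl fun m _ => ?_
    rw [map_smul]
    rfl
  rw [e3, ← Finset.sum_neg_distrib]
  refine Finset.sum_congr rfl fun m _ => ?_
  rw [integral_const_mul, key m, mul_neg]

theorem exists_norm_lineDeriv_cutoffFun_le (v : Space d) :
    ∃ C : ℝ, ∀ (k : ℕ) x, ‖(∂_{v} (cutoffFun d k)) x‖ ≤ C * ((k : ℝ) + 1)⁻¹ := by
  have hχ : ContDiff ℝ 1 (fun y => ((cutoffBump d y : ℝ) : ℂ)) :=
    Complex.ofRealCLM.contDiff.comp (cutoffBump d).contDiff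
  have hcs : HasCompactSupport (fun y => ((cutoffBump d y : ℝ) : ℂ)) :=
    (cutoffBump d).hasCompactSupport.comp_left (g := fun r : ℝ => (r : ℂ)) (by simp)
  obtain ⟨C, hC⟩ := (hcs.fderiv ℝ).exists_bound_of_continuous (hχ.continuous_fderiv (by norm_num))
  refine ⟨C * ‖v‖, fun k x => ?_⟩
  have hk : (0 : ℝ) < ((k : ℝ) + 1)⁻¹ := by positivity
  have e : (cutoffFun d k : Space d → ℂ) = fun x => ((cutoffBump d ((k + 1 : ℝ)⁻¹ • x) : ℝ) : ℂ) := rfl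
  rw [SchwartzMap.lineDerivOp_apply_eq_fderiv, e,
    fderiv_comp_smul (f := fun y => ((cutoffBump d y : ℝ) : ℂ))]
  rw [smul_apply, norm_smul, Real.norm_of_nonneg hk.le]
  calc ((k : ℝ) + 1)⁻¹ * ‖(fderiv ℝ (fun y => ((cutoffBump d y : ℝ) : ℂ)) (((k : ℝ) + 1)⁻¹ • x)) v‖
      ≤ ((k : ℝ) + 1)⁻¹ * (C * ‖v‖) := by
        gcongr
        exact (ContinuousLinearMap.le_opNorm _ _).trans (by gcongr; exact hC _)
    _ = _ := by ring

open Filter Topology in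
/-- Derivatives of finite measures have total mass zero. -/
theorem integral_inner_γ₁ (h : GreenMeasures S R T) (h₁ : GreenGradientMeasures S R T)
    (v : Space d) (n : Fin N) {t : ℝ} (ht : t ∈ Ioc 0 T) :
    ∫ z, inner ℝ v (R.γ₁ n t z) ∂(R.μ₁ n t) = 0 := by
  have ht' : t ∈ Icc 0 T := ⟨ht.1.le, ht.2⟩
  obtain ⟨K, hK0, hK⟩ := h.exists_mass_bound
  obtain ⟨C, hC⟩ := exists_norm_lineDeriv_cutoffFun_le v
  have hi : Integrable (fun z => inner ℝ v (R.γ₁ n t z)) (R.μ₁ n t) :=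
    (h₁.integrable_γ₁ n ht).const_inner v
  have l1 : Tendsto (fun k => ∫ z, ((inner ℝ v (R.γ₁ n t z) : ℝ) : ℂ) * cutoffFun d k z ∂(R.μ₁ n t))
      atTop (𝓝 (∫ z, ((inner ℝ v (R.γ₁ n t z) : ℝ) : ℂ) * 1 ∂(R.μ₁ n t))) := by
    refine tendsto_integral_of_dominated_convergence (fun z => |inner ℝ v (R.γ₁ n t z)| * 2)
      (fun k => (hi.ofReal.aestronglyMeasurable.mul (cutoffFun d k).continuous.aestronglyMeasurable))
      (hi.abs.mul_const 2) (fun k => .of_forall fun z => ?_) (.of_forall fun z => ?_)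
    · rw [norm_mul, Complex.norm_real, Real.norm_eq_abs]
      gcongr
      have := norm_cutoffFun_sub_one_le k z
      calc ‖cutoffFun d k z‖ = ‖(cutoffFun d k z - 1) + 1‖ := by ring_nf
        _ ≤ ‖cutoffFun d k z - 1‖ + ‖(1 : ℂ)‖ := norm_add_le _ _
        _ ≤ 2 := by rw [norm_one]; linarith
    · exact (tendsto_cutoffFun z).const_mul _
  have l2 : Tendsto (fun k => ∫ z, ((inner ℝ v (R.γ₁ n t z) : ℝ) : ℂ) * cutoffFun d k z ∂(R.μ₁ n t))
      atTop (𝓝 0) := by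
    refine squeeze_zero_norm (a := fun k : ℕ => K * (C * ((k : ℝ) + 1)⁻¹)) (fun k => ?_) ?_
    · rw [integral_inner_γ₁_mul h h₁ v n ht, norm_neg]
      exact h.norm_pair_le hK n ht' (hC k)
    · have h1 : Tendsto (fun k : ℕ => ((k : ℝ) + 1)⁻¹) atTop (𝓝 0) := by
        simpa using tendsto_one_div_add_atTop_nhds_zero_nat (𝕜 := ℝ)
      simpa using (h1.const_mul C).const_mul K
  have := tendsto_nhds_unique l1 l2
  simp only [mul_one] at this
  rw [integral_complex_ofReal] at this
  exact_mod_cast this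

theorem pairing_conv_true (h : GreenMeasures S R T) (h₁ : GreenGradientMeasures S R T)
    (v : Space d) (n : Fin N) {t : ℝ} (ht : t ∈ Ioc 0 T) {w : Space d → ℝ}
    (hw : Measurable w) {C : ℝ} (hC : ∀ x, |w x| ≤ C) (ψ : 𝓢(Space d, ℂ)) :
    pairing (R.conv true v n t w) ψ = -R.smear n t w (∂_{v} ψ) := by
  have hm : Measurable (R.wgt true v n t) :=
    R.measurable_wgt true n measurable_const measurable_const measurable_id
  refine (pairing_convolution (integrable_wgt h h₁ true v n ht) hm hw hC ψ).trans ?_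
  rw [GreenData.smear, ← integral_neg]
  refine integral_congr_ae (.of_forall fun y => ?_)
  have := integral_inner_γ₁_mul h h₁ v n ht (shift y ψ)
  simp only [shift_apply, lineDeriv_shift] at this
  simp only
  rw [← mul_neg, ← this]
  rfl

end Gradient

section Mild

variable [NeZero N]

/-- The right-hand side of the Duhamel formula with source `F` (`θ = false`), resp. its derivative
in direction `v` (`θ = true`). -/
def mild (S : Problem d N H) (R : GreenData d N) (θ : Bool) (v : Space d) (F : ℝ → Space d → ℝ)
    (t : ℝ) (x : Space d) : ℝ :=
  ∑ n, S.wt n * R.conv θ v n t (S.f n) x +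
    ∫ s in (0 : ℝ)..t, R.conv θ v (lastIdx N) s (F (t - s)) x

variable {S : Problem d N H} {R : GreenData d N} {T : ℝ}

theorem measurable_duhamel (R : GreenData d N) (θ : Bool) {X : Type*} [MeasurableSpace X]
    {v : X → Space d} (hv : Measurable v) {t : X → ℝ} (ht : Measurable t)
    {F : ℝ → Space d → ℝ} (hF : Measurable fun q : ℝ × Space d => F q.1 q.2)
    {y : X → Space d} (hy : Measurable y) :
    Measurable fun x => ∫ s in Ioc 0 (t x), R.conv θ (v x) (lastIdx N) s (F (t x - s)) (y x) := by
  set A : Set (X × ℝ) := {q | q.2 ∈ Ioc 0 (t q.1)}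
  have hA : MeasurableSet A :=
    (measurableSet_lt measurable_const measurable_snd).inter
      (measurableSet_le measurable_snd (ht.comp measurable_fst))
  have h1 : Measurable fun q : X × ℝ =>
      R.conv θ (v q.1) (lastIdx N) q.2 (F (t q.1 - q.2)) (y q.1) := by
    refine R.measurable_conv θ (lastIdx N) (hv.comp measurable_fst) measurable_snd
      (F := fun q : X × ℝ => F (t q.1 - q.2)) ?_ (hy.comp measurable_fst)
    exact hF.comp ((((ht.comp measurable_fst).sub measurable_snd).comp measurable_fst).prodMk
      measurable_snd)
  have h2 := ((h1.indicator hA).stronglyMeasurable.integral_prod_right'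
    (ν := (volume : Measure ℝ))).measurable
  convert! h2 using 1
  funext x
  rw [← integral_indicator measurableSet_Ioc]
  rfl

omit [NeZero N] in
theorem measurable_conv_f (R : GreenData d N) (S : Problem d N H) (θ : Bool) (n : Fin N)
    {X : Type*} [MeasurableSpace X]
    {v : X → Space d} (hv : Measurable v) {t : X → ℝ} (ht : Measurable t)
    {y : X → Space d} (hy : Measurable y) :
    Measurable fun x => R.conv θ (v x) n (t x) (S.f n) (y x) :=
  R.measurable_conv θ n hv ht (F := fun _ => S.f n)
    ((S.f_cont n).measurable.comp measurable_snd) hy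

theorem abs_conv_le (h : GreenMeasures S R T) (h₁ : GreenGradientMeasures S R T) (θ : Bool)
    (v : Space d) (n : Fin N) {t : ℝ} (ht : t ∈ Ioc 0 T) {w : Space d → ℝ} {C : ℝ}
    (hC : ∀ x, |w x| ≤ C) (x : Space d) :
    |R.conv θ v n t w x| ≤ (∫ z, |R.wgt θ v n t z| ∂(R.law θ n t)) * C :=
  abs_integral_mul_le (w := fun z => w (x - z)) (integrable_wgt h h₁ θ v n ht) fun _ => hC _

theorem pairing_duhamel (h : GreenMeasures S R T) (h₁ : GreenGradientMeasures S R T) (θ : Bool)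
    (v : Space d)
    (hm : IntegrableOn (fun s => ∫ z, |R.wgt θ v (lastIdx N) s z| ∂(R.law θ (lastIdx N) s)) (Ioc 0 T))
    {F : ℝ → Space d → ℝ} (hF : Measurable fun q : ℝ × Space d => F q.1 q.2) {C : ℝ}
    (hC : ∀ s x, |F s x| ≤ C) {t : ℝ} (ht : t ∈ Icc 0 T) (ψ : 𝓢(Space d, ℂ)) :
    pairing (fun x => ∫ s in (0 : ℝ)..t, R.conv θ v (lastIdx N) s (F (t - s)) x) ψ =
      ∫ s in (0 : ℝ)..t, pairing (R.conv θ v (lastIdx N) s (F (t - s))) ψ := by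
  have hmt := hm.mono_set (Ioc_subset_Ioc_right ht.2)
  have hms : Measurable fun q : Space d × ℝ =>
      (R.conv θ v (lastIdx N) q.2 (F (t - q.2)) q.1 : ℂ) * ψ q.1 := by
    refine (Complex.measurable_ofReal.comp (R.measurable_conv θ (lastIdx N) measurable_const
      measurable_snd (F := fun q : Space d × ℝ => F (t - q.2)) ?_ measurable_fst)).mul
      (ψ.continuous.measurable.comp measurable_fst)
    exact hF.comp (((measurable_const.sub measurable_snd).comp measurable_fst).prodMk measurable_snd)
  have hi : Integrable (fun q : Space d × ℝ =>
      (R.conv θ v (lastIdx N) q.2 (F (t - q.2)) q.1 : ℂ) * ψ q.1)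
      (volume.prod (volume.restrict (Ioc 0 t))) := by
    have h1 := (ψ.integrable (μ := volume)).norm.mul_prod hmt
    refine (h1.const_mul C).mono' hms.aestronglyMeasurable ?_
    have : ∀ᵐ q : Space d × ℝ ∂(volume.prod (volume.restrict (Ioc 0 t))), q.2 ∈ Ioc 0 t :=
      Measure.quasiMeasurePreserving_snd.ae (ae_restrict_mem measurableSet_Ioc)
    filter_upwards [this] with q hq
    rw [norm_mul, Complex.norm_real, Real.norm_eq_abs]
    have := abs_conv_le h h₁ θ v (lastIdx N) (t := q.2) ⟨hq.1, hq.2.trans ht.2⟩ (hC (t - q.2)) q.1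
    calc _ ≤ ((∫ z, |R.wgt θ v (lastIdx N) q.2 z| ∂(R.law θ (lastIdx N) q.2)) * C) * ‖ψ q.1‖ := by
          gcongr
      _ = _ := by ring
  rw [intervalIntegral.integral_of_le ht.1]
  simp only [intervalIntegral.integral_of_le ht.1]
  unfold pairing
  rw [← integral_integral_swap hi]
  refine integral_congr_ae (.of_forall fun x => ?_)
  simp only
  rw [← integral_complex_ofReal, ← integral_mul_const]

theorem integrableOn_mass_false (h : GreenMeasures S R T) (v : Space d) :
    IntegrableOn (fun s => ∫ z, |R.wgt false v (lastIdx N) s z| ∂(R.law false (lastIdx N) s)) (Ioc 0 T) :=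
  h.mass_integrable.mono_set Ioc_subset_Icc_self

theorem integrable_conv_mul_schwartz (h : GreenMeasures S R T) (h₁ : GreenGradientMeasures S R T)
    (θ : Bool) (v : Space d) (n : Fin N) {t : ℝ} (ht : t ∈ Ioc 0 T) {w : Space d → ℝ}
    (hw : Measurable w) {C : ℝ} (hC : ∀ x, |w x| ≤ C) (ψ : 𝓢(Space d, ℂ)) :
    Integrable fun x => (R.conv θ v n t w x : ℂ) * ψ x :=
  integrable_mul_schwartz (R.measurable_conv θ n measurable_const measurable_const
    (F := fun _ => w) (hw.comp measurable_snd) measurable_id) (abs_conv_le h h₁ θ v n ht hC) ψ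

theorem abs_duhamel_le (h : GreenMeasures S R T) (h₁ : GreenGradientMeasures S R T) (θ : Bool)
    (v : Space d)
    (hm : IntegrableOn (fun s => ∫ z, |R.wgt θ v (lastIdx N) s z| ∂(R.law θ (lastIdx N) s)) (Ioc 0 T))
    {F : ℝ → Space d → ℝ} {C : ℝ}
    (hC : ∀ s x, |F s x| ≤ C) {t : ℝ} (ht : t ∈ Icc 0 T) (x : Space d) :
    |∫ s in (0 : ℝ)..t, R.conv θ v (lastIdx N) s (F (t - s)) x| ≤
      (∫ s in Ioc 0 t, ∫ z, |R.wgt θ v (lastIdx N) s z| ∂(R.law θ (lastIdx N) s)) * C := by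
  rw [intervalIntegral.integral_of_le ht.1, ← integral_mul_const, ← Real.norm_eq_abs]
  refine norm_integral_le_of_norm_le ((hm.mono_set (Ioc_subset_Ioc_right ht.2)).mul_const C)
    ((ae_restrict_iff' measurableSet_Ioc).2 (.of_forall fun s hs => ?_))
  exact abs_conv_le h h₁ θ v (lastIdx N) ⟨hs.1, hs.2.trans ht.2⟩ (hC _) x

theorem pairing_mild (h : GreenMeasures S R T) (h₁ : GreenGradientMeasures S R T) (θ : Bool)
    (v : Space d)
    (hm : IntegrableOn (fun s => ∫ z, |R.wgt θ v (lastIdx N) s z| ∂(R.law θ (lastIdx N) s)) (Ioc 0 T))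
    {F : ℝ → Space d → ℝ} (hF : Measurable fun q : ℝ × Space d => F q.1 q.2) {C : ℝ}
    (hC : ∀ s x, |F s x| ≤ C) {t : ℝ} (ht : t ∈ Ioc 0 T) (ψ : 𝓢(Space d, ℂ)) :
    pairing (mild S R θ v F t) ψ = ∑ n, (S.wt n : ℂ) * pairing (R.conv θ v n t (S.f n)) ψ +
      ∫ s in (0 : ℝ)..t, pairing (R.conv θ v (lastIdx N) s (F (t - s))) ψ := by
  have ht' : t ∈ Icc 0 T := ⟨ht.1.le, ht.2⟩
  have hi : ∀ n, Integrable fun x => (R.conv θ v n t (S.f n) x : ℂ) * ψ x := fun n => by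
    obtain ⟨C, hC⟩ := S.f_bdd n
    exact integrable_conv_mul_schwartz h h₁ θ v n ht (S.f_cont n).measurable hC ψ
  rw [← pairing_duhamel h h₁ θ v hm hF hC ht' ψ]
  unfold pairing mild
  simp only [← integral_const_mul]
  rw [← integral_finsetSum _ fun n _ => (hi n).const_mul _, ← integral_add]
  · refine integral_congr_ae (.of_forall fun x => ?_)
    simp only
    push_cast
    rw [add_mul, Finset.sum_mul]
    simp only [mul_assoc]
  · exact integrable_finsetSum _ fun n _ => (hi n).const_mul _
  · refine integrable_mul_schwartz ?_ (abs_duhamel_le h h₁ θ v hm hC ht') ψ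
    simp only [intervalIntegral.integral_of_le ht'.1]
    exact measurable_duhamel R θ measurable_const measurable_const hF measurable_id

theorem pairing_mild_false_eq (h : GreenMeasures S R T) (h₁ : GreenGradientMeasures S R T)
    (v : Space d)
    {F : ℝ → Space d → ℝ} (hF : Measurable fun q : ℝ × Space d => F q.1 q.2) {C : ℝ}
    (hC : ∀ s x, |F s x| ≤ C) {t : ℝ} (ht : t ∈ Icc 0 T) (ψ : 𝓢(Space d, ℂ)) :
    pairing (mild S R false v F t) ψ = ∑ n, (S.wt n : ℂ) * R.smear n t (S.f n) ψ +
      ∫ s in (0 : ℝ)..t, R.smear (lastIdx N) (t - s) (F s) ψ := by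
  have hFs : ∀ s, Measurable (F s) := fun s => hF.comp measurable_prodMk_left
  have hfp : ∀ n, pairing (R.conv false v n t (S.f n)) ψ = R.smear n t (S.f n) ψ := fun n => by
    obtain ⟨C, hC⟩ := S.f_bdd n
    exact GreenData.pairing_conv_false h v n ht (S.f_cont n).measurable hC ψ
  rcases ht.1.eq_or_lt with h0 | h0
  · subst h0
    have hi : ∀ n, Integrable fun x => (R.conv false v n 0 (S.f n) x : ℂ) * ψ x := fun n => by
      obtain ⟨C, hC⟩ := S.f_bdd n
      refine integrable_mul_schwartz (R.measurable_conv false n measurable_const measurable_const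
        (F := fun _ => S.f n) ((S.f_cont n).measurable.comp measurable_snd) measurable_id)
        (C := (∫ z, |R.wgt false v n 0 z| ∂(R.law false n 0)) * C) (fun x => ?_) ψ
      exact abs_integral_mul_le (w := fun z => S.f n (x - z)) (h.integrable n 0 ht) fun z => hC _
    simp only [intervalIntegral.integral_same, add_zero, ← hfp]
    unfold pairing mild
    simp only [← integral_const_mul]
    rw [← integral_finsetSum _ fun n _ => (hi n).const_mul _]
    refine integral_congr_ae (.of_forall fun x => ?_)
    simp only [intervalIntegral.integral_same, add_zero]
    push_cast
    rw [Finset.sum_mul]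
    simp only [mul_assoc]
  · rw [pairing_mild h h₁ false v (integrableOn_mass_false h v) hF hC ⟨h0, ht.2⟩]
    simp only [hfp]
    congr 1
    have hrev := intervalIntegral.integral_comp_sub_left (a := 0) (b := t)
      (fun s => pairing (R.conv false v (lastIdx N) s (F (t - s))) ψ) t
    rw [sub_zero, sub_self] at hrev
    rw [← hrev]
    refine intervalIntegral.integral_congr fun s hs => ?_
    rw [uIcc_of_le ht.1] at hs
    simp only [sub_sub_cancel]
    exact GreenData.pairing_conv_false h v _ ⟨by linarith [hs.2], by linarith [hs.1, ht.2]⟩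
      (hFs _) (hC _) ψ

/-- Mild solutions are weak solutions, for an arbitrary bounded source. -/
theorem isWeakSolution_mild (h : GreenMeasures S R T) (h₁ : GreenGradientMeasures S R T)
    (hS : GreenHatTempered S T) (hT : 0 < T) (v : Space d)
    {F : ℝ → Space d → ℝ} (hF : Measurable fun q : ℝ × Space d => F q.1 q.2) {C : ℝ}
    (hC : ∀ s x, |F s x| ≤ C) :
    IsWeakSolution S T (fun t ψ => pairing (mild S R false v F t) ψ)
      (fun n ψ => S.wt n * pairing (S.f n) ψ) (fun s ψ => pairing (F s) ψ) := by
  have h1 : IsWeakSolution S T (fun t ψ => ∑ m, (S.wt m : ℂ) * R.smear m t (S.f m) ψ)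
      (fun n ψ => ∑ m, (S.wt m : ℂ) * if n = m then pairing (S.f m) ψ else 0)
      (fun s ψ => ∑ m : Fin N, (S.wt m : ℂ) * 0) := by
    refine IsWeakSolution.sum hT Finset.univ fun m _ => ?_
    obtain ⟨C, hC⟩ := S.f_bdd m
    exact (h.isWeakSolution_smear hS hT m (S.f_cont m).measurable hC).const_mul hT _
  refine (h1.add hT (h.isWeakSolution_duhamel hS hT hF hC)).congr hT.le (fun t ht ψ => ?_)
    (fun n ψ => ?_) (fun t ht ψ => ?_)
  · exact pairing_mild_false_eq h h₁ v hF hC ht ψ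
  · simp
  · simp

/-- `mild true v` is the distributional derivative of `mild false` in direction `v`. -/
theorem pairing_mild_true (h : GreenMeasures S R T) (h₁ : GreenGradientMeasures S R T) (v u : Space d)
    (hm : IntegrableOn (fun s => ∫ z, |R.wgt true v (lastIdx N) s z| ∂(R.law true (lastIdx N) s)) (Ioc 0 T))
    {F : ℝ → Space d → ℝ} (hF : Measurable fun q : ℝ × Space d => F q.1 q.2) {C : ℝ}
    (hC : ∀ s x, |F s x| ≤ C) {t : ℝ} (ht : t ∈ Ioc 0 T) (ψ : 𝓢(Space d, ℂ)) :
    pairing (mild S R true v F t) ψ = -pairing (mild S R false u F t) (∂_{v} ψ) := by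
  have ht' : t ∈ Icc 0 T := ⟨ht.1.le, ht.2⟩
  have hFs : ∀ s, Measurable (F s) := fun s => hF.comp measurable_prodMk_left
  rw [pairing_mild h h₁ true v hm hF hC ht,
    pairing_mild h h₁ false u (integrableOn_mass_false h u) hF hC ht, neg_add,
    ← Finset.sum_neg_distrib, ← intervalIntegral.integral_neg]
  congr 1
  · refine Finset.sum_congr rfl fun n _ => ?_
    obtain ⟨C, hC⟩ := S.f_bdd n
    rw [pairing_conv_true h h₁ v n ht (S.f_cont n).measurable hC,
      GreenData.pairing_conv_false h u n ht' (S.f_cont n).measurable hC, mul_neg]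
  · refine intervalIntegral.integral_congr_ae (.of_forall fun s hs => ?_)
    rw [uIoc_of_le ht'.1] at hs
    rw [pairing_conv_true h h₁ v _ ⟨hs.1, hs.2.trans ht.2⟩ (hFs _) (hC _),
      GreenData.pairing_conv_false h u _ ⟨hs.1.le, hs.2.trans ht.2⟩ (hFs _) (hC _)]

end Mild

/-! ### Uniqueness for the linear equation -/

section Spectrum

variable (S : Problem d N H)

theorem Problem.fourierInv_transposeOp (φ : 𝓢(Space d, ℂ)) (x : Space d) :
    𝓕⁻ (S.transposeOp φ) x = S.symbol ((2 * Real.pi) • x) * 𝓕⁻ φ x := by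
  have h := S.invFourier_transposeOp φ ((2 * Real.pi) • x)
  rw [invFourier_eq, invFourier_eq, inv_smul_smul₀ (by positivity), mul_left_comm] at h
  have h0 : (((2 * Real.pi) ^ (-(d : ℝ) / 2) : ℝ) : ℂ) ≠ 0 :=
    Complex.ofReal_ne_zero.2 (by positivity)
  exact mul_left_cancel₀ h0 h

theorem fourierInv_apply_eq_fourier_neg (f : 𝓢(Space d, ℂ)) (x : Space d) : 𝓕⁻ f x = 𝓕 f (-x) := by
  rw [SchwartzMap.fourierInv_coe, SchwartzMap.fourier_coe, Real.fourierInv_eq_fourier_neg]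

theorem fourierInv_convolution (f g : 𝓢(Space d, ℂ)) (x : Space d) :
    𝓕⁻ (SchwartzMap.convolution (ContinuousLinearMap.mul ℂ ℂ) f g) x = 𝓕⁻ f x * 𝓕⁻ g x := by
  simp only [fourierInv_apply_eq_fourier_neg, SchwartzMap.fourier_convolution]
  rfl

theorem integral_norm_convolution_le (f g : 𝓢(Space d, ℂ)) :
    ∫ x, ‖SchwartzMap.convolution (ContinuousLinearMap.mul ℂ ℂ) f g x‖ ≤
      (∫ x, ‖f x‖) * ∫ x, ‖g x‖ := by
  have h1 := integral_convolution (ContinuousLinearMap.mul ℝ ℝ) (μ := (volume : Measure (Space d)))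
    (ν := volume) f.integrable.norm g.integrable.norm
  rw [ContinuousLinearMap.mul_apply'] at h1
  rw [← h1]
  refine integral_mono (SchwartzMap.integrable _).norm
    (f.integrable.norm.integrable_convolution _ g.integrable.norm) fun x => ?_
  simp only
  rw [SchwartzMap.convolution_apply]
  refine (norm_integral_le_integral_norm _).trans (le_of_eq ?_)
  refine integral_congr_ae (.of_forall fun y => ?_)
  simp

theorem cutoffFun_eq_one {k : ℕ} {x : Space d} (hx : ‖x‖ ≤ k + 1) : cutoffFun d k x = 1 := by
  rw [cutoffFun_apply, (cutoffBump d).one_of_mem_closedBall, Complex.ofReal_one]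
  rw [mem_closedBall_zero_iff, norm_smul, norm_inv, Real.norm_of_nonneg (by positivity)]
  change ((k : ℝ) + 1)⁻¹ * ‖x‖ ≤ 1
  rw [inv_mul_le_one₀ (by positivity)]
  exact hx

/-- On functions with compact spectrum the spatial operator is bounded: there it is the convolution
with a fixed Schwartz function. -/
theorem Problem.exists_iterate_transposeOp_le {ψ : 𝓢(Space d, ℂ)}
    (hψ : HasCompactSupport (𝓕⁻ ψ : 𝓢(Space d, ℂ))) :
    ∃ A : ℝ, 0 ≤ A ∧ ∀ n, ∫ x, ‖(S.transposeOp^[n] ψ) x‖ ≤ A ^ n * ∫ x, ‖ψ x‖ := by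
  obtain ⟨r, hr⟩ := hψ.isCompact.isBounded.subset_closedBall (0 : Space d)
  obtain ⟨k, hk⟩ := exists_nat_ge r
  set e : 𝓢(Space d, ℂ) := 𝓕 (cutoffFun d k) with he
  have hit : ∀ n x, 𝓕⁻ (S.transposeOp^[n] ψ) x = S.symbol ((2 * Real.pi) • x) ^ n * 𝓕⁻ ψ x := by
    intro n x
    induction n with
    | zero => simp
    | succ n ih =>
      rw [Function.iterate_succ_apply', S.fourierInv_transposeOp, ih]
      ring
  have hcut : ∀ x, cutoffFun d k x * 𝓕⁻ ψ x = 𝓕⁻ ψ x := by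
    intro x
    by_cases hx : x ∈ tsupport (𝓕⁻ ψ : 𝓢(Space d, ℂ))
    · have := mem_closedBall_zero_iff.1 (hr hx)
      rw [cutoffFun_eq_one (by linarith), one_mul]
    · rw [image_eq_zero_of_notMem_tsupport hx, mul_zero]
  have hstep : ∀ n, S.transposeOp^[n + 1] ψ =
      SchwartzMap.convolution (ContinuousLinearMap.mul ℂ ℂ) (S.transposeOp e) (S.transposeOp^[n] ψ) := by
    intro n
    have : (𝓕⁻ (S.transposeOp^[n + 1] ψ) : 𝓢(Space d, ℂ)) = 𝓕⁻ (SchwartzMap.convolution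
        (ContinuousLinearMap.mul ℂ ℂ) (S.transposeOp e) (S.transposeOp^[n] ψ)) := by
      ext x
      rw [fourierInv_convolution, S.fourierInv_transposeOp, hit, hit, he,
        FourierTransform.fourierInv_fourier_eq, ← hcut x]
      linear_combination (-S.symbol ((2 * Real.pi) • x) ^ (n + 1) * cutoffFun d k x) * hcut x
    have h2 := congrArg (fun f : 𝓢(Space d, ℂ) => (𝓕 f : 𝓢(Space d, ℂ))) this
    simpa using h2
  refine ⟨∫ x, ‖S.transposeOp e x‖, integral_nonneg fun _ => norm_nonneg _, fun n => ?_⟩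
  induction n with
  | zero => simp
  | succ n ih =>
    rw [hstep]
    refine (integral_norm_convolution_le _ _).trans ?_
    rw [pow_succ', mul_assoc]
    exact mul_le_mul_of_nonneg_left ih (integral_nonneg fun _ => norm_nonneg _)

theorem hasCompactSupport_fourierInv_mul {f g : 𝓢(Space d, ℂ)}
    (hf : HasCompactSupport (𝓕⁻ f : 𝓢(Space d, ℂ))) (hg : HasCompactSupport (𝓕⁻ g : 𝓢(Space d, ℂ))) :
    HasCompactSupport (𝓕⁻ (SchwartzMap.pairing (ContinuousLinearMap.mul ℂ ℂ) f g) : 𝓢(Space d, ℂ)) := by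
  have h1 := SchwartzMap.fourier_convolution (ContinuousLinearMap.mul ℂ ℂ) (𝓕⁻ f) (𝓕⁻ g)
  rw [FourierTransform.fourier_fourierInv_eq, FourierTransform.fourier_fourierInv_eq] at h1
  rw [← h1, FourierTransform.fourierInv_fourier_eq]
  have h2 : (SchwartzMap.convolution (ContinuousLinearMap.mul ℂ ℂ) (𝓕⁻ f) (𝓕⁻ g) : Space d → ℂ) =
      MeasureTheory.convolution (𝓕⁻ f : 𝓢(Space d, ℂ)) (𝓕⁻ g : 𝓢(Space d, ℂ))
        (ContinuousLinearMap.mul ℂ ℂ) volume := by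
    funext x
    rw [SchwartzMap.convolution_apply]
  rw [h2]
  exact hf.convolution _ hg

theorem hasCompactSupport_fourierInv_cutSpectrum (k : ℕ) (φ : 𝓢(Space d, ℂ)) :
    HasCompactSupport (𝓕⁻ (cutSpectrum k φ) : 𝓢(Space d, ℂ)) := by
  have h : (𝓕⁻ (cutSpectrum k φ) : 𝓢(Space d, ℂ)) = fun ξ => cutoffFun d k ξ * 𝓕⁻ φ ξ :=
    funext (fourierInv_cutSpectrum k φ)
  rw [h]
  exact (hasCompactSupport_cutoffFun k).mul_right

theorem ae_eq_zero_of_pairing_eq_zero {w : Space d → ℝ} (hw : Measurable w) {C : ℝ}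
    (hC : ∀ x, |w x| ≤ C) (h : ∀ ψ, pairing w ψ = 0) : ∀ᵐ x, w x = 0 := by
  refine ae_eq_zero_of_integral_contDiff_smul_eq_zero ?_ fun g hg hgs => ?_
  · refine (locallyIntegrable_const C).mono hw.aestronglyMeasurable (.of_forall fun x => ?_)
    rw [Real.norm_eq_abs, Real.norm_eq_abs]
    exact (hC x).trans (le_abs_self C)
  · have h1 : HasCompactSupport fun x => ((g x : ℝ) : ℂ) :=
      hgs.comp_left (g := fun r : ℝ => (r : ℂ)) (by simp)
    have h2 : ContDiff ℝ ((⊤ : ℕ∞) : WithTop ℕ∞) fun x => ((g x : ℝ) : ℂ) :=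
      Complex.ofRealCLM.contDiff.comp hg
    have h3 := h (h1.toSchwartzMap h2)
    have h4 : pairing w (h1.toSchwartzMap h2) = ((∫ x, g x • w x : ℝ) : ℂ) := by
      rw [← integral_complex_ofReal]
      refine integral_congr_ae (.of_forall fun x => ?_)
      simp [mul_comm]
    rw [h4] at h3
    exact_mod_cast h3

open Filter Topology in
/-- Bounded functions are determined by their pairings with the Schwartz functions of compact
spectrum. -/
theorem ae_eq_zero_of_pairing_eq_zero_of_spectrum {w : Space d → ℝ} (hw : Measurable w) {C : ℝ}
    (hC : ∀ x, |w x| ≤ C)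
    (h : ∀ ψ, HasCompactSupport (𝓕⁻ ψ : 𝓢(Space d, ℂ)) → pairing w ψ = 0) : ∀ᵐ x, w x = 0 := by
  have hC0 : 0 ≤ C := (abs_nonneg _).trans (hC 0)
  -- products of functions with compact spectrum have compact spectrum, and multiplication by a
  -- fixed one turns the uniform convergence of spectral cutoffs into convergence in `L¹`
  have h1 : ∀ e : 𝓢(Space d, ℂ), HasCompactSupport (𝓕⁻ e : 𝓢(Space d, ℂ)) → ∀ φ : 𝓢(Space d, ℂ),
      ∫ x, (w x : ℂ) * (e x * φ x) = 0 := by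
    intro e he φ
    obtain ⟨ε, hε, hφ⟩ := exists_tendsto_cutSpectrum φ
    obtain ⟨B, hB⟩ : ∃ B, ∀ z, ‖φ z‖ ≤ B := ⟨_, fun z => φ.norm_le_seminorm ℝ z⟩
    have hint : ∀ χ : 𝓢(Space d, ℂ), Integrable fun x => (w x : ℂ) * (e x * χ x) := fun χ =>
      integrable_mul_schwartz hw hC (SchwartzMap.pairing (ContinuousLinearMap.mul ℂ ℂ) e χ)
    have hk : ∀ k, ‖∫ x, (w x : ℂ) * (e x * φ x)‖ ≤ C * (ε k * ∫ x, ‖e x‖) := by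
      intro k
      have e1 : ∫ x, (w x : ℂ) * (e x * cutSpectrum k φ x) = 0 :=
        h _ (hasCompactSupport_fourierInv_mul he (hasCompactSupport_fourierInv_cutSpectrum k φ))
      have e2 : ∫ x, (w x : ℂ) * (e x * φ x) =
          -∫ x, (w x : ℂ) * (e x * (cutSpectrum k φ - φ) x) := by
        rw [← sub_zero (∫ x, (w x : ℂ) * (e x * φ x)), ← e1, ← integral_sub (hint _) (hint _),
          ← integral_neg]
        refine integral_congr_ae (.of_forall fun x => ?_)
        simp only [sub_apply]
        ring
      rw [e2, norm_neg, ← integral_const_mul, ← integral_const_mul]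
      refine norm_integral_le_of_norm_le ((e.integrable.norm.const_mul _).const_mul _)
        (.of_forall fun x => ?_)
      rw [norm_mul, norm_mul, Complex.norm_real, Real.norm_eq_abs, sub_apply, mul_comm ‖e x‖]
      gcongr
      · exact hC x
      · exact hφ k x
    have hlim : Tendsto (fun k => C * (ε k * ∫ x, ‖e x‖)) atTop (𝓝 0) := by
      simpa using (hε.mul_const (∫ x, ‖e x‖)).const_mul C
    exact norm_le_zero_iff.1 (ge_of_tendsto' hlim hk)
  -- a function of compact spectrum which does not vanish near a given point
  have h2 : ∀ e : 𝓢(Space d, ℂ), HasCompactSupport (𝓕⁻ e : 𝓢(Space d, ℂ)) →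
      ∀ᵐ x, e x ≠ 0 → w x = 0 := by
    intro e he
    have hloc : LocallyIntegrable (fun x => (w x : ℂ) * e x) :=
      (integrable_mul_schwartz hw hC e).locallyIntegrable
    have := ae_eq_zero_of_integral_contDiff_smul_eq_zero hloc fun g hg hgs => by
      have g1 : HasCompactSupport fun x => ((g x : ℝ) : ℂ) :=
        hgs.comp_left (g := fun r : ℝ => (r : ℂ)) (by simp)
      have g2 : ContDiff ℝ ((⊤ : ℕ∞) : WithTop ℕ∞) fun x => ((g x : ℝ) : ℂ) :=
        Complex.ofRealCLM.contDiff.comp hg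
      rw [← h1 e he (g1.toSchwartzMap g2)]
      refine integral_congr_ae (.of_forall fun x => ?_)
      simp
      ring
    filter_upwards [this] with x hx hne
    rcases mul_eq_zero.1 hx with h' | h'
    · exact_mod_cast h'
    · exact absurd h' hne
  obtain ⟨ε, hε, hφ⟩ := exists_tendsto_cutSpectrum (cutoffFun d 0)
  -- dilating a bump function
  have h3 : ∀ m : ℕ, ∀ᵐ x, ‖x‖ ≤ m + 1 → w x = 0 := by
    intro m
    obtain ⟨ε, hε, hφ⟩ := exists_tendsto_cutSpectrum (cutoffFun d m)
    obtain ⟨k, hk⟩ := (hε.eventually (gt_mem_nhds (show (0 : ℝ) < 1 by norm_num))).exists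
    filter_upwards [h2 _ (hasCompactSupport_fourierInv_cutSpectrum k (cutoffFun d m))] with x hx hxm
    refine hx fun h0 => ?_
    have := hφ k x
    rw [h0, cutoffFun_eq_one hxm, zero_sub, norm_neg, norm_one] at this
    linarith
  rw [← ae_all_iff] at h3
  filter_upwards [h3] with x hx
  obtain ⟨m, hm⟩ := exists_nat_ge ‖x‖
  exact hx m (by linarith)

end Spectrum

section LinearUniqueness

variable [NeZero N] {S : Problem d N H} {T : ℝ} {U : ℝ → 𝓢(Space d, ℂ) → ℂ}

/-- A bound for `U(t)(ψ)` in terms of `U(t)(Lψ)`, in the norm `sup_t e^{-λt} |·|`, for a solution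
of the homogeneous equation. -/
theorem IsWeakSolution.norm_le_exp (hT : 0 < T)
    (h : IsWeakSolution S T U (fun _ _ => 0) (fun _ _ => 0)) {ψ : 𝓢(Space d, ℂ)} {c lam : ℝ}
    (hlam : 1 + ∑ n ∈ Finset.Ico 1 N, |S.a n| < lam)
    (hc : ∀ t ∈ Icc 0 T, ‖U t (S.transposeOp ψ)‖ ≤ c * Real.exp (lam * t)) :
    ∀ t ∈ Icc 0 T, ‖U t ψ‖ ≤
      c / (lam - (1 + ∑ n ∈ Finset.Ico 1 N, |S.a n|)) * Real.exp (lam * t) := by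
  have hN : 0 < N := NeZero.pos N
  set A := 1 + ∑ n ∈ Finset.Ico 1 N, |S.a n| with hA
  have hA0 : 0 < A := by
    have : 0 ≤ ∑ n ∈ Finset.Ico 1 N, |S.a n| := Finset.sum_nonneg fun _ _ => abs_nonneg _
    linarith
  have h0T : (0 : ℝ) ∈ Icc 0 T := ⟨le_rfl, hT.le⟩
  -- the time derivatives of order less than `N` solve a first order system, to which Gronwall's
  -- argument applies
  set y : ℕ → ℝ → ℂ := fun k => iteratedDerivWithin k (fun t => U t ψ) (Icc 0 T) with hy
  have hyc : ∀ k ≤ N - 1, ContinuousOn (y k) (Icc 0 T) := fun k hk =>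
    (h.smooth_time ψ).continuousOn_iteratedDerivWithin (by exact_mod_cast hk) (uniqueDiffOn_Icc hT)
  have hyi : ∀ k ≤ N - 1, ∀ t ∈ Icc 0 T, IntervalIntegrable (y k) volume 0 t := fun k hk t ht =>
    ((hyc k hk).mono (by rw [uIcc_of_le ht.1]; exact Icc_subset_Icc_right ht.2)).intervalIntegrable
  have hy0 : ∀ k ≤ N - 1, y k 0 = 0 := fun k hk => h.initial ψ ⟨k, by omega⟩
  have hyk : ∀ k < N - 1, ∀ t ∈ Icc 0 T, y k t = ∫ s in (0 : ℝ)..t, y (k + 1) s := by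
    intro k hk t ht
    have := iteratedDerivWithin_eq_add_integral hT (h.smooth_time ψ) hk ht
    rwa [show iteratedDerivWithin k (fun t => U t ψ) (Icc 0 T) 0 = 0 from hy0 k hk.le, zero_add] at this
  have hylast : ∀ t ∈ Icc 0 T, y (N - 1) t = (∫ s in (0 : ℝ)..t, U s (S.transposeOp ψ)) -
      ∑ n ∈ Finset.Ico 1 N, (S.a n : ℂ) * ∫ s in (0 : ℝ)..t, y n s := by
    intro t ht
    have e := h.equation ψ t ht
    have hs : Finset.Icc 1 N = insert N (Finset.Ico 1 N) := by
      ext x; simp; omega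
    rw [hs, Finset.sum_insert (by simp), S.a_top, Complex.ofReal_one, one_mul] at e
    have e2 : ∀ n ∈ Finset.Ico 1 N, (S.a n : ℂ) * (y (n - 1) t - y (n - 1) 0) =
        (S.a n : ℂ) * ∫ s in (0 : ℝ)..t, y n s := by
      intro n hn
      have hn' := Finset.mem_Ico.1 hn
      rw [hy0 _ (by omega), hyk (n - 1) (by omega) t ht, Nat.sub_add_cancel hn'.1, sub_zero]
    rw [Finset.sum_congr rfl e2] at e
    have e3 : iteratedDerivWithin (N - 1) (fun t => U t ψ) (Icc 0 T) 0 = 0 := hy0 _ le_rfl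
    rw [e3] at e
    simp only [add_zero, sub_zero] at e
    rw [← e]
    simp only [hy]
    ring
  set M : ℝ → ℝ := fun t => ∑ k ∈ Finset.range N, ‖y k t‖ with hM
  have hMc : ContinuousOn M (Icc 0 T) := continuousOn_finsetSum _ fun k hk =>
    (hyc k (by have := Finset.mem_range.1 hk; omega)).norm
  have hM0 : ∀ t, 0 ≤ M t := fun t => Finset.sum_nonneg fun _ _ => norm_nonneg _
  have hyM : ∀ k < N, ∀ t, ‖y k t‖ ≤ M t := fun k hk t =>
    Finset.single_le_sum (f := fun k => ‖y k t‖) (fun _ _ => norm_nonneg _) (Finset.mem_range.2 hk)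
  obtain ⟨t₀, ht₀, hmax⟩ := isCompact_Icc.exists_isMaxOn ⟨0, h0T⟩
    (hMc.mul (by fun_prop : ContinuousOn (fun t : ℝ => Real.exp (-(lam * t))) (Icc 0 T)))
  set m := M t₀ * Real.exp (-(lam * t₀)) with hm
  have hMm : ∀ t ∈ Icc 0 T, M t ≤ m * Real.exp (lam * t) := by
    intro t ht
    have := hmax ht
    simp only [mem_ofPred_eq] at this
    calc M t = (M t * Real.exp (-(lam * t))) * Real.exp (lam * t) := by
          rw [mul_assoc, ← Real.exp_add]; simp
      _ ≤ _ := by gcongr; exact this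
  have hUi : ∀ t ∈ Icc 0 T, IntervalIntegrable (fun s => U s (S.transposeOp ψ)) volume 0 t :=
    fun t ht => h.intervalIntegrable _ ht
  -- the integral inequality at the maximum point of `e^{-λt} M(t)`
  have hI : M t₀ ≤ ∫ s in (0 : ℝ)..t₀, (c + A * m) * Real.exp (lam * s) := by
    have hsub : ∀ s ∈ Icc 0 t₀, s ∈ Icc 0 T := fun s hs => ⟨hs.1, hs.2.trans ht₀.2⟩
    have hni : ∀ k ≤ N - 1, IntervalIntegrable (fun s => ‖y k s‖) volume 0 t₀ :=
      fun k hk => (hyi k hk t₀ ht₀).norm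
    have b1 : M t₀ ≤ (∑ k ∈ Finset.range (N - 1), ∫ s in (0 : ℝ)..t₀, ‖y (k + 1) s‖) +
        ((∫ s in (0 : ℝ)..t₀, ‖U s (S.transposeOp ψ)‖) +
          ∑ n ∈ Finset.Ico 1 N, |S.a n| * ∫ s in (0 : ℝ)..t₀, ‖y n s‖) := by
      have : M t₀ = (∑ k ∈ Finset.range (N - 1), ‖y k t₀‖) + ‖y (N - 1) t₀‖ := by
        rw [hM, ← Finset.sum_range_succ, Nat.sub_add_cancel hN]
      rw [this]
      gcongr with k hk
      · rw [hyk k (Finset.mem_range.1 hk) t₀ ht₀]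
        exact intervalIntegral.norm_integral_le_integral_norm ht₀.1
      · rw [hylast t₀ ht₀]
        refine (norm_sub_le _ _).trans ?_
        gcongr
        · exact intervalIntegral.norm_integral_le_integral_norm ht₀.1
        · refine (norm_sum_le _ _).trans (Finset.sum_le_sum fun n _ => ?_)
          rw [norm_mul, Complex.norm_real, Real.norm_eq_abs]
          gcongr
          exact intervalIntegral.norm_integral_le_integral_norm ht₀.1
    refine b1.trans ?_
    rw [← intervalIntegral.integral_finsetSum
      (fun k hk => hni (k + 1) (by have := Finset.mem_range.1 hk; omega))]
    simp only [← intervalIntegral.integral_const_mul]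
    rw [← intervalIntegral.integral_finsetSum
      (fun n hn => (hni n (by have := Finset.mem_Ico.1 hn; omega)).const_mul _)]
    have i1 : IntervalIntegrable (fun s => ∑ k ∈ Finset.range (N - 1), ‖y (k + 1) s‖) volume 0 t₀ := by
      have := IntervalIntegrable.sum (s := Finset.range (N - 1)) (f := fun k s => ‖y (k + 1) s‖)
        (fun k hk => hni (k + 1) (by have := Finset.mem_range.1 hk; omega))
      convert! this using 1
      funext s; simp
    have i2 : IntervalIntegrable (fun s => ∑ n ∈ Finset.Ico 1 N, |S.a n| * ‖y n s‖) volume 0 t₀ := by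
      have := IntervalIntegrable.sum (s := Finset.Ico 1 N) (f := fun n s => |S.a n| * ‖y n s‖)
        (fun n hn => (hni n (by have := Finset.mem_Ico.1 hn; omega)).const_mul _)
      convert! this using 1
      funext s; simp
    rw [← intervalIntegral.integral_add (hUi t₀ ht₀).norm i2,
      ← intervalIntegral.integral_add i1 ((hUi t₀ ht₀).norm.add i2)]
    refine intervalIntegral.integral_mono_on ht₀.1 (i1.add ((hUi t₀ ht₀).norm.add i2))
      (Continuous.intervalIntegrable (by fun_prop) _ _) fun s hs => ?_
    have hs' := hsub s hs
    have j1 : ∑ k ∈ Finset.range (N - 1), ‖y (k + 1) s‖ ≤ M s := by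
      have : M s = (∑ k ∈ Finset.range (N - 1), ‖y (k + 1) s‖) + ‖y 0 s‖ := by
        rw [hM, ← Finset.sum_range_succ' (fun k => ‖y k s‖), Nat.sub_add_cancel hN]
      rw [this]
      linarith [norm_nonneg (y 0 s)]
    have j2 : ∑ n ∈ Finset.Ico 1 N, |S.a n| * ‖y n s‖ ≤ (∑ n ∈ Finset.Ico 1 N, |S.a n|) * M s := by
      rw [Finset.sum_mul]
      refine Finset.sum_le_sum fun n hn => ?_
      gcongr
      exact hyM n (Finset.mem_Ico.1 hn).2 s
    have j3 := hc s hs'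
    have j4 := hMm s hs'
    calc _ ≤ M s + (c * Real.exp (lam * s) + (∑ n ∈ Finset.Ico 1 N, |S.a n|) * M s) := by
          gcongr
      _ = c * Real.exp (lam * s) + A * M s := by rw [hA]; ring
      _ ≤ c * Real.exp (lam * s) + A * (m * Real.exp (lam * s)) := by gcongr
      _ = _ := by ring
  have hl0 : 0 < lam := hA0.trans hlam
  have hc0 : 0 ≤ c := by
    have := (norm_nonneg _).trans (hc 0 h0T)
    simpa using this
  have hm0 : 0 ≤ m := mul_nonneg (hM0 _) (Real.exp_pos _).le
  have hint : ∫ s in (0 : ℝ)..t₀, (c + A * m) * Real.exp (lam * s) ≤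
      (c + A * m) * (Real.exp (lam * t₀) / lam) := by
    have e : ∫ s in (0 : ℝ)..t₀, Real.exp (lam * s) = (Real.exp (lam * t₀) - 1) / lam := by
      rw [intervalIntegral.integral_comp_mul_left (fun x => Real.exp x) hl0.ne', integral_exp]
      simp [div_eq_inv_mul]
    rw [intervalIntegral.integral_const_mul, e]
    gcongr
    linarith
  have hmle : m * lam ≤ c + A * m := by
    have h1 := hI.trans hint
    have h2 : m * lam = M t₀ * (Real.exp (-(lam * t₀)) * lam) := by rw [hm]; ring
    rw [h2]
    calc M t₀ * (Real.exp (-(lam * t₀)) * lam)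
        ≤ ((c + A * m) * (Real.exp (lam * t₀) / lam)) * (Real.exp (-(lam * t₀)) * lam) := by gcongr
      _ = (c + A * m) * (Real.exp (lam * t₀) * Real.exp (-(lam * t₀))) * (lam / lam) := by ring
      _ = c + A * m := by
          rw [← Real.exp_add, div_self hl0.ne']; simp
  intro t ht
  have h3 : m ≤ c / (lam - A) := by
    rw [le_div_iff₀ (by linarith)]
    nlinarith
  calc ‖U t ψ‖ = ‖y 0 t‖ := by simp [hy]
    _ ≤ M t := hyM 0 hN t
    _ ≤ m * Real.exp (lam * t) := hMm t ht
    _ ≤ _ := by gcongr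

open Filter Topology in
/-- A solution of the homogeneous equation with zero initial data vanishes on the test functions
with compact spectrum. -/
theorem IsWeakSolution.eq_zero (hT : 0 < T)
    (h : IsWeakSolution S T U (fun _ _ => 0) (fun _ _ => 0)) {C : ℝ} (hC0 : 0 ≤ C)
    (hC : ∀ t ∈ Icc 0 T, ∀ ψ, ‖U t ψ‖ ≤ C * ∫ x, ‖ψ x‖)
    {ψ : 𝓢(Space d, ℂ)} (hψ : HasCompactSupport (𝓕⁻ ψ : 𝓢(Space d, ℂ))) :
    ∀ t ∈ Icc 0 T, U t ψ = 0 := by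
  obtain ⟨A, hA0, hA⟩ := S.exists_iterate_transposeOp_le hψ
  set B := 1 + ∑ n ∈ Finset.Ico 1 N, |S.a n| with hB
  have hB0 : 0 < B := by
    have : 0 ≤ ∑ n ∈ Finset.Ico 1 N, |S.a n| := Finset.sum_nonneg fun _ _ => abs_nonneg _
    linarith
  set lam := B + (A + 1) with hlam
  have hlB : lam - B = A + 1 := by rw [hlam]; ring
  set I := ∫ x, ‖ψ x‖ with hI
  have hI0 : 0 ≤ I := integral_nonneg fun _ => norm_nonneg _
  -- each application of `norm_le_exp` costs a factor `A` from the operator and gains `1 / (A + 1)`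
  have key : ∀ k n : ℕ, ∀ t ∈ Icc 0 T, ‖U t (S.transposeOp^[n] ψ)‖ ≤
      C * (A ^ (n + k) * I) / (A + 1) ^ k * Real.exp (lam * t) := by
    intro k
    induction k with
    | zero =>
      intro n t ht
      refine (hC t ht _).trans ?_
      have h1 : 1 ≤ Real.exp (lam * t) := Real.one_le_exp (mul_nonneg (by positivity) ht.1)
      calc C * ∫ x, ‖(S.transposeOp^[n] ψ) x‖ ≤ C * (A ^ n * I) := by gcongr; exact hA n
        _ = C * (A ^ (n + 0) * I) / (A + 1) ^ 0 * 1 := by simp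
        _ ≤ _ := by gcongr
    | succ k ih =>
      intro n t ht
      have := h.norm_le_exp hT (ψ := S.transposeOp^[n] ψ) (lam := lam)
        (c := C * (A ^ (n + 1 + k) * I) / (A + 1) ^ k) (by rw [hlam]; linarith) (fun s hs => by
          rw [← Function.iterate_succ_apply' S.transposeOp n ψ]
          exact ih (n + 1) s hs) t ht
      refine this.trans (le_of_eq ?_)
      rw [← hB, hlB, div_div, ← pow_succ, show n + 1 + k = n + (k + 1) by ring]
  intro t ht
  have hlim : Tendsto (fun k : ℕ => C * (A ^ (0 + k) * I) / (A + 1) ^ k * Real.exp (lam * t))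
      atTop (𝓝 0) := by
    have h1 : Tendsto (fun k : ℕ => (A / (A + 1)) ^ k) atTop (𝓝 0) :=
      tendsto_pow_atTop_nhds_zero_of_lt_one (by positivity) (by rw [div_lt_one (by linarith)]; linarith)
    have h2 := h1.const_mul (C * I * Real.exp (lam * t))
    rw [mul_zero] at h2
    refine h2.congr fun k => ?_
    rw [div_pow, zero_add]
    ring
  exact norm_le_zero_iff.1 (ge_of_tendsto' hlim fun k => key k 0 t ht)

/-- Bounded weak solutions of the linear equation are unique. -/
theorem ae_eq_of_isWeakSolution (hT : 0 < T) {v w : ℝ → Space d → ℝ}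
    {init : Fin N → 𝓢(Space d, ℂ) → ℂ} {σ : ℝ → 𝓢(Space d, ℂ) → ℂ}
    (hv : IsWeakSolution S T (fun t ψ => pairing (v t) ψ) init σ)
    (hw : IsWeakSolution S T (fun t ψ => pairing (w t) ψ) init σ)
    (hvm : ∀ t ∈ Icc 0 T, Measurable (v t)) (hwm : ∀ t ∈ Icc 0 T, Measurable (w t)) {C : ℝ}
    (hvC : ∀ t ∈ Icc 0 T, ∀ x, |v t x| ≤ C) (hwC : ∀ t ∈ Icc 0 T, ∀ x, |w t x| ≤ C) :
    ∀ t ∈ Icc 0 T, ∀ᵐ x, v t x = w t x := by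
  have hp : ∀ t ∈ Icc 0 T, ∀ ψ, pairing (fun x => v t x - w t x) ψ = pairing (v t) ψ + (-1) * pairing (w t) ψ := by
    intro t ht ψ
    rw [neg_one_mul, ← sub_eq_add_neg]
    unfold pairing
    rw [← integral_sub (integrable_mul_schwartz (hvm t ht) (hvC t ht) ψ)
      (integrable_mul_schwartz (hwm t ht) (hwC t ht) ψ)]
    refine integral_congr_ae (.of_forall fun x => ?_)
    simp only
    push_cast; ring
  have h := (hv.add hT (hw.const_mul hT (-1))).congr hT.le
    (U' := fun t ψ => pairing (fun x => v t x - w t x) ψ) (init' := fun _ _ => 0)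
    (σ' := fun _ _ => 0) hp (fun n ψ => by ring) (fun t ht ψ => by ring)
  have hb : ∀ t ∈ Icc 0 T, ∀ x, |v t x - w t x| ≤ C + C := fun t ht x =>
    (abs_sub _ _).trans (add_le_add (hvC t ht x) (hwC t ht x))
  have hC0 : 0 ≤ C := (abs_nonneg _).trans (hvC 0 ⟨le_rfl, hT.le⟩ 0)
  intro t ht
  filter_upwards [ae_eq_zero_of_pairing_eq_zero_of_spectrum ((hvm t ht).sub (hwm t ht)) (hb t ht)
    fun ψ hψ => h.eq_zero hT (C := C + C) (by linarith)
      (fun t ht ψ => norm_pairing_le (hb t ht) ψ) hψ t ht] with x hx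
  exact sub_eq_zero.1 hx

end LinearUniqueness

/-! ### Weak derivatives -/

/-- The fundamental theorem of calculus for a weak derivative in direction `v`. -/
theorem ae_sub_eq_integral_of_weak_derivative {U V : Space d → ℝ} (hU : Measurable U)
    (hV : Measurable V) {C : ℝ} (hUC : ∀ x, |U x| ≤ C) (hVC : ∀ x, |V x| ≤ C) {v : Space d}
    (h : ∀ ψ : 𝓢(Space d, ℂ), pairing V ψ = -pairing U (∂_{v} ψ : 𝓢(Space d, ℂ))) :
    ∀ᵐ x, U (x + v) - U x = ∫ r in (0 : ℝ)..1, V (x + r • v) := by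
  have hC0 : 0 ≤ C := (abs_nonneg _).trans (hUC 0)
  set I : Space d → ℝ := fun x => ∫ r in (0 : ℝ)..1, V (x + r • v) with hI
  have hVm : Measurable fun q : Space d × ℝ => V (q.1 + q.2 • v) := hV.comp (by fun_prop)
  have hIm : Measurable I := by
    simp only [hI, intervalIntegral.integral_of_le zero_le_one]
    exact (hVm.stronglyMeasurable.integral_prod_right' (ν := volume.restrict (Ioc 0 1))).measurable
  have hIC : ∀ x, |I x| ≤ C := fun x => by
    have := intervalIntegral.norm_integral_le_of_norm_le_const (a := (0 : ℝ)) (b := 1) (C := C)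
      (f := fun r => V (x + r • v)) fun r _ => hVC _
    simpa using this
  have hIp : ∀ ψ : 𝓢(Space d, ℂ), pairing I ψ =
      ∫ r in (0 : ℝ)..1, pairing V (shift (-(r • v)) ψ) := by
    intro ψ
    have hi : Integrable (fun q : Space d × ℝ => (V (q.1 + q.2 • v) : ℂ) * ψ q.1)
        (volume.prod (volume.restrict (Ioc 0 1))) := by
      have h1 : Integrable (fun q : Space d × ℝ => ψ q.1 * (1 : ℂ))
          ((volume : Measure (Space d)).prod (volume.restrict (Ioc (0 : ℝ) 1))) :=
        ψ.integrable.mul_prod (integrable_const (1 : ℂ))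
      simp only [mul_one] at h1
      exact h1.bdd_mul (c := C) (Complex.measurable_ofReal.comp hVm).aestronglyMeasurable
        (.of_forall fun q => by rw [Complex.norm_real]; exact hVC _)
    have e1 : pairing I ψ = ∫ x, ∫ r in Ioc (0 : ℝ) 1, (V (x + r • v) : ℂ) * ψ x := by
      refine integral_congr_ae (.of_forall fun x => ?_)
      simp only [hI, intervalIntegral.integral_of_le zero_le_one]
      rw [← integral_complex_ofReal, ← integral_mul_const]
    rw [e1, integral_integral_swap hi, intervalIntegral.integral_of_le zero_le_one]
    refine integral_congr_ae (.of_forall fun r => ?_)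
    simp only
    rw [← integral_sub_right_eq_self _ (r • v)]
    refine integral_congr_ae (.of_forall fun x => ?_)
    simp only [shift_apply, sub_add_cancel]
    rw [neg_add_eq_sub]
  have hUp : ∀ ψ : 𝓢(Space d, ℂ), pairing (fun x => U (x + v)) ψ - pairing U ψ =
      ∫ r in (0 : ℝ)..1, pairing V (shift (-(r • v)) ψ) := by
    intro ψ
    set D : 𝓢(Space d, ℂ) := ∂_{v} ψ with hD
    have hi : Integrable (fun q : Space d × ℝ => (U q.1 : ℂ) * D (q.1 - q.2 • v))
        (volume.prod (volume.restrict (Ioc 0 1))) := by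
      have hm : Measurable fun q : Space d × ℝ => (U q.1 : ℂ) * D (q.1 - q.2 • v) := by
        have := D.continuous.measurable
        fun_prop
      refine (integrable_prod_iff' hm.aestronglyMeasurable).2 ⟨.of_forall fun r => ?_, ?_⟩
      · exact ((D.integrable (μ := volume)).comp_sub_right (r • v)).bdd_mul (c := C)
          (Complex.measurable_ofReal.comp hU).aestronglyMeasurable (.of_forall fun q => by
            rw [Complex.norm_real]; exact hUC _)
      · refine Integrable.of_bound
          (hm.norm.stronglyMeasurable.integral_prod_left').aestronglyMeasurable (C * ∫ x, ‖D x‖)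
          (.of_forall fun r => ?_)
        rw [Real.norm_of_nonneg (integral_nonneg fun y => norm_nonneg _),
          ← integral_sub_right_eq_self (fun y => ‖D y‖) (r • v), ← integral_const_mul]
        refine integral_mono_of_nonneg (.of_forall fun y => norm_nonneg _)
          (((D.integrable (μ := volume)).comp_sub_right (r • v)).norm.const_mul C)
          (.of_forall fun y => ?_)
        simp only [norm_mul, Complex.norm_real, Real.norm_eq_abs]
        gcongr
        exact hUC y
    have e0 : ∀ x, ψ (x - v) - ψ x = -∫ r in (0 : ℝ)..1, D (x - r • v) := by
      intro x
      have hd : ∀ r : ℝ, HasDerivAt (fun r : ℝ => ψ (x - r • v)) (-D (x - r • v)) r := by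
        intro r
        have h1 : HasFDerivAt ψ (fderiv ℝ ψ (x - r • v)) (x - r • v) := ψ.differentiableAt.hasFDerivAt
        have h2 : HasDerivAt (fun r : ℝ => x - r • v) (-v) r := by
          have := ((hasDerivAt_id r).smul_const v).const_sub x
          simpa using this
        have h3 := h1.comp_hasDerivAt r h2
        rw [map_neg] at h3
        rw [hD, SchwartzMap.lineDerivOp_apply_eq_fderiv]
        exact h3
      have hc : Continuous fun r : ℝ => D (x - r • v) := D.continuous.comp (by fun_prop)
      have := intervalIntegral.integral_eq_sub_of_hasDerivAt (a := 0) (b := 1)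
        (fun r _ => hd r) (hc.neg.intervalIntegrable _ _)
      rw [intervalIntegral.integral_neg] at this
      rw [this]
      simp
    have e1 : pairing (fun x => U (x + v)) ψ = ∫ x, (U x : ℂ) * ψ (x - v) := by
      unfold pairing
      rw [← integral_sub_right_eq_self _ v]
      simp
    have hi1 : Integrable fun x => (U x : ℂ) * ψ (x - v) :=
      ((ψ.integrable (μ := volume)).comp_sub_right v).bdd_mul (c := C)
        (Complex.measurable_ofReal.comp hU).aestronglyMeasurable (.of_forall fun q => by
          rw [Complex.norm_real]; exact hUC _)
    rw [e1]
    unfold pairing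
    rw [← integral_sub hi1 (integrable_mul_schwartz hU hUC ψ)]
    have e2 : ∫ x, ((U x : ℂ) * ψ (x - v) - (U x : ℂ) * ψ x) =
        -∫ x, ∫ r in Ioc (0 : ℝ) 1, (U x : ℂ) * D (x - r • v) := by
      rw [← integral_neg]
      refine integral_congr_ae (.of_forall fun x => ?_)
      simp only
      rw [← mul_sub, e0, intervalIntegral.integral_of_le zero_le_one, integral_const_mul, mul_neg]
    rw [e2, integral_integral_swap hi, ← integral_neg, intervalIntegral.integral_of_le zero_le_one]
    refine integral_congr_ae (.of_forall fun r => ?_)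
    have h4 := h (shift (-(r • v)) ψ)
    rw [lineDeriv_shift] at h4
    simp only [pairing] at h4
    simp only
    rw [h4]
    congr 1
    refine integral_congr_ae (.of_forall fun x => ?_)
    simp only [shift_apply, hD]
    rw [neg_add_eq_sub]
  have hUv : Measurable fun x => U (x + v) := hU.comp (by fun_prop)
  have hfin := ae_eq_zero_of_pairing_eq_zero (w := fun x => U (x + v) - U x - I x) (C := C + C + C)
    ((hUv.sub hU).sub hIm) (fun x => ?_) fun ψ => ?_
  · filter_upwards [hfin] with x hx
    exact sub_eq_zero.1 hx
  · exact (abs_sub _ _).trans (add_le_add ((abs_sub _ _).trans (add_le_add (hUC _) (hUC _))) (hIC _))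
  · have e3 : pairing (fun x => U (x + v) - U x - I x) ψ =
        pairing (fun x => U (x + v)) ψ - pairing U ψ - pairing I ψ := by
      unfold pairing
      have i1 := integrable_mul_schwartz hUv (fun x => hUC (x + v)) ψ
      have i2 := integrable_mul_schwartz hU hUC ψ
      have i3 := integrable_mul_schwartz hIm hIC ψ
      have i12 : Integrable (fun x => (U (x + v) : ℂ) * ψ x - (U x : ℂ) * ψ x) := i1.sub i2
      rw [← integral_sub i1 i2, ← integral_sub i12 i3]
      refine integral_congr_ae (.of_forall fun x => ?_)
      simp only
      push_cast; ring
    rw [e3, hUp, hIp, sub_self]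

/-- A function with continuous weak directional derivatives, linear in the direction, is `C¹`. -/
theorem hasGradientAt_of_sub_eq_integral {U : Space d → ℝ} {G : Space d → Space d} (hG : Continuous G)
    (h : ∀ v x, U (x + v) - U x = ∫ r in (0 : ℝ)..1, inner ℝ v (G (x + r • v))) (x : Space d) :
    HasGradientAt U (G x) x := by
  rw [hasGradientAt_iff_isLittleO, Asymptotics.isLittleO_iff]
  intro c hc
  obtain ⟨δ, hδ, hGδ⟩ := Metric.continuousAt_iff.1 (hG.continuousAt (x := x)) c hc
  filter_upwards [Metric.ball_mem_nhds x hδ] with y hy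
  have e1 := h (y - x) x
  rw [add_sub_cancel] at e1
  have hcont : ∀ v : Space d, Continuous fun r : ℝ => (inner ℝ v (G (x + r • v)) : ℝ) := fun v =>
    continuous_const.inner (hG.comp (by fun_prop))
  have e2 : U y - U x - inner ℝ (G x) (y - x) =
      ∫ r in (0 : ℝ)..1, inner ℝ (y - x) (G (x + r • (y - x)) - G x) := by
    simp only [inner_sub_right]
    rw [intervalIntegral.integral_sub ((hcont _).intervalIntegrable _ _) (by simp), ← e1]
    simp [real_inner_comm, inner_sub_left]
  rw [e2]
  have := intervalIntegral.norm_integral_le_of_norm_le_const (a := (0 : ℝ)) (b := 1) (C := c * ‖y - x‖)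
    (f := fun r => inner ℝ (y - x) (G (x + r • (y - x)) - G x)) fun r hr => by
      rw [uIoc_of_le zero_le_one] at hr
      refine (norm_inner_le_norm _ _).trans ?_
      rw [mul_comm]
      gcongr
      rw [← dist_eq_norm]
      refine (hGδ ?_).le
      rw [dist_eq_norm, add_sub_cancel_left, norm_smul, Real.norm_of_nonneg hr.1.le]
      rw [mem_ball_iff_norm] at hy
      exact (mul_le_of_le_one_left (norm_nonneg _) hr.2).trans_lt hy
  simpa using this

/-! ### The first branching step -/

open unitInterval

section Marks

/-- The law of the branching times `τ_k`. -/
def timeLaw (ρ : ℝ → ℝ) : Measure ℝ :=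
  (volume.restrict (Ioi 0)).withDensity fun s => ENNReal.ofReal (ρ s)

/-- The law of the indices `I⁰_k`. -/
def Problem.indexLaw (S : Problem d N H) : Measure (Fin N) :=
  ∑ n : Fin N, ENNReal.ofReal (S.wt n) • Measure.dirac n

/-- The law of the branching types `j_k`. -/
def Problem.branchLaw (S : Problem d N H) : Measure ℕ :=
  Measure.sum fun j : ℕ => ENNReal.ofReal (S.q j) • Measure.dirac j

/-- The law of the marks of a particle. -/
def Problem.markLaw (S : Problem d N H) (ρ : ℝ → ℝ) : Measure (Mark N) :=
  (timeLaw ρ).prod (S.indexLaw.prod S.branchLaw)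

/-- The law of the marks of a particle, together with a uniform random variable from which its
displacement is sampled. -/
def Problem.seedLaw (S : Problem d N H) (ρ : ℝ → ℝ) : Measure (Mark N × I) :=
  (S.markLaw ρ).prod volume

variable (S : Problem d N H) {ρ : ℝ → ℝ}

theorem IsPositiveDensity.isProbabilityMeasure_timeLaw (hρ : IsPositiveDensity ρ) :
    IsProbabilityMeasure (timeLaw ρ) := by
  constructor
  rw [timeLaw, withDensity_apply _ MeasurableSet.univ, Measure.restrict_univ]
  exact hρ.mass

instance isProbabilityMeasure_indexLaw : IsProbabilityMeasure S.indexLaw := by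
  constructor
  simp only [Problem.indexLaw, Measure.coe_finsetSum, Finset.sum_apply, Measure.smul_apply,
    measure_univ, smul_eq_mul, mul_one]
  rw [← ENNReal.ofReal_sum_of_nonneg fun n _ => (S.wt_pos n).le, S.wt_sum, ENNReal.ofReal_one]

instance isProbabilityMeasure_branchLaw : IsProbabilityMeasure S.branchLaw := by
  constructor
  simp only [Problem.branchLaw, Measure.sum_apply _ MeasurableSet.univ, Measure.smul_apply,
    measure_univ, smul_eq_mul, mul_one]
  rw [← ENNReal.ofReal_tsum_of_nonneg S.q_nonneg S.q_sum.summable, S.q_sum.tsum_eq,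
    ENNReal.ofReal_one]

theorem IsPositiveDensity.isProbabilityMeasure_markLaw (hρ : IsPositiveDensity ρ) :
    IsProbabilityMeasure (S.markLaw ρ) := by
  have := hρ.isProbabilityMeasure_timeLaw
  unfold Problem.markLaw
  infer_instance

theorem IsPositiveDensity.isProbabilityMeasure_seedLaw (hρ : IsPositiveDensity ρ) :
    IsProbabilityMeasure (S.seedLaw ρ) := by
  have := hρ.isProbabilityMeasure_markLaw S
  unfold Problem.seedLaw
  infer_instance

theorem lintegral_indexLaw (f : Fin N → ℝ≥0∞) :
    ∫⁻ n, f n ∂S.indexLaw = ∑ n, ENNReal.ofReal (S.wt n) * f n := by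
  simp [Problem.indexLaw]

theorem integral_indexLaw (f : Fin N → ℝ) : ∫ n, f n ∂S.indexLaw = ∑ n, S.wt n * f n := by
  rw [Problem.indexLaw, integral_finsetSum_measure]
  · simp [integral_smul_measure, ENNReal.toReal_ofReal (S.wt_pos _).le]
  · intro n _
    exact (integrable_dirac (by simp)).smul_measure ENNReal.ofReal_ne_top

theorem lintegral_branchLaw (f : ℕ → ℝ≥0∞) :
    ∫⁻ j, f j ∂S.branchLaw = ∑' j, ENNReal.ofReal (S.q j) * f j := by
  simp [Problem.branchLaw, lintegral_sum_measure]

theorem integral_branchLaw {f : ℕ → ℝ} (hf : Summable fun j => S.q j * |f j|) :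
    Integrable f S.branchLaw ∧ ∫ j, f j ∂S.branchLaw = ∑' j, S.q j * f j := by
  have hi : Integrable f S.branchLaw := by
    refine ⟨(measurable_of_countable f).aestronglyMeasurable, ?_⟩
    rw [hasFiniteIntegral_iff_enorm, lintegral_branchLaw]
    have : ∀ j, ENNReal.ofReal (S.q j) * ‖f j‖ₑ = ENNReal.ofReal (S.q j * |f j|) := fun j => by
      rw [ENNReal.ofReal_mul (S.q_nonneg j), ← Real.norm_eq_abs, ofReal_norm]
    simp only [this]
    rw [← ENNReal.ofReal_tsum_of_nonneg (fun j => mul_nonneg (S.q_nonneg j) (abs_nonneg _)) hf]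
    exact ENNReal.ofReal_lt_top
  refine ⟨hi, ?_⟩
  rw [Problem.branchLaw, integral_sum_measure hi]
  simp [integral_smul_measure, ENNReal.toReal_ofReal (S.q_nonneg _)]

theorem lintegral_timeLaw (hρ : IsPositiveDensity ρ) {f : ℝ → ℝ≥0∞} (hf : Measurable f) :
    ∫⁻ s, f s ∂(timeLaw ρ) = ∫⁻ s in Ioi 0, ENNReal.ofReal (ρ s) * f s := by
  have hm := hρ.meas
  rw [timeLaw, lintegral_withDensity_eq_lintegral_mul _ (by fun_prop) hf]
  rfl

theorem integral_timeLaw (hρ : IsPositiveDensity ρ) (f : ℝ → ℝ) :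
    ∫ s, f s ∂(timeLaw ρ) = ∫ s in Ioi 0, ρ s * f s := by
  have hm := hρ.meas
  rw [timeLaw, integral_withDensity_eq_integral_toReal_smul (by fun_prop)
    (.of_forall fun s => ENNReal.ofReal_lt_top)]
  refine setIntegral_congr_fun measurableSet_Ioi fun s hs => ?_
  simp only [smul_eq_mul]
  rw [ENNReal.toReal_ofReal (hρ.pos s hs).le]

theorem IsPositiveDensity.integrableOn (hρ : IsPositiveDensity ρ) : IntegrableOn ρ (Ioi 0) := by
  refine ⟨hρ.meas.aestronglyMeasurable, ?_⟩
  rw [hasFiniteIntegral_iff_ofReal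
    ((ae_restrict_iff' measurableSet_Ioi).2 (.of_forall fun s hs => (hρ.pos s hs).le)), hρ.mass]
  exact ENNReal.one_lt_top

theorem IsPositiveDensity.tail_pos (hρ : IsPositiveDensity ρ) {t : ℝ} (ht : 0 ≤ t) : 0 < tail ρ t := by
  rw [tail, setIntegral_pos_iff_support_of_nonneg_ae]
  · have : Function.support ρ ∩ Ioi t = Ioi t := by
      rw [inter_eq_right]
      intro s hs
      exact (hρ.pos s (ht.trans_lt hs)).ne'
    rw [this]
    simp
  · exact (ae_restrict_iff' measurableSet_Ioi).2 (.of_forall fun s hs => (hρ.pos s (ht.trans_lt hs)).le)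
  · exact hρ.integrableOn.mono_set (Ioi_subset_Ioi ht)

theorem IsPositiveDensity.ofReal_tail (hρ : IsPositiveDensity ρ) {t : ℝ} (ht : 0 ≤ t) :
    ENNReal.ofReal (tail ρ t) = ∫⁻ s in Ioi t, ENNReal.ofReal (ρ s) := by
  rw [tail, ofReal_integral_eq_lintegral_ofReal (hρ.integrableOn.mono_set (Ioi_subset_Ioi ht))]
  exact (ae_restrict_iff' measurableSet_Ioi).2 (.of_forall fun s hs => (hρ.pos s (ht.trans_lt hs)).le)

theorem lintegral_seedLaw (hρ : IsPositiveDensity ρ) {f : Mark N × I → ℝ≥0∞} (hf : Measurable f) :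
    ∫⁻ e, f e ∂(S.seedLaw ρ) = ∫⁻ s in Ioi 0, ENNReal.ofReal (ρ s) *
      ∑ n, ENNReal.ofReal (S.wt n) * ∑' j, ENNReal.ofReal (S.q j) * ∫⁻ u, f ((s, n, j), u) := by
  have := hρ.isProbabilityMeasure_timeLaw
  have h1 : Measurable fun m : Mark N => ∫⁻ u, f (m, u) := hf.lintegral_prod_right'
  have h2 : Measurable fun s : ℝ => ∫⁻ nj, (∫⁻ u, f ((s, nj), u)) ∂(S.indexLaw.prod S.branchLaw) :=
    h1.lintegral_prod_right'
  rw [Problem.seedLaw, lintegral_prod _ hf.aemeasurable, Problem.markLaw,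
    lintegral_prod _ h1.aemeasurable, lintegral_timeLaw hρ h2]
  refine setLIntegral_congr_fun measurableSet_Ioi fun s _ => ?_
  rw [lintegral_prod _ (by fun_prop), lintegral_indexLaw]
  simp only [lintegral_branchLaw]

theorem integral_seedLaw (hρ : IsPositiveDensity ρ) {f : Mark N × I → ℝ}
    (hf : Integrable f (S.seedLaw ρ)) :
    ∫ e, f e ∂(S.seedLaw ρ) = ∫ s in Ioi 0, ρ s *
      ∫ nj, (∫ u, f ((s, nj), u)) ∂(S.indexLaw.prod S.branchLaw) := by
  have := hρ.isProbabilityMeasure_timeLaw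
  have := hρ.isProbabilityMeasure_markLaw S
  rw [Problem.seedLaw, integral_prod _ hf, Problem.markLaw, integral_prod _ ?_, integral_timeLaw hρ]
  exact hf.integral_prod_left

end Marks

/-! ### Moment bounds -/

section Estimates

variable [NeZero N] {S : Problem d N H} {R : GreenData d N} {T p : ℝ} {ρ : ℝ → ℝ}

/-- The terminal value `f_n(x - z) - 1_{θ ≠ 0} f_n(x)` of a particle. -/
def Problem.leaf (S : Problem d N H) (θ : Bool) (n : Fin N) (x z : Space d) : ℝ :=
  S.f n (x - z) - bif θ then S.f n x else 0

omit [NeZero N] in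
theorem GreenData.measurable_γ₁ (R : GreenData d N) (n : Fin N) (t : ℝ) : Measurable (R.γ₁ n t) :=
  (R.γ₁_meas n).comp measurable_prodMk_left

omit [NeZero N] in
theorem GreenGradientMeasures.lintegral_enorm_γ₁_mul_le (h₁ : GreenGradientMeasures S R T) (n : Fin N)
    {t : ℝ} (ht : t ∈ Ioc 0 T) {g : Space d → ℝ≥0∞} (hg : Measurable g) :
    ∫⁻ z, ‖R.γ₁ n t z‖ₑ * g z ∂(R.μ₁ n t) ≤ ∫⁻ z, g z ∂(R.gradVariation n t) := by
  have hm := R.measurable_γ₁ n t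
  have hmm : ∀ m, Measurable fun z => R.γ₁ n t z m := fun m => by fun_prop
  have e : ∫⁻ z, g z ∂(R.gradVariation n t) = ∫⁻ z, ∑ m, ‖R.γ₁ n t z m‖ₑ * g z ∂(R.μ₁ n t) := by
    rw [GreenData.gradVariation, lintegral_finsetSum_measure, lintegral_finsetSum]
    · refine Finset.sum_congr rfl fun m _ => ?_
      rw [h₁.density n m t ht, lintegral_totalVariation_withDensityᵥ (h₁.integrable n m t ht) (hmm m) hg]
    · intro m _
      exact (hmm m).enorm.mul hg
  rw [e]
  refine lintegral_mono fun z => ?_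
  rw [← Finset.sum_mul]
  gcongr
  have h1 := (EuclideanSpace.basisFun (Fin d) ℝ).sum_repr (R.γ₁ n t z)
  calc ‖R.γ₁ n t z‖ₑ = ‖∑ m, R.γ₁ n t z m • EuclideanSpace.basisFun (Fin d) ℝ m‖ₑ := by
        conv_lhs => rw [← h1]
        rfl
    _ ≤ ∑ m, ‖R.γ₁ n t z m • EuclideanSpace.basisFun (Fin d) ℝ m‖ₑ := enorm_sum_le _ _
    _ = _ := by
        refine Finset.sum_congr rfl fun m _ => ?_
        rw [enorm_smul]
        simp [enorm]

theorem enorm_rpow_eq (hp : 1 < p) {E : Type*} [NormedAddCommGroup E] (a : E) :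
    ‖a‖ₑ ^ p = ‖a‖ₑ * ‖a‖ₑ ^ (p - 1) := by
  by_cases h : ‖a‖ₑ = 0
  · rw [h, ENNReal.zero_rpow_of_pos (by linarith), zero_mul]
  · nth_rewrite 2 [← ENNReal.rpow_one ‖a‖ₑ]
    rw [← ENNReal.rpow_add _ _ h enorm_ne_top]
    congr 1; ring

theorem edist_le_gradNorm_mul (f : Space d → ℝ) (x y : Space d) :
    edist (f x) (f y) ≤ gradNorm f * edist x y := by
  by_cases h : x = y
  · simp [h]
  · have h0 : edist x y ≠ 0 := fun h' => h (edist_eq_zero.1 h')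
    rw [← ENNReal.div_le_iff h0 (edist_ne_top x y)]
    exact (le_iSup (fun y => edist (f x) (f y) / edist x y) y).trans
      (le_iSup (fun x => ⨆ y, edist (f x) (f y) / edist x y) x)

omit [NeZero N] in
theorem GreenData.measurable_wgt_right (R : GreenData d N) (θ : Bool) (v : Space d) (n : Fin N) (t : ℝ) :
    Measurable (R.wgt θ v n t) :=
  R.measurable_wgt θ n measurable_const measurable_const measurable_id

theorem ofReal_rpow_ne {x : ℝ} (hx : 0 < x) (r : ℝ) :
    ENNReal.ofReal x ^ r ≠ 0 ∧ ENNReal.ofReal x ^ r ≠ ∞ := by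
  have h1 : ENNReal.ofReal x ≠ 0 := (ENNReal.ofReal_pos.2 hx).ne'
  exact ⟨fun h => (ENNReal.rpow_pos (pos_iff_ne_zero.2 h1) ENNReal.ofReal_ne_top).ne' h,
    ENNReal.rpow_ne_top_of_ne_zero h1 ENNReal.ofReal_ne_top⟩

omit [NeZero N] in
theorem enorm_wgt_true_le {v : Space d} (hv : ‖v‖ ≤ 1) (n : Fin N) (t : ℝ) (z : Space d) :
    ‖R.wgt true v n t z‖ₑ ≤ ‖R.γ₁ n t z‖ₑ := by
  rw [enorm_le_iff_norm_le]
  calc ‖R.wgt true v n t z‖ ≤ ‖v‖ * ‖R.γ₁ n t z‖ := norm_inner_le_norm _ _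
    _ ≤ 1 * ‖R.γ₁ n t z‖ := by gcongr
    _ = _ := one_mul _

/-- The `p`-th moment of a particle that does not branch, up to its factor `1 / ρ̄`: this is what `r̂_p`
controls, since `|γ|^p dμ = |γ|^{p-1} d|g|`. For the types `θ ≠ 0`, the increment of `f_n` over the
displacement `z` is at most `‖∇f_n‖ |z|`. -/
theorem lintegral_enorm_wgt_mul_leaf_le (h : GreenMeasures S R T) (h₁ : GreenGradientMeasures S R T)
    (hρ : IsPositiveDensity ρ) (hp : 1 < p) (θ : Bool) {v : Space d} (hv : ‖v‖ ≤ 1) (n : Fin N)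
    {t : ℝ} (ht : t ∈ Ioc 0 T) (x : Space d) :
    ∫⁻ z, ‖R.wgt θ v n t z * S.leaf θ n x z‖ₑ ^ p ∂(R.law θ n t) ≤
      rHat S R ρ T p * ENNReal.ofReal (tail ρ t) ^ (p - 1) := by
  have ht' : t ∈ Icc 0 T := ⟨ht.1.le, ht.2⟩
  have hp0 : 0 ≤ p := by linarith
  obtain ⟨hτ0, hτ1⟩ := ofReal_rpow_ne (hρ.tail_pos ht'.1) (p - 1)
  have hr : max (supNorm (S.f n) ^ p * ∫⁻ z, ‖R.γ n t z‖ₑ ^ (p - 1) ∂(R.G n t).totalVariation)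
      (gradNorm (S.f n) ^ p *
        ∫⁻ z, ‖z‖ₑ ^ p * ‖R.γ₁ n t z‖ₑ ^ (p - 1) ∂(R.gradVariation n t)) ≤
      rHat S R ρ T p * ENNReal.ofReal (tail ρ t) ^ (p - 1) := by
    rw [← ENNReal.div_le_iff hτ0 hτ1]
    unfold rHat
    refine le_iSup_of_le t (le_iSup_of_le ht (le_iSup_of_le n le_rfl))
  refine le_trans ?_ hr
  cases θ
  · refine le_trans ?_ (le_max_left _ _)
    have hm := R.measurable_γ n t
    rw [h.density n t ht', lintegral_totalVariation_withDensityᵥ (h.integrable n t ht') hm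
      (by fun_prop), ← lintegral_const_mul _ (by fun_prop)]
    refine lintegral_mono fun z => ?_
    rw [enorm_mul, ENNReal.mul_rpow_of_nonneg _ _ hp0, ← enorm_rpow_eq hp, mul_comm]
    refine mul_le_mul' (ENNReal.rpow_le_rpow ?_ hp0) le_rfl
    simp only [Problem.leaf, cond_false, sub_zero]
    exact le_iSup (fun x => ‖S.f n x‖ₑ) (x - z)
  · refine le_trans ?_ (le_max_right _ _)
    have hm := R.measurable_γ₁ n t
    refine le_trans ?_ (mul_le_mul' le_rfl (h₁.lintegral_enorm_γ₁_mul_le n ht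
      (g := fun z => ‖z‖ₑ ^ p * ‖R.γ₁ n t z‖ₑ ^ (p - 1)) (by fun_prop)))
    rw [← lintegral_const_mul _ (by fun_prop)]
    refine lintegral_mono fun z => ?_
    have e : ‖S.leaf true n x z‖ₑ ≤ gradNorm (S.f n) * ‖z‖ₑ := by
      simp only [Problem.leaf, cond_true]
      rw [← edist_eq_enorm_sub]
      refine (edist_le_gradNorm_mul (S.f n) _ _).trans_eq ?_
      rw [edist_eq_enorm_sub, sub_sub_cancel_left, enorm_neg]
    calc ‖R.wgt true v n t z * S.leaf true n x z‖ₑ ^ p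
        ≤ (‖R.γ₁ n t z‖ₑ * (gradNorm (S.f n) * ‖z‖ₑ)) ^ p := by
          rw [enorm_mul]
          exact ENNReal.rpow_le_rpow (mul_le_mul' (enorm_wgt_true_le hv n t z) e) hp0
      _ = _ := by
          rw [ENNReal.mul_rpow_of_nonneg _ _ hp0, ENNReal.mul_rpow_of_nonneg _ _ hp0, enorm_rpow_eq hp]
          ring

/-- The `p`-th moment of the weight of a branching particle, controlled by `α̂_p`. -/
theorem lintegral_enorm_wgt_le (h : GreenMeasures S R T) (h₁ : GreenGradientMeasures S R T)
    (hρ : IsPositiveDensity ρ) (hp : 1 < p) (θ : Bool) {v : Space d} (hv : ‖v‖ ≤ 1)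
    {t : ℝ} (ht : t ∈ Ioc 0 T) :
    ∫⁻ z, ‖R.wgt θ v (lastIdx N) t z‖ₑ ^ p ∂(R.law θ (lastIdx N) t) ≤
      alphaHat R ρ T p * ENNReal.ofReal (ρ t) ^ (p - 1) := by
  have ht' : t ∈ Icc 0 T := ⟨ht.1.le, ht.2⟩
  have hp0 : 0 ≤ p := by linarith
  obtain ⟨hτ0, hτ1⟩ := ofReal_rpow_ne (hρ.pos t ht.1) (p - 1)
  have hr : max (∫⁻ z, ‖R.γ (lastIdx N) t z‖ₑ ^ (p - 1) ∂(R.G (lastIdx N) t).totalVariation)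
      (∫⁻ z, ‖R.γ₁ (lastIdx N) t z‖ₑ ^ (p - 1) ∂(R.gradVariation (lastIdx N) t)) ≤
      alphaHat R ρ T p * ENNReal.ofReal (ρ t) ^ (p - 1) := by
    rw [← ENNReal.div_le_iff hτ0 hτ1]
    unfold alphaHat
    refine le_iSup_of_le t (le_iSup_of_le ht le_rfl)
  refine le_trans ?_ hr
  cases θ
  · refine le_trans ?_ (le_max_left _ _)
    have hm := R.measurable_γ (lastIdx N) t
    rw [h.density _ t ht', lintegral_totalVariation_withDensityᵥ (h.integrable _ t ht') hm
      (by fun_prop)]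
    refine lintegral_mono fun z => ?_
    rw [← enorm_rpow_eq hp]
    rfl
  · refine le_trans ?_ (le_max_right _ _)
    have hm := R.measurable_γ₁ (lastIdx N) t
    refine le_trans ?_ (h₁.lintegral_enorm_γ₁_mul_le (lastIdx N) ht
      (g := fun z => ‖R.γ₁ (lastIdx N) t z‖ₑ ^ (p - 1)) (by fun_prop))
    refine lintegral_mono fun z => ?_
    rw [← enorm_rpow_eq hp]
    exact ENNReal.rpow_le_rpow (enorm_wgt_true_le hv _ t z) hp0

/-- The total mass of `g_N(s,·)` plus that of its gradient. It bounds the Duhamel kernels of all types,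
and is integrable on `[0,T]` (`integrableOn_mass`). -/
def GreenData.mass (R : GreenData d N) (s : ℝ) : ℝ :=
  ∫ z, |R.γ (lastIdx N) s z| ∂(R.μ (lastIdx N) s) + ∫ z, ‖R.γ₁ (lastIdx N) s z‖ ∂(R.μ₁ (lastIdx N) s)

theorem GreenData.mass_nonneg (R : GreenData d N) (s : ℝ) : 0 ≤ R.mass s :=
  add_nonneg (integral_nonneg fun _ => abs_nonneg _) (integral_nonneg fun _ => norm_nonneg _)

theorem GreenData.measurable_mass (R : GreenData d N) : Measurable R.mass :=
  ((R.γ_meas (lastIdx N)).abs.stronglyMeasurable.integral_kernel_prod_right' (κ := R.μ (lastIdx N))).measurable.add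
    ((R.γ₁_meas (lastIdx N)).norm.stronglyMeasurable.integral_kernel_prod_right' (κ := R.μ₁ (lastIdx N))).measurable

theorem integral_abs_wgt_le_mass (h₁ : GreenGradientMeasures S R T)
    (θ : Bool) {v : Space d} (hv : ‖v‖ ≤ 1) {s : ℝ} (hs : s ∈ Ioc 0 T) :
    ∫ z, |R.wgt θ v (lastIdx N) s z| ∂(R.law θ (lastIdx N) s) ≤ R.mass s := by
  cases θ
  · exact le_add_of_nonneg_right (integral_nonneg fun _ => norm_nonneg _)
  · refine le_trans ?_ (le_add_of_nonneg_left (integral_nonneg fun _ => abs_nonneg _))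
    refine integral_mono_of_nonneg (.of_forall fun _ => abs_nonneg _)
      (h₁.integrable_γ₁ (lastIdx N) hs).norm (.of_forall fun z => ?_)
    have := enorm_wgt_true_le (R := R) hv (lastIdx N) s z
    rwa [enorm_le_iff_norm_le] at this

theorem integrableOn_mass (h : GreenMeasures S R T) (h₁ : GreenGradientMeasures S R T)
    (hρ : IsPositiveDensity ρ) (hp : 1 < p) (hα : alphaHat R ρ T p < ∞) :
    IntegrableOn R.mass (Ioc 0 T) := by
  refine (h.mass_integrable.mono_set Ioc_subset_Icc_self).add ?_
  set α := (alphaHat R ρ T p).toReal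
  have hm : Measurable fun s => ∫ z, ‖R.γ₁ (lastIdx N) s z‖ ∂(R.μ₁ (lastIdx N) s) :=
    ((R.γ₁_meas (lastIdx N)).norm.stronglyMeasurable.integral_kernel_prod_right'
      (κ := R.μ₁ (lastIdx N))).measurable
  refine Integrable.mono' (g := fun s => ρ s + α)
    ((hρ.integrableOn.mono_set Ioc_subset_Ioi_self).add (integrable_const _)) hm.aestronglyMeasurable
    ((ae_restrict_iff' measurableSet_Ioc).2 (.of_forall fun s hs => ?_))
  rw [Real.norm_of_nonneg (integral_nonneg fun _ => norm_nonneg _)]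
  have hρs := hρ.pos s hs.1
  obtain ⟨h0, h1⟩ := ofReal_rpow_ne hρs (p - 1)
  have hγm := R.measurable_γ₁ (lastIdx N) s
  -- `‖γ¹‖ ≤ ρ + ‖γ¹‖^p / ρ^{p-1}`, where `ρ` is integrable and the `p`-th moment is at most
  -- `α̂_p ρ^{p-1}`
  have key : ∀ z, ‖R.γ₁ (lastIdx N) s z‖ₑ ≤ ENNReal.ofReal (ρ s) +
      ‖R.γ₁ (lastIdx N) s z‖ₑ * (‖R.γ₁ (lastIdx N) s z‖ₑ ^ (p - 1) / ENNReal.ofReal (ρ s) ^ (p - 1)) := by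
    intro z
    rcases le_total ‖R.γ₁ (lastIdx N) s z‖ₑ (ENNReal.ofReal (ρ s)) with hle | hle
    · exact hle.trans le_self_add
    · refine le_trans ?_ le_add_self
      refine le_mul_of_one_le_right' ?_
      rw [ENNReal.le_div_iff_mul_le (.inl h0) (.inl h1), one_mul]
      exact ENNReal.rpow_le_rpow hle (by linarith)
  have hle : ∫⁻ z, ‖R.γ₁ (lastIdx N) s z‖ₑ ∂(R.μ₁ (lastIdx N) s) ≤
      ENNReal.ofReal (ρ s) + alphaHat R ρ T p := by
    refine (lintegral_mono key).trans ?_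
    rw [lintegral_add_left measurable_const, lintegral_const, measure_univ, mul_one]
    gcongr
    refine (h₁.lintegral_enorm_γ₁_mul_le (lastIdx N) hs (g := fun z =>
      ‖R.γ₁ (lastIdx N) s z‖ₑ ^ (p - 1) / ENNReal.ofReal (ρ s) ^ (p - 1)) (by fun_prop)).trans ?_
    simp only [div_eq_mul_inv]
    rw [lintegral_mul_const _ (by fun_prop), ← div_eq_mul_inv]
    unfold alphaHat
    exact le_iSup_of_le s (le_iSup_of_le hs (ENNReal.div_le_div_right (le_max_right _ _) _))
  rw [integral_norm_eq_lintegral_enorm hγm.aestronglyMeasurable]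
  refine (ENNReal.toReal_mono (by simp [hα.ne]) hle).trans_eq ?_
  rw [ENNReal.toReal_add ENNReal.ofReal_ne_top hα.ne, ENNReal.toReal_ofReal hρs.le]

theorem integrableOn_mass_wgt (h₁ : GreenGradientMeasures S R T)
    (hM : IntegrableOn R.mass (Ioc 0 T)) (θ : Bool) {v : Space d} (hv : ‖v‖ ≤ 1) :
    IntegrableOn (fun s => ∫ z, |R.wgt θ v (lastIdx N) s z| ∂(R.law θ (lastIdx N) s)) (Ioc 0 T) := by
  have hm : Measurable fun s => ∫ z, |R.wgt θ v (lastIdx N) s z| ∂(R.law θ (lastIdx N) s) :=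
    ((R.measurable_wgt θ (lastIdx N) measurable_const measurable_fst
      measurable_snd).abs.stronglyMeasurable.integral_kernel_prod_right' (κ := R.law θ (lastIdx N))).measurable
  refine hM.mono' hm.aestronglyMeasurable
    ((ae_restrict_iff' measurableSet_Ioc).2 (.of_forall fun s hs => ?_))
  rw [Real.norm_of_nonneg (integral_nonneg fun _ => abs_nonneg _)]
  exact integral_abs_wgt_le_mass h₁ θ hv hs

end Estimates

/-! ### Mild solutions as expectations over the first branching step -/

section Step

/-- The displacement of a particle, as a function of its life time and of a uniform random
variable. -/
def GreenData.sample (R : GreenData d N) (θ : Bool) (n : Fin N) : ℝ → I → Space d :=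
  (Kernel.exists_measurable_map_eq_unitInterval (R.law θ n)).choose

theorem GreenData.measurable_sample (R : GreenData d N) (θ : Bool) (n : Fin N) :
    Measurable (Function.uncurry (R.sample θ n)) :=
  (Kernel.exists_measurable_map_eq_unitInterval (R.law θ n)).choose_spec.1

theorem GreenData.measurable_sample' (R : GreenData d N) (θ : Bool) (n : Fin N) {X : Type*}
    [MeasurableSpace X] {s : X → ℝ} (hs : Measurable s) {u : X → I} (hu : Measurable u) :
    Measurable fun x => R.sample θ n (s x) (u x) :=
  (R.measurable_sample θ n).comp (hs.prodMk hu)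

theorem GreenData.map_sample (R : GreenData d N) (θ : Bool) (n : Fin N) (s : ℝ) :
    volume.map (R.sample θ n s) = R.law θ n s :=
  (Kernel.exists_measurable_map_eq_unitInterval (R.law θ n)).choose_spec.2 s

theorem GreenData.lintegral_sample (R : GreenData d N) (θ : Bool) (n : Fin N) (s : ℝ)
    {f : Space d → ℝ≥0∞} (hf : Measurable f) :
    ∫⁻ u, f (R.sample θ n s u) = ∫⁻ z, f z ∂(R.law θ n s) := by
  have hm : Measurable (R.sample θ n s) := R.measurable_sample' θ n measurable_const measurable_id
  rw [← R.map_sample, lintegral_map hf hm]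

theorem GreenData.integral_sample (R : GreenData d N) (θ : Bool) (n : Fin N) (s : ℝ)
    {f : Space d → ℝ} (hf : Measurable f) :
    ∫ u, f (R.sample θ n s u) = ∫ z, f z ∂(R.law θ n s) := by
  have hm : Measurable (R.sample θ n s) := R.measurable_sample' θ n measurable_const measurable_id
  rw [← R.map_sample, integral_map hm.aemeasurable hf.aestronglyMeasurable]

variable [NeZero N] {S : Problem d N H} {R : GreenData d N} {T p : ℝ} {ρ : ℝ → ℝ}

/-- The value of a particle of type `θ` with derivative direction `v`, started at `x` with horizon
`t`, if the product over its descendants and the coefficient at its branching point is `g`. -/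
def stepVal (S : Problem d N H) (R : GreenData d N) (ρ : ℝ → ℝ) (θ : Bool) (v : Space d)
    (t : ℝ) (x : Space d) (e : Mark N × I) (g : ℝ) : ℝ :=
  if e.1.1 < t then
    R.wgt θ v (lastIdx N) e.1.1 (R.sample θ (lastIdx N) e.1.1 e.2) / ρ e.1.1 * g
  else
    R.wgt θ v e.1.2.1 t (R.sample θ e.1.2.1 t e.2) / tail ρ t *
      S.leaf θ e.1.2.1 x (R.sample θ e.1.2.1 t e.2)

omit [NeZero N] in
theorem Problem.measurable_leaf (S : Problem d N H) (θ : Bool) (n : Fin N) {X : Type*}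
    [MeasurableSpace X] {x z : X → Space d} (hx : Measurable x) (hz : Measurable z) :
    Measurable fun ω => S.leaf θ n (x ω) (z ω) := by
  have := (S.f_cont n).measurable
  cases θ
  · simp only [Problem.leaf, cond_false]
    fun_prop
  · simp only [Problem.leaf, cond_true]
    fun_prop

theorem measurable_tail (ρ : ℝ → ℝ) (hρ : Measurable ρ) : Measurable (tail ρ) := by
  have h1 : Measurable fun q : ℝ × ℝ => ({q : ℝ × ℝ | q.1 < q.2}.indicator fun q => ρ q.2) q :=
    (hρ.comp measurable_snd).indicator (measurableSet_lt measurable_fst measurable_snd)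
  convert! (h1.stronglyMeasurable.integral_prod_right' (ν := (volume : Measure ℝ))).measurable using 1
  funext t
  rw [tail, ← integral_indicator measurableSet_Ioi]
  rfl

theorem measurable_apply_countable {ι X : Type*} [Countable ι] [MeasurableSpace ι]
    [MeasurableSingletonClass ι] [MeasurableSpace X] {f : ι → X → ℝ} (hf : ∀ i, Measurable (f i))
    {i : X → ι} (hi : Measurable i) : Measurable fun x => f (i x) x := by
  have h : Measurable fun q : ι × X => f q.1 q.2 := measurable_from_prod_countable_right hf
  exact h.comp (hi.prodMk measurable_id)

theorem measurable_stepVal (S : Problem d N H) (R : GreenData d N) (hρ : Measurable ρ) (θ : Bool)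
    {X : Type*} [MeasurableSpace X] {v : X → Space d} (hv : Measurable v) {t : X → ℝ}
    (ht : Measurable t) {x : X → Space d} (hx : Measurable x) {e : X → Mark N × I}
    (he : Measurable e) {g : X → ℝ} (hg : Measurable g) :
    Measurable fun ω => stepVal S R ρ θ (v ω) (t ω) (x ω) (e ω) (g ω) := by
  have hs : Measurable fun ω => (e ω).1.1 := measurable_fst.comp (measurable_fst.comp he)
  have hu : Measurable fun ω => (e ω).2 := measurable_snd.comp he
  have hn : Measurable fun ω => (e ω).1.2.1 :=
    measurable_fst.comp (measurable_snd.comp (measurable_fst.comp he))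
  refine Measurable.ite (measurableSet_lt hs ht) ?_ ?_
  · exact ((R.measurable_wgt θ _ hv hs (R.measurable_sample' θ _ hs hu)).div (hρ.comp hs)).mul hg
  · refine measurable_apply_countable (f := fun n ω => R.wgt θ (v ω) n (t ω) (R.sample θ n (t ω) (e ω).2) /
      tail ρ (t ω) * S.leaf θ n (x ω) (R.sample θ n (t ω) (e ω).2)) (fun n => ?_) hn
    have hz := R.measurable_sample' θ n ht hu
    exact ((R.measurable_wgt θ n hv ht hz).div ((measurable_tail ρ hρ).comp ht)).mul
      (S.measurable_leaf θ n hx hz)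

theorem IsPositiveDensity.lintegral_Ici (hρ : IsPositiveDensity ρ) {t : ℝ} (ht : 0 ≤ t) :
    ∫⁻ s in Ici t, ENNReal.ofReal (ρ s) = ENNReal.ofReal (tail ρ t) := by
  rw [hρ.ofReal_tail ht]
  exact setLIntegral_congr Ioi_ae_eq_Ici.symm

theorem Ioi_zero_eq_union {t : ℝ} (ht : 0 < t) : Ioi (0 : ℝ) = Ioo 0 t ∪ Ici t :=
  (Ioo_union_Ici_eq_Ioi ht).symm

/-- The `p`-th moment of the first branching step. -/
theorem lintegral_step_le (h : GreenMeasures S R T) (h₁ : GreenGradientMeasures S R T)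
    (hρ : IsPositiveDensity ρ) (hp : 1 < p) (θ : Bool) {v : Space d} (hv : ‖v‖ ≤ 1) {t : ℝ}
    (ht : t ∈ Ioc 0 T) (x : Space d) {W : ℕ → ℝ → ℝ≥0∞} (hW : ∀ j, Measurable (W j)) :
    ∫⁻ e : Mark N × I, (if e.1.1 < t then
        ‖R.wgt θ v (lastIdx N) e.1.1 (R.sample θ (lastIdx N) e.1.1 e.2) / ρ e.1.1‖ₑ ^ p *
          W e.1.2.2 e.1.1
      else ‖R.wgt θ v e.1.2.1 t (R.sample θ e.1.2.1 t e.2) / tail ρ t *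
        S.leaf θ e.1.2.1 x (R.sample θ e.1.2.1 t e.2)‖ₑ ^ p) ∂(S.seedLaw ρ) ≤
      rHat S R ρ T p + alphaHat R ρ T p * ∫⁻ s in Ioo 0 t, ∑' j, ENNReal.ofReal (S.q j) * W j s := by
  have hp0 : 0 ≤ p := by linarith
  have hρm := hρ.meas
  have hs : Measurable fun e : Mark N × I => e.1.1 := by fun_prop
  have hu : Measurable fun e : Mark N × I => e.2 := by fun_prop
  have hmeas : Measurable fun e : Mark N × I => (if e.1.1 < t then
        ‖R.wgt θ v (lastIdx N) e.1.1 (R.sample θ (lastIdx N) e.1.1 e.2) / ρ e.1.1‖ₑ ^ p *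
          W e.1.2.2 e.1.1
      else ‖R.wgt θ v e.1.2.1 t (R.sample θ e.1.2.1 t e.2) / tail ρ t *
        S.leaf θ e.1.2.1 x (R.sample θ e.1.2.1 t e.2)‖ₑ ^ p) := by
    refine Measurable.ite (measurableSet_lt hs measurable_const) ?_ ?_
    · have h1 := (R.measurable_wgt θ (lastIdx N) (v := fun _ : Mark N × I => v) measurable_const hs
        (R.measurable_sample' θ (lastIdx N) hs hu))
      have h2 : Measurable fun q : ℕ × ℝ => W q.1 q.2 := measurable_from_prod_countable_right hW
      have h3 : Measurable fun e : Mark N × I => W e.1.2.2 e.1.1 :=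
        h2.comp ((measurable_snd.comp (measurable_snd.comp measurable_fst)).prodMk hs)
      exact ((h1.div (hρm.comp hs)).enorm.pow_const p).mul h3
    · have h1 : Measurable fun e : Mark N × I => R.wgt θ v e.1.2.1 t (R.sample θ e.1.2.1 t e.2) / tail ρ t *
          S.leaf θ e.1.2.1 x (R.sample θ e.1.2.1 t e.2) := by
        refine measurable_apply_countable (f := fun n (e : Mark N × I) =>
          R.wgt θ v n t (R.sample θ n t e.2) / tail ρ t * S.leaf θ n x (R.sample θ n t e.2))
          (fun n => ?_) (by fun_prop)
        have hz := R.measurable_sample' θ n (X := Mark N × I) (s := fun _ => t) measurable_const hu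
        exact ((R.measurable_wgt θ n measurable_const measurable_const hz).div_const _).mul
          (S.measurable_leaf θ n measurable_const hz)
      exact h1.enorm.pow_const p
  rw [lintegral_seedLaw S hρ hmeas, Ioi_zero_eq_union ht.1,
    lintegral_union measurableSet_Ici (by
      rw [Set.disjoint_left]; intro s h1 h2; exact absurd h1.2 (not_lt.2 h2)), add_comm]
  have hτ := hρ.tail_pos ht.1.le
  gcongr ?_ + ?_
  · -- no branching before `t`
    obtain ⟨hτ0, hτ1⟩ := ofReal_rpow_ne hτ p
    have hn : ∀ n, ∫⁻ u, ‖R.wgt θ v n t (R.sample θ n t u) / tail ρ t *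
        S.leaf θ n x (R.sample θ n t u)‖ₑ ^ p ≤ rHat S R ρ T p / ENNReal.ofReal (tail ρ t) := by
      intro n
      have hwm := R.measurable_wgt_right θ v n t
      have hlm := S.measurable_leaf θ n (x := fun _ : Space d => x) measurable_const measurable_id
      have hle := lintegral_enorm_wgt_mul_leaf_le h h₁ hρ hp θ hv n ht x
      rw [R.lintegral_sample θ n t (f := fun z => ‖R.wgt θ v n t z / tail ρ t * S.leaf θ n x z‖ₑ ^ p)
        (((hwm.div_const _).mul hlm).enorm.pow_const p)]
      have e : ∀ z, ‖R.wgt θ v n t z / tail ρ t * S.leaf θ n x z‖ₑ ^ p =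
          ‖R.wgt θ v n t z * S.leaf θ n x z‖ₑ ^ p / ENNReal.ofReal (tail ρ t) ^ p := by
        intro z
        rw [div_mul_eq_mul_div, ← ENNReal.div_rpow_of_nonneg _ _ hp0]
        congr 1
        rw [div_eq_mul_inv, enorm_mul, enorm_inv hτ.ne', Real.enorm_of_nonneg hτ.le, div_eq_mul_inv]
      have hm : Measurable fun z => ‖R.wgt θ v n t z * S.leaf θ n x z‖ₑ ^ p :=
        (hwm.mul hlm).enorm.pow_const p
      simp only [e]
      simp only [ENNReal.div_eq_inv_mul]
      rw [lintegral_const_mul _ hm, ← ENNReal.div_eq_inv_mul, ← ENNReal.div_eq_inv_mul,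
        ENNReal.div_le_iff hτ0 hτ1]
      refine hle.trans_eq ?_
      have hT0 : ENNReal.ofReal (tail ρ t) ≠ 0 := (ENNReal.ofReal_pos.2 hτ).ne'
      have e2 : ENNReal.ofReal (tail ρ t) ^ p =
          ENNReal.ofReal (tail ρ t) * ENNReal.ofReal (tail ρ t) ^ (p - 1) := by
        nth_rewrite 2 [← ENNReal.rpow_one (ENNReal.ofReal (tail ρ t))]
        rw [← ENNReal.rpow_add _ _ hT0 ENNReal.ofReal_ne_top]
        congr 1; ring
      rw [e2, ← mul_assoc, ENNReal.div_mul_cancel hT0 ENNReal.ofReal_ne_top]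
    calc _ ≤ ∫⁻ s in Ici t, ENNReal.ofReal (ρ s) * (rHat S R ρ T p / ENNReal.ofReal (tail ρ t)) := by
          refine setLIntegral_mono' measurableSet_Ici fun s hs => ?_
          simp only [if_neg (not_lt.2 (show t ≤ s from hs))]
          gcongr
          have hq : ∑' j, ENNReal.ofReal (S.q j) = 1 := by
            rw [← ENNReal.ofReal_tsum_of_nonneg S.q_nonneg S.q_sum.summable, S.q_sum.tsum_eq,
              ENNReal.ofReal_one]
          have hw : ∑ n, ENNReal.ofReal (S.wt n) = 1 := by
            rw [← ENNReal.ofReal_sum_of_nonneg fun n _ => (S.wt_pos n).le, S.wt_sum, ENNReal.ofReal_one]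
          calc _ ≤ ∑ n, ENNReal.ofReal (S.wt n) * (rHat S R ρ T p / ENNReal.ofReal (tail ρ t)) := by
                gcongr with n
                rw [ENNReal.tsum_mul_right, hq, one_mul]
                exact hn n
            _ = _ := by rw [← Finset.sum_mul, hw, one_mul]
      _ = rHat S R ρ T p := by
          rw [lintegral_mul_const _ (by fun_prop), hρ.lintegral_Ici ht.1.le, mul_comm]
          exact ENNReal.div_mul_cancel (ENNReal.ofReal_pos.2 hτ).ne' ENNReal.ofReal_ne_top
  · rw [← lintegral_const_mul _ (Measurable.tsum fun j => (hW j).const_mul _)]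
    refine setLIntegral_mono' measurableSet_Ioo fun s hs => ?_
    simp only [if_pos hs.2]
    have hsT : s ∈ Ioc 0 T := ⟨hs.1, hs.2.le.trans ht.2⟩
    have hρs := hρ.pos s hs.1
    obtain ⟨hτ0, hτ1⟩ := ofReal_rpow_ne hρs p
    have hT0 : ENNReal.ofReal (ρ s) ≠ 0 := (ENNReal.ofReal_pos.2 hρs).ne'
    have hw : ∑ n, ENNReal.ofReal (S.wt n) = 1 := by
      rw [← ENNReal.ofReal_sum_of_nonneg fun n _ => (S.wt_pos n).le, S.wt_sum, ENNReal.ofReal_one]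
    rw [← Finset.sum_mul, hw, one_mul]
    have hwm := R.measurable_wgt_right θ v (lastIdx N) s
    have hle := lintegral_enorm_wgt_le h h₁ hρ hp θ hv hsT
    have hj : ∀ j, ∫⁻ u, ‖R.wgt θ v (lastIdx N) s (R.sample θ (lastIdx N) s u) / ρ s‖ₑ ^ p * W j s ≤
        alphaHat R ρ T p / ENNReal.ofReal (ρ s) * W j s := by
      intro j
      rw [R.lintegral_sample θ (lastIdx N) s
        (f := fun z => ‖R.wgt θ v (lastIdx N) s z / ρ s‖ₑ ^ p * W j s)
        (((hwm.div_const _).enorm.pow_const p).mul_const _),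
        lintegral_mul_const _ ((hwm.div_const _).enorm.pow_const p)]
      gcongr
      have e : ∀ z, ‖R.wgt θ v (lastIdx N) s z / ρ s‖ₑ ^ p =
          ‖R.wgt θ v (lastIdx N) s z‖ₑ ^ p / ENNReal.ofReal (ρ s) ^ p := by
        intro z
        rw [← ENNReal.div_rpow_of_nonneg _ _ hp0]
        congr 1
        rw [div_eq_mul_inv, enorm_mul, enorm_inv hρs.ne', Real.enorm_of_nonneg hρs.le, div_eq_mul_inv]
      simp only [e]
      simp only [ENNReal.div_eq_inv_mul]
      rw [lintegral_const_mul _ (hwm.enorm.pow_const p), ← ENNReal.div_eq_inv_mul,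
        ← ENNReal.div_eq_inv_mul, ENNReal.div_le_iff hτ0 hτ1]
      refine hle.trans_eq ?_
      have e2 : ENNReal.ofReal (ρ s) ^ p =
          ENNReal.ofReal (ρ s) * ENNReal.ofReal (ρ s) ^ (p - 1) := by
        nth_rewrite 2 [← ENNReal.rpow_one (ENNReal.ofReal (ρ s))]
        rw [← ENNReal.rpow_add _ _ hT0 ENNReal.ofReal_ne_top]
        congr 1; ring
      rw [e2, ← mul_assoc, ENNReal.div_mul_cancel hT0 ENNReal.ofReal_ne_top]
    calc _ ≤ ENNReal.ofReal (ρ s) * ∑' j, ENNReal.ofReal (S.q j) *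
          (alphaHat R ρ T p / ENNReal.ofReal (ρ s) * W j s) := by
          gcongr with j
          exact hj j
      _ = ENNReal.ofReal (ρ s) * (alphaHat R ρ T p / ENNReal.ofReal (ρ s)) *
          ∑' j, ENNReal.ofReal (S.q j) * W j s := by
          have : ∑' j, ENNReal.ofReal (S.q j) * (alphaHat R ρ T p / ENNReal.ofReal (ρ s) * W j s) =
              alphaHat R ρ T p / ENNReal.ofReal (ρ s) * ∑' j, ENNReal.ofReal (S.q j) * W j s := by
            rw [← ENNReal.tsum_mul_left]
            congr 1
            funext j
            ring
          rw [this, mul_assoc]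
      _ = _ := by
          congr 1
          rw [mul_comm]
          exact ENNReal.div_mul_cancel hT0 ENNReal.ofReal_ne_top

theorem integral_wgt_mul_leaf (h : GreenMeasures S R T) (h₁ : GreenGradientMeasures S R T) (θ : Bool)
    (v : Space d) (n : Fin N) {t : ℝ} (ht : t ∈ Ioc 0 T ∨ θ = false) (x : Space d) :
    ∫ z, R.wgt θ v n t z * S.leaf θ n x z ∂(R.law θ n t) = R.conv θ v n t (S.f n) x := by
  cases θ
  · simp only [Problem.leaf, cond_false, sub_zero]
    rfl
  · have ht' : t ∈ Ioc 0 T := by simpa using ht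
    simp only [Problem.leaf, cond_true, mul_sub]
    have hi := integrable_wgt h h₁ true v n ht'
    obtain ⟨C, hC⟩ := S.f_bdd n
    rw [integral_sub _ (hi.mul_const _), integral_mul_const]
    · have : ∫ z, R.wgt true v n t z ∂(R.law true n t) = 0 := integral_inner_γ₁ h h₁ v n ht'
      rw [this, zero_mul, sub_zero]
      rfl
    · exact hi.mul_bdd (c := C) ((S.f_cont n).comp (by fun_prop)).aestronglyMeasurable
        (.of_forall fun z => hC _)

/-- A mild solution is the expectation of its first branching step. -/
theorem integral_stepVal (h : GreenMeasures S R T) (h₁ : GreenGradientMeasures S R T)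
    (hρ : IsPositiveDensity ρ) (θ : Bool) {v : Space d} {t : ℝ}
    (ht0 : 0 ≤ t) (ht : t ∈ Ioc 0 T ∨ θ = false) (x : Space d) {G : ℕ → ℝ → Space d → ℝ}
    {F : ℝ → Space d → ℝ}
    (hF : Measurable fun q : ℝ × Space d => F q.1 q.2)
    (hGF : ∀ s ∈ Ioo 0 t, ∀ y, ∫ j, G j s y ∂S.branchLaw = F s y)
    (hi : Integrable (fun e : Mark N × I => stepVal S R ρ θ v t x e
      (G e.1.2.2 (t - e.1.1) (x - R.sample θ (lastIdx N) e.1.1 e.2))) (S.seedLaw ρ)) :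
    ∫ e : Mark N × I, stepVal S R ρ θ v t x e
      (G e.1.2.2 (t - e.1.1) (x - R.sample θ (lastIdx N) e.1.1 e.2)) ∂(S.seedLaw ρ) =
      mild S R θ v F t x := by
  have := hρ.isProbabilityMeasure_timeLaw
  have := hρ.isProbabilityMeasure_markLaw S
  have hρm := hρ.meas
  set f : Mark N × I → ℝ := fun e => stepVal S R ρ θ v t x e
      (G e.1.2.2 (t - e.1.1) (x - R.sample θ (lastIdx N) e.1.1 e.2)) with hf
  set k : ℝ → ℝ := fun s => ∫ nj, (∫ u, f ((s, nj), u)) ∂(S.indexLaw.prod S.branchLaw) with hk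
  have hτ := hρ.tail_pos ht0
  have hi1 : Integrable (fun m => ∫ u, f (m, u)) ((timeLaw ρ).prod (S.indexLaw.prod S.branchLaw)) :=
    Integrable.integral_prod_left hi
  have hik : IntegrableOn (fun s => ρ s * k s) (Ioi 0) := by
    have h1 : Integrable k (timeLaw ρ) := hi1.integral_prod_left
    rw [timeLaw, integrable_withDensity_iff_integrable_smul' (by fun_prop)
      (.of_forall fun s => ENNReal.ofReal_lt_top)] at h1
    refine IntegrableOn.congr_fun h1 (fun s hs => ?_) measurableSet_Ioi
    simp only [smul_eq_mul]
    rw [ENNReal.toReal_ofReal (hρ.pos s hs).le]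
  -- for almost every branching time, the sections are integrable
  have hsec : ∀ᵐ s ∂(volume.restrict (Ioi (0 : ℝ))),
      Integrable (fun q : (Fin N × ℕ) × I => f ((s, q.1), q.2))
        ((S.indexLaw.prod S.branchLaw).prod volume) := by
    have e1 : MeasurePreserving (MeasurableEquiv.prodAssoc : (ℝ × (Fin N × ℕ)) × I ≃ᵐ ℝ × ((Fin N × ℕ) × I))
        (((timeLaw ρ).prod (S.indexLaw.prod S.branchLaw)).prod volume)
        ((timeLaw ρ).prod ((S.indexLaw.prod S.branchLaw).prod volume)) :=
      measurePreserving_prodAssoc _ _ _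
    have e2 : Integrable (fun q : ℝ × ((Fin N × ℕ) × I) => f ((q.1, q.2.1), q.2.2))
        ((timeLaw ρ).prod ((S.indexLaw.prod S.branchLaw).prod volume)) := by
      rw [← e1.integrable_comp_emb (MeasurableEquiv.measurableEmbedding _)]
      exact hi
    have e3 := e2.prod_right_ae
    rw [timeLaw, ae_withDensity_iff (by fun_prop)] at e3
    filter_upwards [e3, ae_restrict_mem measurableSet_Ioi] with s hs hs0
    exact hs (ENNReal.ofReal_pos.2 (hρ.pos s hs0)).ne'
  have h1 : ∀ᵐ s ∂(volume.restrict (Ioi (0 : ℝ))), s < t →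
      ρ s * k s = R.conv θ v (lastIdx N) s (F (t - s)) x := by
    filter_upwards [hsec, ae_restrict_mem measurableSet_Ioi] with s hs hs0 hst
    have hρs : ρ s ≠ 0 := (hρ.pos s hs0).ne'
    simp only [hk]
    rw [integral_integral_swap hs]
    have e4 : ∀ u, ∫ nj, f ((s, nj), u) ∂(S.indexLaw.prod S.branchLaw) =
        R.wgt θ v (lastIdx N) s (R.sample θ (lastIdx N) s u) / ρ s *
          F (t - s) (x - R.sample θ (lastIdx N) s u) := by
      intro u
      simp only [hf, stepVal, if_pos hst]
      rw [integral_const_mul, integral_fun_snd (fun j => G j (t - s) (x - R.sample θ (lastIdx N) s u)),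
        hGF (t - s) ⟨by linarith, by linarith [show (0 : ℝ) < s from hs0]⟩]
      simp
    simp only [e4]
    have hwm := R.measurable_wgt_right θ v (lastIdx N) s
    have hFs : Measurable (F (t - s)) := hF.comp measurable_prodMk_left
    rw [R.integral_sample θ (lastIdx N) s
      (f := fun z => R.wgt θ v (lastIdx N) s z / ρ s * F (t - s) (x - z))
      ((hwm.div_const _).mul (hFs.comp (by fun_prop))), ← integral_const_mul]
    refine integral_congr_ae (.of_forall fun z => ?_)
    simp only
    field_simp
  have h2 : ∀ s, t ≤ s → k s = (∑ n, S.wt n * R.conv θ v n t (S.f n) x) / tail ρ t := by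
    intro s hs
    have e5 : ∀ nj : Fin N × ℕ, ∫ u, f ((s, nj), u) = R.conv θ v nj.1 t (S.f nj.1) x / tail ρ t := by
      intro nj
      simp only [hf, stepVal, if_neg (not_lt.2 hs)]
      have hwm := R.measurable_wgt_right θ v nj.1 t
      have hlm := S.measurable_leaf θ nj.1 (x := fun _ : Space d => x) measurable_const measurable_id
      rw [R.integral_sample θ nj.1 t (f := fun z => R.wgt θ v nj.1 t z / tail ρ t * S.leaf θ nj.1 x z)
        ((hwm.div_const _).mul hlm), ← integral_wgt_mul_leaf h h₁ θ v nj.1 ht x, ← integral_div]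
      refine integral_congr_ae (.of_forall fun z => ?_)
      simp only
      ring
    simp only [hk, e5]
    rw [integral_fun_fst (fun n => R.conv θ v n t (S.f n) x / tail ρ t), integral_indexLaw]
    simp only [probReal_univ, one_smul, Finset.sum_div, mul_div_assoc]
  rw [integral_seedLaw S hρ hi]
  change ∫ s in Ioi 0, ρ s * k s = _
  have hA : ∫ s in Ici t, ρ s * k s = ∑ n, S.wt n * R.conv θ v n t (S.f n) x := by
    rw [setIntegral_congr_fun measurableSet_Ici (g := fun s => ρ s *
      ((∑ n, S.wt n * R.conv θ v n t (S.f n) x) / tail ρ t)) fun s hs => by rw [h2 s hs],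
      integral_mul_const, integral_Ici_eq_integral_Ioi]
    change tail ρ t * _ = _
    field_simp
  unfold mild
  rw [intervalIntegral.integral_of_le ht0, ← hA, integral_Ioc_eq_integral_Ioo, add_comm]
  rcases ht0.eq_or_lt with h0 | h0
  · subst h0
    simp [integral_Ici_eq_integral_Ioi]
  · have hdisj : Disjoint (Ioo 0 t) (Ici t) := by
      rw [Set.disjoint_left]; intro s h1 h2; exact absurd h1.2 (not_lt.2 h2)
    rw [Ioi_zero_eq_union h0] at hik ⊢
    rw [setIntegral_union hdisj measurableSet_Ici (hik.mono_set subset_union_left)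
      (hik.mono_set subset_union_right)]
    congr 1
    refine setIntegral_congr_ae measurableSet_Ioo ?_
    rw [ae_restrict_iff' measurableSet_Ioi] at h1
    filter_upwards [h1] with s hs hs'
    exact hs hs'.1 hs'.2

end Step

/-! ### A supersolution of the moment equation -/

/-- If `∫_r^s dy / h(y) = α T`, the solution of `φ' = α h(φ)`, `φ(0) = r`, stays in `[r, s]` up to
time `T`. It is obtained by inverting `y ↦ α⁻¹ ∫_r^y dx / h(x)`, and its integral equation is a
change of variables, so that `h` may vanish at `r`. -/
theorem exists_monotone_lintegral_le {r s α T : ℝ} (hrs : r < s) (hα : 0 < α) (hT : 0 ≤ T)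
    {h : ℝ → ℝ} (hc : ContinuousOn h (Icc r s)) (hpos : ∀ y ∈ Ioc r s, 0 < h y)
    (hint : ∫⁻ y in Ioc r s, ENNReal.ofReal (h y)⁻¹ = ENNReal.ofReal (α * T)) :
    ∃ φ : ℝ → ℝ, Monotone φ ∧ (∀ t, φ t ∈ Icc r s) ∧
      ∀ t ∈ Icc 0 T, ∫⁻ u in Ioo 0 t, ENNReal.ofReal (α * h (φ u)) ≤ ENNReal.ofReal (φ t - r) := by
  set g : ℝ → ℝ := fun y => (h y)⁻¹ with hg
  have hgc : ContinuousOn g (Ioc r s) :=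
    (hc.mono Ioc_subset_Icc_self).inv₀ fun y hy => (hpos y hy).ne'
  have hgpos : ∀ y ∈ Ioc r s, 0 < g y := fun y hy => inv_pos.2 (hpos y hy)
  have hgi : IntegrableOn g (Ioc r s) := by
    refine ⟨hgc.aestronglyMeasurable measurableSet_Ioc, ?_⟩
    rw [hasFiniteIntegral_iff_ofReal ((ae_restrict_iff' measurableSet_Ioc).2
      (.of_forall fun y hy => (hgpos y hy).le)), hint]
    exact ENNReal.ofReal_lt_top
  have hgi' : ∀ a ∈ Icc r s, ∀ b ∈ Icc r s, IntervalIntegrable g volume a b := by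
    have h0 : IntervalIntegrable g volume r s := (intervalIntegrable_iff_integrableOn_Ioc_of_le hrs.le).2 hgi
    intro a ha b hb
    refine h0.mono_set ?_
    rw [uIcc_of_le hrs.le]
    exact uIcc_subset_Icc ha hb
  have hrI : r ∈ Icc r s := ⟨le_rfl, hrs.le⟩
  have hsI : s ∈ Icc r s := ⟨hrs.le, le_rfl⟩
  set Θ : ℝ → ℝ := fun y => ∫ x in r..y, g x with hΘ
  have hΘc : ContinuousOn Θ (Icc r s) := by
    have := intervalIntegral.continuousOn_primitive_interval (μ := volume) (f := g) (a := r) (b := s)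
      (by rw [uIcc_of_le hrs.le]; exact (integrableOn_Icc_iff_integrableOn_Ioc).2 hgi)
    rwa [uIcc_of_le hrs.le] at this
  have hΘr : Θ r = 0 := intervalIntegral.integral_same
  have hΘs : Θ s = α * T := by
    simp only [hΘ]
    rw [intervalIntegral.integral_of_le hrs.le, integral_eq_lintegral_of_nonneg_ae
      ((ae_restrict_iff' measurableSet_Ioc).2 (.of_forall fun y hy => (hgpos y hy).le))
      hgi.aestronglyMeasurable, hint, ENNReal.toReal_ofReal (by positivity)]
  have hΘm : StrictMonoOn Θ (Icc r s) := by
    intro a ha b hb hab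
    have h1 : Θ b - Θ a = ∫ x in a..b, g x :=
      intervalIntegral.integral_interval_sub_left (hgi' r hrI b hb) (hgi' r hrI a ha)
    have h2 : 0 < ∫ x in a..b, g x :=
      intervalIntegral.intervalIntegral_pos_of_pos_on (hgi' a ha b hb)
        (fun x hx => hgpos x ⟨ha.1.trans_lt hx.1, hx.2.le.trans hb.2⟩) hab
    linarith
  have hex : ∀ t : ℝ, ∃ y ∈ Icc r s, Θ y = α * max 0 (min t T) := by
    intro t
    have h1 : α * max 0 (min t T) ∈ Icc (Θ r) (Θ s) := by
      rw [hΘr, hΘs]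
      exact ⟨by positivity, by gcongr; exact max_le hT (min_le_right _ _)⟩
    obtain ⟨y, hy, hy'⟩ := intermediate_value_Icc hrs.le hΘc h1
    exact ⟨y, hy, hy'⟩
  choose φ hφI hφ using hex
  refine ⟨φ, ?_, hφI, ?_⟩
  · intro a b hab
    rw [← hΘm.le_iff_le (hφI a) (hφI b), hφ, hφ]
    gcongr
  intro t ht
  have hφt : ∀ u ∈ Icc 0 T, Θ (φ u) = α * u := by
    intro u hu
    rw [hφ, min_eq_left hu.2, max_eq_right hu.1]
  -- `Θ / α` maps `(r, φ t)` onto `(0, t)`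
  have himg : Ioo 0 t ⊆ (fun y => Θ y / α) '' Ioo r (φ t) := by
    intro u hu
    have huT : u ∈ Icc 0 T := ⟨hu.1.le, hu.2.le.trans ht.2⟩
    refine ⟨φ u, ⟨?_, ?_⟩, by simp only [hφt u huT]; field_simp⟩
    · rw [← hΘm.lt_iff_lt hrI (hφI u), hΘr, hφt u huT]
      exact mul_pos hα hu.1
    · rw [← hΘm.lt_iff_lt (hφI u) (hφI t), hφt u huT, hφt t ht]
      exact mul_lt_mul_of_pos_left hu.2 hα
  have hder : ∀ y ∈ Ioo r (φ t), HasDerivWithinAt (fun y => Θ y / α) (g y / α) (Ioo r (φ t)) y := by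
    intro y hy
    have hys : y ∈ Ioo r s := by
      refine ⟨hy.1, hy.2.trans_le (hφI t).2⟩
    have hnhds : Ioc r s ∈ nhds y := Ioc_mem_nhds hys.1 hys.2
    have h1 : HasDerivAt Θ (g y) y :=
      intervalIntegral.integral_hasDerivAt_right (hgi' r hrI y ⟨hys.1.le, hys.2.le⟩)
        (ContinuousOn.stronglyMeasurableAtFilter_nhdsWithin hgc measurableSet_Ioc y |>.filter_mono
          (by rw [nhdsWithin_eq_nhds.2 hnhds])) (hgc.continuousAt hnhds)
    exact (h1.div_const α).hasDerivWithinAt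
  have hinj : InjOn (fun y => Θ y / α) (Ioo r (φ t)) := by
    intro a ha b hb hab
    have hsub : Ioo r (φ t) ⊆ Icc r s := fun y hy => ⟨hy.1.le, hy.2.le.trans (hφI t).2⟩
    refine hΘm.injOn (hsub ha) (hsub hb) ?_
    simpa [div_left_inj' hα.ne'] using hab
  calc ∫⁻ u in Ioo 0 t, ENNReal.ofReal (α * h (φ u))
      ≤ ∫⁻ u in (fun y => Θ y / α) '' Ioo r (φ t), ENNReal.ofReal (α * h (φ u)) :=
        lintegral_mono_set himg
    _ = ∫⁻ y in Ioo r (φ t), ENNReal.ofReal |g y / α| * ENNReal.ofReal (α * h (φ (Θ y / α))) :=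
        lintegral_image_eq_lintegral_abs_deriv_mul measurableSet_Ioo hder hinj _
    _ = ∫⁻ y in Ioo r (φ t), 1 := by
        refine setLIntegral_congr_fun measurableSet_Ioo fun y hy => ?_
        have hys : y ∈ Ioc r s := ⟨hy.1, hy.2.le.trans (hφI t).2⟩
        have hyI : y ∈ Icc r s := Ioc_subset_Icc_self hys
        have h1 : Θ y / α ∈ Icc 0 T := by
          constructor
          · apply div_nonneg _ hα.le
            rw [← hΘr]
            exact hΘm.monotoneOn hrI hyI hys.1.le
          · rw [div_le_iff₀ hα, mul_comm, ← hΘs]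
            exact hΘm.monotoneOn hyI hsI hys.2
        have h2 : φ (Θ y / α) = y := by
          refine hΘm.injOn (hφI _) hyI ?_
          rw [hφt _ h1]
          field_simp
        have hh := hpos y hys
        rw [h2, ← ENNReal.ofReal_mul (abs_nonneg _), abs_of_pos (div_pos (hgpos y hys) hα)]
        simp only [hg]
        rw [← ENNReal.ofReal_one]
        congr 1
        field_simp
    _ = ENNReal.ofReal (φ t - r) := by simp

/-! ### The nonlinearity -/

/-- The children of a particle whose branching mark is `j`. -/
def Problem.children (S : Problem d N H) (j : ℕ) : Finset (Fin (H + 1) × ℕ) :=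
  (Finset.univ.sigma fun h => Finset.range (S.l j h)).map (Equiv.sigmaEquivProd _ _).toEmbedding

theorem Problem.mem_children (S : Problem d N H) {j : ℕ} {e : Fin (H + 1) × ℕ} :
    e ∈ S.children j ↔ e.2 < S.l j e.1 := by
  simp only [Problem.children, Finset.mem_map, Finset.mem_sigma, Finset.mem_univ, true_and,
    Finset.mem_range, Equiv.coe_toEmbedding]
  constructor
  · rintro ⟨a, ha, rfl⟩
    exact ha
  · intro he
    exact ⟨⟨e.1, e.2⟩, he, rfl⟩

theorem Problem.prod_children (S : Problem d N H) (j : ℕ) {A : Type*} [CommMonoid A]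
    (f : Fin (H + 1) → A) : ∏ e ∈ S.children j, f e.1 = ∏ h, f h ^ S.l j h := by
  rw [Problem.children, Finset.prod_map, Finset.prod_sigma]
  simp [Equiv.sigmaEquivProd]

theorem Problem.card_children (S : Problem d N H) (j : ℕ) :
    (S.children j).card = ∑ h, S.l j h := by
  simp [Problem.children, Finset.card_sigma]

/-- The type of a particle of the `h`-th block of descendants, up to the choice of its direction:
`false` for the particles that stand for the solution, `true` for those that stand for one of its
directional derivatives. -/
def kind (h : Fin (H + 1)) : Bool := decide (h ≠ 0)

/-- The coefficient `c_{j,0}`, frozen at negative times. -/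
def Problem.coef (S : Problem d N H) (j : ℕ) (t : ℝ) (x : Space d) : ℝ := S.c₀ j (max t 0) x

/-- The directions `c_{j,h}`, frozen at negative times, and extended by `0` to `h = 0`. -/
def Problem.dir (S : Problem d N H) (j : ℕ) (h : Fin (H + 1)) (t : ℝ) (x : Space d) : Space d :=
  Fin.cases (motive := fun _ => Space d) 0 (fun h' => S.c j h' (max t 0) x) h

theorem Problem.norm_dir_le (S : Problem d N H) (j : ℕ) (h : Fin (H + 1)) (t : ℝ) (x : Space d) :
    ‖S.dir j h t x‖ ≤ 1 := by
  cases h using Fin.cases with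
  | zero => simp [Problem.dir]
  | succ h' => exact S.c_unit j h' _ (le_max_right _ _) x

theorem Problem.continuous_coef (S : Problem d N H) (j : ℕ) :
    Continuous fun q : ℝ × Space d => S.coef j q.1 q.2 :=
  (S.c₀_cont j).comp_continuous (f := fun q : ℝ × Space d => (max q.1 0, q.2)) (by fun_prop)
    fun q => ⟨mem_Ici.2 (le_max_right _ _), mem_univ _⟩

theorem Problem.continuous_dir (S : Problem d N H) (j : ℕ) (h : Fin (H + 1)) :
    Continuous fun q : ℝ × Space d => S.dir j h q.1 q.2 := by
  cases h using Fin.cases with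
  | zero => exact continuous_const
  | succ h' =>
    exact (S.c_cont j h').comp_continuous (f := fun q : ℝ × Space d => (max q.1 0, q.2))
      (by fun_prop) fun q => ⟨mem_Ici.2 (le_max_right _ _), mem_univ _⟩

/-- The sup norm of `c_{j,0}`. -/
def Problem.coefNorm (S : Problem d N H) (j : ℕ) : ℝ≥0∞ := ⨆ t ∈ Ici (0 : ℝ), supNorm (S.c₀ j t)

theorem Problem.enorm_coef_le (S : Problem d N H) (j : ℕ) (t : ℝ) (x : Space d) :
    ‖S.coef j t x‖ₑ ≤ S.coefNorm j :=
  (le_iSup (fun x => ‖S.c₀ j (max t 0) x‖ₑ) x).trans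
    (le_iSup₂ (f := fun t (_ : t ∈ Ici (0 : ℝ)) => supNorm (S.c₀ j t)) (max t 0) (mem_Ici.2 (le_max_right _ _)))

theorem Problem.coefNorm_lt_top (S : Problem d N H) (j : ℕ) : S.coefNorm j < ∞ := by
  obtain ⟨C, hC⟩ := S.c₀_bdd j
  refine lt_of_le_of_lt (b := ENNReal.ofReal C) ?_ ENNReal.ofReal_lt_top
  refine iSup₂_le fun t ht => iSup_le fun x => ?_
  rw [Real.enorm_eq_ofReal_abs]
  exact ENNReal.ofReal_le_ofReal (hC t ht x)

theorem Problem.abs_coef_le (S : Problem d N H) (j : ℕ) (t : ℝ) (x : Space d) :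
    |S.coef j t x| ≤ (S.coefNorm j).toReal := by
  have := ENNReal.toReal_mono (S.coefNorm_lt_top j).ne (S.enorm_coef_le j t x)
  rwa [toReal_enorm, Real.norm_eq_abs] at this

theorem Problem.powerSeries_eq (S : Problem d N H) (p : ℝ) (s : ℝ≥0∞) :
    S.powerSeries p s =
      ∑' j, ENNReal.ofReal (S.q j) * (S.coefNorm j ^ p * s ^ (S.children j).card) := by
  simp only [Problem.powerSeries, Problem.card_children, ← mul_assoc]
  rfl

theorem Problem.powerSeries_mono (S : Problem d N H) (p : ℝ) : Monotone (S.powerSeries p) := by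
  intro a b hab
  unfold Problem.powerSeries
  gcongr

theorem Problem.powerSeries_lt_top (S : Problem d N H) {p : ℝ} {s : ℝ≥0∞} (hs : s < S.radius p) :
    S.powerSeries p s < ∞ := by
  unfold Problem.radius at hs
  rw [lt_iSup_iff] at hs
  obtain ⟨a, ha⟩ := hs
  rw [lt_iSup_iff] at ha
  obtain ⟨h1, h2⟩ := ha
  exact (S.powerSeries_mono p h2.le).trans_lt h1

theorem Problem.summable_powerSeries (S : Problem d N H) {p s : ℝ} (hs : 0 ≤ s)
    (h : ENNReal.ofReal s < S.radius p) :
    Summable (fun j => S.q j * ((S.coefNorm j).toReal ^ p * s ^ (S.children j).card)) ∧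
      ∑' j, S.q j * ((S.coefNorm j).toReal ^ p * s ^ (S.children j).card) =
        (S.powerSeries p (ENNReal.ofReal s)).toReal := by
  have h1 := S.powerSeries_lt_top h
  rw [S.powerSeries_eq] at h1
  have h2 : ∀ j, S.q j * ((S.coefNorm j).toReal ^ p * s ^ (S.children j).card) =
      (ENNReal.ofReal (S.q j) * (S.coefNorm j ^ p * ENNReal.ofReal s ^ (S.children j).card)).toReal := by
    intro j
    rw [ENNReal.toReal_mul, ENNReal.toReal_mul, ENNReal.toReal_ofReal (S.q_nonneg j),
      ENNReal.toReal_pow, ENNReal.toReal_ofReal hs, ← ENNReal.toReal_rpow]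
  simp only [h2]
  refine ⟨ENNReal.summable_toReal h1.ne, ?_⟩
  rw [S.powerSeries_eq, ENNReal.tsum_toReal_eq fun j => ENNReal.ne_top_of_tsum_ne_top h1.ne j]

theorem Problem.continuousOn_powerSeries (S : Problem d N H) {p s : ℝ} (hs : 0 ≤ s)
    (h : ENNReal.ofReal s < S.radius p) :
    ContinuousOn (fun y => (S.powerSeries p (ENNReal.ofReal y)).toReal) (Icc 0 s) := by
  have h1 : ContinuousOn
      (fun y : ℝ => ∑' j, S.q j * ((S.coefNorm j).toReal ^ p * y ^ (S.children j).card)) (Icc 0 s) := by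
    refine continuousOn_tsum (u := fun j => S.q j * ((S.coefNorm j).toReal ^ p * s ^ (S.children j).card))
      (fun j => by fun_prop) (S.summable_powerSeries hs h).1 fun j y hy => ?_
    have hq := S.q_nonneg j
    have hc : 0 ≤ (S.coefNorm j).toReal ^ p := by positivity
    rw [Real.norm_of_nonneg (mul_nonneg hq (mul_nonneg hc (pow_nonneg hy.1 _)))]
    have := hy.1
    gcongr
    exact hy.2
  refine h1.congr fun y hy => ?_
  exact (S.summable_powerSeries hy.1 ((ENNReal.ofReal_le_ofReal hy.2).trans_lt h)).2.symm

/-- The moment equation `φ(t) = r̂_p + α̂_p ∫_0^t H_p(φ(s)) ds` has a supersolution on `[0,T]` with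
values in `[r̂_p, ŝ_p]`. -/
theorem Problem.exists_supersolution (S : Problem d N H) {p s T : ℝ} {r α : ℝ≥0∞} (hT : 0 ≤ T)
    (hα : α < ∞) (hrs : r < ENNReal.ofReal s) (hsR : ENNReal.ofReal s < S.radius p)
    (hint : ∫⁻ y in Ioc r.toReal s, (S.powerSeries p (ENNReal.ofReal y))⁻¹ =
      α * ENNReal.ofReal T) :
    ∃ φ : ℝ → ℝ, Monotone φ ∧ (∀ t, φ t ∈ Icc 0 s) ∧ ∀ t ∈ Icc 0 T,
      r + α * ∫⁻ u in Ioo 0 t, S.powerSeries p (ENNReal.ofReal (φ u)) ≤ ENNReal.ofReal (φ t) := by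
  have hr : r ≠ ∞ := hrs.ne_top
  have hr0 : 0 ≤ r.toReal := ENNReal.toReal_nonneg
  have hrs' : r.toReal < s := by
    rw [← ENNReal.ofReal_toReal hr] at hrs
    exact ENNReal.ofReal_lt_ofReal_iff_of_nonneg hr0 |>.1 hrs
  have hfin : ∀ y, y ≤ s → S.powerSeries p (ENNReal.ofReal y) < ∞ := fun y hy =>
    S.powerSeries_lt_top ((ENNReal.ofReal_le_ofReal hy).trans_lt hsR)
  set h : ℝ → ℝ := fun y => (S.powerSeries p (ENNReal.ofReal y)).toReal with hh
  have hvol : volume (Ioc r.toReal s) ≠ 0 := by simp [hrs']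
  -- a zero of `H_p` at a positive point is only possible if `H_p` vanishes identically
  have hpos' : ∀ y ∈ Ioc r.toReal s, S.powerSeries p (ENNReal.ofReal y) ≠ 0 := by
    intro y hy h0
    have hy0 : 0 < y := hr0.trans_lt hy.1
    rw [S.powerSeries_eq, ENNReal.tsum_eq_zero] at h0
    have h2 : ∀ z, S.powerSeries p z = 0 := by
      intro z
      rw [S.powerSeries_eq, ENNReal.tsum_eq_zero]
      intro j
      have h3 := h0 j
      have h4 : ENNReal.ofReal y ^ (S.children j).card ≠ 0 :=
        pow_ne_zero _ (ENNReal.ofReal_pos.2 hy0).ne'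
      rcases mul_eq_zero.1 h3 with h5 | h5
      · rw [h5, zero_mul]
      · rcases mul_eq_zero.1 h5 with h6 | h6
        · rw [h6, zero_mul, mul_zero]
        · exact absurd h6 h4
    simp only [h2, ENNReal.inv_zero] at hint
    rw [setLIntegral_const, ENNReal.top_mul hvol] at hint
    exact (ENNReal.mul_lt_top hα ENNReal.ofReal_lt_top).ne hint.symm
  have hα0 : α ≠ 0 := by
    intro h0
    rw [h0, zero_mul] at hint
    have hm : Measurable fun y => (S.powerSeries p (ENNReal.ofReal y))⁻¹ :=
      ((S.powerSeries_mono p).measurable.comp ENNReal.measurable_ofReal).inv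
    rw [lintegral_eq_zero_iff hm] at hint
    have : ∀ᵐ y ∂(volume.restrict (Ioc r.toReal s)), False := by
      filter_upwards [hint, ae_restrict_mem measurableSet_Ioc] with y h1 hy
      simp only [Pi.zero_apply, ENNReal.inv_eq_zero] at h1
      exact (hfin y hy.2).ne h1
    rw [Filter.eventually_false_iff_eq_bot, ae_eq_bot, Measure.restrict_eq_zero] at this
    exact hvol this
  have hαr : 0 < α.toReal := ENNReal.toReal_pos hα0 hα.ne
  obtain ⟨φ, hφ, hφI, hφi⟩ := exists_monotone_lintegral_le (h := h) hrs' hαr hT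
    ((S.continuousOn_powerSeries (hr0.trans hrs'.le) hsR).mono (Icc_subset_Icc_left hr0))
    (fun y hy => ENNReal.toReal_pos (hpos' y hy) (hfin y hy.2).ne) (by
      rw [ENNReal.ofReal_mul hαr.le, ENNReal.ofReal_toReal hα.ne, ← hint]
      refine setLIntegral_congr_fun measurableSet_Ioc fun y hy => ?_
      simp only [hh]
      rw [ENNReal.ofReal_inv_of_pos (ENNReal.toReal_pos (hpos' y hy) (hfin y hy.2).ne),
        ENNReal.ofReal_toReal (hfin y hy.2).ne])
  refine ⟨φ, hφ, fun t => ⟨hr0.trans (hφI t).1, (hφI t).2⟩, fun t ht => ?_⟩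
  have h1 := hφi t ht
  have h2 : ∀ u, ENNReal.ofReal (α.toReal * h (φ u)) = α * S.powerSeries p (ENNReal.ofReal (φ u)) := by
    intro u
    rw [ENNReal.ofReal_mul hαr.le, ENNReal.ofReal_toReal hα.ne]
    simp only [hh]
    rw [ENNReal.ofReal_toReal (hfin _ (hφI u).2).ne]
  simp only [h2] at h1
  rw [lintegral_const_mul' _ _ hα.ne] at h1
  calc _ ≤ r + ENNReal.ofReal (φ t - r.toReal) := by gcongr
    _ = ENNReal.ofReal (φ t) := by
      nth_rewrite 1 [← ENNReal.ofReal_toReal hr]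
      rw [← ENNReal.ofReal_add hr0 (sub_nonneg.2 (hφI t).1)]
      congr 1
      ring

/-- A family `V θ v t x`, where `V false v` stands for a function and `V true v` for its derivative
in the direction `v`. -/
abbrev Field (d : ℕ) := Bool → Space d → ℝ → Space d → ℝ

/-- The `j`-th term of the nonlinearity of a field, without its weight `q_j`. -/
def Problem.reactTerm (S : Problem d N H) (V : Field d) (j : ℕ) (t : ℝ) (x : Space d) : ℝ :=
  S.coef j t x * ∏ e ∈ S.children j, V (kind e.1) (S.dir j e.1 t x) t x

/-- The nonlinearity of a field. -/
def Problem.reaction (S : Problem d N H) (V : Field d) (t : ℝ) (x : Space d) : ℝ :=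
  ∑' j, S.q j * S.reactTerm V j t x

theorem abs_prod_sub_prod_le {ι : Type*} (s : Finset ι) {a b : ι → ℝ} {M δ : ℝ} (hM : 0 ≤ M)
    (ha : ∀ i ∈ s, |a i| ≤ M) (hb : ∀ i ∈ s, |b i| ≤ M) (hab : ∀ i ∈ s, |a i - b i| ≤ δ) :
    |∏ i ∈ s, a i - ∏ i ∈ s, b i| ≤ s.card * M ^ (s.card - 1) * δ := by
  classical
  induction s using Finset.induction_on with
  | empty => simp
  | insert i s hi ih =>
    rw [Finset.prod_insert hi, Finset.prod_insert hi, Finset.card_insert_of_notMem hi]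
    have h1 := ih (fun k hk => ha k (Finset.mem_insert_of_mem hk))
      (fun k hk => hb k (Finset.mem_insert_of_mem hk)) (fun k hk => hab k (Finset.mem_insert_of_mem hk))
    have h2 : |∏ i ∈ s, a i| ≤ M ^ s.card := by
      rw [Finset.abs_prod, ← Finset.prod_const]
      exact Finset.prod_le_prod (fun k _ => abs_nonneg _) fun k hk => ha k (Finset.mem_insert_of_mem hk)
    have hδ : 0 ≤ δ := (abs_nonneg _).trans (hab i (Finset.mem_insert_self _ _))
    have e : a i * ∏ i ∈ s, a i - b i * ∏ i ∈ s, b i =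
        (a i - b i) * ∏ i ∈ s, a i + b i * (∏ i ∈ s, a i - ∏ i ∈ s, b i) := by ring
    have h3 : M * ((s.card : ℝ) * M ^ (s.card - 1) * δ) = s.card * M ^ s.card * δ := by
      rcases Nat.eq_zero_or_pos s.card with h0 | h0
      · simp [h0]
      · obtain ⟨m, hm⟩ := Nat.exists_eq_succ_of_ne_zero h0.ne'
        rw [hm]
        simp only [Nat.succ_eq_add_one, Nat.add_sub_cancel, pow_succ]
        ring
    calc _ ≤ |a i - b i| * |∏ i ∈ s, a i| + |b i| * |∏ i ∈ s, a i - ∏ i ∈ s, b i| := by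
          rw [e, ← abs_mul, ← abs_mul]
          exact abs_add_le _ _
      _ ≤ δ * M ^ s.card + M * (s.card * M ^ (s.card - 1) * δ) := by
          gcongr
          · exact hab i (Finset.mem_insert_self _ _)
          · exact hb i (Finset.mem_insert_self _ _)
      _ = _ := by
          rw [h3]
          push_cast
          ring

theorem Problem.summable_bound (S : Problem d N H) {p M : ℝ} (hp : 1 ≤ p) (hM : 0 ≤ M)
    (h : ENNReal.ofReal (M ^ p) < S.radius p) :
    Summable fun j => S.q j * ((S.coefNorm j).toReal * M ^ (S.children j).card) := by
  have hp0 : 0 ≤ p := by linarith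
  have h1 := (S.q_sum.summable).add (S.summable_powerSeries (by positivity) h).1
  refine Summable.of_nonneg_of_le (fun j => ?_) (fun j => ?_) h1
  · exact mul_nonneg (S.q_nonneg j) (by positivity)
  · have hq := S.q_nonneg j
    set x := (S.coefNorm j).toReal * M ^ (S.children j).card with hx
    have hx0 : 0 ≤ x := by positivity
    have e : (S.coefNorm j).toReal ^ p * (M ^ p) ^ (S.children j).card = x ^ p := by
      rw [hx, Real.mul_rpow ENNReal.toReal_nonneg (by positivity), ← Real.rpow_natCast (M ^ p),
        ← Real.rpow_mul hM, mul_comm p, Real.rpow_mul hM, Real.rpow_natCast]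
    rw [e]
    have hxp : x ≤ 1 + x ^ p := by
      rcases le_total x 1 with h2 | h2
      · linarith [Real.rpow_nonneg hx0 p]
      · have := Real.rpow_le_rpow_of_exponent_le h2 hp
        rw [Real.rpow_one] at this
        linarith
    calc S.q j * x ≤ S.q j * (1 + x ^ p) := by gcongr
      _ = _ := by ring

theorem Problem.exists_gt_of_lt_radius (S : Problem d N H) {p M : ℝ} (hp : 0 < p)
    (h : ENNReal.ofReal (M ^ p) < S.radius p) :
    ∃ M', M < M' ∧ ENNReal.ofReal (M' ^ p) < S.radius p := by
  have h1 : ContinuousAt (fun x : ℝ => ENNReal.ofReal (x ^ p)) M :=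
    (ENNReal.continuous_ofReal.comp (Real.continuous_rpow_const hp.le)).continuousAt
  have h2 := (h1.eventually (gt_mem_nhds h)).filter_mono (nhdsWithin_le_nhds (s := Ioi M))
  obtain ⟨M', h3, h4⟩ := (h2.and self_mem_nhdsWithin).exists
  exact ⟨M', h4, h3⟩

theorem Problem.summable_lip (S : Problem d N H) {p M : ℝ} (hp : 1 ≤ p) (hM : 0 < M)
    (h : ENNReal.ofReal (M ^ p) < S.radius p) :
    Summable fun j => S.q j * ((S.coefNorm j).toReal *
      ((S.children j).card * M ^ ((S.children j).card - 1))) := by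
  obtain ⟨M', hMM, hM'⟩ := S.exists_gt_of_lt_radius (by linarith) h
  have hM'0 : 0 < M' := hM.trans hMM
  have h1 := tendsto_self_mul_const_pow_of_lt_one (r := M / M') (by positivity)
    ((div_lt_one hM'0).2 hMM)
  obtain ⟨B, hB⟩ := h1.bddAbove_range
  have hB' : ∀ n : ℕ, n * (M / M') ^ n ≤ B := fun n => hB ⟨n, rfl⟩
  have hB0 : 0 ≤ B := by simpa using hB' 0
  have hle : ∀ n : ℕ, n * M ^ (n - 1) ≤ B / M * M' ^ n := by
    intro n
    rcases Nat.eq_zero_or_pos n with rfl | hn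
    · simp only [Nat.cast_zero, zero_mul]
      positivity
    · have h2 := hB' n
      rw [div_pow, ← mul_div_assoc, div_le_iff₀ (by positivity)] at h2
      rw [div_mul_eq_mul_div, le_div_iff₀ hM, mul_assoc, ← pow_succ, Nat.sub_add_cancel hn]
      exact h2
  refine Summable.of_nonneg_of_le (fun j => mul_nonneg (S.q_nonneg j) (by positivity)) (fun j => ?_)
    ((S.summable_bound hp hM'0.le hM').mul_left (B / M))
  have hq := S.q_nonneg j
  calc _ ≤ S.q j * ((S.coefNorm j).toReal * (B / M * M' ^ (S.children j).card)) := by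
        have := hle (S.children j).card
        gcongr
    _ = _ := by ring

/-- A bound of the nonlinearity of a field that is bounded by `M`. -/
def Problem.reactBound (S : Problem d N H) (M : ℝ) : ℝ :=
  ∑' j, S.q j * ((S.coefNorm j).toReal * M ^ (S.children j).card)

/-- A Lipschitz constant of the nonlinearity on the fields that are bounded by `M`. -/
def Problem.reactLip (S : Problem d N H) (M : ℝ) : ℝ :=
  ∑' j, S.q j * ((S.coefNorm j).toReal * ((S.children j).card * M ^ ((S.children j).card - 1)))

theorem Problem.reactLip_nonneg (S : Problem d N H) {M : ℝ} (hM : 0 ≤ M) : 0 ≤ S.reactLip M :=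
  tsum_nonneg fun j => mul_nonneg (S.q_nonneg j) (by positivity)

theorem Problem.reactBound_nonneg (S : Problem d N H) {M : ℝ} (hM : 0 ≤ M) : 0 ≤ S.reactBound M :=
  tsum_nonneg fun j => mul_nonneg (S.q_nonneg j) (by positivity)

section Reaction

variable {S : Problem d N H} {V V' : Field d} {p M δ t : ℝ} {x : Space d}

theorem abs_reactTerm_le (hV : ∀ θ v, ‖v‖ ≤ 1 → |V θ v t x| ≤ M) (j : ℕ) :
    |S.reactTerm V j t x| ≤ (S.coefNorm j).toReal * M ^ (S.children j).card := by
  rw [Problem.reactTerm, abs_mul, Finset.abs_prod, ← Finset.prod_const]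
  gcongr
  · exact S.abs_coef_le j t x
  · exact hV _ _ (S.norm_dir_le _ _ _ _)

theorem abs_mul_reactTerm_le (hV : ∀ θ v, ‖v‖ ≤ 1 → |V θ v t x| ≤ M) (j : ℕ) :
    |S.q j * S.reactTerm V j t x| ≤ S.q j * ((S.coefNorm j).toReal * M ^ (S.children j).card) := by
  rw [abs_mul, abs_of_nonneg (S.q_nonneg j)]
  exact mul_le_mul_of_nonneg_left (abs_reactTerm_le hV j) (S.q_nonneg j)

theorem summable_reactTerm (hp : 1 ≤ p) (hM : 0 ≤ M) (h : ENNReal.ofReal (M ^ p) < S.radius p)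
    (hV : ∀ θ v, ‖v‖ ≤ 1 → |V θ v t x| ≤ M) : Summable fun j => |S.q j * S.reactTerm V j t x| :=
  Summable.of_nonneg_of_le (fun _ => abs_nonneg _) (abs_mul_reactTerm_le hV) (S.summable_bound hp hM h)

theorem abs_reaction_le (hp : 1 ≤ p) (hM : 0 ≤ M) (h : ENNReal.ofReal (M ^ p) < S.radius p)
    (hV : ∀ θ v, ‖v‖ ≤ 1 → |V θ v t x| ≤ M) : |S.reaction V t x| ≤ S.reactBound M := by
  have h1 := summable_reactTerm hp hM h hV
  refine (norm_tsum_le_tsum_norm (f := fun j => S.q j * S.reactTerm V j t x) h1).trans ?_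
  exact h1.tsum_le_tsum (abs_mul_reactTerm_le hV) (S.summable_bound hp hM h)

theorem abs_reaction_sub_le (hp : 1 ≤ p) (hM : 0 < M) (h : ENNReal.ofReal (M ^ p) < S.radius p)
    (hV : ∀ θ v, ‖v‖ ≤ 1 → |V θ v t x| ≤ M) (hV' : ∀ θ v, ‖v‖ ≤ 1 → |V' θ v t x| ≤ M)
    (hd : ∀ θ v, ‖v‖ ≤ 1 → |V θ v t x - V' θ v t x| ≤ δ) :
    |S.reaction V t x - S.reaction V' t x| ≤ S.reactLip M * δ := by
  have h1 := (summable_reactTerm hp hM.le h hV).of_abs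
  have h2 := (summable_reactTerm hp hM.le h hV').of_abs
  have hl := (S.summable_lip hp hM h).mul_right δ
  have hle : ∀ j, |S.q j * S.reactTerm V j t x - S.q j * S.reactTerm V' j t x| ≤
      S.q j * ((S.coefNorm j).toReal *
        ((S.children j).card * M ^ ((S.children j).card - 1))) * δ := by
    intro j
    have hq := S.q_nonneg j
    rw [← mul_sub, abs_mul, abs_of_nonneg hq, mul_assoc]
    gcongr
    rw [Problem.reactTerm, Problem.reactTerm, ← mul_sub, abs_mul, mul_assoc]
    gcongr
    · exact S.abs_coef_le j t x
    · exact abs_prod_sub_prod_le _ hM.le (fun e _ => hV _ _ (S.norm_dir_le _ _ _ _))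
        (fun e _ => hV' _ _ (S.norm_dir_le _ _ _ _)) (fun e _ => hd _ _ (S.norm_dir_le _ _ _ _))
  have h3 : Summable fun j => |S.q j * S.reactTerm V j t x - S.q j * S.reactTerm V' j t x| :=
    Summable.of_nonneg_of_le (fun _ => abs_nonneg _) hle hl
  rw [Problem.reaction, Problem.reaction, ← h1.tsum_sub h2]
  refine (norm_tsum_le_tsum_norm (f := fun j => S.q j * S.reactTerm V j t x - S.q j * S.reactTerm V' j t x) h3).trans ?_
  rw [Problem.reactLip, ← tsum_mul_right]
  exact h3.tsum_le_tsum hle hl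

theorem measurable_reactTerm (hV : ∀ θ, Measurable fun q : Space d × ℝ × Space d => V θ q.1 q.2.1 q.2.2)
    (j : ℕ) : Measurable fun q : ℝ × Space d => S.reactTerm V j q.1 q.2 := by
  refine (S.continuous_coef j).measurable.mul (Finset.measurable_prod _ fun e _ => ?_)
  exact (hV (kind e.1)).comp (((S.continuous_dir j e.1).measurable).prodMk
    (measurable_fst.prodMk measurable_snd))

theorem measurable_reaction (hp : 1 ≤ p) (hM : 0 ≤ M) (h : ENNReal.ofReal (M ^ p) < S.radius p)
    (hVM : ∀ θ v, ‖v‖ ≤ 1 → ∀ t x, |V θ v t x| ≤ M)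
    (hV : ∀ θ, Measurable fun q : Space d × ℝ × Space d => V θ q.1 q.2.1 q.2.2) :
    Measurable fun q : ℝ × Space d => S.reaction V q.1 q.2 := by
  refine measurable_of_tendsto_metrizable
    (f := fun n (q : ℝ × Space d) => ∑ j ∈ Finset.range n, S.q j * S.reactTerm V j q.1 q.2)
    (fun n => Finset.measurable_sum _ fun j _ => (measurable_reactTerm hV j).const_mul _) ?_
  rw [tendsto_pi_nhds]
  intro q
  exact (summable_reactTerm hp hM h fun θ v hv => hVM θ v hv q.1 q.2).of_abs.hasSum.tendsto_sum_nat

theorem continuous_reaction (hp : 1 ≤ p) (hM : 0 ≤ M) (h : ENNReal.ofReal (M ^ p) < S.radius p)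
    (hVM : ∀ θ v, ‖v‖ ≤ 1 → ∀ x, |V θ v t x| ≤ M)
    (hV : ∀ θ, ContinuousOn (fun q : Space d × Space d => V θ q.1 t q.2)
      (Metric.closedBall 0 1 ×ˢ univ)) : Continuous (S.reaction V t) := by
  refine continuous_tsum (u := fun j => S.q j * ((S.coefNorm j).toReal * M ^ (S.children j).card))
    (fun j => ?_) (S.summable_bound hp hM h) fun j x => abs_mul_reactTerm_le (fun θ v hv => hVM θ v hv x) j
  refine continuous_const.mul (((S.continuous_coef j).comp (Continuous.prodMk_right t)).mul
    (continuous_finsetProd _ fun e _ => ?_))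
  refine (hV (kind e.1)).comp_continuous (((S.continuous_dir j e.1).comp
    (Continuous.prodMk_right t)).prodMk continuous_id) fun x => ⟨?_, mem_univ _⟩
  simpa using S.norm_dir_le j e.1 t x

/-- The nonlinearity of the field formed by a function and its directional derivatives. -/
theorem nonlinTerm_eq (v : ℝ → Space d → ℝ) (ht : 0 ≤ t) (hf : ∀ w, V false w t x = v t x)
    (hg : ∀ w, V true w t x = inner ℝ w (gradient (v t) x)) (j : ℕ) :
    S.nonlinTerm v t x j = S.q j * S.reactTerm V j t x := by
  rw [Problem.nonlinTerm, Problem.reactTerm,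
    S.prod_children j (fun h => V (kind h) (S.dir j h t x) t x), Fin.prod_univ_succ]
  have h0 : kind (0 : Fin (H + 1)) = false := by simp [kind]
  have h1 : ∀ h : Fin H, kind h.succ = true := fun h => by simp [kind, Fin.succ_ne_zero]
  simp only [h0, h1, hf, hg, Problem.coef, Problem.dir, Fin.cases_succ, max_eq_left ht]
  ring

end Reaction

/-! ### Regularity and contraction properties of the Duhamel formula -/

section MildAnalysis

variable [NeZero N] {S : Problem d N H} {R : GreenData d N} {T : ℝ}

omit [NeZero N] in
theorem wgt_true_smul (R : GreenData d N) (c : ℝ) (v : Space d) (n : Fin N) (s : ℝ) (z : Space d) :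
    R.wgt true (c • v) n s z = c * R.wgt true v n s z :=
  real_inner_smul_left _ _ _

theorem integrableOn_mass_wgt_of_direction (h : GreenMeasures S R T) (h₁ : GreenGradientMeasures S R T)
    (hM : IntegrableOn R.mass (Ioc 0 T)) (θ : Bool) (v : Space d) :
    IntegrableOn (fun s => ∫ z, |R.wgt θ v (lastIdx N) s z| ∂(R.law θ (lastIdx N) s)) (Ioc 0 T) := by
  cases θ
  · exact integrableOn_mass_false h v
  · have hc : 0 < ‖v‖ + 1 := by positivity
    have hv : v = (‖v‖ + 1) • ((‖v‖ + 1)⁻¹ • v) := by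
      rw [smul_smul, mul_inv_cancel₀ hc.ne', one_smul]
    have h1 : ‖(‖v‖ + 1)⁻¹ • v‖ ≤ 1 := by
      rw [norm_smul, norm_inv, Real.norm_of_nonneg hc.le, inv_mul_le_iff₀ hc]
      linarith
    have e : ∀ s z, |R.wgt true v (lastIdx N) s z| =
        (‖v‖ + 1) * |R.wgt true ((‖v‖ + 1)⁻¹ • v) (lastIdx N) s z| := by
      intro s z
      nth_rewrite 1 [hv]
      rw [wgt_true_smul, abs_mul, abs_of_pos hc]
    simp only [e, integral_const_mul]
    exact (integrableOn_mass_wgt h₁ hM true h1).const_mul _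

theorem integrable_wgt_mul (h : GreenMeasures S R T) (h₁ : GreenGradientMeasures S R T) (θ : Bool)
    (v : Space d) (n : Fin N) {t : ℝ} (ht : t ∈ Ioc 0 T) {w : Space d → ℝ} (hw : Measurable w) {C : ℝ}
    (hC : ∀ x, |w x| ≤ C) (x : Space d) :
    Integrable (fun z => R.wgt θ v n t z * w (x - z)) (R.law θ n t) :=
  (integrable_wgt h h₁ θ v n ht).mul_bdd (c := C)
    (hw.comp (measurable_const.sub measurable_id)).aestronglyMeasurable (.of_forall fun _ => hC _)

theorem conv_sub (h : GreenMeasures S R T) (h₁ : GreenGradientMeasures S R T) (θ : Bool)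
    (v : Space d) (n : Fin N) {t : ℝ} (ht : t ∈ Ioc 0 T) {w w' : Space d → ℝ} (hw : Measurable w)
    (hw' : Measurable w') {C : ℝ} (hC : ∀ x, |w x| ≤ C) (hC' : ∀ x, |w' x| ≤ C) (x : Space d) :
    R.conv θ v n t w x - R.conv θ v n t w' x = R.conv θ v n t (fun y => w y - w' y) x := by
  rw [GreenData.conv, GreenData.conv, ← integral_sub (integrable_wgt_mul h h₁ θ v n ht hw hC x)
    (integrable_wgt_mul h h₁ θ v n ht hw' hC' x)]
  simp only [← mul_sub]
  rfl

theorem integrableOn_conv (h : GreenMeasures S R T) (h₁ : GreenGradientMeasures S R T)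
    (hM : IntegrableOn R.mass (Ioc 0 T)) (θ : Bool) (v : Space d)
    {F : ℝ → Space d → ℝ} (hF : Measurable fun q : ℝ × Space d => F q.1 q.2) {C : ℝ}
    (hC : ∀ s x, |F s x| ≤ C) {t : ℝ} (ht : t ∈ Icc 0 T) (x : Space d) :
    IntegrableOn (fun s => R.conv θ v (lastIdx N) s (F (t - s)) x) (Ioc 0 t) := by
  have hm := (integrableOn_mass_wgt_of_direction h h₁ hM θ v).mono_set (Ioc_subset_Ioc_right ht.2)
  refine Integrable.mono' (hm.mul_const C) ?_ ?_
  · refine (R.measurable_conv θ (lastIdx N) measurable_const measurable_id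
      (F := fun s : ℝ => F (t - s)) ?_ measurable_const).aestronglyMeasurable
    exact hF.comp ((measurable_const.sub measurable_fst).prodMk measurable_snd)
  · exact (ae_restrict_iff' measurableSet_Ioc).2 (.of_forall fun s hs =>
      abs_conv_le h h₁ θ v (lastIdx N) ⟨hs.1, hs.2.trans ht.2⟩ (hC _) x)

/-- The Duhamel formula is a contraction up to the mass of the kernels. -/
theorem abs_mild_sub_le (h : GreenMeasures S R T) (h₁ : GreenGradientMeasures S R T)
    (hM : IntegrableOn R.mass (Ioc 0 T)) (θ : Bool) {v : Space d} (hv : ‖v‖ ≤ 1)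
    {F F' : ℝ → Space d → ℝ} (hF : Measurable fun q : ℝ × Space d => F q.1 q.2)
    (hF' : Measurable fun q : ℝ × Space d => F' q.1 q.2) {C : ℝ}
    (hC : ∀ s x, |F s x| ≤ C) (hC' : ∀ s x, |F' s x| ≤ C) {t : ℝ} (ht : t ∈ Icc 0 T) {D : ℝ → ℝ}
    (hD : ∀ s ∈ Ioo 0 t, ∀ x, |F s x - F' s x| ≤ D s)
    (hDi : IntegrableOn (fun s => R.mass s * D (t - s)) (Ioc 0 t)) (x : Space d) :
    |mild S R θ v F t x - mild S R θ v F' t x| ≤ ∫ s in Ioc 0 t, R.mass s * D (t - s) := by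
  have hFs : ∀ s, Measurable (F s) := fun s => hF.comp measurable_prodMk_left
  have hFs' : ∀ s, Measurable (F' s) := fun s => hF'.comp measurable_prodMk_left
  rw [mild, mild, add_sub_add_left_eq_sub, intervalIntegral.integral_of_le ht.1,
    intervalIntegral.integral_of_le ht.1, ← integral_sub (integrableOn_conv h h₁ hM θ v hF hC ht x)
    (integrableOn_conv h h₁ hM θ v hF' hC' ht x), ← Real.norm_eq_abs]
  refine norm_integral_le_of_norm_le hDi ?_
  rw [← restrict_Ioo_eq_restrict_Ioc]
  refine (ae_restrict_iff' measurableSet_Ioo).2 (.of_forall fun s hs => ?_)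
  have hsT : s ∈ Ioc 0 T := ⟨hs.1, hs.2.le.trans ht.2⟩
  have hts : t - s ∈ Ioo 0 t := ⟨by linarith [hs.2], by linarith [hs.1]⟩
  rw [Real.norm_eq_abs, conv_sub h h₁ θ v _ hsT (hFs _) (hFs' _) (hC _) (hC' _)]
  refine (abs_conv_le h h₁ θ v (lastIdx N) hsT (hD _ hts) x).trans ?_
  have h0 : 0 ≤ D (t - s) := (abs_nonneg _).trans (hD _ hts 0)
  gcongr
  exact integral_abs_wgt_le_mass h₁ θ hv hsT

/-- The Duhamel kernel may be singular at time `0`, and the weight `e^{-ls}` absorbs its mass by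
dominated convergence. -/
theorem exists_exp_weight (hM : IntegrableOn R.mass (Ioc 0 T)) (L : ℝ) :
    ∃ l : ℝ, 0 ≤ l ∧ L * ∫ s in Ioc 0 T, R.mass s * Real.exp (-(l * s)) ≤ 1 / 2 := by
  have h1 : Filter.Tendsto (fun n : ℕ => ∫ s in Ioc 0 T, R.mass s * Real.exp (-(n * s)))
      Filter.atTop (nhds (∫ s in Ioc 0 T, (0 : ℝ))) := by
    refine tendsto_integral_of_dominated_convergence R.mass (fun n => ?_) hM (fun n => ?_) ?_
    · exact (R.measurable_mass.mul (by fun_prop)).aestronglyMeasurable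
    · refine (ae_restrict_iff' measurableSet_Ioc).2 (.of_forall fun s hs => ?_)
      rw [Real.norm_of_nonneg (mul_nonneg (R.mass_nonneg s) (Real.exp_pos _).le)]
      refine mul_le_of_le_one_right (R.mass_nonneg s) (Real.exp_le_one_iff.2 ?_)
      have := hs.1
      simp only [Left.neg_nonpos_iff]
      positivity
    · refine (ae_restrict_iff' measurableSet_Ioc).2 (.of_forall fun s hs => ?_)
      have h2 : Filter.Tendsto (fun n : ℕ => Real.exp (-(n * s))) Filter.atTop (nhds 0) := by
        refine Real.tendsto_exp_neg_atTop_nhds_zero.comp ?_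
        exact tendsto_natCast_atTop_atTop.atTop_mul_const hs.1
      simpa using h2.const_mul (R.mass s)
  rw [integral_zero] at h1
  have h3 := (h1.const_mul L).eventually (ge_mem_nhds (show L * 0 < 1 / 2 by norm_num))
  obtain ⟨n, hn⟩ := h3.exists
  exact ⟨n, Nat.cast_nonneg n, hn⟩

/-- In a suitable exponentially weighted norm, the Duhamel formula composed with an `L`-Lipschitz
source is a contraction. -/
theorem abs_mild_sub_le_half (h : GreenMeasures S R T) (h₁ : GreenGradientMeasures S R T)
    (hM : IntegrableOn R.mass (Ioc 0 T)) {L l : ℝ} (hL : 0 ≤ L)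
    (hl : L * ∫ s in Ioc 0 T, R.mass s * Real.exp (-(l * s)) ≤ 1 / 2) (θ : Bool) {v : Space d} (hv : ‖v‖ ≤ 1)
    {F F' : ℝ → Space d → ℝ} (hF : Measurable fun q : ℝ × Space d => F q.1 q.2)
    (hF' : Measurable fun q : ℝ × Space d => F' q.1 q.2) {C : ℝ}
    (hC : ∀ s x, |F s x| ≤ C) (hC' : ∀ s x, |F' s x| ≤ C) {t : ℝ} (ht : t ∈ Icc 0 T) {δ : ℝ}
    (hδ : 0 ≤ δ)
    (hD : ∀ s ∈ Ioo 0 t, ∀ x, |F s x - F' s x| ≤ L * (δ * Real.exp (l * s))) (x : Space d) :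
    |mild S R θ v F t x - mild S R θ v F' t x| ≤ δ / 2 * Real.exp (l * t) := by
  have hi0 : IntegrableOn (fun s => R.mass s * Real.exp (-(l * s))) (Ioc 0 T) := by
    refine Integrable.mul_bdd (c := Real.exp (|l| * T)) hM
      (Continuous.aestronglyMeasurable (by fun_prop)) ?_
    refine (ae_restrict_iff' measurableSet_Ioc).2 (.of_forall fun s hs => ?_)
    rw [Real.norm_of_nonneg (Real.exp_pos _).le, Real.exp_le_exp]
    calc -(l * s) ≤ |l * s| := neg_le_abs _
      _ = |l| * s := by rw [abs_mul, abs_of_pos hs.1]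
      _ ≤ |l| * T := by have := hs.2; gcongr
  have e : ∀ s, R.mass s * (L * (δ * Real.exp (l * (t - s)))) =
      L * δ * Real.exp (l * t) * (R.mass s * Real.exp (-(l * s))) := by
    intro s
    have : Real.exp (l * (t - s)) = Real.exp (l * t) * Real.exp (-(l * s)) := by
      rw [← Real.exp_add]
      congr 1
      ring
    rw [this]
    ring
  have hit := hi0.mono_set (Ioc_subset_Ioc_right ht.2)
  refine (abs_mild_sub_le h h₁ hM θ hv hF hF' hC hC' ht (D := fun s => L * (δ * Real.exp (l * s)))
    hD ?_ x).trans ?_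
  · simp only [e]
    exact hit.const_mul _
  · simp only [e]
    rw [integral_const_mul]
    have h1 : ∫ s in Ioc 0 t, R.mass s * Real.exp (-(l * s)) ≤
        ∫ s in Ioc 0 T, R.mass s * Real.exp (-(l * s)) :=
      setIntegral_mono_set hi0 (.of_forall fun s => mul_nonneg (R.mass_nonneg s) (Real.exp_pos _).le)
        (Ioc_subset_Ioc_right ht.2).eventuallyLE
    calc _ ≤ L * δ * Real.exp (l * t) * ∫ s in Ioc 0 T, R.mass s * Real.exp (-(l * s)) := by gcongr
      _ = δ * Real.exp (l * t) * (L * ∫ s in Ioc 0 T, R.mass s * Real.exp (-(l * s))) := by ring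
      _ ≤ δ * Real.exp (l * t) * (1 / 2) := by gcongr
      _ = _ := by ring

theorem exists_abs_mild_le (h : GreenMeasures S R T) (h₁ : GreenGradientMeasures S R T)
    (hM : IntegrableOn R.mass (Ioc 0 T)) (θ : Bool) (v : Space d) {F : ℝ → Space d → ℝ} {C : ℝ}
    (hC : ∀ s x, |F s x| ≤ C) {t : ℝ} (ht : t ∈ Ioc 0 T) : ∃ K, ∀ x, |mild S R θ v F t x| ≤ K := by
  choose Cf hCf using S.f_bdd
  have ht' : t ∈ Icc 0 T := ⟨ht.1.le, ht.2⟩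
  refine ⟨∑ n, S.wt n * ((∫ z, |R.wgt θ v n t z| ∂(R.law θ n t)) * Cf n) +
    (∫ s in Ioc 0 t, ∫ z, |R.wgt θ v (lastIdx N) s z| ∂(R.law θ (lastIdx N) s)) * C,
    fun x => (abs_add_le _ _).trans (add_le_add
    ((Finset.abs_sum_le_sum_abs _ _).trans (Finset.sum_le_sum fun n _ => ?_))
    (abs_duhamel_le h h₁ θ v (integrableOn_mass_wgt_of_direction h h₁ hM θ v) hC ht' x))⟩
  · rw [abs_mul, abs_of_pos (S.wt_pos n)]
    exact mul_le_mul_of_nonneg_left (abs_conv_le h h₁ θ v n ht (hCf n) x) (S.wt_pos n).le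

/-- On `[0,T]`, the Duhamel formula is bounded in terms of the data. -/
theorem exists_abs_mild_false_le (h : GreenMeasures S R T) (v : Space d)
    {F : ℝ → Space d → ℝ} {C : ℝ}
    (hC : ∀ s x, |F s x| ≤ C) : ∃ K, ∀ t ∈ Icc 0 T, ∀ x, |mild S R false v F t x| ≤ K := by
  choose Cf hCf using S.f_bdd
  obtain ⟨K, hK, hKb⟩ := h.exists_mass_bound
  have hC0 : 0 ≤ C := (abs_nonneg _).trans (hC 0 0)
  have hconv : ∀ n, ∀ t ∈ Icc 0 T, ∀ (w : Space d → ℝ) (B : ℝ), (∀ x, |w x| ≤ B) → ∀ x,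
      |R.conv false v n t w x| ≤ K * B := by
    intro n t ht w B hB x
    have hB0 : 0 ≤ B := (abs_nonneg _).trans (hB 0)
    refine (abs_integral_mul_le (w := fun z => w (x - z)) (h.integrable n t ht) fun z => hB _).trans ?_
    exact mul_le_mul_of_nonneg_right (hKb n t ht) hB0
  refine ⟨∑ n, S.wt n * (K * Cf n) + K * C * T, fun t ht x => (abs_add_le _ _).trans (add_le_add
    ((Finset.abs_sum_le_sum_abs _ _).trans (Finset.sum_le_sum fun n _ => ?_)) ?_)⟩
  · rw [abs_mul, abs_of_pos (S.wt_pos n)]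
    exact mul_le_mul_of_nonneg_left (hconv n t ht _ _ (hCf n) x) (S.wt_pos n).le
  · have h1 := intervalIntegral.norm_integral_le_of_norm_le_const (a := 0) (b := t) (C := K * C)
      (f := fun s => R.conv false v (lastIdx N) s (F (t - s)) x) fun s hs => by
        rw [uIoc_of_le ht.1] at hs
        exact hconv _ s ⟨hs.1.le, hs.2.trans ht.2⟩ _ _ (hC _) x
    rw [sub_zero, abs_of_nonneg ht.1] at h1
    refine h1.trans ?_
    have := ht.2
    gcongr

theorem continuous_conv (h : GreenMeasures S R T) (h₁ : GreenGradientMeasures S R T) (θ : Bool)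
    (v : Space d) (n : Fin N) {t : ℝ} (ht : t ∈ Ioc 0 T) {w : Space d → ℝ} (hw : Continuous w)
    {C : ℝ} (hC : ∀ x, |w x| ≤ C) : Continuous (R.conv θ v n t w) := by
  have hi := integrable_wgt h h₁ θ v n ht
  refine continuous_of_dominated (bound := fun z => |R.wgt θ v n t z| * C) (fun x => ?_) (fun x => ?_)
    (hi.abs.mul_const C) (.of_forall fun z => by fun_prop)
  · exact (integrable_wgt_mul h h₁ θ v n ht hw.measurable hC x).aestronglyMeasurable
  · refine .of_forall fun z => ?_
    rw [Real.norm_eq_abs, abs_mul]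
    exact mul_le_mul_of_nonneg_left (hC _) (abs_nonneg _)

theorem continuous_mild (h : GreenMeasures S R T) (h₁ : GreenGradientMeasures S R T)
    (hM : IntegrableOn R.mass (Ioc 0 T)) (θ : Bool) (v : Space d)
    {F : ℝ → Space d → ℝ} (hF : Measurable fun q : ℝ × Space d => F q.1 q.2) {C : ℝ}
    (hC : ∀ s x, |F s x| ≤ C) {t : ℝ} (ht : t ∈ Ioc 0 T) (hFc : ∀ s ∈ Ioc 0 T, Continuous (F s)) :
    Continuous (mild S R θ v F t) := by
  have ht' : t ∈ Icc 0 T := ⟨ht.1.le, ht.2⟩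
  refine Continuous.add (continuous_finsetSum _ fun n _ => continuous_const.mul ?_) ?_
  · obtain ⟨Cf, hCf⟩ := S.f_bdd n
    exact continuous_conv h h₁ θ v n ht (S.f_cont n) hCf
  · simp only [intervalIntegral.integral_of_le ht.1.le]
    have hm := (integrableOn_mass_wgt_of_direction h h₁ hM θ v).mono_set (Ioc_subset_Ioc_right ht.2)
    refine continuous_of_dominated (bound := fun s =>
      (∫ z, |R.wgt θ v (lastIdx N) s z| ∂(R.law θ (lastIdx N) s)) * C)
      (fun x => (integrableOn_conv h h₁ hM θ v hF hC ht' x).aestronglyMeasurable) (fun x => ?_)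
      (hm.mul_const C) ?_
    · exact (ae_restrict_iff' measurableSet_Ioc).2 (.of_forall fun s hs =>
        abs_conv_le h h₁ θ v (lastIdx N) ⟨hs.1, hs.2.trans ht.2⟩ (hC _) x)
    · rw [← restrict_Ioo_eq_restrict_Ioc]
      refine (ae_restrict_iff' measurableSet_Ioo).2 (.of_forall fun s hs => ?_)
      exact continuous_conv h h₁ θ v _ ⟨hs.1, hs.2.le.trans ht.2⟩
        (hFc _ ⟨by linarith [hs.2], by linarith [hs.1, ht.2]⟩) (hC _)

theorem conv_false_eq_sconv (h : GreenMeasures S R T) (v : Space d) (n : Fin N) {t : ℝ}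
    (ht : t ∈ Icc 0 T) {w : Space d → ℝ} (hw : Measurable w) {C : ℝ} (hC : ∀ x, |w x| ≤ C) (x : Space d) :
    R.conv false v n t w x = sconv (R.G n t) w x := by
  rw [sconv, h.density n t ht, sintegral_withDensityᵥ (h.integrable n t ht) (R.measurable_γ n t)]
  · rfl
  · exact (h.integrable n t ht).mul_bdd (c := C)
      (hw.comp (measurable_const.sub measurable_id)).aestronglyMeasurable (.of_forall fun z => hC _)

theorem continuousOn_mild (h : GreenMeasures S R T) (v : Space d)
    {F : ℝ → Space d → ℝ} (hF : Measurable fun q : ℝ × Space d => F q.1 q.2) {C : ℝ}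
    (hC : ∀ s x, |F s x| ≤ C) (hFc : ∀ s ∈ Ioc 0 T, Continuous (F s)) :
    ContinuousOn (fun z : ℝ × Space d => mild S R false v F z.1 z.2) (Icc 0 T ×ˢ univ) := by
  have hFs : ∀ s, Measurable (F s) := fun s => hF.comp measurable_prodMk_left
  obtain ⟨K, hK, hKb⟩ := h.exists_mass_bound
  have hC0 : 0 ≤ C := (abs_nonneg _).trans (hC 0 0)
  refine ContinuousOn.add (continuousOn_finsetSum _ fun n _ => continuousOn_const.mul ?_) ?_
  · obtain ⟨Cf, hCf⟩ := S.f_bdd n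
    exact (h.conv_cont n _ (S.f_cont n) ⟨Cf, hCf⟩).congr fun z hz =>
      conv_false_eq_sconv h v n hz.1 (S.f_cont n).measurable hCf z.2
  have e : ∀ z ∈ Icc 0 T ×ˢ (univ : Set (Space d)),
      ∫ s in (0 : ℝ)..z.1, R.conv false v (lastIdx N) s (F (z.1 - s)) z.2 =
        ∫ s in Ioc 0 T, (Iio z.1).indicator
          (fun s => R.conv false v (lastIdx N) (z.1 - s) (F s) z.2) s := by
    rintro ⟨t, x⟩ ⟨ht, -⟩
    simp only at ht ⊢
    have hrev := intervalIntegral.integral_comp_sub_left (a := 0) (b := t)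
      (fun s => R.conv false v (lastIdx N) s (F (t - s)) x) t
    rw [sub_zero, sub_self] at hrev
    simp only [sub_sub_cancel] at hrev
    rw [← hrev, intervalIntegral.integral_of_le ht.1, integral_Ioc_eq_integral_Ioo,
      setIntegral_indicator measurableSet_Iio]
    congr 2
    ext s
    simp only [mem_Ioo, mem_inter_iff, mem_Ioc, mem_Iio]
    constructor
    · rintro ⟨h1, h2⟩
      exact ⟨⟨h1, h2.le.trans ht.2⟩, h2⟩
    · rintro ⟨⟨h1, -⟩, h2⟩
      exact ⟨h1, h2⟩
  refine ContinuousOn.congr ?_ e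
  rintro ⟨t₀, x₀⟩ hz₀
  refine continuousWithinAt_of_dominated (bound := fun _ => K * C) (.of_forall fun z => ?_) ?_
    (integrableOn_const (by simp)) ?_
  · refine ((R.measurable_conv false (lastIdx N) measurable_const (measurable_const.sub measurable_id)
      (F := F) hF measurable_const).indicator measurableSet_Iio).aestronglyMeasurable
  · filter_upwards [self_mem_nhdsWithin] with z hz
    refine (ae_restrict_iff' measurableSet_Ioc).2 (.of_forall fun s hs => ?_)
    by_cases hst : s ∈ Iio z.1
    · rw [indicator_of_mem hst]
      have hts : z.1 - s ∈ Icc 0 T :=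
        ⟨by linarith [show s < z.1 from hst], by linarith [hs.1, hz.1.2]⟩
      refine (abs_integral_mul_le (w := fun y => F s (z.2 - y)) (h.integrable (lastIdx N) _ hts)
        fun y => hC _ _).trans ?_
      exact mul_le_mul_of_nonneg_right (hKb _ _ hts) hC0
    · rw [indicator_of_notMem hst, norm_zero]
      positivity
  · have hne : ∀ᵐ s ∂(volume.restrict (Ioc 0 T)), s ≠ t₀ :=
      ae_restrict_of_ae (measure_eq_zero_iff_ae_notMem.1 (measure_singleton t₀))
    filter_upwards [hne, ae_restrict_mem measurableSet_Ioc] with s hs hsT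
    rcases lt_or_gt_of_ne hs with hst | hst
    · set A : Set (ℝ × Space d) := (Icc 0 T ×ˢ univ) ∩ {z | s < z.1} with hA
      have hAo : IsOpen {z : ℝ × Space d | s < z.1} := isOpen_lt continuous_const continuous_fst
      have hAn : A ∈ nhdsWithin (t₀, x₀) (Icc 0 T ×ˢ univ) :=
        inter_mem_nhdsWithin _ (hAo.mem_nhds hst)
      refine ContinuousWithinAt.mono_of_mem_nhdsWithin (t := A) ?_ hAn
      have h1 : ContinuousOn (fun z : ℝ × Space d => sconv (R.G (lastIdx N) (z.1 - s)) (F s) z.2) A := by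
        refine (h.conv_cont (lastIdx N) _ (hFc s hsT) ⟨C, hC s⟩).comp
          (f := fun z : ℝ × Space d => (z.1 - s, z.2)) (by fun_prop) fun z hz => ?_
        exact ⟨⟨by linarith [show s < z.1 from hz.2], by linarith [hz.1.1.2, hsT.1]⟩, mem_univ _⟩
      refine (h1.congr fun z hz => ?_) (t₀, x₀) ⟨hz₀, hst⟩
      rw [indicator_of_mem (show s ∈ Iio z.1 from hz.2)]
      exact conv_false_eq_sconv h v _
        ⟨by linarith [show s < z.1 from hz.2], by linarith [hz.1.1.2, hsT.1]⟩ (hFs s) (hC s) z.2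
    · refine (continuousWithinAt_const (b := (0 : ℝ))).congr_of_eventuallyEq ?_ ?_
      · have hAo : IsOpen {z : ℝ × Space d | z.1 < s} := isOpen_lt continuous_fst continuous_const
        filter_upwards [mem_nhdsWithin_of_mem_nhds (hAo.mem_nhds hst)] with z hz
        exact indicator_of_notMem (s := Iio z.1) (not_lt.2 (le_of_lt (show z.1 < s from hz))) _
      · exact indicator_of_notMem (s := Iio t₀) (not_lt.2 (le_of_lt hst)) _

/-- The gradient of a mild solution. -/
def mildGrad (S : Problem d N H) (R : GreenData d N) (F : ℝ → Space d → ℝ) (t : ℝ) (x : Space d) :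
    Space d :=
  WithLp.toLp 2 fun m => mild S R true (EuclideanSpace.single m (1 : ℝ)) F t x

omit [NeZero N] in
theorem wgt_true_eq_sum (R : GreenData d N) (v : Space d) (n : Fin N) (s : ℝ) (z : Space d) :
    R.wgt true v n s z = ∑ m, v m * R.wgt true (EuclideanSpace.single m (1 : ℝ)) n s z := by
  simp only [GreenData.wgt, PiLp.inner_apply]
  simp [mul_comm]

theorem mild_true_eq_inner (h : GreenMeasures S R T) (h₁ : GreenGradientMeasures S R T)
    (hM : IntegrableOn R.mass (Ioc 0 T)) (v : Space d)
    {F : ℝ → Space d → ℝ} (hF : Measurable fun q : ℝ × Space d => F q.1 q.2) {C : ℝ}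
    (hC : ∀ s x, |F s x| ≤ C) {t : ℝ} (ht : t ∈ Ioc 0 T) (x : Space d) :
    mild S R true v F t x = inner ℝ v (mildGrad S R F t x) := by
  have ht' : t ∈ Icc 0 T := ⟨ht.1.le, ht.2⟩
  have hFs : ∀ s, Measurable (F s) := fun s => hF.comp measurable_prodMk_left
  have hconv : ∀ (n : Fin N), ∀ s ∈ Ioc 0 T, ∀ (w : Space d → ℝ), Measurable w → ∀ B, (∀ y, |w y| ≤ B) →
      R.conv true v n s w x = ∑ m, v m * R.conv true (EuclideanSpace.single m (1 : ℝ)) n s w x := by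
    intro n s hs w hw B hB
    simp only [GreenData.conv, ← integral_const_mul]
    rw [← integral_finsetSum _ fun m _ => (integrable_wgt_mul h h₁ true _ n hs hw hB x).const_mul _]
    refine integral_congr_ae (.of_forall fun z => ?_)
    simp only
    rw [wgt_true_eq_sum, Finset.sum_mul]
    simp only [mul_assoc]
  have hin : inner ℝ v (mildGrad S R F t x) =
      ∑ m, v m * mild S R true (EuclideanSpace.single m (1 : ℝ)) F t x := by
    simp [PiLp.inner_apply, mildGrad, mul_comm]
  rw [hin]
  have h2 : ∫ s in (0 : ℝ)..t, R.conv true v (lastIdx N) s (F (t - s)) x =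
      ∑ m, v m * ∫ s in (0 : ℝ)..t,
        R.conv true (EuclideanSpace.single m (1 : ℝ)) (lastIdx N) s (F (t - s)) x := by
    simp only [intervalIntegral.integral_of_le ht.1.le, ← integral_const_mul]
    rw [← integral_finsetSum _ fun m _ => (integrableOn_conv h h₁ hM true _ hF hC ht' x).const_mul _]
    refine setIntegral_congr_fun measurableSet_Ioc fun s hs => ?_
    exact hconv _ s ⟨hs.1, hs.2.trans ht.2⟩ _ (hFs _) _ (hC _)
  have h3 : ∀ n, S.wt n * R.conv true v n t (S.f n) x = ∑ m, v m *
      (S.wt n * R.conv true (EuclideanSpace.single m (1 : ℝ)) n t (S.f n) x) := by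
    intro n
    obtain ⟨Cf, hCf⟩ := S.f_bdd n
    rw [hconv n t ht _ (S.f_cont n).measurable _ hCf, Finset.mul_sum]
    refine Finset.sum_congr rfl fun m _ => ?_
    ring
  simp only [mild, mul_add, Finset.sum_add_distrib]
  rw [h2, Finset.sum_congr rfl fun n _ => h3 n, Finset.sum_comm]
  simp only [Finset.mul_sum]

theorem continuous_mildGrad (h : GreenMeasures S R T) (h₁ : GreenGradientMeasures S R T)
    (hM : IntegrableOn R.mass (Ioc 0 T))
    {F : ℝ → Space d → ℝ} (hF : Measurable fun q : ℝ × Space d => F q.1 q.2) {C : ℝ}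
    (hC : ∀ s x, |F s x| ≤ C) {t : ℝ} (ht : t ∈ Ioc 0 T) (hFc : ∀ s ∈ Ioc 0 T, Continuous (F s)) :
    Continuous (mildGrad S R F t) :=
  (PiLp.continuous_toLp 2 _).comp (continuous_pi fun _ => continuous_mild h h₁ hM true _ hF hC ht hFc)

theorem measurable_mild (S : Problem d N H) (R : GreenData d N) (θ : Bool) {X : Type*}
    [MeasurableSpace X] {v : X → Space d} (hv : Measurable v)
    {F : ℝ → Space d → ℝ} (hF : Measurable fun q : ℝ × Space d => F q.1 q.2)
    {t : ℝ} (ht : 0 ≤ t) {y : X → Space d} (hy : Measurable y) :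
    Measurable fun x => mild S R θ (v x) F t (y x) := by
  simp only [mild, intervalIntegral.integral_of_le ht]
  refine (Finset.measurable_sum _ fun n _ => ?_).add
    (measurable_duhamel R θ hv measurable_const hF hy)
  exact (measurable_conv_f R S θ n hv measurable_const hy).const_mul _

theorem mild_sub_eq_integral (h : GreenMeasures S R T) (h₁ : GreenGradientMeasures S R T)
    (hM : IntegrableOn R.mass (Ioc 0 T)) (u v : Space d)
    {F : ℝ → Space d → ℝ} (hF : Measurable fun q : ℝ × Space d => F q.1 q.2) {C : ℝ}
    (hC : ∀ s x, |F s x| ≤ C) {t : ℝ} (ht : t ∈ Ioc 0 T) :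
    ∀ᵐ x, mild S R false u F t (x + v) - mild S R false u F t x =
      ∫ r in (0 : ℝ)..1, mild S R true v F t (x + r • v) := by
  obtain ⟨K, hK⟩ := exists_abs_mild_le h h₁ hM false u hC ht
  obtain ⟨K', hK'⟩ := exists_abs_mild_le h h₁ hM true v hC ht
  exact ae_sub_eq_integral_of_weak_derivative
    (measurable_mild S R false measurable_const hF ht.1.le measurable_id)
    (measurable_mild S R true measurable_const hF ht.1.le measurable_id) (C := max K K')
    (fun x => (hK x).trans (le_max_left _ _)) (fun x => (hK' x).trans (le_max_right _ _))
    fun ψ => pairing_mild_true h h₁ v u (integrableOn_mass_wgt_of_direction h h₁ hM true v) hF hC ht ψ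

theorem hasGradientAt_mild (h : GreenMeasures S R T) (h₁ : GreenGradientMeasures S R T)
    (hM : IntegrableOn R.mass (Ioc 0 T)) (u : Space d)
    {F : ℝ → Space d → ℝ} (hF : Measurable fun q : ℝ × Space d => F q.1 q.2) {C : ℝ}
    (hC : ∀ s x, |F s x| ≤ C) {t : ℝ} (ht : t ∈ Ioc 0 T) (hFc : ∀ s ∈ Ioc 0 T, Continuous (F s))
    (x : Space d) : HasGradientAt (mild S R false u F t) (mildGrad S R F t x) x := by
  refine hasGradientAt_of_sub_eq_integral (continuous_mildGrad h h₁ hM hF hC ht hFc) (fun v => ?_) x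
  have hc := continuous_mild h h₁ hM false u hF hC ht hFc
  have hc' := continuous_mild h h₁ hM true v hF hC ht hFc
  have h1 := mild_sub_eq_integral h h₁ hM u v hF hC ht
  have hl : Continuous fun x => mild S R false u F t (x + v) - mild S R false u F t x := by fun_prop
  have hr : Continuous fun x => ∫ r in (0 : ℝ)..1, mild S R true v F t (x + r • v) :=
    intervalIntegral.continuous_parametric_intervalIntegral_of_continuous' (by fun_prop) _ _
  have h2 := (hl.ae_eq_iff_eq volume hr).1 h1
  intro x
  refine (congrFun h2 x).trans ?_
  simp only [mild_true_eq_inner h h₁ hM v hF hC ht]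

/-- Directional derivatives of a function that agrees almost everywhere with a difference of mild
solutions are bounded by the differences of the derivatives of the mild solutions. -/
theorem abs_inner_gradient_le (h : GreenMeasures S R T) (h₁ : GreenGradientMeasures S R T)
    (hM : IntegrableOn R.mass (Ioc 0 T)) {F F' : ℝ → Space d → ℝ}
    (hF : Measurable fun q : ℝ × Space d => F q.1 q.2)
    (hF' : Measurable fun q : ℝ × Space d => F' q.1 q.2) {C : ℝ}
    (hC : ∀ s x, |F s x| ≤ C) (hC' : ∀ s x, |F' s x| ≤ C) {t : ℝ} (ht : t ∈ Ioc 0 T)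
    {U : Space d → ℝ} (hU : Continuous U)
    (hUe : ∀ᵐ x, U x = mild S R false 0 F t x - mild S R false 0 F' t x) {v : Space d} {B : ℝ}
    (hB : ∀ x, |mild S R true v F t x - mild S R true v F' t x| ≤ B) {x g : Space d}
    (hg : HasGradientAt U g x) : |inner ℝ v g| ≤ B := by
  have hB0 : 0 ≤ B := (abs_nonneg _).trans (hB 0)
  have hscale : ∀ (r : ℝ) y, |mild S R true (r • v) F t y - mild S R true (r • v) F' t y| ≤ |r| * B := by
    intro r y
    rw [mild_true_eq_inner h h₁ hM _ hF hC ht, mild_true_eq_inner h h₁ hM _ hF' hC' ht,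
      real_inner_smul_left, real_inner_smul_left, ← mul_sub, abs_mul,
      ← mild_true_eq_inner h h₁ hM _ hF hC ht, ← mild_true_eq_inner h h₁ hM _ hF' hC' ht]
    exact mul_le_mul_of_nonneg_left (hB y) (abs_nonneg _)
  have hinc : ∀ (r : ℝ) y, |U (y + r • v) - U y| ≤ |r| * B := by
    intro r
    have h0 : ∀ᵐ y, |U (y + r • v) - U y| ≤ |r| * B := by
      have hshift : ∀ᵐ y, U (y + r • v) = mild S R false 0 F t (y + r • v) -
          mild S R false 0 F' t (y + r • v) :=
        (measurePreserving_add_right volume (r • v)).quasiMeasurePreserving.ae hUe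
      obtain ⟨K, hK⟩ := exists_abs_mild_le h h₁ hM true (r • v) hC ht
      obtain ⟨K', hK'⟩ := exists_abs_mild_le h h₁ hM true (r • v) hC' ht
      filter_upwards [hUe, hshift, mild_sub_eq_integral h h₁ hM 0 (r • v) hF hC ht,
        mild_sub_eq_integral h h₁ hM 0 (r • v) hF' hC' ht] with y e1 e2 e3 e4
      have hi : ∀ {G : ℝ → Space d → ℝ}, (Measurable fun q : ℝ × Space d => G q.1 q.2) → ∀ {K : ℝ},
          (∀ x, |mild S R true (r • v) G t x| ≤ K) →
          IntervalIntegrable (fun a : ℝ => mild S R true (r • v) G t (y + a • r • v)) volume 0 1 := by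
        intro G hG K hK
        rw [intervalIntegrable_iff_integrableOn_Ioc_of_le zero_le_one]
        refine Measure.integrableOn_of_bounded (M := K) (by simp) ?_ (.of_forall fun a => hK _)
        exact (measurable_mild S R true measurable_const hG ht.1.le (by fun_prop)).aestronglyMeasurable
      have e5 : U (y + r • v) - U y = ∫ a in (0 : ℝ)..1, (mild S R true (r • v) F t (y + a • r • v) -
          mild S R true (r • v) F' t (y + a • r • v)) := by
        rw [intervalIntegral.integral_sub (hi hF hK) (hi hF' hK'), ← e3, ← e4, e1, e2]
        ring
      rw [e5]
      have := intervalIntegral.norm_integral_le_of_norm_le_const (a := 0) (b := 1) (C := |r| * B)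
        (f := fun a : ℝ => mild S R true (r • v) F t (y + a • r • v) -
          mild S R true (r • v) F' t (y + a • r • v)) fun a _ => hscale r _
      simpa using this
    have hcl : IsClosed {y | |U (y + r • v) - U y| ≤ |r| * B} :=
      isClosed_le (by fun_prop) continuous_const
    have hd : Dense {y | |U (y + r • v) - U y| ≤ |r| * B} := Measure.dense_of_ae h0
    intro y
    have := hcl.closure_eq ▸ hd.closure_eq
    exact (this ▸ mem_univ y : y ∈ {y | |U (y + r • v) - U y| ≤ |r| * B})
  -- the difference quotients in direction `v` are bounded by `B`
  have hder : HasDerivAt (fun r : ℝ => U (x + r • v)) (inner ℝ v g) 0 := by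
    have h1 : HasDerivAt (fun r : ℝ => x + r • v) v 0 := by
      simpa using ((hasDerivAt_id (0 : ℝ)).smul_const v).const_add x
    have h2 : HasFDerivAt U (InnerProductSpace.toDual ℝ (Space d) g) (x + (0 : ℝ) • v) := by
      simpa using hg.hasFDerivAt
    have h3 := h2.comp_hasDerivAt (0 : ℝ) h1
    rw [InnerProductSpace.toDual_apply_apply, real_inner_comm] at h3
    exact h3
  have hlim := hder.tendsto_slope_zero
  refine le_of_tendsto hlim.abs ?_
  filter_upwards [self_mem_nhdsWithin] with r hr
  have hr0 : 0 < |r| := abs_pos.2 hr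
  rw [smul_eq_mul, abs_mul, abs_inv, inv_mul_le_iff₀ hr0]
  simpa using hinc r x

end MildAnalysis

/-! ### Independent seeds and the branching functional -/

section Seeds

/-- The randomness of a particle: its marks, and a uniform variable from which its displacement is
sampled. -/
abbrev Seed (N : ℕ) := Mark N × I

/-- The seeds of the subtree of the child `e` of the root. -/
def subtree {Y : Type*} (E : Particle H → Y) (e : Fin (H + 1) × ℕ) : Particle H → Y :=
  fun k => E (k ++ [e])

/-- The seed of the root and the seeds of the subtrees of its potential children are independent, and
each subtree is a copy of the whole tree. -/
theorem measurePreserving_subtree {Y : Type*} [MeasurableSpace Y] (μ : Measure Y)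
    [IsProbabilityMeasure μ] :
    MeasurePreserving (fun E : Particle H → Y => (E [], subtree E))
      (Measure.infinitePi fun _ : Particle H => μ)
      (μ.prod (Measure.infinitePi fun _ : Fin (H + 1) × ℕ => Measure.infinitePi fun _ : Particle H => μ)) := by
  -- `Particle H` is the disjoint union of the root and of the pairs (child, particle of its subtree)
  let κ : Bool → Type := fun b => bif b then (Fin (H + 1) × ℕ) × Particle H else Unit
  let f : (Σ b, κ b) → Particle H := fun p => match p with
    | ⟨false, _⟩ => []
    | ⟨true, q⟩ => q.2 ++ [q.1]
  have hf : Function.Injective f := by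
    rintro ⟨a, p⟩ ⟨b, q⟩ hpq
    cases a <;> cases b
    · rfl
    · simp [f] at hpq
    · simp [f] at hpq
    · obtain ⟨e, k⟩ := p
      obtain ⟨e', k'⟩ := q
      simp only [f] at hpq
      have h1 := List.append_inj' hpq rfl
      obtain ⟨rfl, h2⟩ := h1
      simp only [List.cons.injEq, and_true] at h2
      subst h2
      rfl
  have m1 : MeasurePreserving (fun (E : Particle H → Y) (p : Σ b, κ b) => E (f p))
      (Measure.infinitePi fun _ : Particle H => μ) (Measure.infinitePi fun _ : (Σ b, κ b) => μ) :=
    ⟨by fun_prop, Measure.map_infinitePi_infinitePi_of_inj hf⟩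
  have m2 : MeasurePreserving (MeasurableEquiv.piCurry fun (b : Bool) (_ : κ b) => Y)
      (Measure.infinitePi fun _ : (Σ b, κ b) => μ)
      (Measure.infinitePi fun b : Bool => Measure.infinitePi fun _ : κ b => μ) :=
    ⟨MeasurableEquiv.measurable _, Measure.infinitePi_map_piCurry (fun (b : Bool) (_ : κ b) => μ)⟩
  have m3 : MeasurePreserving (fun E : (b : Bool) → κ b → Y => (E false, E true))
      (Measure.infinitePi fun b : Bool => Measure.infinitePi fun _ : κ b => μ)
      ((Measure.infinitePi fun _ : κ false => μ).prod (Measure.infinitePi fun _ : κ true => μ)) :=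
    ⟨by fun_prop, Measure.infinitePi_map_eval_prod (P := fun b : Bool => Measure.infinitePi fun _ : κ b => μ)
      Bool.false_ne_true⟩
  have m4 := measurePreserving_eval_infinitePi (fun _ : κ false => μ) ()
  have m5 : MeasurePreserving (MeasurableEquiv.curry (Fin (H + 1) × ℕ) (Particle H) Y)
      (Measure.infinitePi fun _ : (Fin (H + 1) × ℕ) × Particle H => μ)
      (Measure.infinitePi fun _ : Fin (H + 1) × ℕ => Measure.infinitePi fun _ : Particle H => μ) :=
    ⟨MeasurableEquiv.measurable _, Measure.infinitePi_map_curry (fun (_ : Fin (H + 1) × ℕ) (_ : Particle H) => μ)⟩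
  exact (m4.prod m5).comp (m3.comp (m2.comp m1))

theorem measurable_subtree {Y : Type*} [MeasurableSpace Y] :
    Measurable (subtree : (Particle H → Y) → Fin (H + 1) × ℕ → Particle H → Y) := by
  refine measurable_pi_lambda _ fun e => measurable_pi_lambda _ fun k => ?_
  exact measurable_pi_apply _

end Seeds

section BranchVal

variable [NeZero N]

/-- The contribution of the descendants of a particle with branching mark `j`, born at time `s`
before the horizon at the point `x`, if the child `e` contributes through the field `A e`. -/
def Problem.offspring (S : Problem d N H) (A : Fin (H + 1) × ℕ → Field d) (j : ℕ) (s : ℝ) (x : Space d) : ℝ :=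
  S.coef j s x * ∏ e ∈ S.children j, A e (kind e.1) (S.dir j e.1 s x) s x

/-- One branching step: the functional of a particle in terms of its own seed `a` and of the fields
`A e` of its children. -/
def branchStep (S : Problem d N H) (R : GreenData d N) (ρ : ℝ → ℝ) (a : Seed N)
    (A : Fin (H + 1) × ℕ → Field d) : Field d := fun θ v t x =>
  stepVal S R ρ θ v t x a
    (S.offspring A a.1.2.2 (t - a.1.1) (x - R.sample θ (lastIdx N) a.1.1 a.2))

/-- The branching functional of a particle of type `θ` and direction `v` that is started at `x` with
horizon `t`, set to zero if there are descendants of generation `n`. -/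
def branchVal (S : Problem d N H) (R : GreenData d N) (ρ : ℝ → ℝ) : ℕ → (Particle H → Seed N) → Field d
  | 0, _ => fun _ _ _ _ => 0
  | n + 1, E => branchStep S R ρ (E []) fun e => branchVal S R ρ n (subtree E e)

/-- The law of the family of seeds. -/
def treeLaw (S : Problem d N H) (ρ : ℝ → ℝ) : Measure (Particle H → Seed N) :=
  Measure.infinitePi fun _ => S.seedLaw ρ

variable {S : Problem d N H} {R : GreenData d N} {T p : ℝ} {ρ : ℝ → ℝ}

omit [NeZero N] in
theorem IsPositiveDensity.isProbabilityMeasure_treeLaw (hρ : IsPositiveDensity ρ) (S : Problem d N H) :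
    IsProbabilityMeasure (treeLaw S ρ) := by
  have := hρ.isProbabilityMeasure_seedLaw S
  unfold treeLaw
  infer_instance

omit [NeZero N] in
theorem measurable_offspring {X : Type*} [MeasurableSpace X] {A : X → Fin (H + 1) × ℕ → Field d}
    (hA : ∀ e θ, Measurable fun q : X × Space d × ℝ × Space d => A q.1 e θ q.2.1 q.2.2.1 q.2.2.2)
    {j : X → ℕ} (hj : Measurable j) {s : X → ℝ} (hs : Measurable s) {x : X → Space d}
    (hx : Measurable x) : Measurable fun ω => S.offspring (A ω) (j ω) (s ω) (x ω) := by
  refine measurable_apply_countable (f := fun j ω => S.offspring (A ω) j (s ω) (x ω)) (fun j => ?_) hj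
  refine ((S.continuous_coef j).measurable.comp (hs.prodMk hx)).mul (Finset.measurable_prod _ fun e _ => ?_)
  exact (hA e (kind e.1)).comp (measurable_id.prodMk
    (((S.continuous_dir j e.1).measurable.comp (hs.prodMk hx)).prodMk (hs.prodMk hx)))

theorem measurable_branchStep (hρ : Measurable ρ) {X : Type*} [MeasurableSpace X]
    {A : X → Fin (H + 1) × ℕ → Field d}
    (hA : ∀ e θ, Measurable fun q : X × Space d × ℝ × Space d => A q.1 e θ q.2.1 q.2.2.1 q.2.2.2)
    {a : X → Seed N} (ha : Measurable a) (θ : Bool) {v : X → Space d} (hv : Measurable v) {t : X → ℝ}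
    (ht : Measurable t) {x : X → Space d} (hx : Measurable x) :
    Measurable fun ω => branchStep S R ρ (a ω) (A ω) θ (v ω) (t ω) (x ω) := by
  have hτ : Measurable fun ω => (a ω).1.1 := measurable_fst.comp (measurable_fst.comp ha)
  have hj : Measurable fun ω => (a ω).1.2.2 :=
    measurable_snd.comp (measurable_snd.comp (measurable_fst.comp ha))
  exact measurable_stepVal S R hρ θ hv ht hx ha (measurable_offspring hA hj (ht.sub hτ)
    (hx.sub (R.measurable_sample' θ _ hτ (measurable_snd.comp ha))))

theorem measurable_branchVal (hρ : Measurable ρ) (n : ℕ) (θ : Bool) :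
    Measurable fun q : (Particle H → Seed N) × Space d × ℝ × Space d =>
      branchVal S R ρ n q.1 θ q.2.1 q.2.2.1 q.2.2.2 := by
  induction n generalizing θ with
  | zero => exact measurable_const
  | succ n ih =>
    refine measurable_branchStep hρ (X := (Particle H → Seed N) × Space d × ℝ × Space d)
      (A := fun q e => branchVal S R ρ n (subtree q.1 e)) (fun e θ => ?_)
      (a := fun q => q.1 []) (v := fun q => q.2.1) (t := fun q => q.2.2.1) (x := fun q => q.2.2.2)
      (by fun_prop) θ (by fun_prop) (by fun_prop) (by fun_prop)
    refine (ih θ).comp (Measurable.prodMk ?_ measurable_snd)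
    exact (measurable_pi_apply e).comp (measurable_subtree.comp (measurable_fst.comp measurable_fst))

theorem measurable_branchVal_right (hρ : Measurable ρ) (n : ℕ) (θ : Bool) (v : Space d) (t : ℝ)
    (x : Space d) : Measurable fun E : Particle H → Seed N => branchVal S R ρ n E θ v t x :=
  (measurable_branchVal (S := S) (R := R) hρ n θ).comp (measurable_prodMk_right (y := (v, t, x)))

theorem measurable_branchStep_branchVal (hρ : Measurable ρ) (n : ℕ) (θ : Bool) (v : Space d) (t : ℝ)
    (x : Space d) : Measurable fun q : Seed N × (Fin (H + 1) × ℕ → Particle H → Seed N) =>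
      branchStep S R ρ q.1 (fun e => branchVal S R ρ n (q.2 e)) θ v t x := by
  refine measurable_branchStep hρ (A := fun (q : Seed N × (Fin (H + 1) × ℕ → Particle H → Seed N)) e =>
    branchVal S R ρ n (q.2 e)) (fun e θ => ?_) measurable_fst θ measurable_const measurable_const
    measurable_const
  refine (measurable_branchVal hρ n θ).comp (Measurable.prodMk ?_ measurable_snd)
  exact (measurable_pi_apply e).comp (measurable_snd.comp measurable_fst)

theorem integral_comp_measurePreserving {X Y : Type*} [MeasurableSpace X] [MeasurableSpace Y]
    {μ : Measure X} {ν : Measure Y} {f : X → Y} (hf : MeasurePreserving f μ ν) {g : Y → ℝ}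
    (hg : Measurable g) : ∫ x, g (f x) ∂μ = ∫ y, g y ∂ν := by
  rw [← hf.map_eq, integral_map hf.measurable.aemeasurable hg.aestronglyMeasurable]

theorem lintegral_infinitePi_prod {ι Y : Type*} [MeasurableSpace Y] (Q : Measure Y)
    [IsProbabilityMeasure Q] (s : Finset ι) {g : ι → Y → ℝ≥0∞} (hg : ∀ e, Measurable (g e)) :
    ∫⁻ ω, ∏ e ∈ s, g e (ω e) ∂(Measure.infinitePi fun _ : ι => Q) = ∏ e ∈ s, ∫⁻ y, g e y ∂Q := by
  rw [lintegral_prod_eq_prod_lintegral_of_indepFun s (fun e (ω : ι → Y) => g e (ω e))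
    (iIndepFun_infinitePi (P := fun _ : ι => Q) hg) fun e => (hg e).comp (measurable_pi_apply e)]
  exact Finset.prod_congr rfl fun e _ =>
    (measurePreserving_eval_infinitePi (fun _ : ι => Q) e).lintegral_comp (hg e)

theorem integral_infinitePi_prod {ι Y : Type*} [MeasurableSpace Y] (Q : Measure Y)
    [IsProbabilityMeasure Q] (s : Finset ι) {g : ι → Y → ℝ} (hg : ∀ e, Measurable (g e)) :
    ∫ ω, ∏ e ∈ s, g e (ω e) ∂(Measure.infinitePi fun _ : ι => Q) = ∏ e ∈ s, ∫ y, g e y ∂Q := by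
  have h1 : iIndepFun (fun (e : s) (ω : ι → Y) => g e (ω e)) (Measure.infinitePi fun _ : ι => Q) :=
    (iIndepFun_infinitePi (P := fun _ : ι => Q) hg).precomp Subtype.val_injective
  have h2 := h1.integral_fun_prod_comp (f := fun _ => id)
    (fun e => ((hg e).comp (measurable_pi_apply _)).aemeasurable)
    (fun e => measurable_id.aestronglyMeasurable)
  simp only [id] at h2
  have h3 : ∀ ω : ι → Y, ∏ e ∈ s, g e (ω e) = ∏ e : s, g e (ω e) := fun ω =>
    (Finset.prod_coe_sort s fun e => g e (ω e)).symm
  simp only [h3]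
  rw [h2, ← Finset.prod_coe_sort s fun e => ∫ y, g e y ∂Q]
  refine Finset.prod_congr rfl fun e _ => ?_
  exact integral_comp_measurePreserving (measurePreserving_eval_infinitePi (fun _ : ι => Q) e.1) (hg e)

/-- Moments of a product over independent subtrees. -/
theorem lintegral_offspring_le (hρ : IsPositiveDensity ρ) (hp : 0 ≤ p) (n : ℕ) {s : ℝ} {B : ℝ≥0∞}
    (hB : ∀ θ v, ‖v‖ ≤ 1 → ∀ x, ∫⁻ E, ‖branchVal S R ρ n E θ v s x‖ₑ ^ p ∂(treeLaw S ρ) ≤ B)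
    (j : ℕ) (x : Space d) :
    ∫⁻ ω : Fin (H + 1) × ℕ → Particle H → Seed N,
        ‖S.offspring (fun e => branchVal S R ρ n (ω e)) j s x‖ₑ ^ p
        ∂(Measure.infinitePi fun _ => treeLaw S ρ) ≤ S.coefNorm j ^ p * B ^ (S.children j).card := by
  have := hρ.isProbabilityMeasure_treeLaw S
  have hm : ∀ e : Fin (H + 1) × ℕ, Measurable fun E : Particle H → Seed N =>
      ‖branchVal S R ρ n E (kind e.1) (S.dir j e.1 s x) s x‖ₑ ^ p := fun e =>
    (measurable_branchVal_right hρ.meas n _ _ _ _).enorm.pow_const p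
  have e1 : ∀ ω : Fin (H + 1) × ℕ → Particle H → Seed N,
      ‖S.offspring (fun e => branchVal S R ρ n (ω e)) j s x‖ₑ ^ p = ‖S.coef j s x‖ₑ ^ p *
        ∏ e ∈ S.children j, ‖branchVal S R ρ n (ω e) (kind e.1) (S.dir j e.1 s x) s x‖ₑ ^ p := by
    intro ω
    have : ‖∏ e ∈ S.children j, branchVal S R ρ n (ω e) (kind e.1) (S.dir j e.1 s x) s x‖ₑ =
        ∏ e ∈ S.children j, ‖branchVal S R ρ n (ω e) (kind e.1) (S.dir j e.1 s x) s x‖ₑ := by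
      simp only [enorm, nnnorm_prod, ENNReal.ofNNReal_finsetProd]
    rw [Problem.offspring, enorm_mul, ENNReal.mul_rpow_of_nonneg _ _ hp, this,
      ENNReal.prod_rpow_of_nonneg hp]
  simp only [e1]
  have hmP : Measurable fun ω : Fin (H + 1) × ℕ → Particle H → Seed N =>
      ∏ e ∈ S.children j, ‖branchVal S R ρ n (ω e) (kind e.1) (S.dir j e.1 s x) s x‖ₑ ^ p :=
    Finset.measurable_prod _ fun e _ => (hm e).comp (measurable_pi_apply e)
  rw [lintegral_const_mul _ hmP, lintegral_infinitePi_prod (treeLaw S ρ) (S.children j) hm,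
    ← Finset.prod_const]
  gcongr with e he
  · exact S.enorm_coef_le j s x
  · exact hB _ _ (S.norm_dir_le _ _ _ _) x

theorem setLIntegral_Ioo_sub_left (t : ℝ) {f : ℝ → ℝ≥0∞} (hf : Measurable f) :
    ∫⁻ s in Ioo 0 t, f (t - s) = ∫⁻ s in Ioo 0 t, f s := by
  have h := (Measure.measurePreserving_sub_left volume t).setLIntegral_comp_preimage
    (measurableSet_Ioo (a := 0) (b := t)) hf
  rwa [Set.preimage_const_sub_Ioo, sub_self, sub_zero] at h

/-- The moments of the branching functional are bounded by a supersolution of the moment equation. -/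
theorem lintegral_branchVal_le (h : GreenMeasures S R T) (h₁ : GreenGradientMeasures S R T)
    (hρ : IsPositiveDensity ρ) (hp : 1 < p) {φ : ℝ → ℝ} (hφm : Monotone φ)
    (hφ : ∀ t ∈ Icc 0 T, rHat S R ρ T p + alphaHat R ρ T p *
      ∫⁻ u in Ioo 0 t, S.powerSeries p (ENNReal.ofReal (φ u)) ≤ ENNReal.ofReal (φ t))
    (n : ℕ) (θ : Bool) {v : Space d} (hv : ‖v‖ ≤ 1) {t : ℝ} (ht : t ∈ Ioc 0 T) (x : Space d) :
    ∫⁻ E, ‖branchVal S R ρ n E θ v t x‖ₑ ^ p ∂(treeLaw S ρ) ≤ ENNReal.ofReal (φ t) := by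
  have hp0 : 0 < p := by linarith
  have := hρ.isProbabilityMeasure_seedLaw S
  have := hρ.isProbabilityMeasure_treeLaw S
  induction n generalizing θ v t x with
  | zero => simp [branchVal, ENNReal.zero_rpow_of_pos hp0]
  | succ n ih =>
    have hm := measurable_branchStep_branchVal (S := S) (R := R) hρ.meas n θ v t x
    have e1 : ∫⁻ E, ‖branchVal S R ρ (n + 1) E θ v t x‖ₑ ^ p ∂(treeLaw S ρ) =
        ∫⁻ a, ∫⁻ ω : Fin (H + 1) × ℕ → Particle H → Seed N,
          ‖branchStep S R ρ a (fun e => branchVal S R ρ n (ω e)) θ v t x‖ₑ ^ p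
          ∂(Measure.infinitePi fun _ => treeLaw S ρ) ∂(S.seedLaw ρ) := by
      have e2 := (measurePreserving_subtree (H := H) (S.seedLaw ρ)).lintegral_comp (hm.enorm.pow_const p)
      refine e2.trans ?_
      exact lintegral_prod _ (hm.enorm.pow_const p).aemeasurable
    -- the moments of the descendants, where non-positive branching times are irrelevant
    set W : ℕ → ℝ → ℝ≥0∞ := fun j s => if 0 < s then
      S.coefNorm j ^ p * ENNReal.ofReal (φ (t - s)) ^ (S.children j).card else ∞ with hW
    have hφme : Measurable fun s : ℝ => ENNReal.ofReal (φ (t - s)) :=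
      ENNReal.measurable_ofReal.comp (hφm.measurable.comp (measurable_const.sub measurable_id))
    have hWm : ∀ j, Measurable (W j) := fun j =>
      Measurable.ite measurableSet_Ioi ((hφme.pow_const _).const_mul _) measurable_const
    calc _ ≤ _ := by
          rw [e1]
          refine lintegral_mono (g := fun a : Seed N => if a.1.1 < t then
            ‖R.wgt θ v (lastIdx N) a.1.1 (R.sample θ (lastIdx N) a.1.1 a.2) / ρ a.1.1‖ₑ ^ p *
              W a.1.2.2 a.1.1
            else ‖R.wgt θ v a.1.2.1 t (R.sample θ a.1.2.1 t a.2) / tail ρ t *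
              S.leaf θ a.1.2.1 x (R.sample θ a.1.2.1 t a.2)‖ₑ ^ p) fun a => ?_
          by_cases hat : a.1.1 < t
          · simp only [branchStep, stepVal, if_pos hat, enorm_mul, ENNReal.mul_rpow_of_nonneg _ _ hp0.le]
            have hmo : Measurable fun ω : Fin (H + 1) × ℕ → Particle H → Seed N =>
                S.offspring (fun e => branchVal S R ρ n (ω e)) a.1.2.2 (t - a.1.1)
                  (x - R.sample θ (lastIdx N) a.1.1 a.2) := by
              refine measurable_offspring (A := fun (ω : Fin (H + 1) × ℕ → Particle H → Seed N) e =>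
                branchVal S R ρ n (ω e)) (fun e θ => ?_) measurable_const measurable_const measurable_const
              refine (measurable_branchVal hρ.meas n θ).comp (Measurable.prodMk ?_ measurable_snd)
              exact (measurable_pi_apply e).comp measurable_fst
            rw [lintegral_const_mul _ (hmo.enorm.pow_const p)]
            gcongr
            by_cases ha0 : 0 < a.1.1
            · simp only [hW, if_pos ha0]
              exact lintegral_offspring_le hρ hp0.le n (fun θ v hv x =>
                ih θ hv ⟨by linarith, by linarith [ht.2]⟩ x) _ _
            · simp only [hW, if_neg ha0, le_top]
          · simp only [branchStep, stepVal, if_neg hat, lintegral_const, measure_univ, mul_one, le_refl]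
      _ ≤ rHat S R ρ T p + alphaHat R ρ T p *
          ∫⁻ s in Ioo 0 t, ∑' j, ENNReal.ofReal (S.q j) * W j s :=
          lintegral_step_le h h₁ hρ hp θ hv ht x hWm
      _ = rHat S R ρ T p + alphaHat R ρ T p *
          ∫⁻ s in Ioo 0 t, S.powerSeries p (ENNReal.ofReal (φ (t - s))) := by
          congr 2
          refine setLIntegral_congr_fun measurableSet_Ioo fun s hs => ?_
          simp only [hW, if_pos hs.1]
          exact (S.powerSeries_eq p _).symm
      _ ≤ _ := by
          rw [setLIntegral_Ioo_sub_left t (f := fun s => S.powerSeries p (ENNReal.ofReal (φ s)))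
            ((S.powerSeries_mono p).measurable.comp (ENNReal.measurable_ofReal.comp hφm.measurable))]
          exact hφ t ⟨ht.1.le, ht.2⟩

/-! ### The expectations of the branching functional -/

/-- The expectation of the truncated branching functional. -/
def meanVal (S : Problem d N H) (R : GreenData d N) (ρ : ℝ → ℝ) (n : ℕ) : Field d :=
  fun θ v t x => ∫ E, branchVal S R ρ n E θ v t x ∂(treeLaw S ρ)

/-- A field, set to zero outside the time interval `(0,T]`. -/
def truncField (T : ℝ) (V : Field d) : Field d := fun θ v t x => (Ioc 0 T).indicator (fun t => V θ v t x) t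

theorem truncField_of_mem {V : Field d} {t : ℝ} (ht : t ∈ Ioc 0 T) (θ : Bool) (v x : Space d) :
    truncField T V θ v t x = V θ v t x := indicator_of_mem ht _

theorem abs_truncField_le {V : Field d} {M : ℝ} (hM : 0 ≤ M)
    (hV : ∀ θ v, ‖v‖ ≤ 1 → ∀ t ∈ Ioc 0 T, ∀ x, |V θ v t x| ≤ M) (θ : Bool) (v : Space d) (hv : ‖v‖ ≤ 1)
    (t : ℝ) (x : Space d) : |truncField T V θ v t x| ≤ M := by
  by_cases ht : t ∈ Ioc 0 T
  · rw [truncField_of_mem ht]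
    exact hV θ v hv t ht x
  · simpa [truncField, indicator_of_notMem ht] using hM

theorem measurable_truncField {V : Field d}
    (hV : ∀ θ, Measurable fun q : Space d × ℝ × Space d => V θ q.1 q.2.1 q.2.2) (θ : Bool) :
    Measurable fun q : Space d × ℝ × Space d => truncField T V θ q.1 q.2.1 q.2.2 := by
  have : (fun q : Space d × ℝ × Space d => truncField T V θ q.1 q.2.1 q.2.2) =
      {q : Space d × ℝ × Space d | q.2.1 ∈ Ioc 0 T}.indicator fun q => V θ q.1 q.2.1 q.2.2 := by
    funext q
    by_cases hq : q.2.1 ∈ Ioc 0 T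
    · rw [truncField_of_mem hq, indicator_of_mem (show q ∈ {q : Space d × ℝ × Space d | q.2.1 ∈ Ioc 0 T} from hq)]
    · rw [truncField, indicator_of_notMem hq,
        indicator_of_notMem (show q ∉ {q : Space d × ℝ × Space d | q.2.1 ∈ Ioc 0 T} from hq)]
  rw [this]
  exact (hV θ).indicator ((measurable_fst.comp measurable_snd) measurableSet_Ioc)

theorem measurable_meanVal (hρ : IsPositiveDensity ρ) (n : ℕ) (θ : Bool) :
    Measurable fun q : Space d × ℝ × Space d => meanVal S R ρ n θ q.1 q.2.1 q.2.2 := by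
  have := hρ.isProbabilityMeasure_treeLaw S
  have h := (measurable_branchVal (S := S) (R := R) hρ.meas n θ).comp measurable_swap
  exact (h.stronglyMeasurable.integral_prod_right' (ν := treeLaw S ρ)).measurable

theorem integrable_and_abs_integral_le {Ω : Type*} [MeasurableSpace Ω] {P : Measure Ω}
    [IsProbabilityMeasure P] {f : Ω → ℝ} (hf : AEStronglyMeasurable f P) {s : ℝ} (hs : 0 ≤ s) (hp : 1 ≤ p)
    (hfs : ∫⁻ ω, ‖f ω‖ₑ ^ p ∂P ≤ ENNReal.ofReal s) :
    Integrable f P ∧ |∫ ω, f ω ∂P| ≤ s ^ p⁻¹ := by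
  have hp0 : 0 < p := by linarith
  have h1 : ∫⁻ ω, ‖f ω‖ₑ ∂P ≤ ENNReal.ofReal (s ^ p⁻¹) := by
    have h2 := eLpNorm_le_eLpNorm_of_exponent_le (p := 1) (q := ENNReal.ofReal p) (μ := P)
      (by rw [← ENNReal.ofReal_one]; exact ENNReal.ofReal_le_ofReal hp) hf
    rw [eLpNorm_one_eq_lintegral_enorm, eLpNorm_eq_lintegral_rpow_enorm_toReal
      (by simpa using hp0) ENNReal.ofReal_ne_top, ENNReal.toReal_ofReal hp0.le] at h2
    refine h2.trans ?_
    rw [← ENNReal.ofReal_rpow_of_nonneg hs (by positivity), one_div]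
    gcongr
  refine ⟨⟨hf, h1.trans_lt ENNReal.ofReal_lt_top⟩, ?_⟩
  have h3 := enorm_integral_le_lintegral_enorm (μ := P) f
  have h4 := h3.trans h1
  rw [Real.enorm_eq_ofReal_abs] at h4
  exact (ENNReal.ofReal_le_ofReal_iff (by positivity)).1 h4

omit [NeZero N] in
theorem ae_seedLaw_pos (S : Problem d N H) (hρ : IsPositiveDensity ρ) :
    ∀ᵐ a ∂(S.seedLaw ρ), 0 < a.1.1 := by
  have := hρ.isProbabilityMeasure_timeLaw
  have := hρ.isProbabilityMeasure_markLaw S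
  have h1 : ∀ᵐ s ∂(timeLaw ρ), 0 < s :=
    (withDensity_absolutelyContinuous _ _).ae_le (ae_restrict_mem measurableSet_Ioi)
  have h2 : ∀ᵐ m ∂(S.markLaw ρ), 0 < m.1 := Measure.quasiMeasurePreserving_fst.ae h1
  exact Measure.quasiMeasurePreserving_fst.ae h2

/-- The expectations of the truncated functionals satisfy a Picard iteration for the Duhamel
formula. -/
theorem meanVal_succ (h : GreenMeasures S R T) (h₁ : GreenGradientMeasures S R T)
    (hρ : IsPositiveDensity ρ) (hp : 1 ≤ p) {M : ℝ} (hM : 0 ≤ M)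
    (hMR : ENNReal.ofReal (M ^ p) < S.radius p) {n : ℕ}
    (hn : ∀ θ v, ‖v‖ ≤ 1 → ∀ t ∈ Ioc 0 T, ∀ x, |meanVal S R ρ n θ v t x| ≤ M) (θ : Bool) {v : Space d}
    {t : ℝ} (ht0 : 0 ≤ t) (htT : t ≤ T) (ht : t ∈ Ioc 0 T ∨ θ = false) (x : Space d)
    (hi : Integrable (fun E => branchVal S R ρ (n + 1) E θ v t x) (treeLaw S ρ)) :
    meanVal S R ρ (n + 1) θ v t x =
      mild S R θ v (S.reaction (truncField T (meanVal S R ρ n))) t x := by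
  have := hρ.isProbabilityMeasure_seedLaw S
  have := hρ.isProbabilityMeasure_treeLaw S
  set V := truncField T (meanVal S R ρ n) with hV
  have hVM : ∀ θ v, ‖v‖ ≤ 1 → ∀ t x, |V θ v t x| ≤ M := abs_truncField_le hM hn
  have hVm : ∀ θ, Measurable fun q : Space d × ℝ × Space d => V θ q.1 q.2.1 q.2.2 :=
    measurable_truncField (measurable_meanVal hρ n)
  have hm := measurable_branchStep_branchVal (S := S) (R := R) hρ.meas n θ v t x
  have hmp := measurePreserving_subtree (H := H) (S.seedLaw ρ)
  have hi1 : Integrable (fun q : Seed N × (Fin (H + 1) × ℕ → Particle H → Seed N) =>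
      branchStep S R ρ q.1 (fun e => branchVal S R ρ n (q.2 e)) θ v t x)
      ((S.seedLaw ρ).prod (Measure.infinitePi fun _ => treeLaw S ρ)) :=
    (hmp.integrable_comp hm.aestronglyMeasurable).1 hi
  -- integrating out the subtrees
  have hinner : ∀ a : Seed N, 0 < a.1.1 →
      ∫ ω : Fin (H + 1) × ℕ → Particle H → Seed N,
        branchStep S R ρ a (fun e => branchVal S R ρ n (ω e)) θ v t x
        ∂(Measure.infinitePi fun _ => treeLaw S ρ) = stepVal S R ρ θ v t x a
      (S.reactTerm V a.1.2.2 (t - a.1.1) (x - R.sample θ (lastIdx N) a.1.1 a.2)) := by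
    intro a ha
    by_cases hat : a.1.1 < t
    · simp only [branchStep, stepVal, if_pos hat]
      rw [integral_const_mul]
      congr 1
      have hts : t - a.1.1 ∈ Ioc 0 T := ⟨by linarith, by linarith⟩
      simp only [Problem.offspring, Problem.reactTerm]
      rw [integral_const_mul]
      congr 1
      set s := t - a.1.1
      set y := x - R.sample θ (lastIdx N) a.1.1 a.2
      set j := a.1.2.2
      have hmb : ∀ e : Fin (H + 1) × ℕ, Measurable fun E : Particle H → Seed N =>
          branchVal S R ρ n E (kind e.1) (S.dir j e.1 s y) s y := fun e =>
        measurable_branchVal_right hρ.meas n _ _ _ _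
      rw [integral_infinitePi_prod (treeLaw S ρ) (S.children j) hmb]
      refine Finset.prod_congr rfl fun e _ => ?_
      rw [hV, truncField_of_mem hts]
      rfl
    · simp only [branchStep, stepVal, if_neg hat, integral_const, probReal_univ, one_smul]
  have hae : (fun a : Seed N => ∫ ω : Fin (H + 1) × ℕ → Particle H → Seed N,
        branchStep S R ρ a (fun e => branchVal S R ρ n (ω e)) θ v t x
        ∂(Measure.infinitePi fun _ => treeLaw S ρ)) =ᵐ[S.seedLaw ρ] fun a => stepVal S R ρ θ v t x a
      (S.reactTerm V a.1.2.2 (t - a.1.1) (x - R.sample θ (lastIdx N) a.1.1 a.2)) := by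
    filter_upwards [ae_seedLaw_pos S hρ] with a ha using hinner a ha
  have e0 : meanVal S R ρ (n + 1) θ v t x = ∫ a, ∫ ω : Fin (H + 1) × ℕ → Particle H → Seed N,
        branchStep S R ρ a (fun e => branchVal S R ρ n (ω e)) θ v t x
        ∂(Measure.infinitePi fun _ => treeLaw S ρ) ∂(S.seedLaw ρ) := by
    rw [← integral_prod _ hi1]
    exact integral_comp_measurePreserving hmp hm
  rw [e0, integral_congr_ae hae]
  refine integral_stepVal h h₁ hρ θ ht0 ht x (G := S.reactTerm V)
    (measurable_reaction hp hM hMR hVM hVm) (fun s _ y => ?_) (hi1.integral_prod_left.congr hae)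
  have hsum := summable_reactTerm (S := S) hp hM hMR fun θ v hv => hVM θ v hv s y
  refine (integral_branchLaw (S := S) (f := fun j => S.reactTerm V j s y) ?_).2
  refine hsum.congr fun j => ?_
  rw [abs_mul, abs_of_nonneg (S.q_nonneg j)]

end BranchVal

/-! ### The limit of the Picard iteration -/

section Limit

variable [NeZero N] {S : Problem d N H} {R : GreenData d N} {T p M : ℝ}

/-- The field formed by a mild solution and its directional derivatives. -/
def mildField (S : Problem d N H) (R : GreenData d N) (F : ℝ → Space d → ℝ) : Field d :=
  fun θ v t x => mild S R θ v F t x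

theorem continuous_mildField (h : GreenMeasures S R T) (h₁ : GreenGradientMeasures S R T)
    (hmass : IntegrableOn R.mass (Ioc 0 T)) (θ : Bool)
    {F : ℝ → Space d → ℝ} (hF : Measurable fun q : ℝ × Space d => F q.1 q.2) {C : ℝ}
    (hC : ∀ s x, |F s x| ≤ C) {t : ℝ} (ht : t ∈ Ioc 0 T) (hFc : ∀ s ∈ Ioc 0 T, Continuous (F s)) :
    Continuous fun q : Space d × Space d => mildField S R F θ q.1 t q.2 := by
  cases θ
  · exact (continuous_mild h h₁ hmass false 0 hF hC ht hFc).comp continuous_snd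
  · simp only [mildField, mild_true_eq_inner h h₁ hmass _ hF hC ht]
    exact continuous_fst.inner ((continuous_mildGrad h h₁ hmass hF hC ht hFc).comp continuous_snd)

omit [NeZero N] in
theorem reaction_congr {V V' : Field d} {t : ℝ} {x : Space d}
    (h : ∀ θ v, ‖v‖ ≤ 1 → V θ v t x = V' θ v t x) : S.reaction V t x = S.reaction V' t x := by
  unfold Problem.reaction Problem.reactTerm
  congr 1
  funext j
  congr 2
  exact Finset.prod_congr rfl fun e _ => h _ _ (S.norm_dir_le _ _ _ _)

/-- A source `F` which is the nonlinearity of its own mild solution, where the mild solution and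
its directional derivatives are bounded by `M`. -/
structure IsMildSource (S : Problem d N H) (R : GreenData d N) (T M : ℝ) (F : ℝ → Space d → ℝ) :
    Prop where
  meas : Measurable fun q : ℝ × Space d => F q.1 q.2
  bdd : ∃ C : ℝ, ∀ s x, |F s x| ≤ C
  cont : ∀ s ∈ Ioc 0 T, Continuous (F s)
  abs_le : ∀ θ v, ‖v‖ ≤ 1 → ∀ t ∈ Ioc 0 T, ∀ x, |mildField S R F θ v t x| ≤ M
  eq_reaction : ∀ t ∈ Ioc 0 T, ∀ x, F t x = S.reaction (mildField S R F) t x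

/-- A bounded Picard iteration for the Duhamel formula converges, geometrically in an exponentially
weighted norm. -/
theorem exists_isMildSource (h : GreenMeasures S R T) (h₁ : GreenGradientMeasures S R T)
    (hmass : IntegrableOn R.mass (Ioc 0 T)) (hp : 1 ≤ p) (hM : 0 < M)
    (hMR : ENNReal.ofReal (M ^ p) < S.radius p) {V : ℕ → Field d} (hV0 : ∀ θ v t x, V 0 θ v t x = 0)
    (hVM : ∀ n θ v, ‖v‖ ≤ 1 → ∀ t ∈ Ioc 0 T, ∀ x, |V n θ v t x| ≤ M)
    (hVm : ∀ n θ, Measurable fun q : Space d × ℝ × Space d => V n θ q.1 q.2.1 q.2.2)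
    (hV : ∀ n θ v, ‖v‖ ≤ 1 → ∀ t ∈ Ioc 0 T, ∀ x,
      V (n + 1) θ v t x = mild S R θ v (S.reaction (truncField T (V n))) t x) :
    ∃ F, IsMildSource S R T M F ∧ ∀ t ∈ Icc 0 T, ∀ v, ‖v‖ ≤ 1 → ∀ θ x,
      Filter.Tendsto (fun n => mild S R θ v (S.reaction (truncField T (V n))) t x) Filter.atTop
        (nhds (mild S R θ v F t x)) := by
  set A : ℕ → Field d := fun n => truncField T (V n) with hA
  set F : ℕ → ℝ → Space d → ℝ := fun n => S.reaction (A n) with hF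
  have hAM : ∀ n θ v, ‖v‖ ≤ 1 → ∀ t x, |A n θ v t x| ≤ M := fun n => abs_truncField_le hM.le (hVM n)
  have hFm : ∀ n, Measurable fun q : ℝ × Space d => F n q.1 q.2 := fun n =>
    measurable_reaction hp hM.le hMR (hAM n) (measurable_truncField (hVm n))
  have hFC : ∀ n s x, |F n s x| ≤ S.reactBound M := fun n s x =>
    abs_reaction_le hp hM.le hMR fun θ v hv => hAM n θ v hv s x
  have hC0 : 0 ≤ S.reactBound M := S.reactBound_nonneg hM.le
  have hL : 0 ≤ S.reactLip M := S.reactLip_nonneg hM.le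
  obtain ⟨l, hl0, hl⟩ := exists_exp_weight hmass (S.reactLip M)
  have hFsub : ∀ m n s x δ, 0 ≤ δ →
      (s ∈ Ioc 0 T → ∀ θ v, ‖v‖ ≤ 1 → |V m θ v s x - V n θ v s x| ≤ δ) →
      |F m s x - F n s x| ≤ S.reactLip M * δ := by
    intro m n s x δ hδ hd
    refine abs_reaction_sub_le hp hM hMR (fun θ v hv => hAM m θ v hv s x)
      (fun θ v hv => hAM n θ v hv s x) fun θ v hv => ?_
    by_cases hs : s ∈ Ioc 0 T
    · simp only [hA, truncField_of_mem hs]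
      exact hd hs θ v hv
    · simpa [hA, truncField, indicator_of_notMem hs] using hδ
  have hgeo : ∀ n, ∀ θ v, ‖v‖ ≤ 1 → ∀ t ∈ Ioc 0 T, ∀ x,
      |V (n + 1) θ v t x - V n θ v t x| ≤ M * (1 / 2) ^ n * Real.exp (l * t) := by
    intro n
    induction n with
    | zero =>
      intro θ v hv t ht x
      rw [hV0, sub_zero, pow_zero, mul_one]
      refine (hVM _ θ v hv t ht x).trans (le_mul_of_one_le_right hM.le ?_)
      exact Real.one_le_exp (mul_nonneg hl0 ht.1.le)
    | succ n ih =>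
      intro θ v hv t ht x
      rw [hV (n + 1) θ v hv t ht, hV n θ v hv t ht]
      refine (abs_mild_sub_le_half h h₁ hmass hL hl θ hv (hFm (n + 1)) (hFm n) (hFC _) (hFC _)
        ⟨ht.1.le, ht.2⟩ (δ := M * (1 / 2) ^ n) (by positivity) (fun s hs y => ?_) x).trans_eq ?_
      · exact hFsub _ _ _ _ _ (by positivity) fun hs' θ v hv => ih θ v hv s hs' y
      · rw [pow_succ]
        ring
  set K : ℝ := S.reactLip M * (M * Real.exp (l * |T|)) with hK
  have hK0 : 0 ≤ K := by positivity
  have hFgeo : ∀ n s x, dist (F n s x) (F (n + 1) s x) ≤ K * (1 / 2) ^ n := by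
    intro n s x
    rw [dist_comm, Real.dist_eq]
    refine (hFsub (n + 1) n s x (M * (1 / 2) ^ n * Real.exp (l * |T|)) (by positivity) ?_).trans_eq
      (by rw [hK]; ring)
    intro hs θ v hv
    refine (hgeo n θ v hv s hs x).trans ?_
    have : s ≤ |T| := hs.2.trans (le_abs_self T)
    gcongr
  -- `G` is the limit of the sources
  choose G hG using fun s x => cauchySeq_tendsto_of_complete
    (cauchySeq_of_le_geometric (1 / 2) K (by norm_num) fun n => hFgeo n s x)
  have hFG : ∀ n s x, |F n s x - G s x| ≤ 2 * K * (1 / 2) ^ n := by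
    intro n s x
    have h1 := dist_le_of_le_geometric_of_tendsto (1 / 2) K (by norm_num) (fun n => hFgeo n s x)
      (hG s x) n
    rw [Real.dist_eq] at h1
    refine h1.trans_eq ?_
    ring
  have hε : Filter.Tendsto (fun n : ℕ => 2 * K * (1 / 2) ^ n) Filter.atTop (nhds 0) := by
    simpa using (tendsto_pow_atTop_nhds_zero_of_lt_one (r := (1 / 2 : ℝ)) (by norm_num)
      (by norm_num)).const_mul (2 * K)
  have hGm : Measurable fun q : ℝ × Space d => G q.1 q.2 :=
    measurable_of_tendsto_metrizable hFm (tendsto_pi_nhds.2 fun q => hG q.1 q.2)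
  have hGC : ∀ s x, |G s x| ≤ S.reactBound M := fun s x =>
    le_of_tendsto (hG s x).abs (.of_forall fun n => hFC n s x)
  -- the sources of the iteration are continuous in space
  have hFc : ∀ n, ∀ s ∈ Ioc 0 T, Continuous (F n s) := by
    intro n
    induction n with
    | zero =>
      intro s hs
      refine continuous_reaction hp hM.le hMR (fun θ v hv x => hAM 0 θ v hv s x) fun θ => ?_
      simp only [hA, truncField_of_mem hs, hV0]
      exact continuousOn_const
    | succ n ih =>
      intro s hs
      refine continuous_reaction hp hM.le hMR (fun θ v hv x => hAM (n + 1) θ v hv s x) fun θ => ?_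
      refine (continuous_mildField h h₁ hmass θ (hFm n) (hFC n) hs ih).continuousOn.congr fun q hq => ?_
      simp only [hA, truncField_of_mem hs]
      exact hV n θ q.1 (by simpa using hq.1) s hs q.2
  have hGc : ∀ s ∈ Ioc 0 T, Continuous (G s) := by
    intro s hs
    refine TendstoUniformly.continuous (F := fun n x => F n s x) (p := Filter.atTop) ?_
      (Filter.Eventually.frequently (.of_forall fun n => hFc n s hs))
    rw [Metric.tendstoUniformly_iff]
    intro ε hε0
    filter_upwards [hε.eventually (gt_mem_nhds hε0)] with n hn x
    rw [dist_comm, Real.dist_eq]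
    exact (hFG n s x).trans_lt hn
  -- convergence of the mild solutions
  set m : ℝ := ∫ s in Ioc 0 T, R.mass s with hm
  have hm0 : 0 ≤ m := integral_nonneg fun s => R.mass_nonneg s
  have hmild : ∀ n, ∀ θ v, ‖v‖ ≤ 1 → ∀ t ∈ Icc 0 T, ∀ x,
      |mild S R θ v (F n) t x - mild S R θ v G t x| ≤ m * (2 * K * (1 / 2) ^ n) := by
    intro n θ v hv t ht x
    have hmt : IntegrableOn R.mass (Ioc 0 t) := hmass.mono_set (Ioc_subset_Ioc_right ht.2)
    refine (abs_mild_sub_le h h₁ hmass θ hv (hFm n) hGm (hFC n) hGC ht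
      (D := fun _ => 2 * K * (1 / 2) ^ n) (fun s _ y => hFG n s y) (hmt.mul_const _) x).trans ?_
    rw [integral_mul_const]
    gcongr
    exact setIntegral_mono_set hmass (.of_forall fun s => R.mass_nonneg s)
      (Ioc_subset_Ioc_right ht.2).eventuallyLE
  have hε' : Filter.Tendsto (fun n : ℕ => m * (2 * K * (1 / 2) ^ n)) Filter.atTop (nhds 0) := by
    simpa using hε.const_mul m
  have hlim : ∀ t ∈ Icc 0 T, ∀ v, ‖v‖ ≤ 1 → ∀ θ x,
      Filter.Tendsto (fun n => mild S R θ v (F n) t x) Filter.atTop (nhds (mild S R θ v G t x)) := by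
    intro t ht v hv θ x
    rw [tendsto_iff_dist_tendsto_zero]
    exact squeeze_zero (fun n => dist_nonneg) (fun n => hmild n θ v hv t ht x) hε'
  have hGM : ∀ θ v, ‖v‖ ≤ 1 → ∀ t ∈ Ioc 0 T, ∀ x, |mildField S R G θ v t x| ≤ M := by
    intro θ v hv t ht x
    refine le_of_tendsto (hlim t ⟨ht.1.le, ht.2⟩ v hv θ x).abs (.of_forall fun n => ?_)
    simp only [hF, hA]
    rw [← hV n θ v hv t ht]
    exact hVM (n + 1) θ v hv t ht x
  refine ⟨G, ⟨hGm, ⟨_, hGC⟩, hGc, hGM, fun t ht x => ?_⟩, hlim⟩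
  have h1 : Filter.Tendsto (fun n => F (n + 1) t x) Filter.atTop
      (nhds (S.reaction (mildField S R G) t x)) := by
    rw [tendsto_iff_dist_tendsto_zero]
    refine squeeze_zero (fun n => dist_nonneg) (fun n => ?_)
      (g := fun n => S.reactLip M * (m * (2 * K * (1 / 2) ^ n))) (by simpa using hε'.const_mul (S.reactLip M))
    refine abs_reaction_sub_le hp hM hMR (fun θ v hv => hAM (n + 1) θ v hv t x)
      (fun θ v hv => hGM θ v hv t ht x) fun θ v hv => ?_
    simp only [hA, truncField_of_mem ht]
    rw [hV n θ v hv t ht]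
    exact hmild n θ v hv t ⟨ht.1.le, ht.2⟩ x
  exact tendsto_nhds_unique (hG t x) ((Filter.tendsto_add_atTop_iff_nat 1).1 h1)

end Limit

/-! ### Existence and uniqueness of bounded solutions -/

section Solutions

variable [NeZero N] {S : Problem d N H} {R : GreenData d N} {T p M : ℝ} {F : ℝ → Space d → ℝ}

theorem gradient_mild (h : GreenMeasures S R T) (h₁ : GreenGradientMeasures S R T)
    (hmass : IntegrableOn R.mass (Ioc 0 T)) (hF : IsMildSource S R T M F) {t : ℝ} (ht : t ∈ Ioc 0 T)
    (x : Space d) : HasGradientAt (mild S R false 0 F t) (mildGrad S R F t x) x := by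
  obtain ⟨C, hC⟩ := hF.bdd
  exact hasGradientAt_mild h h₁ hmass 0 hF.meas hC ht hF.cont x

theorem nonlinTerm_mild (h : GreenMeasures S R T) (h₁ : GreenGradientMeasures S R T)
    (hmass : IntegrableOn R.mass (Ioc 0 T)) (hF : IsMildSource S R T M F) {t : ℝ} (ht : t ∈ Ioc 0 T)
    (x : Space d) (j : ℕ) : S.nonlinTerm (mild S R false 0 F) t x j =
      S.q j * S.reactTerm (mildField S R F) j t x := by
  obtain ⟨C, hC⟩ := hF.bdd
  refine nonlinTerm_eq _ ht.1.le (fun w => rfl) (fun w => ?_) j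
  rw [(gradient_mild h h₁ hmass hF ht x).gradient]
  exact mild_true_eq_inner h h₁ hmass w hF.meas hC ht x

theorem nonlin_mild (h : GreenMeasures S R T) (h₁ : GreenGradientMeasures S R T)
    (hmass : IntegrableOn R.mass (Ioc 0 T)) (hF : IsMildSource S R T M F) {t : ℝ} (ht : t ∈ Ioc 0 T)
    (x : Space d) : S.nonlin (mild S R false 0 F) t x = F t x := by
  rw [hF.eq_reaction t ht, Problem.nonlin, Problem.reaction]
  simp only [nonlinTerm_mild h h₁ hmass hF ht]

/-- A mild solution whose source is its own nonlinearity is a bounded solution. -/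
theorem isBoundedSolution_mild (h : GreenMeasures S R T) (h₁ : GreenGradientMeasures S R T)
    (hS : GreenHatTempered S T) (hT : 0 < T)
    (hmass : IntegrableOn R.mass (Ioc 0 T)) (hp : 1 ≤ p) (hM : 0 < M)
    (hMR : ENNReal.ofReal (M ^ p) < S.radius p) (hF : IsMildSource S R T M F) :
    IsBoundedSolution S T (mild S R false 0 F) := by
  obtain ⟨C, hC⟩ := hF.bdd
  have hw := isWeakSolution_mild h h₁ hS hT 0 hF.meas hC
  exact
    { cont := continuousOn_mild h 0 hF.meas hC hF.cont
      bdd := exists_abs_mild_false_le h 0 hC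
      smooth_space := by
        intro t ht
        have hg := gradient_mild h h₁ hmass hF ht
        rw [contDiff_one_iff_fderiv]
        refine ⟨fun x => (hg x).differentiableAt, ?_⟩
        have : fderiv ℝ (mild S R false 0 F t) =
            fun x => InnerProductSpace.toDual ℝ (Space d) (mildGrad S R F t x) := by
          funext x
          exact (hg x).hasFDerivAt.fderiv
        rw [this]
        exact (InnerProductSpace.toDual ℝ (Space d)).continuous.comp
          (continuous_mildGrad h h₁ hmass hF.meas hC ht hF.cont)
      summable_nonlin := by
        intro t ht x
        have := summable_reactTerm (S := S) hp hM.le hMR fun θ v hv => hF.abs_le θ v hv t ht x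
        exact this.of_abs.congr fun j => (nonlinTerm_mild h h₁ hmass hF ht x j).symm
      nonlin_bdd := ⟨C, fun t ht x => by
        rw [nonlin_mild h h₁ hmass hF ht]
        exact hC t x⟩
      smooth_time := hw.smooth_time
      initial := hw.initial
      equation := by
        intro ψ t ht
        rw [hw.equation ψ t ht]
        refine intervalIntegral.integral_congr_ae (.of_forall fun s hs => ?_)
        rw [uIoc_of_le ht.1] at hs
        have : S.nonlin (mild S R false 0 F) s = F s := by
          funext x
          exact nonlin_mild h h₁ hmass hF ⟨hs.1, hs.2.trans ht.2⟩ x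
        rw [this] }

/-- The field formed by a function and its directional derivatives. -/
def fieldOf (v : ℝ → Space d → ℝ) : Field d := fun θ w t x =>
  bif θ then inner ℝ w (gradient (v t) x) else v t x

omit [NeZero N] in
theorem nonlin_eq_reaction (v : ℝ → Space d → ℝ) {t : ℝ} (ht : 0 ≤ t) (x : Space d) :
    S.nonlin v t x = S.reaction (fieldOf v) t x := by
  rw [Problem.nonlin, Problem.reaction]
  simp only [nonlinTerm_eq (S := S) (V := fieldOf v) v ht (fun w => rfl) (fun w => rfl)]

/-- The nonlinearity of a bounded solution, set to zero outside `(0,T]`. -/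
def Problem.source (S : Problem d N H) (T : ℝ) (v : ℝ → Space d → ℝ) (t : ℝ) (x : Space d) : ℝ :=
  (Ioc 0 T).indicator (fun t => S.nonlin v t x) t

omit [NeZero N] in
/-- The gradient of a bounded solution need not be continuous in time, but it is jointly measurable
because the solution is jointly continuous. -/
theorem measurable_source {v : ℝ → Space d → ℝ} (hT : 0 ≤ T) (hv : IsBoundedSolution S T v) :
    Measurable fun q : ℝ × Space d => S.source T v q.1 q.2 := by
  -- extend `v` continuously to all times
  set w : ℝ → Space d → ℝ := fun t => v (projIcc 0 T hT t) with hw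
  have hwv : ∀ t ∈ Ioc 0 T, w t = v t := fun t ht => by
    simp only [hw, projIcc_of_mem hT ⟨ht.1.le, ht.2⟩]
  have hwc : Continuous (Function.uncurry w) :=
    hv.cont.comp_continuous (f := fun q : ℝ × Space d => ((projIcc 0 T hT q.1 : ℝ), q.2))
      (((continuous_subtype_val.comp continuous_projIcc).comp continuous_fst).prodMk continuous_snd)
      fun q => ⟨(projIcc 0 T hT q.1).2, mem_univ _⟩
  have hgm : Measurable fun q : ℝ × Space d => gradient (w q.1) q.2 :=
    (InnerProductSpace.toDual ℝ (Space d)).symm.continuous.measurable.comp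
      (measurable_fderiv_with_param ℝ hwc)
  have hVm : ∀ θ, Measurable fun q : Space d × ℝ × Space d => fieldOf w θ q.1 q.2.1 q.2.2 := by
    intro θ
    cases θ
    · exact hwc.measurable.comp measurable_snd
    · exact measurable_fst.inner (hgm.comp measurable_snd)
  have hI : MeasurableSet {q : ℝ × Space d | q.1 ∈ Ioc 0 T} := measurable_fst measurableSet_Ioc
  refine measurable_of_tendsto_metrizable (f := fun n => {q : ℝ × Space d | q.1 ∈ Ioc 0 T}.indicator
    fun q => ∑ j ∈ Finset.range n, S.q j * S.reactTerm (fieldOf w) j q.1 q.2)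
    (fun n => (Finset.measurable_sum _ fun j _ => (measurable_reactTerm hVm j).const_mul _).indicator hI) ?_
  rw [tendsto_pi_nhds]
  rintro ⟨t, x⟩
  by_cases ht : t ∈ Ioc 0 T
  · have e : ∀ j, S.q j * S.reactTerm (fieldOf w) j t x = S.nonlinTerm v t x j := fun j =>
      (nonlinTerm_eq v ht.1.le (fun z => by simp [fieldOf, hwv t ht])
        (fun z => by simp [fieldOf, hwv t ht]) j).symm
    simp only [Problem.source, indicator_of_mem ht,
      indicator_of_mem (show (t, x) ∈ {q : ℝ × Space d | q.1 ∈ Ioc 0 T} from ht), e]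
    exact (hv.summable_nonlin t ht x).hasSum.tendsto_sum_nat
  · simp only [Problem.source, indicator_of_notMem ht,
      indicator_of_notMem (show (t, x) ∉ {q : ℝ × Space d | q.1 ∈ Ioc 0 T} from ht)]
    exact tendsto_const_nhds

omit [NeZero N] in
theorem IsBoundedSolution.continuous {v : ℝ → Space d → ℝ} (hv : IsBoundedSolution S T v) {t : ℝ}
    (ht : t ∈ Icc 0 T) : Continuous (v t) :=
  hv.cont.comp_continuous (f := fun x : Space d => (t, x)) (by fun_prop) fun _ => ⟨ht, mem_univ _⟩

omit [NeZero N] in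
theorem exists_abs_source_le {v : ℝ → Space d → ℝ} (hv : IsBoundedSolution S T v) :
    ∃ C : ℝ, ∀ s x, |S.source T v s x| ≤ C := by
  obtain ⟨C, hC⟩ := hv.nonlin_bdd
  refine ⟨max C 0, fun s x => ?_⟩
  by_cases hs : s ∈ Ioc 0 T
  · rw [Problem.source, indicator_of_mem hs]
    exact (hC s hs x).trans (le_max_left _ _)
  · rw [Problem.source, indicator_of_notMem hs, abs_zero]
    exact le_max_right _ _

/-- Bounded solutions satisfy the Duhamel formula. -/
theorem IsBoundedSolution.ae_eq_mild (h : GreenMeasures S R T) (h₁ : GreenGradientMeasures S R T)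
    (hS : GreenHatTempered S T) (hT : 0 < T) {v : ℝ → Space d → ℝ} (hv : IsBoundedSolution S T v) :
    ∀ t ∈ Icc 0 T, ∀ᵐ x, v t x = mild S R false 0 (S.source T v) t x := by
  have hm := measurable_source hT.le hv
  obtain ⟨C, hC⟩ := exists_abs_source_le hv
  obtain ⟨Cv, hCv⟩ := hv.bdd
  obtain ⟨Cm, hCm⟩ := exists_abs_mild_false_le h 0 hC
  have hw := isWeakSolution_mild h h₁ hS hT 0 hm hC
  have hvw : IsWeakSolution S T (fun t ψ => pairing (v t) ψ)
      (fun n ψ => S.wt n * pairing (S.f n) ψ) (fun s ψ => pairing (S.source T v s) ψ) :=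
    { integrable_source := hw.integrable_source
      smooth_time := hv.smooth_time
      initial := hv.initial
      equation := by
        intro ψ t ht
        rw [hv.equation ψ t ht]
        refine intervalIntegral.integral_congr_ae (.of_forall fun s hs => ?_)
        rw [uIoc_of_le ht.1] at hs
        have : S.source T v s = S.nonlin v s := by
          funext x
          exact indicator_of_mem (show s ∈ Ioc 0 T from ⟨hs.1, hs.2.trans ht.2⟩) _
        rw [this] }
  exact ae_eq_of_isWeakSolution hT hvw hw (fun t ht => (hv.continuous ht).measurable)
    (fun t ht => measurable_mild S R false measurable_const hm ht.1 measurable_id) (C := max Cv Cm)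
    (fun t ht x => (hCv t ht x).trans (le_max_left _ _))
    (fun t ht x => (hCm t ht x).trans (le_max_right _ _))

theorem exists_small_mass (hmass : IntegrableOn R.mass (Ioc 0 T)) {ε : ℝ} (hε : 0 < ε) :
    ∃ δ : ℝ, 0 < δ ∧ ∫ s in Ioc 0 T, (Iio δ).indicator R.mass s ≤ ε := by
  have h1 : Filter.Tendsto (fun n : ℕ => ∫ s in Ioc 0 T, (Iio (1 / ((n : ℝ) + 1))).indicator R.mass s)
      Filter.atTop (nhds (∫ s in Ioc 0 T, (0 : ℝ))) := by
    refine tendsto_integral_of_dominated_convergence R.mass (fun n => ?_) hmass (fun n => ?_) ?_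
    · exact (R.measurable_mass.indicator measurableSet_Iio).aestronglyMeasurable
    · refine .of_forall fun s => ?_
      refine (norm_indicator_le_norm_self _ _).trans_eq ?_
      exact Real.norm_of_nonneg (R.mass_nonneg s)
    · refine (ae_restrict_iff' measurableSet_Ioc).2 (.of_forall fun s hs => ?_)
      refine tendsto_const_nhds.congr' ?_
      filter_upwards [(tendsto_one_div_add_atTop_nhds_zero_nat (𝕜 := ℝ)).eventually (gt_mem_nhds hs.1)]
        with n hn
      exact (indicator_of_notMem (s := Iio (1 / ((n : ℝ) + 1))) (not_lt.2 hn.le) _).symm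
  rw [integral_zero] at h1
  obtain ⟨n, hn⟩ := (h1.eventually (ge_mem_nhds hε)).exists
  exact ⟨1 / ((n : ℝ) + 1), by positivity, hn⟩

theorem le_of_ae_le {U : Space d → ℝ} (hU : Continuous U) {B : ℝ} (h : ∀ᵐ x, |U x| ≤ B) (x : Space d) :
    |U x| ≤ B := by
  have hcl : IsClosed {y | |U y| ≤ B} := isClosed_le (by fun_prop) continuous_const
  have hd : Dense {y | |U y| ≤ B} := Measure.dense_of_ae h
  have := hcl.closure_eq ▸ hd.closure_eq
  exact (this ▸ mem_univ x : x ∈ {y | |U y| ≤ B})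

/-- Every bounded solution is the mild solution of `IsMildSource`. Two bounded solutions agree on a
short time interval, as their distance is small there and the nonlinearity is Lipschitz; the length
of the interval does not depend on its left end point. -/
theorem IsBoundedSolution.eq_mild (h : GreenMeasures S R T) (h₁ : GreenGradientMeasures S R T)
    (hS : GreenHatTempered S T) (hT : 0 < T)
    (hmass : IntegrableOn R.mass (Ioc 0 T)) (hp : 1 ≤ p) (hM : 0 < M)
    (hMR : ENNReal.ofReal (M ^ p) < S.radius p) (hF : IsMildSource S R T M F)
    {v : ℝ → Space d → ℝ} (hv : IsBoundedSolution S T v) :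
    ∀ t ∈ Icc 0 T, ∀ x, v t x = mild S R false 0 F t x := by
  set Fv := S.source T v with hFv
  have hFvm := measurable_source hT.le hv
  obtain ⟨C₁, hC₁⟩ := exists_abs_source_le hv
  obtain ⟨C₂, hC₂⟩ := hF.bdd
  set C := max C₁ C₂ with hCdef
  have hFvC : ∀ s x, |Fv s x| ≤ C := fun s x => (hC₁ s x).trans (le_max_left _ _)
  have hFC : ∀ s x, |F s x| ≤ C := fun s x => (hC₂ s x).trans (le_max_right _ _)
  have hC0 : 0 ≤ C := (abs_nonneg _).trans (hFC 0 0)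
  have hae := hv.ae_eq_mild h h₁ hS hT
  set V := fieldOf v with hV
  set U := mildField S R F with hU
  -- distances of fields are controlled by distances of mild solutions
  have key : ∀ t ∈ Ioc 0 T, ∀ θ w B, (∀ x, |mild S R θ w Fv t x - mild S R θ w F t x| ≤ B) →
      ∀ x, |V θ w t x - U θ w t x| ≤ B := by
    intro t ht θ w B hB x
    have ht' : t ∈ Icc 0 T := ⟨ht.1.le, ht.2⟩
    have hc := continuous_mild h h₁ hmass false 0 hF.meas hFC ht hF.cont
    have hcv := hv.continuous ht'
    cases θ
    · refine le_of_ae_le (U := fun x => v t x - mild S R false 0 F t x) (by fun_prop) ?_ x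
      filter_upwards [hae t ht'] with y hy
      rw [hy]
      exact hB y
    · have hd : DifferentiableAt ℝ (v t) x := (hv.smooth_space t ht).differentiable one_ne_zero x
      have hg := hd.hasGradientAt.hasFDerivAt.sub (gradient_mild h h₁ hmass hF ht x).hasFDerivAt
      rw [← map_sub] at hg
      have hg' : HasGradientAt (fun x => v t x - mild S R false 0 F t x)
        (gradient (v t) x - mildGrad S R F t x) x := hg
      have h2 := abs_inner_gradient_le h h₁ hmass hFvm hF.meas hFvC hFC ht
        (U := fun x => v t x - mild S R false 0 F t x) (by fun_prop)
        ((hae t ht').mono fun y hy => by rw [hy]) hB hg'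
      rw [inner_sub_right, ← mild_true_eq_inner h h₁ hmass w hF.meas hFC ht] at h2
      exact h2
  have hFvr : ∀ s ∈ Ioc 0 T, ∀ x, Fv s x = S.reaction V s x := fun s hs x => by
    rw [hFv, Problem.source, indicator_of_mem hs]
    exact nonlin_eq_reaction v hs.1.le x
  obtain ⟨M', hMM, hMR'⟩ := S.exists_gt_of_lt_radius (by linarith) hMR
  have hM' : 0 < M' := hM.trans hMM
  have hL : 0 ≤ S.reactLip M' := S.reactLip_nonneg hM'.le
  obtain ⟨l, hl0, hl⟩ := exists_exp_weight hmass (S.reactLip M')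
  have hUM : ∀ θ w, ‖w‖ ≤ 1 → ∀ t ∈ Ioc 0 T, ∀ x, |U θ w t x| ≤ M' := fun θ w hw t ht x =>
    (hF.abs_le θ w hw t ht x).trans hMM.le
  -- contraction, as long as the field of `v` is bounded by `M'`, which is chosen strictly between `M`
  -- and the radius of convergence to leave room for the time step below
  have contr : ∀ τ, τ ≤ T → (∀ t ∈ Ioc 0 τ, ∀ θ w, ‖w‖ ≤ 1 → ∀ x, |V θ w t x| ≤ M') →
      ∀ t ∈ Ioc 0 τ, ∀ θ w, ‖w‖ ≤ 1 → ∀ x, V θ w t x = U θ w t x := by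
    intro τ hτ hVM
    have hsub : Ioc 0 τ ⊆ Ioc 0 T := Ioc_subset_Ioc_right hτ
    have hn : ∀ n : ℕ, ∀ t ∈ Ioc 0 τ, ∀ θ w, ‖w‖ ≤ 1 → ∀ x,
        |V θ w t x - U θ w t x| ≤ 2 * M' * (1 / 2) ^ n * Real.exp (l * t) := by
      intro n
      induction n with
      | zero =>
        intro t ht θ w hw x
        rw [pow_zero, mul_one]
        refine le_trans ?_ (le_mul_of_one_le_right (by positivity)
          (Real.one_le_exp (mul_nonneg hl0 ht.1.le)))
        refine (abs_sub _ _).trans ?_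
        linarith [hVM t ht θ w hw x, hUM θ w hw t (hsub ht) x]
      | succ n ih =>
        intro t ht θ w hw x
        refine key t (hsub ht) θ w _ (fun y => ?_) x
        refine (abs_mild_sub_le_half h h₁ hmass hL hl θ hw hFvm hF.meas hFvC hFC
          ⟨ht.1.le, (hsub ht).2⟩ (δ := 2 * M' * (1 / 2) ^ n) (by positivity) (fun s hs z => ?_) y).trans_eq ?_
        · have hsτ : s ∈ Ioc 0 τ := ⟨hs.1, hs.2.le.trans ht.2⟩
          change |Fv s z - F s z| ≤ _
          rw [hFvr s (hsub hsτ), hF.eq_reaction s (hsub hsτ)]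
          exact abs_reaction_sub_le hp hM' hMR' (fun θ w hw => hVM s hsτ θ w hw z)
            (fun θ w hw => hUM θ w hw s (hsub hsτ) z) fun θ w hw => ih s hsτ θ w hw z
        · rw [pow_succ]
          ring
    intro t ht θ w hw x
    have h1 : Filter.Tendsto (fun n : ℕ => 2 * M' * (1 / 2) ^ n * Real.exp (l * t)) Filter.atTop
        (nhds 0) := by
      have := ((tendsto_pow_atTop_nhds_zero_of_lt_one (r := (1 / 2 : ℝ)) (by norm_num)
        (by norm_num)).const_mul (2 * M')).mul_const (Real.exp (l * t))
      simpa using this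
    have h2 := ge_of_tendsto' h1 fun n => hn n t ht θ w hw x
    exact sub_eq_zero.1 (abs_eq_zero.1 (le_antisymm h2 (abs_nonneg _)))
  -- if the fields agree up to time `a`, they differ up to time `a + δ` by at most `2 C` times the mass of
  -- the kernels on `(0,δ)`, hence by at most `M' - M`
  obtain ⟨δ, hδ, hδm⟩ := exists_small_mass hmass (ε := (M' - M) / (2 * C + 1))
    (div_pos (by linarith) (by linarith))
  have ext : ∀ a, 0 ≤ a → (∀ t ∈ Ioc 0 T, t ≤ a → ∀ θ w, ‖w‖ ≤ 1 → ∀ x, V θ w t x = U θ w t x) →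
      ∀ t ∈ Ioc 0 T, t ≤ a + δ → ∀ θ w, ‖w‖ ≤ 1 → ∀ x, |V θ w t x| ≤ M' := by
    intro a ha hVU t ht hta θ w hw x
    have ht' : t ∈ Icc 0 T := ⟨ht.1.le, ht.2⟩
    have hdist : |V θ w t x - U θ w t x| ≤ M' - M := by
      refine key t ht θ w _ (fun y => ?_) x
      set D : ℝ → ℝ := (Ioi a).indicator fun _ => 2 * C with hD
      have hDm : Measurable D := measurable_const.indicator measurableSet_Ioi
      have hDle : ∀ s, D s ≤ 2 * C := fun s => indicator_le_self' (fun _ _ => by positivity) s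
      have hD0 : ∀ s, 0 ≤ D s := fun s => indicator_nonneg (fun _ _ => by positivity) s
      have hDi : IntegrableOn (fun s => R.mass s * D (t - s)) (Ioc 0 t) := by
        refine Integrable.mul_bdd (c := 2 * C) (hmass.mono_set (Ioc_subset_Ioc_right ht.2))
          (hDm.comp (measurable_const.sub measurable_id)).aestronglyMeasurable (.of_forall fun s => ?_)
        rw [Real.norm_of_nonneg (hD0 _)]
        exact hDle _
      refine (abs_mild_sub_le h h₁ hmass θ hw hFvm hF.meas hFvC hFC ht' (D := D) (fun s hs z => ?_)
        hDi y).trans ?_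
      · have hsT : s ∈ Ioc 0 T := ⟨hs.1, hs.2.le.trans ht.2⟩
        by_cases hsa : s ≤ a
        · change |Fv s z - F s z| ≤ _
          rw [hFvr s hsT, hF.eq_reaction s hsT, reaction_congr fun θ w hw => hVU s hsT hsa θ w hw z,
            sub_self, abs_zero]
          exact hD0 s
        · rw [hD, indicator_of_mem (show s ∈ Ioi a from not_le.1 hsa)]
          refine (abs_sub _ _).trans ?_
          linarith [hFvC s z, hFC s z]
      · have hle : ∀ s, R.mass s * D (t - s) ≤ 2 * C * (Iio δ).indicator R.mass s := by
          intro s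
          by_cases hsa : t - s ∈ Ioi a
          · have : s ∈ Iio δ := by
              have := mem_Ioi.1 hsa
              rw [mem_Iio]
              linarith
            rw [hD, indicator_of_mem hsa, indicator_of_mem this, mul_comm]
          · rw [hD, indicator_of_notMem hsa, mul_zero]
            exact mul_nonneg (by positivity) (indicator_nonneg (fun s _ => R.mass_nonneg s) s)
        have hi2 : IntegrableOn (fun s => (Iio δ).indicator R.mass s) (Ioc 0 T) :=
          Integrable.indicator hmass measurableSet_Iio
        calc _ ≤ ∫ s in Ioc 0 t, 2 * C * (Iio δ).indicator R.mass s :=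
              integral_mono hDi ((hi2.mono_set (Ioc_subset_Ioc_right ht.2)).const_mul _) hle
          _ = 2 * C * ∫ s in Ioc 0 t, (Iio δ).indicator R.mass s := integral_const_mul _ _
          _ ≤ 2 * C * ∫ s in Ioc 0 T, (Iio δ).indicator R.mass s := by
              refine mul_le_mul_of_nonneg_left (setIntegral_mono_set hi2
                (.of_forall fun s => indicator_nonneg (fun s _ => R.mass_nonneg s) s)
                (Ioc_subset_Ioc_right ht.2).eventuallyLE) (by positivity)
          _ ≤ 2 * C * ((M' - M) / (2 * C + 1)) := by gcongr
          _ ≤ M' - M := by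
              rw [mul_div_assoc', div_le_iff₀ (by linarith)]
              nlinarith
    have h3 := hF.abs_le θ w hw t ht x
    calc |V θ w t x| = |(V θ w t x - U θ w t x) + U θ w t x| := by rw [sub_add_cancel]
      _ ≤ |V θ w t x - U θ w t x| + |U θ w t x| := abs_add_le _ _
      _ ≤ M' := by linarith
  have hind : ∀ k : ℕ, ∀ t ∈ Ioc 0 T, t ≤ k * δ → ∀ θ w, ‖w‖ ≤ 1 → ∀ x, V θ w t x = U θ w t x := by
    intro k
    induction k with
    | zero =>
      intro t ht hk
      rw [Nat.cast_zero, zero_mul] at hk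
      exact absurd ht.1 (not_lt.2 hk)
    | succ k ih =>
      intro t ht hk
      have hb := ext (k * δ) (by positivity) ih
      refine contr (min T ((k + 1 : ℕ) * δ)) (min_le_left _ _) (fun s hs => ?_) t ⟨ht.1, le_min ht.2 hk⟩
      refine hb s ⟨hs.1, hs.2.trans (min_le_left _ _)⟩ ((hs.2.trans (min_le_right _ _)).trans_eq ?_)
      push_cast
      ring
  have hpos : ∀ t ∈ Ioc 0 T, ∀ x, v t x = mild S R false 0 F t x := by
    intro t ht x
    obtain ⟨k, hk⟩ := exists_nat_ge (t / δ)
    exact hind k t ht ((div_le_iff₀ hδ).1 hk) false 0 (by simp) x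
  intro t ht x
  rcases ht.1.eq_or_lt with h0 | h0
  · subst h0
    have e1 : ∀ y, mild S R false 0 Fv 0 y = mild S R false 0 F 0 y := fun y => by simp [mild]
    have hc0 : Continuous (mild S R false 0 F 0) :=
      (continuousOn_mild h 0 hF.meas hFC hF.cont).comp_continuous (f := fun x : Space d => ((0 : ℝ), x))
        (by fun_prop) fun _ => ⟨ht, mem_univ _⟩
    have e2 : v 0 =ᵐ[volume] mild S R false 0 F 0 := (hae 0 ht).mono fun y hy => hy.trans (e1 y)
    exact congrFun (((hv.continuous ht).ae_eq_iff_eq volume hc0).1 e2) x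
  · exact hpos t ⟨h0, ht.2⟩ x

end Solutions

/-! ### The branching functional as a product over the genealogical tree -/

section Genealogy

variable {t : ℝ} {D : Particle H → Mark N}

theorem brTime_eq (t : ℝ) (D : Particle H → Mark N) (k : Particle H) :
    brTime t D k = min t (birthTime t D k + (D k).1) := by
  cases k with
  | nil => simp [brTime, birthTime]
  | cons e k => rfl

theorem brTime_le (t : ℝ) (D : Particle H → Mark N) (k : Particle H) : brTime t D k ≤ t := by
  rw [brTime_eq]
  exact min_le_left _ _

theorem brTime_lt_iff (k : Particle H) : brTime t D k < t ↔ (D k).1 < t - birthTime t D k := by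
  rw [brTime_eq, min_lt_iff, lt_sub_iff_add_lt']
  simp

theorem brTime_of_lt {k : Particle H} (h : brTime t D k < t) :
    brTime t D k = birthTime t D k + (D k).1 := by
  rw [brTime_eq] at h ⊢
  exact min_eq_right (le_of_lt ((min_lt_iff.1 h).resolve_left (lt_irrefl t)))

theorem lifeTime_of_lt {k : Particle H} (h : brTime t D k < t) : lifeTime t D k = (D k).1 := by
  rw [lifeTime, brTime_of_lt h, add_sub_cancel_left]

theorem lifeTime_of_not_lt {k : Particle H} (h : ¬ brTime t D k < t) :
    lifeTime t D k = t - birthTime t D k := by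
  rw [lifeTime, le_antisymm (brTime_le t D k) (not_lt.1 h)]

theorem position_eq (x : Space d) (Z : Particle H → Space d) (k : Particle H) :
    position x Z k = birthPosition x Z k - Z k := by
  cases k <;> rfl

/-- The derivative direction `c_{j,θ_k}` carried by the particle `k`, where `j` is the branching mark
of its parent; it is `0` for the particles of type `0`. -/
def direction (S : Problem d N H) (t : ℝ) (D : Particle H → Mark N) (x : Space d)
    (Z : Particle H → Space d) : Particle H → Space d
  | [] => 0
  | e :: k => S.dir (D k).2.2 e.1 (t - brTime t D k) (position x Z k)

variable [NeZero N]

theorem weight_eq (S : Problem d N H) (R : GreenData d N) (t : ℝ) (D : Particle H → Mark N)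
    (x : Space d) (Z : Particle H → Space d) (k : Particle H) :
    weight S R t D x Z k =
      R.wgt (kind (theta k)) (direction S t D x Z k) (idx t D k) (lifeTime t D k) (Z k) := by
  cases k with
  | nil => rfl
  | cons e k =>
    obtain ⟨h, i⟩ := e
    induction h using Fin.cases with
    | zero => rfl
    | succ h =>
      have : kind (theta ((h.succ, i) :: k)) = true := by simp [kind, theta]
      simp only [weight, Fin.cases_succ, this, GreenData.wgt, direction, Problem.dir,
        max_eq_left (sub_nonneg.2 (brTime_le t D k))]

theorem factor_of_lt (S : Problem d N H) (R : GreenData d N) (ρ : ℝ → ℝ) (x : Space d)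
    (Z : Particle H → Space d) {k : Particle H} (h : brTime t D k < t) :
    factor S R ρ t D x Z k = weight S R t D x Z k / ρ (lifeTime t D k) *
      S.coef (D k).2.2 (t - brTime t D k) (position x Z k) := by
  rw [factor, if_pos h, Problem.coef, max_eq_left (sub_nonneg.2 (brTime_le t D k))]

theorem factor_of_not_lt (S : Problem d N H) (R : GreenData d N) (ρ : ℝ → ℝ) (x : Space d)
    (Z : Particle H → Space d) {k : Particle H} (h : ¬ brTime t D k < t) :
    factor S R ρ t D x Z k = weight S R t D x Z k / tail ρ (lifeTime t D k) *
      S.leaf (kind (theta k)) (idx t D k) (birthPosition x Z k) (Z k) := by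
  rw [factor, if_neg h, Problem.leaf, position_eq]
  by_cases hk : theta k = 0 <;> simp [kind, hk]

open Classical in
/-- The particles of generation `n` that are living prior to `t`. Words grow at
their head, so that the children of `k` are `e :: k`. -/
def generation (S : Problem d N H) (t : ℝ) (D : Particle H → Mark N) : ℕ → Finset (Particle H)
  | 0 => {[]}
  | n + 1 => (generation S t D n).biUnion fun k =>
      if brTime t D k < t then (S.children (D k).2.2).image (· :: k) else ∅

omit [NeZero N] in
theorem mem_generation {S : Problem d N H} {n : ℕ} {k : Particle H} :
    k ∈ generation S t D n ↔ Born S t D k ∧ k.length = n := by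
  classical
  induction n generalizing k with
  | zero =>
    rw [generation, Finset.mem_singleton, List.length_eq_zero_iff]
    constructor
    · rintro rfl
      exact ⟨trivial, rfl⟩
    · exact fun h => h.2
  | succ n ih =>
    rw [generation, Finset.mem_biUnion]
    constructor
    · rintro ⟨k', hk', hk⟩
      split_ifs at hk with hb
      · obtain ⟨e, he, rfl⟩ := Finset.mem_image.1 hk
        rw [S.mem_children] at he
        rw [ih] at hk'
        exact ⟨⟨hk'.1, hb, he⟩, by rw [List.length_cons, hk'.2]⟩
      · simp at hk
    · rintro ⟨hb, hl⟩
      cases k with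
      | nil => simp at hl
      | cons e k =>
        obtain ⟨h, i⟩ := e
        refine ⟨k, ih.2 ⟨hb.1, by simpa using hl⟩, ?_⟩
        rw [if_pos hb.2.1]
        exact Finset.mem_image.2 ⟨(h, i), S.mem_children.2 hb.2.2, rfl⟩

omit [NeZero N] in
theorem disjoint_generation {S : Problem d N H} :
    Pairwise (Function.onFun Disjoint (generation S t D)) := by
  intro m n hmn
  rw [Function.onFun, Finset.disjoint_left]
  intro k hm hn
  exact hmn ((mem_generation.1 hm).2.symm.trans (mem_generation.1 hn).2)

omit [NeZero N] in
theorem generation_eq_empty_of_le {S : Problem d N H} {m n : ℕ} (hmn : m ≤ n)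
    (hm : generation S t D m = ∅) : generation S t D n = ∅ := by
  induction n, hmn using Nat.le_induction with
  | base => exact hm
  | succ n _ ih => rw [generation, ih, Finset.biUnion_empty]

omit [NeZero N] in
open Classical in
theorem setOf_born_eq {S : Problem d N H} {n : ℕ} (hn : generation S t D n = ∅) :
    {k | Born S t D k} = ((Finset.range n).biUnion (generation S t D) : Finset (Particle H)) := by
  ext k
  simp only [mem_ofPred_eq, Finset.coe_biUnion, Finset.coe_range, mem_iUnion, Finset.mem_coe]
  constructor
  · intro hk
    refine ⟨k.length, ?_, mem_generation.2 ⟨hk, rfl⟩⟩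
    by_contra hlt
    have h1 := generation_eq_empty_of_le (not_lt.1 hlt) hn
    have h2 : k ∈ generation S t D k.length := mem_generation.2 ⟨hk, rfl⟩
    rw [h1] at h2
    simp at h2
  · rintro ⟨m, -, hk⟩
    exact (mem_generation.1 hk).1

omit [NeZero N] in
theorem exists_generation_eq_empty {S : Problem d N H} (hfin : {k | Born S t D k}.Finite) :
    ∃ n, generation S t D n = ∅ := by
  refine ⟨hfin.toFinset.sup List.length + 1, ?_⟩
  rw [Finset.eq_empty_iff_forall_notMem]
  intro k hk
  obtain ⟨h1, h2⟩ := mem_generation.1 hk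
  have : k.length ≤ hfin.toFinset.sup List.length := Finset.le_sup (hfin.mem_toFinset.2 h1)
  omega

omit [NeZero N] in
theorem prod_generation_succ (S : Problem d N H) (t : ℝ) (D : Particle H → Mark N) (n : ℕ)
    (g : Particle H → ℝ) : ∏ k ∈ generation S t D (n + 1), g k = ∏ k ∈ generation S t D n,
      if brTime t D k < t then ∏ e ∈ S.children (D k).2.2, g (e :: k) else 1 := by
  classical
  rw [generation, Finset.prod_biUnion]
  · refine Finset.prod_congr rfl fun k _ => ?_
    split_ifs with hk
    · rw [Finset.prod_image fun a _ b _ hab => (List.cons.inj hab).1]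
    · simp
  · intro k _ k' _ hkk
    rw [Function.onFun, Finset.disjoint_left]
    intro l hl hl'
    split_ifs at hl with h1
    · split_ifs at hl' with h2
      · obtain ⟨e, -, rfl⟩ := Finset.mem_image.1 hl
        obtain ⟨e', -, he⟩ := Finset.mem_image.1 hl'
        exact hkk (List.cons.inj he).2.symm
      · simp at hl'
    · simp at hl

end Genealogy

section Sampling

variable [NeZero N] (S : Problem d N H) (R : GreenData d N) (ρ : ℝ → ℝ) (t : ℝ)

/-- The displacement of the particle `k`, sampled from its seed. -/
def displacement (E : Particle H → Seed N) (k : Particle H) : Space d :=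
  R.sample (kind (theta k)) (idx t (fun k => (E k).1) k) (lifeTime t (fun k => (E k).1) k) (E k).2

/-- The truncated functional of the subtree of the particle `k`. -/
def subtreeVal (E : Particle H → Seed N) (x : Space d) (n : ℕ) (k : Particle H) : ℝ :=
  branchVal S R ρ n (fun k' => E (k' ++ k)) (kind (theta k))
    (direction S t (fun k => (E k).1) x (displacement R t E) k)
    (t - birthTime t (fun k => (E k).1) k) (birthPosition x (displacement R t E) k)

/-- The recursion holds for all words `k`, whether or not the particle `k` is living prior to `t`. -/
theorem subtreeVal_succ (E : Particle H → Seed N) (x : Space d) (n : ℕ) (k : Particle H) :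
    subtreeVal S R ρ t E x (n + 1) k =
      factor S R ρ t (fun k => (E k).1) x (displacement R t E) k *
        if brTime t (fun k => (E k).1) k < t then
          ∏ e ∈ S.children (E k).1.2.2, subtreeVal S R ρ t E x n (e :: k) else 1 := by
  set D : Particle H → Mark N := fun k => (E k).1 with hD
  have hsub : ∀ e, subtree (fun k' => E (k' ++ k)) e = fun k' => E (k' ++ e :: k) := by
    intro e
    funext k'
    simp [subtree]
  have h0 : (fun k' => E (k' ++ k)) [] = E k := rfl
  have hE : (E k).1 = D k := rfl
  by_cases hk : brTime t D k < t
  · have hk' := (brTime_lt_iff (t := t) (D := D) k).1 hk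
    have hl := lifeTime_of_lt hk
    have hi : idx t D k = lastIdx N := if_pos hk
    have hz : R.sample (kind (theta k)) (lastIdx N) (D k).1 (E k).2 = displacement R t E k := by
      rw [displacement, ← hD, hl, hi]
    have ht : t - birthTime t D k - (D k).1 = t - brTime t D k := by
      rw [brTime_of_lt hk]
      ring
    rw [factor_of_lt S R ρ x _ hk, if_pos hk, weight_eq, hl, hi]
    simp only [subtreeVal, branchVal, branchStep, stepVal, hsub, h0, ← hD, hE, if_pos hk', hz, ht,
      Problem.offspring, ← position_eq]
    rw [mul_assoc]
    rfl
  · have hk' := (brTime_lt_iff (t := t) (D := D) k).not.1 hk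
    have hl := lifeTime_of_not_lt hk
    have hi : idx t D k = (D k).2.1 := if_neg hk
    have hz : R.sample (kind (theta k)) (D k).2.1 (t - birthTime t D k) (E k).2 =
        displacement R t E k := by
      rw [displacement, ← hD, hl, hi]
    rw [factor_of_not_lt S R ρ x _ hk, if_neg hk, weight_eq, hl, hi, mul_one]
    simp only [subtreeVal, branchVal, branchStep, stepVal, h0, ← hD, hE, if_neg hk', hz]

/-- The functional of the root, unrolled over the first `m` generations. -/
theorem subtreeVal_nil_eq (E : Particle H → Seed N) (x : Space d) (m n : ℕ) :
    subtreeVal S R ρ t E x (m + n) [] =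
      (∏ i ∈ Finset.range m, ∏ k ∈ generation S t (fun k => (E k).1) i,
        factor S R ρ t (fun k => (E k).1) x (displacement R t E) k) *
      ∏ k ∈ generation S t (fun k => (E k).1) m, subtreeVal S R ρ t E x n k := by
  induction m generalizing n with
  | zero => simp [generation]
  | succ m ih =>
    rw [add_right_comm, add_assoc, ih, Finset.prod_range_succ, mul_assoc, prod_generation_succ,
      ← Finset.prod_mul_distrib]
    simp only [subtreeVal_succ]

open Classical in
/-- The truncated functional is the product of all factors, provided that there are no descendants
of generation `n`. -/
theorem branchVal_eq_xiHat (E : Particle H → Seed N) (x : Space d) (n : ℕ) :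
    branchVal S R ρ n E false 0 t x = if generation S t (fun k => (E k).1) n = ∅ then
      xiHat S R ρ t (fun k => (E k).1) x (displacement R t E) else 0 := by
  have h1 : branchVal S R ρ n E false 0 t x = subtreeVal S R ρ t E x n [] := by
    simp [subtreeVal, theta, kind, direction, birthTime, birthPosition]
  have h2 := subtreeVal_nil_eq S R ρ t E x n 0
  rw [add_zero] at h2
  rw [h1, h2]
  split_ifs with hn
  · have hB := setOf_born_eq hn
    have hfin : {k | Born S t (fun k => (E k).1) k}.Finite := by
      rw [hB]
      exact Finset.finite_toSet _
    have hset : hfin.toFinset = (Finset.range n).biUnion (generation S t fun k => (E k).1) := by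
      rw [← Finset.coe_inj, Finite.coe_toFinset, hB]
    rw [hn, Finset.prod_empty, mul_one, xiHat, dif_pos hfin, hset, Finset.prod_biUnion]
    exact fun i _ j _ hij => disjoint_generation hij
  · obtain ⟨k, hk⟩ := Finset.nonempty_iff_ne_empty.2 hn
    rw [Finset.prod_eq_zero hk (by rfl), mul_zero]

theorem abs_branchVal_le_xiHat (E : Particle H → Seed N) (x : Space d) (n : ℕ) :
    |branchVal S R ρ n E false 0 t x| ≤
      |xiHat S R ρ t (fun k => (E k).1) x (displacement R t E)| := by
  classical
  rw [branchVal_eq_xiHat]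
  split_ifs
  · exact le_rfl
  · simp

/-- If the tree is infinite, then the truncated functionals and their limit are all zero. -/
theorem tendsto_branchVal (E : Particle H → Seed N) (x : Space d) :
    Filter.Tendsto (fun n => branchVal S R ρ n E false 0 t x) Filter.atTop
      (nhds (xiHat S R ρ t (fun k => (E k).1) x (displacement R t E))) := by
  classical
  by_cases hfin : {k | Born S t (fun k => (E k).1) k}.Finite
  · obtain ⟨m, hm⟩ := exists_generation_eq_empty hfin
    refine tendsto_const_nhds.congr' ?_
    filter_upwards [Filter.eventually_ge_atTop m] with n hn
    rw [branchVal_eq_xiHat, if_pos (generation_eq_empty_of_le hn hm)]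
  · refine tendsto_const_nhds.congr fun n => ?_
    rw [branchVal_eq_xiHat]
    split_ifs with hn
    · rfl
    · rw [xiHat, dif_neg hfin]

end Sampling

/-! ### Measurability of the branching functional -/

section Measurability

theorem measurable_brTime (t : ℝ) (k : Particle H) :
    Measurable fun D : Particle H → Mark N => brTime t D k := by
  induction k with
  | nil => exact measurable_const.min (measurable_fst.comp (measurable_pi_apply _))
  | cons e k ih => exact measurable_const.min (ih.add (measurable_fst.comp (measurable_pi_apply _)))

theorem measurable_lifeTime (t : ℝ) (k : Particle H) :
    Measurable fun D : Particle H → Mark N => lifeTime t D k := by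
  cases k with
  | nil => exact (measurable_brTime t []).sub measurable_const
  | cons e k => exact (measurable_brTime t (e :: k)).sub (measurable_brTime t k)

theorem measurable_branchMark (k : Particle H) :
    Measurable fun D : Particle H → Mark N => (D k).2.2 :=
  measurable_snd.comp (measurable_snd.comp (measurable_pi_apply k))

theorem measurableSet_brTime_lt (t : ℝ) (k : Particle H) :
    MeasurableSet {D : Particle H → Mark N | brTime t D k < t} :=
  measurableSet_lt (measurable_brTime t k) measurable_const

theorem measurableSet_born (S : Problem d N H) (t : ℝ) (k : Particle H) :
    MeasurableSet {D : Particle H → Mark N | Born S t D k} := by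
  induction k with
  | nil => exact MeasurableSet.univ
  | cons e k ih =>
    obtain ⟨h, i⟩ := e
    refine ih.inter ((measurableSet_brTime_lt t k).inter ?_)
    exact measurable_branchMark k (MeasurableSet.of_discrete (s := {j | i < S.l j h}))

theorem measurableSet_bornSet_eq (S : Problem d N H) (t : ℝ) (K : Finset (Particle H)) :
    MeasurableSet {D : Particle H → Mark N | {k | Born S t D k} = K} := by
  have : {D : Particle H → Mark N | {k | Born S t D k} = K} =
      ⋂ k, {D | Born S t D k ↔ k ∈ K} := by
    ext D
    simp only [mem_ofPred_eq, Set.ext_iff, Finset.mem_coe, mem_iInter]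
  rw [this]
  exact .iInter fun k => (measurableSet_born S t k).iff (.const _)

variable [NeZero N]

theorem measurable_idx (t : ℝ) (k : Particle H) :
    Measurable fun D : Particle H → Mark N => idx t D k := by
  classical
  refine Measurable.ite (measurableSet_brTime_lt t k) measurable_const ?_
  exact measurable_fst.comp (measurable_snd.comp (measurable_pi_apply k))

theorem stepLaw_eq (R : GreenData d N) (t : ℝ) (D : Particle H → Mark N) (k : Particle H) :
    stepLaw R t D k = R.law (kind (theta k)) (idx t D k) (lifeTime t D k) := by
  rw [stepLaw]
  by_cases hk : theta k = 0 <;> simp [kind, hk, GreenData.law]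

theorem measurable_stepLaw (R : GreenData d N) (t : ℝ) (k : Particle H) {A : Set (Space d)}
    (hA : MeasurableSet A) : Measurable fun D : Particle H → Mark N => stepLaw R t D k A := by
  simp only [stepLaw_eq]
  have h : Measurable fun q : Fin N × ℝ => R.law (kind (theta k)) q.1 q.2 A :=
    measurable_from_prod_countable_right fun n => (R.law (kind (theta k)) n).measurable_coe hA
  exact h.comp ((measurable_idx t k).prodMk (measurable_lifeTime t k))

theorem measurable_position (x : Space d) (k : Particle H) :
    Measurable fun Z : Particle H → Space d => position x Z k := by
  induction k with
  | nil => exact measurable_const.sub (measurable_pi_apply _)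
  | cons e k ih => exact ih.sub (measurable_pi_apply _)

theorem measurable_birthPosition (x : Space d) (k : Particle H) :
    Measurable fun Z : Particle H → Space d => birthPosition x Z k := by
  cases k with
  | nil => exact measurable_const
  | cons e k => exact measurable_position x k

omit [NeZero N] in
theorem measurable_direction (S : Problem d N H) (t : ℝ) (x : Space d) (k : Particle H) :
    Measurable fun q : (Particle H → Mark N) × (Particle H → Space d) =>
      direction S t q.1 x q.2 k := by
  cases k with
  | nil => exact measurable_const
  | cons e k =>
    have h : Measurable fun q : ℕ × ℝ × Space d => S.dir q.1 e.1 q.2.1 q.2.2 :=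
      measurable_from_prod_countable_right fun j => (S.continuous_dir j e.1).measurable
    exact h.comp (((measurable_branchMark k).comp measurable_fst).prodMk
      ((measurable_const.sub ((measurable_brTime t k).comp measurable_fst)).prodMk
        ((measurable_position x k).comp measurable_snd)))

theorem measurable_factor (S : Problem d N H) (R : GreenData d N) {ρ : ℝ → ℝ} (hρ : Measurable ρ)
    (t : ℝ) (x : Space d) (k : Particle H) :
    Measurable fun q : (Particle H → Mark N) × (Particle H → Space d) =>
      factor S R ρ t q.1 x q.2 k := by
  classical
  have hl : Measurable fun q : (Particle H → Mark N) × (Particle H → Space d) => lifeTime t q.1 k :=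
    (measurable_lifeTime t k).comp measurable_fst
  have hi : Measurable fun q : (Particle H → Mark N) × (Particle H → Space d) => idx t q.1 k :=
    (measurable_idx t k).comp measurable_fst
  have hz : Measurable fun q : (Particle H → Mark N) × (Particle H → Space d) => q.2 k :=
    (measurable_pi_apply k).comp measurable_snd
  have hp : Measurable fun q : (Particle H → Mark N) × (Particle H → Space d) => position x q.2 k :=
    (measurable_position x k).comp measurable_snd
  have hb : Measurable fun q : (Particle H → Mark N) × (Particle H → Space d) =>
      birthPosition x q.2 k := (measurable_birthPosition x k).comp measurable_snd
  have hw : Measurable fun q : (Particle H → Mark N) × (Particle H → Space d) =>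
      weight S R t q.1 x q.2 k := by
    simp only [weight_eq]
    exact measurable_apply_countable (f := fun n (q : (Particle H → Mark N) × (Particle H → Space d)) =>
      R.wgt (kind (theta k)) (direction S t q.1 x q.2 k) n (lifeTime t q.1 k) (q.2 k))
      (fun n => R.measurable_wgt _ n (measurable_direction S t x k) hl hz) hi
  have hc : Measurable fun q : (Particle H → Mark N) × (Particle H → Space d) =>
      S.coef (q.1 k).2.2 (t - brTime t q.1 k) (position x q.2 k) := by
    have h : Measurable fun q : ℕ × ℝ × Space d => S.coef q.1 q.2.1 q.2.2 :=
      measurable_from_prod_countable_right fun j => (S.continuous_coef j).measurable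
    exact h.comp (((measurable_branchMark k).comp measurable_fst).prodMk
      ((measurable_const.sub ((measurable_brTime t k).comp measurable_fst)).prodMk hp))
  have hs : Measurable fun q : (Particle H → Mark N) × (Particle H → Space d) =>
      S.leaf (kind (theta k)) (idx t q.1 k) (birthPosition x q.2 k) (q.2 k) :=
    measurable_apply_countable (f := fun n (q : (Particle H → Mark N) × (Particle H → Space d)) =>
      S.leaf (kind (theta k)) n (birthPosition x q.2 k) (q.2 k))
      (fun n => S.measurable_leaf _ n hb hz) hi
  have e : (fun q : (Particle H → Mark N) × (Particle H → Space d) => factor S R ρ t q.1 x q.2 k) =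
      fun q => if brTime t q.1 k < t then weight S R t q.1 x q.2 k / ρ (lifeTime t q.1 k) *
        S.coef (q.1 k).2.2 (t - brTime t q.1 k) (position x q.2 k)
      else weight S R t q.1 x q.2 k / tail ρ (lifeTime t q.1 k) *
        S.leaf (kind (theta k)) (idx t q.1 k) (birthPosition x q.2 k) (q.2 k) := by
    funext q
    split_ifs with h
    · exact factor_of_lt S R ρ x _ h
    · exact factor_of_not_lt S R ρ x _ h
  rw [e]
  exact Measurable.ite (measurable_fst (measurableSet_brTime_lt t k)) ((hw.div (hρ.comp hl)).mul hc)
    ((hw.div ((measurable_tail ρ hρ).comp hl)).mul hs)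

end Measurability

/-! ### The law of the branching functional -/

section Law

theorem born_of_suffix {S : Problem d N H} {t : ℝ} {D : Particle H → Mark N} {k k' : Particle H}
    (h : k' <:+ k) (hk : Born S t D k) : Born S t D k' := by
  induction k with
  | nil =>
    rw [List.suffix_nil.1 h]
    trivial
  | cons e k ih =>
    rcases List.suffix_cons_iff.1 h with rfl | h
    · exact hk
    · exact ih h hk.1

theorem position_congr (x : Space d) {Z Z' : Particle H → Space d} {k : Particle H}
    (h : ∀ k', k' <:+ k → Z k' = Z' k') : position x Z k = position x Z' k := by
  induction k with
  | nil => rw [position, position, h [] (List.suffix_refl _)]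
  | cons e k ih =>
    rw [position, position, h _ (List.suffix_refl _), ih fun k' hk' => h k' (hk'.trans (List.suffix_cons e k))]

variable [NeZero N]

/-- The factor of a particle depends on the displacements of its ancestors only. -/
theorem factor_congr (S : Problem d N H) (R : GreenData d N) (ρ : ℝ → ℝ) (t : ℝ)
    (D : Particle H → Mark N) (x : Space d) {Z Z' : Particle H → Space d} {k : Particle H}
    (h : ∀ k', k' <:+ k → Z k' = Z' k') : factor S R ρ t D x Z k = factor S R ρ t D x Z' k := by
  have h1 := position_congr x h
  have h2 : birthPosition x Z k = birthPosition x Z' k := by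
    cases k with
    | nil => rfl
    | cons e k => exact position_congr x fun k' hk' => h k' (hk'.trans (List.suffix_cons e k))
  have h3 : direction S t D x Z k = direction S t D x Z' k := by
    cases k with
    | nil => rfl
    | cons e k => simp only [direction, show position x Z k = position x Z' k from h2]
  have h4 : weight S R t D x Z k = weight S R t D x Z' k := by
    rw [weight_eq, weight_eq, h3, h k (List.suffix_refl _)]
  simp only [factor, h1, h2, h4]

variable {S : Problem d N H} {R : GreenData d N} {ρ : ℝ → ℝ} {T : ℝ}
  {Ω : Type*} [MeasurableSpace Ω] {P : Measure Ω}

/-- The marks of all particles, and the displacements of finitely many particles. -/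
def BranchingSystem.joint (Y : BranchingSystem S R ρ T P) (t : ℝ) (K : Finset (Particle H)) (ω : Ω) :
    (Particle H → Mark N) × (K → Space d) :=
  (fun k => Y.mark k ω, fun k => Y.Z t k ω)

theorem BranchingSystem.measurable_mark (Y : BranchingSystem S R ρ T P) :
    Measurable fun ω k => Y.mark k ω := measurable_pi_lambda _ Y.mark_meas

theorem BranchingSystem.measurable_joint (Y : BranchingSystem S R ρ T P) (t : ℝ)
    (K : Finset (Particle H)) : Measurable (Y.joint t K) :=
  Y.measurable_mark.prodMk (measurable_pi_lambda _ fun k => Y.Z_meas t k)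

theorem BranchingSystem.map_mark [IsProbabilityMeasure P] (Y : BranchingSystem S R ρ T P) :
    P.map (fun ω k => Y.mark k ω) = Measure.infinitePi fun _ : Particle H => S.markLaw ρ := by
  rw [Y.mark_indep.map_fun_eq_infinitePi_map Y.mark_meas]
  congr 1
  funext k
  exact (Y.mark_law k).map_eq

/-- The genealogical tree of the particles living prior to `t` is `K`. -/
def BranchingSystem.treeEvent (Y : BranchingSystem S R ρ T P) (t : ℝ) (K : Finset (Particle H)) :
    Set Ω := {ω | {k | Born S t (fun k => Y.mark k ω) k} = K}

theorem BranchingSystem.measurableSet_treeEvent (Y : BranchingSystem S R ρ T P) (t : ℝ)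
    (K : Finset (Particle H)) : MeasurableSet (Y.treeEvent t K) :=
  Y.measurable_mark (measurableSet_bornSet_eq S t K)

/-- On the event that the tree is `K`, the conditional law of the displacements given the marks is a
product over `K`, which determines the joint law on boxes. -/
theorem BranchingSystem.measure_treeEvent_inter_box [IsProbabilityMeasure P]
    (Y : BranchingSystem S R ρ T P) {t : ℝ} (ht : t ∈ Icc 0 T) (K : Finset (Particle H))
    {B : Set (Particle H → Mark N)} (hB : MeasurableSet B) {A : Particle H → Set (Space d)}
    (hA : ∀ k, MeasurableSet (A k)) :
    P (Y.joint t K ⁻¹' (B ×ˢ univ.pi fun k : K => A k) ∩ Y.treeEvent t K) =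
      ∫⁻ D in B ∩ {D | {k | Born S t D k} = K}, ∏ k ∈ K, stepLaw R t D k (A k)
        ∂(Measure.infinitePi fun _ : Particle H => S.markLaw ρ) := by
  have hB' := hB.inter (measurableSet_bornSet_eq S t K)
  have hborn : ∀ D : Particle H → Mark N, D ∈ B ∩ {D | {k | Born S t D k} = K} →
      ∀ k ∈ K, Born S t D k := by
    intro D hD k hk
    have h : k ∈ {k | Born S t D k} := by
      rw [show {k | Born S t D k} = (K : Set (Particle H)) from hD.2]
      exact hk
    exact h
  have h := Y.Z_law t ht K A _ hA hB'
  have e1 : {ω | (fun k => Y.mark k ω) ∈ B ∩ {D | {k | Born S t D k} = K} ∧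
      ∀ k ∈ K, Born S t (fun k => Y.mark k ω) k} =
      (fun ω k => Y.mark k ω) ⁻¹' (B ∩ {D | {k | Born S t D k} = K}) := by
    ext ω
    exact ⟨fun h => h.1, fun h => ⟨h, hborn _ h⟩⟩
  rw [e1] at h
  rw [← Y.map_mark, setLIntegral_map hB'
    (Finset.measurable_prod _ fun k _ => measurable_stepLaw R t k (hA k)) Y.measurable_mark, ← h]
  congr 1
  ext ω
  constructor
  · rintro ⟨⟨h1, h2⟩, h3⟩
    exact ⟨⟨⟨h1, h3⟩, hborn _ ⟨h1, h3⟩⟩, fun k hk => h2 ⟨k, hk⟩ (mem_univ _)⟩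
  · rintro ⟨⟨⟨h1, h3⟩, -⟩, h2⟩
    exact ⟨⟨h1, fun k _ => h2 k k.2⟩, h3⟩

variable {Ω' : Type*} [MeasurableSpace Ω'] {P' : Measure Ω'}

/-- The joint law of the marks and of the displacements in a given finite tree does not depend on
the probability space. -/
theorem BranchingSystem.measure_treeEvent_inter_eq [IsProbabilityMeasure P] [IsProbabilityMeasure P']
    (Y : BranchingSystem S R ρ T P) (Y' : BranchingSystem S R ρ T P') {t : ℝ} (ht : t ∈ Icc 0 T)
    (K : Finset (Particle H)) {C : Set ((Particle H → Mark N) × (K → Space d))}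
    (hC : MeasurableSet C) :
    P (Y.joint t K ⁻¹' C ∩ Y.treeEvent t K) = P' (Y'.joint t K ⁻¹' C ∩ Y'.treeEvent t K) := by
  classical
  have hbox : ∀ (B : Set (Particle H → Mark N)) (A : K → Set (Space d)), MeasurableSet B →
      (∀ k, MeasurableSet (A k)) →
      P (Y.joint t K ⁻¹' (B ×ˢ univ.pi A) ∩ Y.treeEvent t K) =
        P' (Y'.joint t K ⁻¹' (B ×ˢ univ.pi A) ∩ Y'.treeEvent t K) := by
    intro B A hB hA
    set A' : Particle H → Set (Space d) := fun k => if hk : k ∈ K then A ⟨k, hk⟩ else univ with hA'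
    have hAm : ∀ k, MeasurableSet (A' k) := by
      intro k
      by_cases hk : k ∈ K
      · simp only [hA', dif_pos hk, hA]
      · simp only [hA', dif_neg hk, MeasurableSet.univ]
    have e : A = fun k : K => A' k := by
      funext k
      simp only [hA', dif_pos k.2]
    rw [e, Y.measure_treeEvent_inter_box ht K hB hAm, Y'.measure_treeEvent_inter_box ht K hB hAm]
  set μ₁ := (P.restrict (Y.treeEvent t K)).map (Y.joint t K) with hμ₁
  set μ₂ := (P'.restrict (Y'.treeEvent t K)).map (Y'.joint t K) with hμ₂
  have e1 : ∀ C, MeasurableSet C → μ₁ C = P (Y.joint t K ⁻¹' C ∩ Y.treeEvent t K) := fun C hC => by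
    rw [hμ₁, Measure.map_apply (Y.measurable_joint t K) hC, Measure.restrict_apply
      (Y.measurable_joint t K hC)]
  have e2 : ∀ C, MeasurableSet C → μ₂ C = P' (Y'.joint t K ⁻¹' C ∩ Y'.treeEvent t K) := fun C hC => by
    rw [hμ₂, Measure.map_apply (Y'.measurable_joint t K) hC, Measure.restrict_apply
      (Y'.measurable_joint t K hC)]
  have hb : ∀ (B : Set (Particle H → Mark N)) (A : K → Set (Space d)), MeasurableSet B →
      (∀ k, MeasurableSet (A k)) → μ₁ (B ×ˢ univ.pi A) = μ₂ (B ×ˢ univ.pi A) := fun B A hB hA => by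
    have hm := hB.prod (MeasurableSet.univ_pi hA)
    rw [e1 _ hm, e2 _ hm, hbox B A hB hA]
  rw [← e1 C hC, ← e2 C hC]
  congr 1
  refine ext_of_generate_finite _ (generateFrom_eq_prod MeasurableSpace.generateFrom_measurableSet
    generateFrom_pi isCountablySpanning_measurableSet ⟨fun _ => univ, fun _ =>
      ⟨fun _ => univ, fun _ _ => MeasurableSet.univ, pi_univ _⟩, iUnion_const _⟩).symm
    (MeasurableSpace.isPiSystem_measurableSet.prod isPiSystem_pi) ?_ ?_
  · rintro _ ⟨B, hB, _, ⟨A, hA, rfl⟩, rfl⟩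
    exact hb B A hB fun k => hA k (mem_univ k)
  · have := hb univ (fun _ => univ) .univ fun _ => .univ
    rwa [pi_univ, univ_prod_univ] at this

/-- The product of the factors of a finite set of particles, as a function of the marks and of the
displacements of these particles. -/
def factorProd (S : Problem d N H) (R : GreenData d N) (ρ : ℝ → ℝ) (t : ℝ) (x : Space d)
    (K : Finset (Particle H)) (q : (Particle H → Mark N) × (K → Space d)) : ℝ :=
  ∏ k ∈ K, factor S R ρ t q.1 x (Function.extend Subtype.val q.2 0) k

theorem measurable_factorProd (S : Problem d N H) (R : GreenData d N) (hρ : Measurable ρ) (t : ℝ)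
    (x : Space d) (K : Finset (Particle H)) : Measurable (factorProd S R ρ t x K) := by
  classical
  have hext : ∀ k, Measurable fun z : K → Space d => Function.extend Subtype.val z 0 k := by
    intro k
    by_cases hk : k ∈ K
    · have e : (fun z : K → Space d => Function.extend Subtype.val z 0 k) = fun z => z ⟨k, hk⟩ :=
        funext fun z => Subtype.val_injective.extend_apply z 0 ⟨k, hk⟩
      rw [e]
      exact measurable_pi_apply _
    · have e : (fun z : K → Space d => Function.extend Subtype.val z 0 k) = fun _ => (0 : Space d) := by
        refine funext fun z => Function.extend_apply' z (0 : Particle H → Space d) k ?_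
        rintro ⟨a, rfl⟩
        exact hk a.2
      rw [e]
      exact measurable_const
  exact Finset.measurable_prod _ fun k _ => (measurable_factor S R hρ t x k).comp
    (measurable_fst.prodMk (measurable_pi_lambda _ fun k => (hext k).comp measurable_snd))

theorem BranchingSystem.xi_eq_factorProd (Y : BranchingSystem S R ρ T P) (t : ℝ) (x : Space d)
    {K : Finset (Particle H)} {ω : Ω} (hω : ω ∈ Y.treeEvent t K) :
    Y.xi t x ω = factorProd S R ρ t x K (Y.joint t K ω) := by
  have hB : {k | Born S t (fun k => Y.mark k ω) k} = K := hω
  have hfin : {k | Born S t (fun k => Y.mark k ω) k}.Finite := by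
    rw [hB]
    exact K.finite_toSet
  have hset : hfin.toFinset = K := by rw [← Finset.coe_inj, Finite.coe_toFinset, hB]
  rw [BranchingSystem.xi, xiHat, dif_pos hfin, hset]
  refine Finset.prod_congr rfl fun k hk => factor_congr S R ρ t _ x fun k' hk' => ?_
  have hk'K : k' ∈ K := by
    have h1 : k ∈ {k | Born S t (fun k => Y.mark k ω) k} := by
      rw [hB]
      exact hk
    have h2 : k' ∈ {k | Born S t (fun k => Y.mark k ω) k} := born_of_suffix hk' h1
    rwa [hB] at h2
  exact (Subtype.val_injective.extend_apply (Y.joint t K ω).2 0 ⟨k', hk'K⟩).symm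

theorem BranchingSystem.xi_eq_zero (Y : BranchingSystem S R ρ T P) (t : ℝ) (x : Space d) {ω : Ω}
    (hω : ω ∉ ⋃ K, Y.treeEvent t K) : Y.xi t x ω = 0 := by
  rw [BranchingSystem.xi, xiHat, dif_neg]
  intro hfin
  refine hω (mem_iUnion.2 ⟨hfin.toFinset, ?_⟩)
  exact (Finite.coe_toFinset hfin).symm

theorem BranchingSystem.preimage_xi_inter (Y : BranchingSystem S R ρ T P) (t : ℝ) (x : Space d)
    (A : Set ℝ) (K : Finset (Particle H)) : Y.xi t x ⁻¹' A ∩ Y.treeEvent t K =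
      Y.joint t K ⁻¹' (factorProd S R ρ t x K ⁻¹' A) ∩ Y.treeEvent t K := by
  ext ω
  simp only [mem_inter_iff, mem_preimage, and_congr_left_iff]
  intro hω
  rw [Y.xi_eq_factorProd t x hω]

theorem BranchingSystem.pairwise_disjoint_treeEvent (Y : BranchingSystem S R ρ T P) (t : ℝ) :
    Pairwise (Function.onFun Disjoint (Y.treeEvent t)) := by
  intro K K' hK
  rw [Function.onFun, Set.disjoint_left]
  intro ω h h'
  exact hK (Finset.coe_inj.1 (Eq.trans (Eq.symm h) h'))

theorem BranchingSystem.measurable_xi (Y : BranchingSystem S R ρ T P) (hρ : Measurable ρ) (t : ℝ)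
    (x : Space d) : Measurable (Y.xi t x) := by
  intro A hA
  have hU : MeasurableSet (⋃ K, Y.treeEvent t K) := .iUnion fun K => Y.measurableSet_treeEvent t K
  rw [← inter_union_sdiff (Y.xi t x ⁻¹' A) (⋃ K, Y.treeEvent t K), inter_iUnion]
  refine (MeasurableSet.iUnion fun K => ?_).union ?_
  · rw [Y.preimage_xi_inter]
    exact (Y.measurable_joint t K (measurable_factorProd S R hρ t x K hA)).inter
      (Y.measurableSet_treeEvent t K)
  · by_cases h0 : (0 : ℝ) ∈ A
    · convert! hU.compl using 1
      ext ω
      simp only [mem_sdiff, mem_preimage, mem_compl_iff, and_iff_right_iff_imp]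
      intro hω
      rwa [Y.xi_eq_zero t x hω]
    · convert! MeasurableSet.empty using 1
      ext ω
      simp only [mem_sdiff, mem_preimage, mem_empty_iff_false, iff_false, not_and]
      intro h hω
      rw [Y.xi_eq_zero t x hω] at h
      exact h0 h

/-- The law of the branching functional does not depend on the probability space. -/
theorem BranchingSystem.map_xi_eq [IsProbabilityMeasure P] [IsProbabilityMeasure P']
    (Y : BranchingSystem S R ρ T P) (Y' : BranchingSystem S R ρ T P') (hρ : Measurable ρ) {t : ℝ}
    (ht : t ∈ Icc 0 T) (x : Space d) : P.map (Y.xi t x) = P'.map (Y'.xi t x) := by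
  have hK : ∀ K {A : Set ℝ}, MeasurableSet A → P (Y.xi t x ⁻¹' A ∩ Y.treeEvent t K) =
      P' (Y'.xi t x ⁻¹' A ∩ Y'.treeEvent t K) := by
    intro K A hA
    rw [Y.preimage_xi_inter, Y'.preimage_xi_inter]
    exact Y.measure_treeEvent_inter_eq Y' ht K (measurable_factorProd S R hρ t x K hA)
  have hsum : ∀ {A : Set ℝ}, MeasurableSet A → P (Y.xi t x ⁻¹' A ∩ ⋃ K, Y.treeEvent t K) =
      P' (Y'.xi t x ⁻¹' A ∩ ⋃ K, Y'.treeEvent t K) := by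
    intro A hA
    rw [inter_iUnion, inter_iUnion, measure_iUnion, measure_iUnion]
    · exact tsum_congr fun K => hK K hA
    · exact fun K K' h => (Y'.pairwise_disjoint_treeEvent t h).mono inter_subset_right inter_subset_right
    · exact fun K => (Y'.measurable_xi hρ t x hA).inter (Y'.measurableSet_treeEvent t K)
    · exact fun K K' h => (Y.pairwise_disjoint_treeEvent t h).mono inter_subset_right inter_subset_right
    · exact fun K => (Y.measurable_xi hρ t x hA).inter (Y.measurableSet_treeEvent t K)
  have hU : MeasurableSet (⋃ K, Y.treeEvent t K) := .iUnion fun K => Y.measurableSet_treeEvent t K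
  have hU' : MeasurableSet (⋃ K, Y'.treeEvent t K) := .iUnion fun K => Y'.measurableSet_treeEvent t K
  have hc : P (⋃ K, Y.treeEvent t K)ᶜ = P' (⋃ K, Y'.treeEvent t K)ᶜ := by
    have := hsum MeasurableSet.univ
    simp only [preimage_univ, univ_inter] at this
    rw [prob_compl_eq_one_sub hU, prob_compl_eq_one_sub hU', this]
  ext A hA
  rw [Measure.map_apply (Y.measurable_xi hρ t x) hA, Measure.map_apply (Y'.measurable_xi hρ t x) hA,
    ← measure_inter_add_sdiff _ hU, ← measure_inter_add_sdiff (Y'.xi t x ⁻¹' A) hU', hsum hA]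
  congr 1
  by_cases h0 : (0 : ℝ) ∈ A
  · convert! hc using 2
    · ext ω
      simp only [mem_sdiff, mem_preimage, mem_compl_iff, and_iff_right_iff_imp]
      intro hω
      rwa [Y.xi_eq_zero t x hω]
    · ext ω
      simp only [mem_sdiff, mem_preimage, mem_compl_iff, and_iff_right_iff_imp]
      intro hω
      rwa [Y'.xi_eq_zero t x hω]
  · have e1 : Y.xi t x ⁻¹' A \ ⋃ K, Y.treeEvent t K = ∅ := by
      ext ω
      simp only [mem_sdiff, mem_preimage, mem_empty_iff_false, iff_false, not_and]
      intro h hω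
      rw [Y.xi_eq_zero t x hω] at h
      exact h0 h
    have e2 : Y'.xi t x ⁻¹' A \ ⋃ K, Y'.treeEvent t K = ∅ := by
      ext ω
      simp only [mem_sdiff, mem_preimage, mem_empty_iff_false, iff_false, not_and]
      intro h hω
      rw [Y'.xi_eq_zero t x hω] at h
      exact h0 h
    rw [e1, e2, measure_empty, measure_empty]

end Law

/-! ### A branching system built from independent seeds -/

section Canonical

/-- Sequences of independent pairs are pairs of independent sequences. -/
theorem measurePreserving_zip {ι X Y : Type*} [MeasurableSpace X] [MeasurableSpace Y] (μ : Measure X)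
    (ν : Measure Y) [IsProbabilityMeasure μ] [IsProbabilityMeasure ν] :
    MeasurePreserving (fun (q : (ι → X) × (ι → Y)) i => (q.1 i, q.2 i))
      ((Measure.infinitePi fun _ : ι => μ).prod (Measure.infinitePi fun _ : ι => ν))
      (Measure.infinitePi fun _ : ι => μ.prod ν) := by
  have hm : Measurable fun (q : (ι → X) × (ι → Y)) i => (q.1 i, q.2 i) := by fun_prop
  refine ⟨hm, Measure.eq_infinitePi _ fun s t ht => ?_⟩
  have hs : MeasurableSet (Set.pi (s : Set ι) t) :=
    MeasurableSet.pi s.countable_toSet fun i _ => ht i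
  rw [Measure.map_apply hm hs, Measure.prod_apply (hm hs)]
  have e : ∀ D : ι → X, (Measure.infinitePi fun _ : ι => ν)
      (Prod.mk D ⁻¹' ((fun (q : (ι → X) × (ι → Y)) i => (q.1 i, q.2 i)) ⁻¹' Set.pi (s : Set ι) t)) =
      ∏ i ∈ s, ν (Prod.mk (D i) ⁻¹' t i) := fun D =>
    Measure.infinitePi_pi (μ := fun _ : ι => ν) (t := fun i => Prod.mk (D i) ⁻¹' t i)
      fun i _ => measurable_prodMk_left (ht i)
  simp only [e]
  rw [lintegral_infinitePi_prod μ s (g := fun i x => ν (Prod.mk x ⁻¹' t i))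
    fun i => measurable_measure_prodMk_left (ht i)]
  exact Finset.prod_congr rfl fun i _ => (Measure.prod_apply (ht i)).symm

variable [NeZero N]

theorem measurable_displacement (R : GreenData d N) (t : ℝ) (k : Particle H) :
    Measurable fun E : Particle H → Seed N => displacement R t E k := by
  have hD : Measurable fun (E : Particle H → Seed N) k => (E k).1 := by fun_prop
  have h : Measurable fun q : Fin N × ℝ × I => R.sample (kind (theta k)) q.1 q.2.1 q.2.2 :=
    measurable_from_prod_countable_right fun n => R.measurable_sample (kind (theta k)) n
  exact h.comp (((measurable_idx t k).comp hD).prodMk (((measurable_lifeTime t k).comp hD).prodMk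
    (measurable_snd.comp (measurable_pi_apply k))))

variable {S : Problem d N H} {R : GreenData d N} {ρ : ℝ → ℝ}

omit [NeZero N] in
theorem map_treeLaw_fst (hρ : IsPositiveDensity ρ) (S : Problem d N H) :
    MeasurePreserving (fun (E : Particle H → Seed N) k => (E k).1) (treeLaw S ρ)
      (Measure.infinitePi fun _ => S.markLaw ρ) := by
  have := hρ.isProbabilityMeasure_markLaw S
  have := hρ.isProbabilityMeasure_seedLaw S
  refine ⟨by fun_prop, ?_⟩
  rw [treeLaw, Measure.infinitePi_map_pi (fun _ : Particle H => S.seedLaw ρ)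
    (f := fun _ => Prod.fst) fun _ => measurable_fst]
  congr 1
  funext k
  exact measurePreserving_fst.map_eq

/-- The displacements sampled from independent seeds are conditionally independent given the marks. -/
theorem treeLaw_displacement (hρ : IsPositiveDensity ρ) (t : ℝ) (K : Finset (Particle H))
    {A : Particle H → Set (Space d)} (hA : ∀ k, MeasurableSet (A k)) {B : Set (Particle H → Mark N)}
    (hB : MeasurableSet B) :
    treeLaw S ρ {E | (fun k => (E k).1) ∈ B ∧ ∀ k ∈ K, displacement R t E k ∈ A k} =
      ∫⁻ E in {E | (fun k => (E k).1) ∈ B}, ∏ k ∈ K, stepLaw R t (fun k => (E k).1) k (A k)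
        ∂(treeLaw S ρ) := by
  have := hρ.isProbabilityMeasure_markLaw S
  have hms : MeasurableSet {E : Particle H → Seed N |
      (fun k => (E k).1) ∈ B ∧ ∀ k ∈ K, displacement R t E k ∈ A k} := by
    refine ((map_treeLaw_fst hρ S).measurable hB).inter ?_
    have : {E : Particle H → Seed N | ∀ k ∈ K, displacement R t E k ∈ A k} =
        ⋂ k ∈ K, {E | displacement R t E k ∈ A k} := by
      ext
      simp
    have h : MeasurableSet {E : Particle H → Seed N | ∀ k ∈ K, displacement R t E k ∈ A k} := by
      rw [this]
      exact K.measurableSet_biInter fun k _ => measurable_displacement R t k (hA k)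
    exact h
  have hzip := measurePreserving_zip (ι := Particle H) (S.markLaw ρ) (volume : Measure I)
  have hf : Measurable fun D : Particle H → Mark N => ∏ k ∈ K, stepLaw R t D k (A k) :=
    Finset.measurable_prod _ fun k _ => measurable_stepLaw R t k (hA k)
  have e1 := (map_treeLaw_fst hρ S).setLIntegral_comp_preimage hB hf
  refine Eq.trans ?_ e1.symm
  have e2 := hzip.measure_preimage hms.nullMeasurableSet
  refine e2.symm.trans ?_
  rw [Measure.prod_apply (hzip.measurable hms), ← lintegral_indicator hB]
  refine lintegral_congr fun D => ?_
  by_cases hD : D ∈ B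
  · rw [indicator_of_mem hD]
    have e3 : Prod.mk D ⁻¹' ((fun (q : (Particle H → Mark N) × (Particle H → I)) i => (q.1 i, q.2 i)) ⁻¹'
        {E | (fun k => (E k).1) ∈ B ∧ ∀ k ∈ K, displacement R t E k ∈ A k}) =
        Set.pi (K : Set (Particle H)) fun k =>
          R.sample (kind (theta k)) (idx t D k) (lifeTime t D k) ⁻¹' A k := by
      ext U
      exact ⟨fun h k hk => h.2 k hk, fun h => ⟨hD, fun k hk => h k hk⟩⟩
    have hsm : ∀ k, Measurable (R.sample (kind (theta k)) (idx t D k) (lifeTime t D k)) := fun k =>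
      R.measurable_sample' _ _ measurable_const measurable_id
    rw [e3, Measure.infinitePi_pi _ fun k _ => hsm k (hA k)]
    refine Finset.prod_congr rfl fun k _ => ?_
    rw [stepLaw_eq, ← R.map_sample, Measure.map_apply (hsm k) (hA k)]
  · rw [indicator_of_notMem hD]
    refine (congrArg _ ?_).trans (measure_empty (μ := Measure.infinitePi fun _ : Particle H => (volume : Measure I)))
    ext U
    exact ⟨fun h => hD h.1, fun h => h.elim⟩

/-- The branching system whose displacements are sampled from independent seeds. -/
def seedSystem (hρ : IsPositiveDensity ρ) (S : Problem d N H) (R : GreenData d N) (T : ℝ) :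
    BranchingSystem S R ρ T (treeLaw S ρ) where
  mark k E := (E k).1
  mark_law k := by
    have := hρ.isProbabilityMeasure_markLaw S
    have := hρ.isProbabilityMeasure_seedLaw S
    have h : MeasurePreserving (fun E : Particle H → Seed N => (E k).1) (treeLaw S ρ) (S.markLaw ρ) :=
      measurePreserving_fst.comp (measurePreserving_eval_infinitePi (fun _ => S.seedLaw ρ) k)
    exact ⟨h.measurable.aemeasurable, h.map_eq⟩
  mark_meas k := measurable_fst.comp (measurable_pi_apply k)
  mark_indep := by
    have := hρ.isProbabilityMeasure_seedLaw S
    exact iIndepFun_infinitePi (P := fun _ : Particle H => S.seedLaw ρ) (X := fun _ => Prod.fst)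
      fun _ => measurable_fst
  Z t k E := displacement R t E k
  Z_meas t k := measurable_displacement R t k
  Z_law t _ K A B hA hB := by
    have hB' : MeasurableSet (B ∩ ⋂ k ∈ K, {D | Born S t D k}) :=
      hB.inter (K.measurableSet_biInter fun k _ => measurableSet_born S t k)
    have e : ∀ D : Particle H → Mark N, D ∈ (B ∩ ⋂ k ∈ K, {D | Born S t D k}) ↔
        (D ∈ B ∧ ∀ k ∈ K, Born S t D k) := by
      intro D
      simp only [mem_inter_iff, mem_iInter, mem_ofPred_eq]
    have h := treeLaw_displacement (S := S) (R := R) hρ t K hA hB'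
    simp only [e] at h
    exact h

end Canonical

/-! ### The expectation of the branching functional -/

section Expectation

theorem IsBoundedSolution.congr {S : Problem d N H} {T : ℝ} {u v : ℝ → Space d → ℝ}
    (hu : IsBoundedSolution S T u) (hT : 0 ≤ T) (huv : ∀ t ∈ Icc 0 T, ∀ x, v t x = u t x) :
    IsBoundedSolution S T v := by
  have hfun : ∀ t ∈ Icc 0 T, v t = u t := fun t ht => funext (huv t ht)
  have hfun' : ∀ t ∈ Ioc 0 T, v t = u t := fun t ht => hfun t ⟨ht.1.le, ht.2⟩
  have hterm : ∀ t, v t = u t → ∀ x, S.nonlinTerm v t x = S.nonlinTerm u t x := by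
    intro t ht x
    funext j
    simp only [Problem.nonlinTerm, ht]
  have hnon : ∀ t, v t = u t → S.nonlin v t = S.nonlin u t := by
    intro t ht
    funext x
    simp only [Problem.nonlin, hterm t ht]
  have hpair : ∀ ψ, EqOn (fun t => pairing (v t) ψ) (fun t => pairing (u t) ψ) (Icc 0 T) :=
    fun ψ t ht => by simp only [hfun t ht]
  have hder : ∀ ψ n, ∀ t ∈ Icc 0 T,
      iteratedDerivWithin n (fun t => pairing (v t) ψ) (Icc 0 T) t =
        iteratedDerivWithin n (fun t => pairing (u t) ψ) (Icc 0 T) t := fun ψ n t ht =>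
    iteratedDerivWithin_congr (hpair ψ) ht
  have h0 : (0 : ℝ) ∈ Icc 0 T := ⟨le_rfl, hT⟩
  exact
    { cont := hu.cont.congr fun z hz => huv z.1 hz.1 z.2
      bdd := by
        obtain ⟨C, hC⟩ := hu.bdd
        exact ⟨C, fun t ht x => by rw [huv t ht]; exact hC t ht x⟩
      smooth_space := fun t ht => by rw [hfun' t ht]; exact hu.smooth_space t ht
      summable_nonlin := fun t ht x => by rw [hterm t (hfun' t ht)]; exact hu.summable_nonlin t ht x
      nonlin_bdd := by
        obtain ⟨C, hC⟩ := hu.nonlin_bdd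
        exact ⟨C, fun t ht x => by rw [hnon t (hfun' t ht)]; exact hC t ht x⟩
      smooth_time := fun ψ => (hu.smooth_time ψ).congr (hpair ψ)
      initial := fun ψ n => by rw [hder ψ n 0 h0]; exact hu.initial ψ n
      equation := fun ψ t ht => by
        simp only [hder ψ _ t ht, hder ψ _ 0 h0]
        rw [hu.equation ψ t ht]
        refine intervalIntegral.integral_congr fun s hs => ?_
        rw [uIcc_of_le ht.1] at hs
        have hs' := hfun s ⟨hs.1, hs.2.trans ht.2⟩
        simp only [hs', hnon s hs'] }

variable [NeZero N] {S : Problem d N H} {R : GreenData d N} {T p : ℝ} {ρ : ℝ → ℝ}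

/-- At time `0` the root almost surely does not branch, and `f_n` and `γ_n(0,·)` are bounded. This
case needs a separate argument, as the moment bound covers only `t > 0`. -/
theorem exists_abs_branchVal_zero_le (h : GreenMeasures S R T) (hT : 0 ≤ T) (hρ : IsPositiveDensity ρ)
    (x : Space d) : ∃ C, ∀ n, ∀ᵐ E ∂(treeLaw S ρ), |branchVal S R ρ n E false 0 0 x| ≤ C := by
  have := hρ.isProbabilityMeasure_seedLaw S
  have := hρ.isProbabilityMeasure_markLaw S
  choose Cf hCf using S.f_bdd
  choose Cγ hCγ using fun n => h.density_bdd n 0 ⟨le_rfl, hT⟩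
  have h1 : ∀ᵐ u : I, ∀ n, |R.γ n 0 (R.sample false n 0 u)| ≤ Cγ n := by
    rw [ae_all_iff]
    intro n
    have hm : Measurable (R.sample false n 0) := R.measurable_sample' _ _ measurable_const measurable_id
    refine ae_of_ae_map hm.aemeasurable (p := fun z => |R.γ n 0 z| ≤ Cγ n) ?_
    rw [R.map_sample]
    exact hCγ n
  have h2 : ∀ᵐ a ∂(S.seedLaw ρ), ∀ n, |R.γ n 0 (R.sample false n 0 a.2)| ≤ Cγ n :=
    Measure.quasiMeasurePreserving_snd.ae h1
  have h3 : ∀ᵐ E ∂(treeLaw (H := H) S ρ), 0 < (E []).1.1 ∧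
      ∀ n, |R.γ n 0 (R.sample false n 0 (E []).2)| ≤ Cγ n :=
    (measurePreserving_eval_infinitePi (fun _ : Particle H => S.seedLaw ρ)
      []).quasiMeasurePreserving.ae ((ae_seedLaw_pos S hρ).and h2)
  set C : ℝ := ∑ n, |Cγ n| / tail ρ 0 * |Cf n| with hC
  have ht0 := hρ.tail_pos le_rfl
  have hterm : ∀ n, 0 ≤ |Cγ n| / tail ρ 0 * |Cf n| := fun n =>
    mul_nonneg (div_nonneg (abs_nonneg _) ht0.le) (abs_nonneg _)
  refine ⟨C, fun n => ?_⟩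
  filter_upwards [h3] with E hE
  cases n with
  | zero =>
    rw [branchVal, abs_zero]
    exact Finset.sum_nonneg fun n _ => hterm n
  | succ n =>
    simp only [branchVal, branchStep, stepVal, if_neg (not_lt.2 hE.1.le), GreenData.wgt, Problem.leaf,
      cond_false, sub_zero]
    set m := (E []).1.2.1
    refine le_trans ?_ (Finset.single_le_sum (fun n _ => hterm n) (Finset.mem_univ m))
    rw [abs_mul, abs_div, abs_of_pos ht0]
    have e1 := (hE.2 m).trans (le_abs_self _)
    have e2 := (hCf m (x - R.sample false m 0 (E []).2)).trans (le_abs_self _)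
    gcongr

theorem measurable_xiHat_seed (hρ : IsPositiveDensity ρ) (S : Problem d N H) (R : GreenData d N) (t : ℝ)
    (x : Space d) : Measurable fun E : Particle H → Seed N =>
      xiHat S R ρ t (fun k => (E k).1) x (displacement R t E) :=
  measurable_of_tendsto_metrizable (fun n => measurable_branchVal_right hρ.meas n false 0 t x)
    (tendsto_pi_nhds.2 fun E => tendsto_branchVal S R ρ t E x)

theorem memLp_xiHat_seed (h : GreenMeasures S R T) (hT : 0 < T) (hρ : IsPositiveDensity ρ) (hp : 1 < p)
    {s : ℝ} (hs : ∀ t ∈ Ioc 0 T, ∀ n x,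
      ∫⁻ E, ‖branchVal S R ρ n E false 0 t x‖ₑ ^ p ∂(treeLaw S ρ) ≤ ENNReal.ofReal s)
    {t : ℝ} (ht : t ∈ Icc 0 T) (x : Space d) :
    MemLp (fun E : Particle H → Seed N => xiHat S R ρ t (fun k => (E k).1) x (displacement R t E))
      (ENNReal.ofReal p) (treeLaw S ρ) := by
  have := hρ.isProbabilityMeasure_treeLaw S
  have hp0 : 0 < p := by linarith
  have hm := measurable_xiHat_seed hρ S R t x
  have hlim := fun E : Particle H → Seed N => tendsto_branchVal S R ρ t E x
  rcases ht.1.eq_or_lt with rfl | ht0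
  · obtain ⟨C, hC⟩ := exists_abs_branchVal_zero_le (H := H) h hT.le hρ x
    refine MemLp.of_bound hm.aestronglyMeasurable C ?_
    filter_upwards [ae_all_iff.2 hC] with E hE
    exact le_of_tendsto' (hlim E).norm hE
  · refine ⟨hm.aestronglyMeasurable, ?_⟩
    rw [eLpNorm_lt_top_iff_lintegral_rpow_enorm_lt_top (by simpa using hp0) ENNReal.ofReal_ne_top,
      ENNReal.toReal_ofReal hp0.le]
    have e : ∀ E : Particle H → Seed N,
        ‖xiHat S R ρ t (fun k => (E k).1) x (displacement R t E)‖ₑ ^ p =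
          Filter.liminf (fun n => ‖branchVal S R ρ n E false 0 t x‖ₑ ^ p) Filter.atTop := fun E =>
      (((ENNReal.continuous_rpow_const.tendsto _).comp (hlim E).enorm).liminf_eq).symm
    simp only [e]
    refine (lintegral_liminf_le fun n =>
      (measurable_branchVal_right hρ.meas n _ _ _ _).enorm.pow_const p).trans_lt ?_
    refine lt_of_le_of_lt ?_ (ENNReal.ofReal_lt_top (r := s))
    refine (Filter.liminf_le_liminf (Filter.Eventually.of_forall fun n => hs t ⟨ht0, ht.2⟩ n x)).trans_eq ?_
    exact Filter.liminf_const _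

/-- Under the assumptions on the constants, the branching functional has finite moments of order `p`,
and its expectation is the mild solution of the Cauchy problem. -/
theorem exists_isMildSource_integral_xiHat (h : GreenMeasures S R T) (h₁ : GreenGradientMeasures S R T)
    (hT : 0 < T) (hρ : IsPositiveDensity ρ) (hp : 1 < p)
    (hα : alphaHat R ρ T p < ∞)
    (hint : ∃ s : ℝ, rHat S R ρ T p < ENNReal.ofReal s ∧ ENNReal.ofReal s < S.radius p ∧
      ∫⁻ y in Ioc (rHat S R ρ T p).toReal s, (S.powerSeries p (ENNReal.ofReal y))⁻¹ =
        alphaHat R ρ T p * ENNReal.ofReal T) :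
    (∀ t ∈ Icc 0 T, ∀ x, MemLp (fun E : Particle H → Seed N =>
      xiHat S R ρ t (fun k => (E k).1) x (displacement R t E)) (ENNReal.ofReal p) (treeLaw S ρ)) ∧
    ∃ M F, 0 < M ∧ ENNReal.ofReal (M ^ p) < S.radius p ∧ IsMildSource S R T M F ∧
      ∀ t ∈ Icc 0 T, ∀ x, ∫ E, xiHat S R ρ t (fun k => (E k).1) x (displacement R t E) ∂(treeLaw S ρ) =
        mild S R false 0 F t x := by
  obtain ⟨s, hrs, hsR, hint⟩ := hint
  have := hρ.isProbabilityMeasure_treeLaw S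
  have hp0 : 0 < p := by linarith
  have hs0 : 0 < s := ENNReal.ofReal_pos.1 (hrs.trans_le' bot_le)
  obtain ⟨φ, hφm, hφs, hφ⟩ := S.exists_supersolution hT.le hα hrs hsR hint
  have hmom : ∀ n θ v, ‖v‖ ≤ 1 → ∀ t ∈ Ioc 0 T, ∀ x,
      ∫⁻ E, ‖branchVal S R ρ n E θ v t x‖ₑ ^ p ∂(treeLaw S ρ) ≤ ENNReal.ofReal s :=
    fun n θ v hv t ht x => (lintegral_branchVal_le h h₁ hρ hp hφm hφ n θ hv ht x).trans
      (ENNReal.ofReal_le_ofReal (hφs t).2)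
  have hLp : ∀ t ∈ Icc 0 T, ∀ x, MemLp (fun E : Particle H → Seed N =>
      xiHat S R ρ t (fun k => (E k).1) x (displacement R t E)) (ENNReal.ofReal p) (treeLaw S ρ) :=
    fun t ht x => memLp_xiHat_seed h hT hρ hp (fun t ht n x => hmom n false 0 (by simp) t ht x) ht x
  refine ⟨hLp, ?_⟩
  set M : ℝ := s ^ p⁻¹ with hM
  have hM0 : 0 < M := by positivity
  have hMp : M ^ p = s := Real.rpow_inv_rpow hs0.le hp0.ne'
  have hMR : ENNReal.ofReal (M ^ p) < S.radius p := by rwa [hMp]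
  have hmass := integrableOn_mass h h₁ hρ hp hα
  have hbr : ∀ n θ v, ‖v‖ ≤ 1 → ∀ t ∈ Ioc 0 T, ∀ x,
      Integrable (fun E => branchVal S R ρ n E θ v t x) (treeLaw S ρ) ∧
        |meanVal S R ρ n θ v t x| ≤ M := fun n θ v hv t ht x =>
    integrable_and_abs_integral_le (measurable_branchVal_right hρ.meas n θ v t x).aestronglyMeasurable
      hs0.le hp.le (hmom n θ v hv t ht x)
  have hVM := fun n θ v hv t ht x => (hbr n θ v hv t ht x).2
  obtain ⟨F, hF, hFlim⟩ := exists_isMildSource h h₁ hmass hp.le hM0 hMR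
    (V := meanVal S R ρ) (fun θ v t x => by simp [meanVal, branchVal]) hVM
    (fun n θ => measurable_meanVal hρ n θ) fun n θ v hv t ht x =>
      meanVal_succ h h₁ hρ hp.le hM0.le hMR (hVM n) θ ht.1.le ht.2 (.inl ht) x (hbr (n + 1) θ v hv t ht x).1
  refine ⟨M, F, hM0, hMR, hF, fun t ht x => ?_⟩
  have hxi := (hLp t ht x).integrable (by simpa using hp.le)
  have hi : ∀ n, Integrable (fun E => branchVal S R ρ n E false 0 t x) (treeLaw S ρ) := fun n =>
    hxi.mono (measurable_branchVal_right hρ.meas n false 0 t x).aestronglyMeasurable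
      (.of_forall fun E => abs_branchVal_le_xiHat S R ρ t E x n)
  have hlim1 : Filter.Tendsto (fun n => meanVal S R ρ n false 0 t x) Filter.atTop
      (nhds (∫ E, xiHat S R ρ t (fun k => (E k).1) x (displacement R t E) ∂(treeLaw S ρ))) :=
    tendsto_integral_of_dominated_convergence _ (fun n => (hi n).1) hxi.norm
      (fun n => .of_forall fun E => abs_branchVal_le_xiHat S R ρ t E x n)
      (.of_forall fun E => tendsto_branchVal S R ρ t E x)
  have hlim2 := hFlim t ht 0 (by simp) false x
  refine tendsto_nhds_unique ((Filter.tendsto_add_atTop_iff_nat 1).2 hlim1) (hlim2.congr fun n => ?_)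
  exact (meanVal_succ h h₁ hρ hp.le hM0.le hMR (hVM n) false ht.1 ht.2 (.inr rfl) x (hi (n + 1))).symm

end Expectation

end BranchingCauchy

end

open BranchingCauchy in
theorem theorem4p1 {d N H : ℕ} [NeZero N] (S : Problem d N H)
    (hf : ∀ n, ∃ K : ℝ≥0, LipschitzWith K (S.f n))
    (R : GreenData d N) (ρ : ℝ → ℝ) (hρ : IsPositiveDensity ρ)
    (T : ℝ) (hT : 0 < T) (p : ℝ) (hp : 1 < p)
    (h_tempered : GreenHatTempered S T)
    (h_green : GreenMeasures S R T)
    (h_grad : GreenGradientMeasures S R T)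
    (h_r : rHat S R ρ T p < S.radius p)
    (h_alpha : alphaHat R ρ T p < ∞)
    (h_int : ∃ s : ℝ, rHat S R ρ T p < ENNReal.ofReal s ∧ ENNReal.ofReal s < S.radius p ∧
      ∫⁻ y in Ioc (rHat S R ρ T p).toReal s, (S.powerSeries p (ENNReal.ofReal y))⁻¹ =
        alphaHat R ρ T p * ENNReal.ofReal T)
    {Ω : Type*} [MeasurableSpace Ω] (P : Measure Ω) [IsProbabilityMeasure P]
    (Y : BranchingSystem S R ρ T P) :
    (∀ t ∈ Icc 0 T, ∀ x, MemLp (Y.xi t x) (ENNReal.ofReal p) P) ∧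
    IsBoundedSolution S T (fun t x => ∫ ω, Y.xi t x ω ∂P) ∧
    ∀ v : ℝ → Space d → ℝ, IsBoundedSolution S T v →
      ∀ t ∈ Icc 0 T, ∀ x, v t x = ∫ ω, Y.xi t x ω ∂P := by
  have := hρ.isProbabilityMeasure_treeLaw S
  obtain ⟨hLp, M, F, hM, hMR, hF, hmean⟩ :=
    exists_isMildSource_integral_xiHat (H := H) h_green h_grad hT hρ hp h_alpha h_int
  have hmass := integrableOn_mass h_green h_grad hρ hp h_alpha
  have hlaw : ∀ t ∈ Icc 0 T, ∀ x, IdentDistrib (Y.xi t x) ((seedSystem hρ S R T).xi t x) P (treeLaw S ρ) :=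
    fun t ht x => ⟨(Y.measurable_xi hρ.meas t x).aemeasurable,
      ((seedSystem hρ S R T).measurable_xi hρ.meas t x).aemeasurable,
      Y.map_xi_eq (seedSystem hρ S R T) hρ.meas ht x⟩
  have hu : ∀ t ∈ Icc 0 T, ∀ x, ∫ ω, Y.xi t x ω ∂P = mild S R false 0 F t x := fun t ht x =>
    (hlaw t ht x).integral_eq.trans (hmean t ht x)
  refine ⟨fun t ht x => (hlaw t ht x).memLp_iff.2 (hLp t ht x), ?_, fun v hv t ht x => ?_⟩
  · exact (isBoundedSolution_mild h_green h_grad h_tempered hT hmass hp.le hM hMR hF).congr hT.le hu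
  · rw [hu t ht x]
    exact hv.eq_mild h_green h_grad h_tempered hT hmass hp.le hM hMR hF t ht x
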